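/- Let $(\mathfrak M,+,0)$ be an abelian monoid scheme over $\mathbb C$, i.e. a commutative monoid object in the category of $\mathbb C$-schemes. A *variety over $\mathfrak M$* is a separated scheme $X$ of finite type over $\mathbb C$ with a morphism of $\mathbb C$-schemes $p_X\colon X\to\mathfrak M$. Let $K_0(\mathrm{Var}/\mathfrak M)$ be the abelian group generated by the isomorphism classes $[X\to\mathfrak M]$ of varieties over $\mathfrak M$ with the relations $[X\to\mathfrak M]=[Z\to\mathfrak M]+[X\setminus Z\to\mathfrak M]$ for closed subschemes $Z\subset X$; it is a commutative ring with product $[X\to\mathfrak M]\cdot[Y\to\mathfrak M]=[X\times Y\to\mathfrak M\times\mathfrak M\xrightarrow{+}\mathfrak M]$ and unit $[\mathrm{Spec}\,\mathbb C\xrightarrow{0}\mathfrak M]$. The effective classes, i.e. the classes $[X\to\mathfrak M]$ of varieties over $\mathfrak M$, form a sub-semiring $S_0(\mathrm{Var}/\mathfrak M)$. A *power structure* on a commutative semiring $R$ is a map $(1+tR[[t]])\times R\to 1+tR[[t]]$, $(A(t),r)\mapsto A(t)^r$, such that for all $A(t),B(t)\in 1+tR[[t]]$ and $n,m\in R$: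 (1) $A(t)^0=1$; (2) $A(t)^1=A(t)$; (3) $A(t)^n\cdot B(t)^n=(A(t)\cdot B(t))^n$; (4) $A(t)^{n+m}=A(t)^n\cdot A(t)^m$; (5) $A(t)^{nm}=(A(t)^n)^m$. Let $M$ and $A_i$ ($i\ge 0$) be varieties over $\mathfrak M$. For a partition $\alpha\vdash n$ with $b_i(\alpha)$ parts of size $i$, let $S_\alpha=\prod_i S_{b_i(\alpha)}$ and $$B_\alpha=\Big(\prod_{i\ge1}M^{b_i(\alpha)}\setminus\Delta\Big)\times_{S_\alpha}\Big(\prod_{i\ge1}A_i^{b_i(\alpha)}\Big),$$ the quotient by the diagonal action of $S_\alpha$ permuting the factors, where $\Delta$ is the large diagonal (two of the points of $M$ coincide). Thus $B_\alpha$ parametrizes configurations of distinct particles $s\in M$, each with a multiplicity $i$ and an internal state $\phi(s)\in A_i$, with $b_i(\alpha)$ particles of multiplicity $i$. The map $B_\alpha\to\mathfrak M$ is the total weight, the sum over the particles $s$ of $i\cdot p_M(s)+p_{A_i}(\phi(s))$. **Theorem.** (a) If every finite set of points of $M$, and of each $A_i$, lies in an affine open subset (as for quasi-projective varieties), then the quotients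 $B_\alpha$ exist as varieties over $\mathfrak M$. (b) There is a unique map $$(1+tS_0(\mathrm{Var}/\mathfrak M)[[t]])\times S_0(\mathrm{Var}/\mathfrak M)\to 1+tS_0(\mathrm{Var}/\mathfrak M)[[t]],\qquad (A(t),[M])\mapsto A(t)^{[M]},$$ such that, for all varieties $M$ and $A_i$ over $\mathfrak M$ with $A(t)=\sum_{i\ge0}[A_i\to\mathfrak M]\,t^i\in 1+tS_0(\mathrm{Var}/\mathfrak M)[[t]]$ and every $n\ge 0$ for which the geometric quotients $B_\alpha$, $\alpha\vdash n$, exist as varieties over $\mathfrak M$, the coefficient of $t^n$ in $A(t)^{[M]}$ is $\sum_{\alpha\vdash n}[B_\alpha\to\mathfrak M]$. This map is a power structure on $S_0(\mathrm{Var}/\mathfrak M)$. -/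

import Mathlib

noncomputable section

open CategoryTheory Limits AlgebraicGeometry MonoidalCategory CartesianMonoidalCategory MonObj
open scoped PowerSeries

namespace RelativeMotives

/-- The base scheme `Spec ℂ`. -/
abbrev SpecC : Scheme.{0} := Spec (CommRingCat.of ℂ)

/-- A variety over `𝔐`: a separated scheme of finite type over `ℂ` together with a morphism of
`ℂ`-schemes to `𝔐`. -/
structure RelVar (𝔐 : Over SpecC) where
  /-- the underlying `ℂ`-scheme -/
  obj : Over SpecC
  /-- the structure morphism to `𝔐` -/
  str : obj ⟶ 𝔐
  locallyOfFiniteType : LocallyOfFiniteType obj.hom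
  quasiCompact : QuasiCompact obj.hom
  isSeparated : IsSeparated obj.hom

attribute [instance] RelVar.locallyOfFiniteType RelVar.quasiCompact RelVar.isSeparated

namespace RelVar

variable {𝔐 : Over SpecC}

/-- Two varieties over `𝔐` are isomorphic if there is an isomorphism commuting with the maps
to `𝔐`. -/
instance isoSetoid (𝔐 : Over SpecC) : Setoid (RelVar 𝔐) where
  r X Y := ∃ e : X.obj ≅ Y.obj, e.hom ≫ Y.str = X.str
  iseqv :=
    { refl := fun X => ⟨Iso.refl _, by simp⟩
      symm := by
        rintro X Y ⟨e, he⟩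
        exact ⟨e.symm, by simp [← he]⟩
      trans := by
        rintro X Y Z ⟨e, he⟩ ⟨f, hf⟩
        exact ⟨e ≪≫ f, by simp [he, hf]⟩ }

/-- The point `Spec ℂ`, mapping to the neutral element of `𝔐`. -/
def point (𝔐 : Over SpecC) [MonObj 𝔐] : RelVar 𝔐 where
  obj := 𝟙_ (Over SpecC)
  str := η[𝔐]
  locallyOfFiniteType := inferInstanceAs (LocallyOfFiniteType (𝟙 SpecC))
  quasiCompact := inferInstanceAs (QuasiCompact (𝟙 SpecC))
  isSeparated := inferInstanceAs (IsSeparated (𝟙 SpecC))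

/-- The product `X × Y ⟶ 𝔐 × 𝔐 ⟶ 𝔐`, the second map being the monoid operation. -/
def prod [MonObj 𝔐] (X Y : RelVar 𝔐) : RelVar 𝔐 where
  obj := X.obj ⊗ Y.obj
  str := (X.str ⊗ₘ Y.str) ≫ μ[𝔐]
  locallyOfFiniteType := by rw [Over.tensorObj_hom]; infer_instance
  quasiCompact := by rw [Over.tensorObj_hom]; infer_instance
  isSeparated := by rw [Over.tensorObj_hom]; infer_instance

lemma prod_str [MonObj 𝔐] (X Y : RelVar 𝔐) :
    (prod X Y).str = (fst X.obj Y.obj ≫ X.str) * (snd X.obj Y.obj ≫ Y.str) := by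
  rw [Hom.mul_def, lift_fst_comp_snd_comp]
  rfl

/-- The empty variety. -/
def empty (𝔐 : Over SpecC) : RelVar 𝔐 where
  obj := Over.mk (Scheme.emptyTo SpecC)
  str := Over.homMk (Scheme.emptyTo 𝔐.left) (Scheme.empty_ext _ _)
  locallyOfFiniteType := by dsimp; infer_instance
  quasiCompact := by dsimp; infer_instance
  isSeparated := by dsimp; infer_instance

/-- The disjoint union of two varieties over `𝔐`. -/
def coprod (X Y : RelVar 𝔐) : RelVar 𝔐 where
  obj := Over.mk (Limits.coprod.desc X.obj.hom Y.obj.hom)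
  str := Over.homMk (Limits.coprod.desc X.str.left Y.str.left) (by
    change Limits.coprod.desc X.str.left Y.str.left ≫ 𝔐.hom = Limits.coprod.desc X.obj.hom Y.obj.hom
    apply Limits.coprod.hom_ext
    · rw [coprod.inl_desc_assoc, coprod.inl_desc, Over.w]
    · rw [coprod.inr_desc_assoc, coprod.inr_desc, Over.w])
  locallyOfFiniteType := by
    change LocallyOfFiniteType (Limits.coprod.desc X.obj.hom Y.obj.hom)
    have hloc : IsZariskiLocalAtSource (@LocallyOfFiniteType : MorphismProperty Scheme.{0}) :=
      HasRingHomProperty.instIsZariskiLocalAtSource (Q := @RingHom.FiniteType)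
    rw [IsZariskiLocalAtSource.iff_of_openCover
      (P := (@LocallyOfFiniteType : MorphismProperty Scheme.{0}))
      (coprodOpenCover.{0, 0} X.obj.left Y.obj.left)]
    rintro (⟨⟨⟩⟩ | ⟨⟨⟩⟩)
    · change LocallyOfFiniteType (Limits.coprod.inl ≫ Limits.coprod.desc X.obj.hom Y.obj.hom)
      rw [coprod.inl_desc]; infer_instance
    · change LocallyOfFiniteType (Limits.coprod.inr ≫ Limits.coprod.desc X.obj.hom Y.obj.hom)
      rw [coprod.inr_desc]; infer_instance
  quasiCompact := by
    change QuasiCompact (Limits.coprod.desc X.obj.hom Y.obj.hom)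
    have hX : CompactSpace X.obj.left := QuasiCompact.compactSpace_of_compactSpace X.obj.hom
    have hY : CompactSpace Y.obj.left := QuasiCompact.compactSpace_of_compactSpace Y.obj.hom
    have hXY : CompactSpace (X.obj.left ⨿ Y.obj.left : Scheme.{0}) :=
      (coprodMk X.obj.left Y.obj.left).compactSpace
    infer_instance
  isSeparated := by
    change IsSeparated (Limits.coprod.desc X.obj.hom Y.obj.hom)
    have h : Limits.coprod.desc X.obj.hom Y.obj.hom =
        Limits.coprod.map X.obj.hom Y.obj.hom ≫ Limits.coprod.desc (𝟙 SpecC) (𝟙 SpecC) := by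
      simp
    have h1 : IsSeparated (Limits.coprod.map X.obj.hom Y.obj.hom) :=
      IsZariskiLocalAtTarget.coprodMap _ _ X.isSeparated Y.isSeparated
    rw [h]
    infer_instance

end RelVar

/-- Isomorphism classes of varieties over `𝔐`. -/
def IsoClass (𝔐 : Over SpecC) : Type 1 := Quotient (RelVar.isoSetoid 𝔐)

/-- The isomorphism class of a variety over `𝔐`. -/
def IsoClass.mk {𝔐 : Over SpecC} (X : RelVar 𝔐) : IsoClass 𝔐 := Quotient.mk _ X

section GrothendieckRing

variable (𝔐 : Over SpecC) [MonObj 𝔐] [IsCommMonObj 𝔐]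

instance : CommMonoid (IsoClass 𝔐) where
  mul := Quotient.map₂ RelVar.prod (by
    rintro X X' ⟨e, he⟩ Y Y' ⟨f, hf⟩
    refine ⟨e ⊗ᵢ f, ?_⟩
    simp only [RelVar.prod, ← he, ← hf]
    simp)
  one := IsoClass.mk (RelVar.point 𝔐)
  mul_assoc := by
    rintro ⟨X⟩ ⟨Y⟩ ⟨Z⟩
    refine Quotient.sound ⟨α_ X.obj Y.obj Z.obj, ?_⟩
    change (α_ X.obj Y.obj Z.obj).hom ≫ (X.str ⊗ₘ ((Y.str ⊗ₘ Z.str) ≫ μ[𝔐])) ≫ μ[𝔐] =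
      (((X.str ⊗ₘ Y.str) ≫ μ[𝔐]) ⊗ₘ Z.str) ≫ μ[𝔐]
    have h1 : (X.str ⊗ₘ ((Y.str ⊗ₘ Z.str) ≫ μ[𝔐])) =
        (X.str ⊗ₘ (Y.str ⊗ₘ Z.str)) ≫ (𝔐 ◁ μ[𝔐]) := by
      rw [← id_tensorHom, tensorHom_comp_tensorHom, Category.comp_id]
    have h2 : (((X.str ⊗ₘ Y.str) ≫ μ[𝔐]) ⊗ₘ Z.str) =
        ((X.str ⊗ₘ Y.str) ⊗ₘ Z.str) ≫ (μ[𝔐] ▷ 𝔐) := by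
      rw [← tensorHom_id, tensorHom_comp_tensorHom, Category.comp_id]
    rw [h1, h2, Category.assoc, Category.assoc, MonObj.mul_assoc, associator_naturality_assoc]
  one_mul := by
    rintro ⟨X⟩
    refine Quotient.sound ⟨λ_ X.obj, ?_⟩
    change (λ_ X.obj).hom ≫ X.str = (η[𝔐] ⊗ₘ X.str) ≫ μ[𝔐]
    rw [tensorHom_def', Category.assoc, MonObj.one_mul, leftUnitor_naturality]
  mul_one := by
    rintro ⟨X⟩
    refine Quotient.sound ⟨ρ_ X.obj, ?_⟩
    change (ρ_ X.obj).hom ≫ X.str = (X.str ⊗ₘ η[𝔐]) ≫ μ[𝔐]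
    rw [MonoidalCategory.tensorHom_def, Category.assoc, MonObj.mul_one, rightUnitor_naturality]
  mul_comm := by
    rintro ⟨X⟩ ⟨Y⟩
    refine Quotient.sound ⟨β_ X.obj Y.obj, ?_⟩
    change (β_ X.obj Y.obj).hom ≫ (Y.str ⊗ₘ X.str) ≫ μ[𝔐] = (X.str ⊗ₘ Y.str) ≫ μ[𝔐]
    rw [← BraidedCategory.braiding_naturality_assoc, IsCommMonObj.mul_comm]

variable {𝔐} in
/-- The cut and paste relations `[X] - [Z] - [U]`, for `Z` a closed subscheme of `X` and `U` its
open complement, both with the restricted map to `𝔐`. -/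
def scissors : Set (FreeAbelianGroup (IsoClass 𝔐)) :=
  {r | ∃ (X Z U : RelVar 𝔐) (i : Z.obj ⟶ X.obj) (j : U.obj ⟶ X.obj),
    IsClosedImmersion i.left ∧ IsOpenImmersion j.left ∧
    IsCompl (Set.range i.left) (Set.range j.left) ∧
    i ≫ X.str = Z.str ∧ j ≫ X.str = U.str ∧
    r = .of (.mk X) - .of (.mk Z) - .of (.mk U)}

/-- The Grothendieck ring `K₀(Var/𝔐)`: the free abelian group on isomorphism classes of varieties
over `𝔐` modulo the cut and paste relations, with product induced by `RelVar.prod`. The product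
of a cut and paste relation with the class of a variety is again one, so the ideal below is the
additive subgroup generated by these relations. -/
def K0 : Type 1 :=
  FreeAbelianGroup (IsoClass 𝔐) ⧸ Ideal.span (scissors (𝔐 := 𝔐))

instance : CommRing (K0 𝔐) :=
  inferInstanceAs (CommRing (FreeAbelianGroup (IsoClass 𝔐) ⧸ Ideal.span (scissors (𝔐 := 𝔐))))

variable {𝔐} in
/-- The class `[X ⟶ 𝔐]` in `K₀(Var/𝔐)`. -/
def cls (X : RelVar 𝔐) : K0 𝔐 :=
  Ideal.Quotient.mk (Ideal.span (scissors (𝔐 := 𝔐))) (FreeAbelianGroup.of (IsoClass.mk X))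

section

variable {𝔐}

lemma cls_prod (X Y : RelVar 𝔐) : cls (X.prod Y) = cls X * cls Y := by
  have h : IsoClass.mk (X.prod Y) = IsoClass.mk X * IsoClass.mk Y := rfl
  unfold cls
  rw [h, FreeAbelianGroup.of_mul]
  exact map_mul (Ideal.Quotient.mk (Ideal.span (scissors (𝔐 := 𝔐)))) _ _

lemma cls_point : cls (RelVar.point 𝔐) = 1 :=
  map_one (Ideal.Quotient.mk (Ideal.span (scissors (𝔐 := 𝔐))))

lemma cls_eq_add {X Z U : RelVar 𝔐} (i : Z.obj ⟶ X.obj) (j : U.obj ⟶ X.obj)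
    (hi : IsClosedImmersion i.left) (hj : IsOpenImmersion j.left)
    (hij : IsCompl (Set.range i.left) (Set.range j.left))
    (hZ : i ≫ X.str = Z.str) (hU : j ≫ X.str = U.str) : cls X = cls Z + cls U := by
  have h := Ideal.Quotient.eq_zero_iff_mem.mpr (Ideal.subset_span
    (show _ ∈ scissors (𝔐 := 𝔐) from ⟨X, Z, U, i, j, hi, hj, hij, hZ, hU, rfl⟩))
  rw [map_sub, map_sub, sub_sub, sub_eq_zero] at h
  exact h

lemma cls_coprod (X Y : RelVar 𝔐) : cls (X.coprod Y) = cls X + cls Y := by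
  refine cls_eq_add (Over.homMk coprod.inl (coprod.inl_desc _ _))
    (Over.homMk coprod.inr (coprod.inr_desc _ _)) ?_ ?_ ?_ ?_ ?_
  · change IsClosedImmersion (coprod.inl : X.obj.left ⟶ X.obj.left ⨿ Y.obj.left)
    refine IsClosedImmersion.of_isPreimmersion _ ?_
    rw [← (isCompl_range_inl_inr X.obj.left Y.obj.left).symm.compl_eq, isClosed_compl_iff]
    exact (coprod.inr : Y.obj.left ⟶ X.obj.left ⨿ Y.obj.left).isOpenEmbedding.isOpen_range
  · change IsOpenImmersion (coprod.inr : Y.obj.left ⟶ X.obj.left ⨿ Y.obj.left)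
    infer_instance
  · exact isCompl_range_inl_inr _ _
  · ext1
    exact coprod.inl_desc _ _
  · ext1
    exact coprod.inr_desc _ _

lemma cls_empty : cls (RelVar.empty 𝔐) = 0 := by
  have h : cls (RelVar.empty 𝔐) = cls (RelVar.empty 𝔐) + cls (RelVar.empty 𝔐) := by
    refine cls_eq_add (𝟙 _) (𝟙 _) ?_ ?_ ?_ (Category.id_comp _) (Category.id_comp _)
    · change IsClosedImmersion (𝟙 (∅ : Scheme.{0}))
      infer_instance
    · change IsOpenImmersion (𝟙 (∅ : Scheme.{0}))
      infer_instance
    · have he : ∀ t : Set (RelVar.empty 𝔐).obj.left, t = ∅ := fun t =>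
        Set.eq_empty_iff_forall_notMem.mpr fun x => (PEmpty.elim x)
      rw [isCompl_iff, disjoint_iff, codisjoint_iff]
      exact ⟨he _, (he _).trans (he _).symm⟩
  simpa using h

end

/-- The effective classes `S₀(Var/𝔐) ⊆ K₀(Var/𝔐)`: the sub-semiring of all classes `[X ⟶ 𝔐]` of
varieties over `𝔐`. -/
def S0 : Subsemiring (K0 𝔐) where
  carrier := Set.range cls
  mul_mem' := by
    rintro _ _ ⟨X, rfl⟩ ⟨Y, rfl⟩
    exact ⟨X.prod Y, cls_prod X Y⟩
  one_mem' := ⟨RelVar.point 𝔐, cls_point⟩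
  add_mem' := by
    rintro _ _ ⟨X, rfl⟩ ⟨Y, rfl⟩
    exact ⟨X.coprod Y, cls_coprod X Y⟩
  zero_mem' := ⟨RelVar.empty 𝔐, cls_empty⟩

variable {𝔐} in
/-- The class of a variety over `𝔐` as an element of `S₀(Var/𝔐)`. -/
def effCls (X : RelVar 𝔐) : S0 𝔐 := ⟨cls X, X, rfl⟩

end GrothendieckRing

/-! ### Power structures -/

/-- The set `1 + t R⟦t⟧` of power series with constant term `1`, as a multiplicative monoid. -/
abbrev OneSeries (R : Type*) [CommSemiring R] : Submonoid R⟦X⟧ :=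
  MonoidHom.mker (PowerSeries.constantCoeff (R := R))

/-- A power structure on a commutative semiring `R`: a map
`(1 + t R⟦t⟧) × R ⟶ 1 + t R⟦t⟧`, `(A, r) ↦ A ^ r`, satisfying the five axioms. -/
structure IsPowerStructure {R : Type*} [CommSemiring R]
    (pow : OneSeries R → R → OneSeries R) : Prop where
  pow_zero : ∀ A, pow A 0 = 1
  pow_one : ∀ A, pow A 1 = A
  mul_pow : ∀ A B n, pow A n * pow B n = pow (A * B) n
  pow_add : ∀ A n m, pow A (n + m) = pow A n * pow A m
  pow_mul : ∀ A n m, pow A (n * m) = pow (pow A n) m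

/-! ### Quotients by finite groups -/

/-- `q : X ⟶ B` is a (geometric) quotient of the `S`-scheme `X` by the action `ρ` of a finite
group `G`: it is an invariant finite surjective morphism whose fibres are the `G`-orbits and such
that the functions on an open `U ⊆ B` are the invariant functions on `q⁻¹ U`. -/
structure IsGeometricQuotient {S : Scheme.{0}} {G : Type} [Group G] {X B : Over S}
    (ρ : G →* End X) (q : X ⟶ B) : Prop where
  invariant : ∀ g : G, (ρ g : X ⟶ X) ≫ q = q
  finite : IsFinite q.left
  surjective : Surjective q.left
  orbits : ∀ x y : X.left, q.left x = q.left y → ∃ g : G, (ρ g : X ⟶ X).left x = y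
  injective : ∀ U : B.left.Opens, Function.Injective (q.left.app U)
  sections : ∀ (U : B.left.Opens) (s : Γ(X.left, q.left ⁻¹ᵁ U)),
    (∀ (g : G) (h : q.left ⁻¹ᵁ U ≤ (ρ g : X ⟶ X).left ⁻¹ᵁ q.left ⁻¹ᵁ U),
      (ρ g : X ⟶ X).left.appLE (q.left ⁻¹ᵁ U) (q.left ⁻¹ᵁ U) h s = s) →
    ∃ t : Γ(B.left, U), q.left.app U t = s

/-! ### The configuration spaces -/

section Configurations

variable {n : ℕ} (α : n.Partition)

/-- `S_α = ∏ᵢ S_{bᵢ(α)}`, where `bᵢ(α)` is the number of parts of `α` of size `i`. -/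
abbrev PartPerm : Type := ∀ i : ℕ, Equiv.Perm (Fin (α.parts.count i))

variable {α} in
/-- The action of `S_α` on the set `α.parts` of parts of `α`: a part is a pair of its size `i`
and an element of `Fin (bᵢ(α))`, and the `i`-th factor of `S_α` permutes the parts of size `i`. -/
def PartPerm.act (σ : PartPerm α) (p : α.parts) : α.parts := α.parts.mkToType p.1 (σ p.1 p.2)

instance : HasFiniteProducts (Over SpecC) :=
  Over.ConstructProducts.over_finiteProducts_of_finiteWidePullbacks

lemma PartPerm.act_mul (σ τ : PartPerm α) (p : α.parts) : (σ * τ).act p = σ.act (τ.act p) := rfl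

lemma PartPerm.act_one (p : α.parts) : (1 : PartPerm α).act p = p := rfl

lemma PartPerm.act_injective (σ : PartPerm α) : Function.Injective σ.act := by
  intro p q h
  have h' : (σ⁻¹ * σ).act p = (σ⁻¹ * σ).act q := by rw [act_mul, act_mul, h]
  rwa [inv_mul_cancel] at h'

variable (M : Over SpecC) (A : ℕ → Over SpecC)

/-- The product `∏ᵢ M ^ bᵢ(α)`, with one factor `M` for each part of `α`. -/
def powObj : Over SpecC := ∏ᶜ fun _ : α.parts => M

/-- The product `∏ᵢ Aᵢ ^ bᵢ(α)`, with one factor `Aᵢ` for each part of `α` of size `i`. -/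
def stateObj : Over SpecC := ∏ᶜ fun p : α.parts => A p.1

/-- The coordinate of `∏ᵢ M ^ bᵢ(α)` at a part of `α`. -/
def powπ (p : α.parts) : powObj α M ⟶ M := Pi.π (fun _ : α.parts => M) p

/-- The coordinate of `∏ᵢ Aᵢ ^ bᵢ(α)` at a part of `α`. -/
def stateπ (p : α.parts) : stateObj α A ⟶ A p.1 := Pi.π (fun p : α.parts => A p.1) p

/-- The large diagonal `Δ`, where two coordinates belonging to different parts agree. -/
def largeDiagonal : Set (powObj α M).left :=
  ⋃ (p : α.parts) (q : α.parts) (_ : p ≠ q),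
    (lift (powπ α M p) (powπ α M q)).left ⁻¹' Set.range (lift (𝟙 M) (𝟙 M)).left

lemma isClosed_largeDiagonal [IsSeparated M.hom] : IsClosed (largeDiagonal α M) := by
  have h : IsClosedImmersion (lift (𝟙 M) (𝟙 M)).left :=
    inferInstanceAs (IsClosedImmersion (pullback.diagonal M.hom))
  refine isClosed_iUnion_of_finite fun p => isClosed_iUnion_of_finite fun q =>
    isClosed_iUnion_of_finite fun _ => ?_
  exact (lift (𝟙 M) (𝟙 M)).left.isClosedEmbedding.isClosed_range.preimage
    (lift (powπ α M p) (powπ α M q)).left.continuous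

variable {α}

/-- The permutation of the coordinates of `∏ᵢ M ^ bᵢ(α)` given by an element of `S_α`. -/
def permPow (σ : PartPerm α) : powObj α M ⟶ powObj α M :=
  Pi.lift fun p => powπ α M (σ⁻¹.act p)

/-- The permutation of the coordinates of `∏ᵢ Aᵢ ^ bᵢ(α)` given by an element of `S_α`. -/
def permState (σ : PartPerm α) : stateObj α A ⟶ stateObj α A :=
  Pi.lift fun p => stateπ α A (σ⁻¹.act p)

lemma permPow_π (σ : PartPerm α) (p : α.parts) :
    permPow M σ ≫ powπ α M p = powπ α M (σ⁻¹.act p) := Pi.lift_π _ _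

lemma permState_π (σ : PartPerm α) (p : α.parts) :
    permState A σ ≫ stateπ α A p = stateπ α A (σ⁻¹.act p) := Pi.lift_π _ _

lemma pow_hom_ext {Z : Over SpecC} {f g : Z ⟶ powObj α M}
    (h : ∀ p, f ≫ powπ α M p = g ≫ powπ α M p) : f = g := Pi.hom_ext _ _ h

lemma state_hom_ext {Z : Over SpecC} {f g : Z ⟶ stateObj α A}
    (h : ∀ p, f ≫ stateπ α A p = g ≫ stateπ α A p) : f = g := Pi.hom_ext _ _ h

lemma permPow_one : permPow M (1 : PartPerm α) = 𝟙 _ :=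
  pow_hom_ext M fun p => by
    rw [permPow_π, Category.id_comp, inv_one, PartPerm.act_one]

lemma permPow_mul (σ τ : PartPerm α) : permPow M (σ * τ) = permPow M τ ≫ permPow M σ :=
  pow_hom_ext M fun p => by
    rw [permPow_π, Category.assoc, permPow_π, permPow_π, mul_inv_rev, PartPerm.act_mul]

lemma permState_one : permState A (1 : PartPerm α) = 𝟙 _ :=
  state_hom_ext A fun p => by
    rw [permState_π, Category.id_comp]
    rfl

lemma permState_mul (σ τ : PartPerm α) : permState A (σ * τ) = permState A τ ≫ permState A σ :=
  state_hom_ext A fun p => by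
    rw [permState_π, Category.assoc, permState_π, mul_inv_rev]
    exact (permState_π A τ (σ⁻¹.act p)).symm

variable (α)

variable [IsSeparated M.hom]

/-- The complement of the large diagonal as an open subset. -/
def confOpen : (powObj α M).left.Opens :=
  ⟨(largeDiagonal α M)ᶜ, (isClosed_largeDiagonal α M).isOpen_compl⟩

/-- The ordered configuration space `∏ᵢ M ^ bᵢ(α) \ Δ`. -/
def confObj : Over SpecC := Over.mk ((confOpen α M).ι ≫ (powObj α M).hom)

/-- The inclusion of `∏ᵢ M ^ bᵢ(α) \ Δ` into `∏ᵢ M ^ bᵢ(α)`. -/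
def confι : confObj α M ⟶ powObj α M := Over.homMk (confOpen α M).ι rfl

variable {α}

lemma permPow_mem (σ : PartPerm α) (x : (powObj α M).left) (hx : x ∈ confOpen α M) :
    (permPow M σ).left x ∈ confOpen α M := by
  intro hmem
  apply hx
  simp only [largeDiagonal, Set.mem_iUnion] at hmem ⊢
  obtain ⟨p, q, hpq, y, hy⟩ := hmem
  refine ⟨σ⁻¹.act p, σ⁻¹.act q, fun h => hpq (PartPerm.act_injective _ _ h), y, ?_⟩
  rw [hy, ← permPow_π, ← permPow_π, ← comp_lift, Over.comp_left, Scheme.Hom.comp_apply]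

/-- The action of an element of `S_α` on the complement of the large diagonal. -/
def permConfLeft (σ : PartPerm α) : (confOpen α M).toScheme ⟶ (confOpen α M).toScheme :=
  IsOpenImmersion.lift (confOpen α M).ι ((confOpen α M).ι ≫ (permPow M σ).left) (by
    rintro _ ⟨x, rfl⟩
    rw [Scheme.Opens.range_ι, Scheme.Hom.comp_apply]
    exact permPow_mem M σ _ x.2)

lemma permConfLeft_ι (σ : PartPerm α) :
    permConfLeft M σ ≫ (confOpen α M).ι = (confOpen α M).ι ≫ (permPow M σ).left :=
  IsOpenImmersion.lift_fac _ _ _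

/-- The action of an element of `S_α` on `∏ᵢ M ^ bᵢ(α) \ Δ`. -/
def permConf (σ : PartPerm α) : confObj α M ⟶ confObj α M :=
  Over.homMk (permConfLeft M σ) (by
    change permConfLeft M σ ≫ (confOpen α M).ι ≫ (powObj α M).hom =
      (confOpen α M).ι ≫ (powObj α M).hom
    rw [← Category.assoc, permConfLeft_ι, Category.assoc, Over.w])

lemma permConf_ι (σ : PartPerm α) : permConf M σ ≫ confι α M = confι α M ≫ permPow M σ := by
  ext1
  exact permConfLeft_ι M σ

instance : Mono (confι α M) :=
  have _h : Mono (confι α M).left := inferInstanceAs (Mono (confOpen α M).ι)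
  Over.mono_of_mono_left _

lemma permConf_one : permConf M (1 : PartPerm α) = 𝟙 _ := by
  rw [← cancel_mono (confι α M), permConf_ι, permPow_one, Category.comp_id, Category.id_comp]

lemma permConf_mul (σ τ : PartPerm α) : permConf M (σ * τ) = permConf M τ ≫ permConf M σ := by
  rw [← cancel_mono (confι α M), permConf_ι, permPow_mul, Category.assoc, permConf_ι,
    ← Category.assoc, ← Category.assoc, permConf_ι]

variable (α)

/-- The variety `(∏ᵢ M ^ bᵢ(α) \ Δ) × ∏ᵢ Aᵢ ^ bᵢ(α)` of ordered configurations of charged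
particles: there is one particle for each part of `α`, and a particle of multiplicity `i` has
internal state in `Aᵢ`. -/
def orderedObj : Over SpecC := confObj α M ⊗ stateObj α A

/-- The diagonal action of `S_α` on `(∏ᵢ M ^ bᵢ(α) \ Δ) × ∏ᵢ Aᵢ ^ bᵢ(α)`. -/
def orderedAct : PartPerm α →* End (orderedObj α M A) where
  toFun σ := permConf M σ ⊗ₘ permState A σ
  map_one' := by
    rw [permConf_one, permState_one, id_tensorHom_id]
    rfl
  map_mul' σ τ := by
    rw [permConf_mul, permState_mul, ← tensorHom_comp_tensorHom]
    rfl

/-- The position in `M` of the particle belonging to a part of `α`. -/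
def position (p : α.parts) : orderedObj α M A ⟶ M :=
  fst (confObj α M) (stateObj α A) ≫ confι α M ≫ powπ α M p

/-- The internal state in `Aᵢ` of the particle belonging to a part of `α` of size `i`. -/
def internalState (p : α.parts) : orderedObj α M A ⟶ A p.1 :=
  snd (confObj α M) (stateObj α A) ≫ stateπ α A p

end Configurations

section Weights

variable {𝔐 : Over SpecC} [MonObj 𝔐] [IsCommMonObj 𝔐] {n : ℕ}

/-- The total weight `∑ₚ (i(p) · p_M(position of p) + p_A(state of p))` of an ordered configuration,
`i(p)` being the size of the part `p`, as a map to `𝔐`. The sum is taken in the commutative monoid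
of morphisms to `𝔐`, which is written multiplicatively. -/
def totalWeight (α : n.Partition) (M : RelVar 𝔐) (A : ℕ → RelVar 𝔐) :
    orderedObj α M.obj (fun i => (A i).obj) ⟶ 𝔐 :=
  ∏ p : α.parts, (position α M.obj (fun i => (A i).obj) p ≫ M.str) ^ p.1 *
    (internalState α M.obj (fun i => (A i).obj) p ≫ (A p.1).str)

/-- `B` is the variety
`B_α = (∏ᵢ M ^ bᵢ(α) \ Δ) ×_{S_α} ∏ᵢ Aᵢ ^ bᵢ(α)`
over `𝔐`: it is the quotient of the variety of ordered configurations by `S_α`, and its map to `𝔐` is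
induced by the total weight. -/
def IsConfigurationSpace (α : n.Partition) (M : RelVar 𝔐) (A : ℕ → RelVar 𝔐) (B : RelVar 𝔐) :
    Prop :=
  ∃ q : orderedObj α M.obj (fun i => (A i).obj) ⟶ B.obj,
    IsGeometricQuotient (orderedAct α M.obj (fun i => (A i).obj)) q ∧
    q ≫ B.str = totalWeight α M A

/-- The map `(A(t), m) ↦ A(t) ^ m` is given by the charged particle construction: whenever
`A(t) = ∑ᵢ [Aᵢ] tⁱ` and `B_α` are the configuration spaces formed with `M` and the `Aᵢ`, the
coefficient of `tⁿ` in `A(t) ^ [M]` is the sum of the classes `[B_α]` over all partitions `α`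
of `n`. -/
def IsChargedParticlePower (pow : OneSeries (S0 𝔐) → S0 𝔐 → OneSeries (S0 𝔐)) : Prop :=
  ∀ (A : ℕ → RelVar 𝔐) (M : RelVar 𝔐) (a : OneSeries (S0 𝔐)),
    (∀ i, PowerSeries.coeff i (a : (S0 𝔐)⟦X⟧) = effCls (A i)) →
    ∀ (n : ℕ) (B : n.Partition → RelVar 𝔐), (∀ α, IsConfigurationSpace α M A (B α)) →
      PowerSeries.coeff n (pow a (effCls M) : (S0 𝔐)⟦X⟧) = ∑ α, effCls (B α)

/-- Every finite set of points lies in an affine open subset. All quasi-projective varieties have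
this property; it is the standard condition for quotients by finite groups to exist as schemes. -/
def FinitelyAffine (X : RelVar 𝔐) : Prop :=
  ∀ s : Set X.obj.left, s.Finite → ∃ U : X.obj.left.Opens, IsAffineOpen U ∧ s ⊆ U

end Weights

end RelativeMotives

end

open CategoryTheory RelativeMotives

noncomputable section

open CategoryTheory Limits AlgebraicGeometry MonoidalCategory CartesianMonoidalCategory MonObj
open scoped PowerSeries

namespace RelativeMotives

/-! Classes are compared through geometric points, the `K`-points for algebraically closed
extensions `K` of `ℂ`. A morphism over `𝔐` which is bijective on all of these identifies classes
(`cls_eq_of_kBijective`). Indeed, its residue extension at a generic point is purely inseparable,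
hence trivial in characteristic zero, so that it has a section over a nonempty open subset, and
Noetherian induction treats the complement. More flexibly, two sums of classes agree as soon as
finitely many varieties mapping to both sides induce a bijection of `K`-points compatible with the
weights (`sum_cls_eq_of_correspondence`): by Chevalley the graph of this bijection is constructible,
and it can be presented as a variety which projects bijectively to both sides.

The `K`-points of a quotient by a finite group are the orbits of `K`-points (`KPt.exists_lift'`,
`IsGeometricQuotient.exists_kpt_eq`). So a `K`-point of the disjoint union of the `B_α`, `α ⊢ n`, is
a finite set of particles with distinct positions and total degree `n`, its
`IsConfigurationSpace.code`, and the axioms become statements about such sets. The axioms for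
exponents `0` and `1` hold since the empty variety carries no particle and a point carries at most
one. A configuration on a disjoint union is a pair of configurations (`sum_cls_coprod`). A particle
whose state is a pair of states of degrees `i` and `j` splits into two particles at the same
position, those of degree zero being dropped (`sum_cls_mul`). Grouping the particles on `N × M` by
their coordinate in `M` gives particles on `M` whose states are configurations on `N`
(`sum_cls_prod`).

Two difficulties remain. First, the quotients need not exist. They do when finite sets of points
have affine neighbourhoods: spectra of rings of invariants of stable affine open subsets are glued,
which is part (a). Moreover every variety receives a morphism from an affine one that is bijective
on geometric points, and such replacements do not change the sum of the classes of the `B_α`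
(`sum_cls_eq_of_kBijective`). This defines `confSeries` for all data and also gives uniqueness.

Second, the coefficients must depend only on the classes of `M` and the `A_i`. For `M`, the series
is a unit and turns disjoint unions into products, so it factors through `K₀` (`eq_of_cls_eq`). For
the `A_i`, equal classes only give varieties that become piecewise equivalent after adding some `C`.
Multiplying both series by an invertible series with `C` among its states absorbs `C`, and this is
done one degree at a time (`coeff_confSeries_eq_of_cls_eq`). -/

/-! ### Geometric points -/

/-- The spectrum of a field extension of `ℂ`, as a `ℂ`-scheme. -/
abbrev SpecK (K : Type) [Field K] [Algebra ℂ K] : Over SpecC :=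
  Over.mk (Spec.map (CommRingCat.ofHom (algebraMap ℂ K)))

/-- The set `X(K)` of `K`-valued points of a `ℂ`-scheme. -/
abbrev KPt (K : Type) [Field K] [Algebra ℂ K] (X : Over SpecC) : Type := SpecK K ⟶ X

/-- The unique point of `Spec K`. -/
def specPt (K : Type) [Field K] [Algebra ℂ K] : (SpecK K).left :=
  show PrimeSpectrum K from IsLocalRing.closedPoint K

/-- The point of the underlying space of a `K`-valued point. -/
def KPt.pt {K : Type} [Field K] [Algebra ℂ K] {X : Over SpecC} (v : KPt K X) : X.left :=
  v.left (specPt K)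

section

variable {K : Type} [Field K] [Algebra ℂ K]

lemma KPt.left_apply {X : Over SpecC} (v : KPt K X) (z : (SpecK K).left) : v.left z = v.pt :=
  congrArg _ (Subsingleton.elim (α := PrimeSpectrum K) _ _)

end

/-- Every morphism from the spectrum of a field to a `ℂ`-scheme extends to a geometric point. -/
lemma exists_kpt_of_spec {X : Over SpecC} {k : Type} [Field k] (g : Spec (.of k) ⟶ X.left) :
    ∃ (K : Type) (_ : Field K) (_ : Algebra ℂ K) (_ : IsAlgClosed K) (_ : Algebra k K)
      (v : KPt K X), v.left = Spec.map (CommRingCat.ofHom (algebraMap k K)) ≫ g := by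
  let φ := Spec.preimage (g ≫ X.hom)
  let _ : Algebra ℂ k := φ.hom.toAlgebra
  refine ⟨AlgebraicClosure k, inferInstance, inferInstance, inferInstance, inferInstance,
    Over.homMk (Spec.map (CommRingCat.ofHom (algebraMap k (AlgebraicClosure k))) ≫ g) ?_, rfl⟩
  dsimp
  rw [Category.assoc, ← Spec.map_preimage (g ≫ X.hom), ← Spec.map_comp]
  rfl

/-- The algebraic closure of the residue field of `x` supplies the point. -/
lemma exists_kpt_pt (X : Over SpecC) (x : X.left) :
    ∃ (K : Type) (_ : Field K) (_ : Algebra ℂ K) (_ : IsAlgClosed K) (v : KPt K X), v.pt = x := by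
  obtain ⟨K, _, _, _, _, v, hv⟩ := exists_kpt_of_spec (X := X) (X.left.fromSpecResidueField x)
  refine ⟨K, _, _, inferInstance, v, ?_⟩
  rw [KPt.pt, hv]
  exact X.left.fromSpecResidueField_apply x _

/-- Two morphisms to a scheme from a reduced `ℂ`-scheme agree if they agree on geometric points. -/
lemma hom_ext_of_kpts {X Z : Over SpecC} [IsReduced X.left] {f g : X ⟶ Z}
    (h : ∀ (K : Type) [Field K] [Algebra ℂ K] [IsAlgClosed K] (v : KPt K X), v ≫ f = v ≫ g) :
    f = g := by
  ext1
  -- Every geometric point factors through the equalizer, and a surjective closed immersion into a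
  -- reduced scheme is an isomorphism.
  have hs : Surjective (equalizer.ι f.left g.left) := by
    refine ⟨fun x => ?_⟩
    obtain ⟨K, _, _, _, v, rfl⟩ := exists_kpt_pt X x
    have hv : v.left ≫ f.left = v.left ≫ g.left := congrArg (·.left) (h K v)
    refine ⟨equalizer.lift v.left hv (specPt K), ?_⟩
    rw [← Scheme.Hom.comp_apply, equalizer.lift_ι]
    rfl
  have : IsClosedImmersion (equalizer.ι f.left g.left) :=
    .of_isPreimmersion _ (by rw [hs.1.range_eq]; exact isClosed_univ)
  have := isIso_of_isClosedImmersion_of_surjective (Y := X.left) (equalizer.ι f.left g.left)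
  rw [← cancel_epi (equalizer.ι f.left g.left), equalizer.condition]

/-- A morphism which is injective on geometric points is universally injective. -/
lemma universallyInjective_of_kpts {X Y : Over SpecC} {f : X ⟶ Y}
    (h : ∀ (K : Type) [Field K] [Algebra ℂ K] [IsAlgClosed K] (v w : KPt K X),
      v ≫ f = w ≫ f → v = w) : UniversallyInjective f.left := by
  refine ((tfae_universallyInjective f.left).out 0 1).mpr ?_
  intro k _ g₁ g₂ hg
  dsimp only at hg
  obtain ⟨K, _, _, _, _, v, hv⟩ := exists_kpt_of_spec (X := X) g₁
  have hw : (Spec.map (CommRingCat.ofHom (algebraMap k K)) ≫ g₂) ≫ X.hom =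
      (SpecK K).hom := by
    rw [Category.assoc, ← Over.w f, ← reassoc_of% hg, Over.w f, ← Category.assoc, ← hv]
    exact Over.w v
  have := h K v (Over.homMk _ hw) (by
    ext1
    rw [Over.comp_left, Over.comp_left, hv]
    exact (Category.assoc _ _ _).trans ((congrArg _ hg).trans (Category.assoc _ _ _).symm))
  have h2 := congrArg (·.left) this
  dsimp at h2
  rw [hv] at h2
  -- Equality over `K` descends to `k`, since the map of spectra is flat and surjective.
  have : Epi (Spec.map (CommRingCat.ofHom (algebraMap k K))) := by
    have h1 : Flat (Spec.map (CommRingCat.ofHom (algebraMap k K))) := by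
      rw [Flat.SpecMap_iff]
      exact RingHom.flat_algebraMap_iff.mpr inferInstance
    have h2 : Surjective (Spec.map (CommRingCat.ofHom (algebraMap k K))) :=
      ⟨fun z => ⟨IsLocalRing.closedPoint K, Subsingleton.elim (α := PrimeSpectrum k) _ _⟩⟩
    infer_instance
  exact (cancel_epi _).mp h2

lemma exists_closedPoint_of_nonempty {X : Scheme.{0}} [IsAffine X] [Nonempty X] :
    ∃ x : X, IsClosed {x} := by
  have : CompactSpace X := inferInstance
  obtain ⟨x, -, hx⟩ := (isClosed_univ (X := X)).exists_closed_singleton Set.univ_nonempty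
  exact ⟨x, hx⟩

/-- Over an algebraically closed field, a geometric point of the target lifts along a morphism
locally of finite type as soon as the underlying point does. -/
lemma KPt.exists_lift {K : Type} [Field K] [Algebra ℂ K] [IsAlgClosed K] {X Y : Over SpecC}
    (f : X ⟶ Y) [LocallyOfFiniteType f.left] (y : KPt K Y) (x : X.left) (hx : f.left x = y.pt) :
    ∃ v : KPt K X, v ≫ f = y := by
  -- The fibre of `f` over `y` is nonempty and locally of finite type over `K`. By the
  -- Nullstellensatz a closed point of a nonempty affine open subset of it is `K`-rational.
  obtain ⟨z, hz, -⟩ := Scheme.Pullback.exists_preimage_pullback (f := f.left) (g := y.left) x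
    (specPt K) hx
  obtain ⟨_, ⟨U : (pullback f.left y.left).Opens, hU, rfl⟩, hzU, -⟩ :=
    (pullback f.left y.left).isBasis_affineOpens.exists_subset_of_mem_open (Set.mem_univ z)
      isOpen_univ
  have : IsAffine U.toScheme := hU
  have : Nonempty U.toScheme := ⟨⟨z, hzU⟩⟩
  obtain ⟨u, hu⟩ := exists_closedPoint_of_nonempty (X := U.toScheme)
  let p := pointOfClosedPoint (K := K) (U.ι ≫ pullback.snd f.left y.left) u hu
  have hp : p ≫ U.ι ≫ pullback.snd f.left y.left = 𝟙 _ := pointOfClosedPoint_comp _ _ _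
  have hq : (p ≫ U.ι ≫ pullback.fst f.left y.left) ≫ f.left = y.left := by
    rw [Category.assoc, Category.assoc, pullback.condition, ← Category.assoc U.ι,
      ← Category.assoc p, hp, Category.id_comp]
  refine ⟨Over.homMk (p ≫ U.ι ≫ pullback.fst f.left y.left) ?_, ?_⟩
  · rw [← Over.w f, ← Category.assoc, hq]
    exact Over.w y
  · ext1
    exact hq

lemma surjective_of_kpts {X Y : Over SpecC} {f : X ⟶ Y}
    (h : ∀ (K : Type) [Field K] [Algebra ℂ K] [IsAlgClosed K] (y : KPt K Y),
      ∃ v : KPt K X, v ≫ f = y) : Surjective f.left := by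
  refine ⟨fun y => ?_⟩
  obtain ⟨K, _, _, _, v, rfl⟩ := exists_kpt_pt Y y
  obtain ⟨w, rfl⟩ := h K v
  exact ⟨w.pt, rfl⟩


/-! ### Classes in the Grothendieck ring -/

lemma isReduced_subscheme_vanishingIdeal {X : Scheme.{0}} (Z : TopologicalSpace.Closeds X) :
    IsReduced (Scheme.IdealSheafData.vanishingIdeal Z).subscheme := by
  have key : ∀ U : X.affineOpens, IsReduced (Spec (.of
      (Γ(X, U.1) ⧸ (Scheme.IdealSheafData.vanishingIdeal Z).ideal U))) := by
    intro U
    have : _root_.IsReduced (Γ(X, U.1) ⧸ (Scheme.IdealSheafData.vanishingIdeal Z).ideal U) := by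
      rw [← Ideal.isRadical_iff_quotient_reduced, Scheme.IdealSheafData.vanishingIdeal_ideal]
      exact PrimeSpectrum.isRadical_vanishingIdeal _
    infer_instance
  exact @IsReduced.of_openCover _
    (Scheme.IdealSheafData.vanishingIdeal Z).subschemeCover.openCover key

/-- A closed subset of a scheme is the range of a closed immersion from a reduced scheme. -/
lemma exists_reduced_closedImmersion (X : Scheme.{0}) (T : Set X) (hT : IsClosed T) :
    ∃ (Z : Scheme.{0}) (i : Z ⟶ X), IsReduced Z ∧ IsClosedImmersion i ∧ Set.range i = T := by
  refine ⟨_, (Scheme.IdealSheafData.vanishingIdeal ⟨T, hT⟩).subschemeι,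
    isReduced_subscheme_vanishingIdeal _, inferInstance, ?_⟩
  rw [Scheme.IdealSheafData.range_subschemeι, Scheme.IdealSheafData.coe_support_vanishingIdeal]
  rfl

/-- Algebraic extensions in characteristic zero are separable, and an extension that is both
separable and purely inseparable is trivial. -/
lemma bijective_of_isPurelyInseparable_of_charZero {k l : Type*} [Field k] [Field l] [CharZero k]
    (φ : k →+* l) (h : φ.IsPurelyInseparable) : Function.Bijective φ := by
  algebraize [φ]
  have : Algebra.IsSeparable k l := inferInstance
  exact ⟨φ.injective, IsPurelyInseparable.surjective_algebraMap_of_isSeparable k l⟩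

/-- A universally injective and surjective morphism to an integral scheme of characteristic zero
has a section over a nonempty open subset. -/
lemma exists_section_of_isIntegral {V W : Scheme.{0}} [IsIntegral W] (h : W ⟶ SpecC) (f : V ⟶ W)
    [LocallyOfFiniteType f] [UniversallyInjective f] [Surjective f] :
    ∃ (U : W.Opens) (_ : (U : Set W).Nonempty) (s : U.toScheme ⟶ V), s ≫ f = U.ι := by
  obtain ⟨x, hx⟩ := f.surjective (genericPoint W)
  have hp := ((tfae_universallyInjective f).out 0 2).mp ‹UniversallyInjective f›
  replace hp := hp.2 x
  have : CharZero (W.residueField (f x)) := by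
    let φ : ℂ →+* W.residueField (f x) := (Spec.preimage (W.fromSpecResidueField (f x) ≫ h)).hom
    exact (φ.charZero_iff φ.injective).mp inferInstance
  have h1 := bijective_of_isPurelyInseparable_of_charZero _ hp
  have : IsIso (f.residueFieldMap x) := (ConcreteCategory.isIso_iff_bijective _).mpr h1
  -- The local ring at the generic point is the function field, so it equals its residue field.
  -- Inverting the two residue maps gives a section over the spectrum of this local ring, which
  -- spreads out to a neighbourhood.
  have hF : IsField (W.presheaf.stalk (f x)) := by
    rw [hx]
    exact Field.toIsField W.functionField
  have h2 : Function.Bijective (W.residue (f x)) := by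
    refine ⟨?_, IsLocalRing.residue_surjective⟩
    let _ := hF.toField
    exact (W.residue (f x)).hom.injective
  have : IsIso (W.residue (f x)) := (ConcreteCategory.isIso_iff_bijective _).mpr h2
  obtain ⟨U, hU, s, -, hs⟩ := spread_out_of_isGermInjective' (𝟙 W) f (x := f x)
    (inv (Spec.map (W.residue (f x))) ≫ inv (Spec.map (f.residueFieldMap x)) ≫
      V.fromSpecResidueField x) (by
      rw [Category.assoc, Category.assoc, ← Scheme.Hom.SpecMap_residueFieldMap_fromSpecResidueField,
        IsIso.inv_hom_id_assoc, Category.comp_id, IsIso.inv_comp_eq]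
      rfl)
  exact ⟨U, ⟨_, hU⟩, s, by rw [hs, Category.comp_id]⟩

/-- A Noetherian space has a nonempty open subset inside a single irreducible component. Such an
open subscheme of a reduced scheme is integral, so the integral case applies over it. -/
lemma exists_section_of_isReduced {V W : Scheme.{0}} [IsReduced W]
    [TopologicalSpace.NoetherianSpace W] [Nonempty W] (h : W ⟶ SpecC) (f : V ⟶ W)
    [LocallyOfFiniteType f] [UniversallyInjective f] [Surjective f] :
    ∃ (U : W.Opens) (_ : (U : Set W).Nonempty) (s : U.toScheme ⟶ V), s ≫ f = U.ι := by
  obtain ⟨x⟩ := ‹Nonempty W›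
  obtain ⟨o, ho, hne, hoZ⟩ :=
    TopologicalSpace.NoetherianSpace.exists_isOpen_nonempty_subset_irreducibleComponent
      (irreducibleComponent x) (irreducibleComponent_mem_irreducibleComponents x)
  let U₀ : W.Opens := ⟨o, ho⟩
  have hirr : IsIrreducible o :=
    ⟨hne, (isIrreducible_irreducibleComponent (x := x)).2.open_subset ho hoZ⟩
  have : IrreducibleSpace U₀ := Subtype.irreducibleSpace hirr
  have : IrreducibleSpace U₀.toScheme := this
  have : IsIntegral U₀.toScheme := isIntegral_of_irreducibleSpace_of_isReduced _
  have : UniversallyInjective (f ∣_ U₀) := IsZariskiLocalAtTarget.restrict ‹_› U₀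
  have : Surjective (f ∣_ U₀) := IsZariskiLocalAtTarget.restrict ‹_› U₀
  obtain ⟨U, ⟨u, hu⟩, s, hs⟩ := exists_section_of_isIntegral (U₀.ι ≫ h) (f ∣_ U₀)
  refine ⟨U₀.ι ''ᵁ U, ⟨_, u, hu, rfl⟩, (U₀.ι.isoImage U).inv ≫ s ≫ (f ⁻¹ᵁ U₀).ι, ?_⟩
  rw [Category.assoc, Category.assoc, ← morphismRestrict_ι, reassoc_of% hs,
    Scheme.Hom.isoImage_inv_ι]

namespace RelVar

variable {𝔐 : Over SpecC}

instance (X : RelVar 𝔐) : CompactSpace X.obj.left :=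
  QuasiCompact.compactSpace_of_compactSpace X.obj.hom

instance (X : RelVar 𝔐) : IsLocallyNoetherian X.obj.left :=
  LocallyOfFiniteType.isLocallyNoetherian X.obj.hom

instance (X : RelVar 𝔐) : AlgebraicGeometry.IsNoetherian X.obj.left where

instance (X : RelVar 𝔐) : TopologicalSpace.NoetherianSpace X.obj.left :=
  IsNoetherian.noetherianSpace

/-- A separated scheme of finite type over a variety over `𝔐`, as a variety over `𝔐`. -/
def sub (X : RelVar 𝔐) {V : Scheme.{0}} (f : V ⟶ X.obj.left)
    [LocallyOfFiniteType f] [QuasiCompact f] [IsSeparated f] : RelVar 𝔐 where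
  obj := Over.mk (f ≫ X.obj.hom)
  str := Over.homMk f ≫ X.str
  locallyOfFiniteType := inferInstanceAs (LocallyOfFiniteType (f ≫ X.obj.hom))
  quasiCompact := inferInstanceAs (QuasiCompact (f ≫ X.obj.hom))
  isSeparated := inferInstanceAs (IsSeparated (f ≫ X.obj.hom))

/-- The morphism defining `RelVar.sub`. -/
def subι (X : RelVar 𝔐) {V : Scheme.{0}} (f : V ⟶ X.obj.left)
    [LocallyOfFiniteType f] [QuasiCompact f] [IsSeparated f] : (X.sub f).obj ⟶ X.obj :=
  Over.homMk f

lemma hom_properties {X Y : RelVar 𝔐} (f : X.obj ⟶ Y.obj) :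
    LocallyOfFiniteType f.left ∧ QuasiCompact f.left ∧ IsSeparated f.left := by
  have h := Over.w f
  have h1 : LocallyOfFiniteType (f.left ≫ Y.obj.hom) := by rw [h]; infer_instance
  have h2 : QuasiCompact (f.left ≫ Y.obj.hom) := by rw [h]; infer_instance
  have h3 : IsSeparated (f.left ≫ Y.obj.hom) := by rw [h]; infer_instance
  exact ⟨locallyOfFiniteType_of_comp f.left Y.obj.hom, .of_comp f.left Y.obj.hom, .of_comp f.left Y.obj.hom⟩

end RelVar

section Classes

variable {𝔐 : Over SpecC} [MonObj 𝔐] [IsCommMonObj 𝔐]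

lemma cls_eq_of_iso {X Y : RelVar 𝔐} (e : X.obj ≅ Y.obj) (h : e.hom ≫ Y.str = X.str) :
    cls X = cls Y := by
  have : IsoClass.mk X = IsoClass.mk Y := Quotient.sound ⟨e, h⟩
  rw [cls, cls, this]

lemma cls_eq_of_iso_left {X Y : RelVar 𝔐} (e : X.obj.left ≅ Y.obj.left)
    (h₁ : e.hom ≫ Y.obj.hom = X.obj.hom) (h₂ : e.hom ≫ Y.str.left = X.str.left) :
    cls X = cls Y :=
  cls_eq_of_iso (Over.isoMk e h₁) (by ext1; exact h₂)

lemma cls_sub_congr (X : RelVar 𝔐) {V W : Scheme.{0}} (f : V ⟶ X.obj.left) (g : W ⟶ X.obj.left)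
    [LocallyOfFiniteType f] [QuasiCompact f] [IsSeparated f]
    [LocallyOfFiniteType g] [QuasiCompact g] [IsSeparated g] (e : V ≅ W) (h : e.hom ≫ g = f) :
    cls (X.sub f) = cls (X.sub g) := by
  refine cls_eq_of_iso_left (X := X.sub f) (Y := X.sub g) e ?_ ?_
  · change e.hom ≫ g ≫ X.obj.hom = f ≫ X.obj.hom
    rw [← h, Category.assoc]
  · change e.hom ≫ g ≫ X.str.left = f ≫ X.str.left
    rw [← h, Category.assoc]

lemma cls_sub_sub (X : RelVar 𝔐) {V W : Scheme.{0}} (f : V ⟶ X.obj.left) (g : W ⟶ V)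
    [LocallyOfFiniteType f] [QuasiCompact f] [IsSeparated f]
    [hg₁ : LocallyOfFiniteType g] [hg₂ : QuasiCompact g] [hg₃ : IsSeparated g] :
    cls (@RelVar.sub _ (X.sub f) _ g hg₁ hg₂ hg₃) = cls (X.sub (g ≫ f)) := by
  refine cls_eq_of_iso_left (Iso.refl _) ?_ ?_
  · change 𝟙 W ≫ (g ≫ f) ≫ X.obj.hom = g ≫ f ≫ X.obj.hom
    rw [Category.id_comp, Category.assoc]
  · change 𝟙 W ≫ (g ≫ f) ≫ X.str.left = g ≫ f ≫ X.str.left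
    rw [Category.id_comp, Category.assoc]

lemma cls_sub_hom {X Y : RelVar 𝔐} (f : X.obj ⟶ Y.obj) (hf : f ≫ Y.str = X.str)
    [LocallyOfFiniteType f.left] [QuasiCompact f.left] [IsSeparated f.left] :
    cls (Y.sub f.left) = cls X := by
  refine cls_eq_of_iso_left (X := Y.sub f.left) (Y := X) (Iso.refl _) ?_ ?_
  · change 𝟙 X.obj.left ≫ X.obj.hom = f.left ≫ Y.obj.hom
    rw [Category.id_comp, Over.w]
  · change 𝟙 X.obj.left ≫ X.str.left = f.left ≫ Y.str.left
    rw [Category.id_comp, ← hf]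
    rfl

lemma cls_eq_sub_add_sub (X : RelVar 𝔐) {Z U : Scheme.{0}} (i : Z ⟶ X.obj.left)
    (j : U ⟶ X.obj.left) [IsClosedImmersion i] [IsOpenImmersion j]
    [QuasiCompact j] (h : IsCompl (Set.range i) (Set.range j)) :
    cls X = cls (X.sub i) + cls (X.sub j) :=
  cls_eq_add (X.subι i) (X.subι j) ‹_› ‹_› h rfl rfl

/-- The open complement is empty: nilpotents do not contribute to the class. -/
lemma cls_sub_of_surjective (X : RelVar 𝔐) {Z : Scheme.{0}} (i : Z ⟶ X.obj.left)
    [IsClosedImmersion i] [Surjective i] : cls (X.sub i) = cls X := by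
  have h : cls X = cls (X.sub i) + cls (RelVar.empty 𝔐) := by
    refine cls_eq_add (X.subι i) (Over.homMk (Scheme.emptyTo _) (Scheme.empty_ext _ _)) ‹_› ?_ ?_
      rfl ?_
    · change IsOpenImmersion (Scheme.emptyTo X.obj.left)
      infer_instance
    · have h1 : Set.range (X.subι i).left = Set.univ := i.surjective.range_eq
      have h2 : IsEmpty (RelVar.empty 𝔐).obj.left := inferInstanceAs (IsEmpty PEmpty)
      rw [h1, Set.range_eq_empty]
      exact isCompl_top_bot
    · ext1
      exact Scheme.empty_ext _ _
  rw [h, cls_empty, add_zero]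

/-- The class of a finite type scheme over `Y` only depends on the scheme up to surjective closed
immersions. -/
lemma cls_sub_comp_of_surjective (Y : RelVar 𝔐) {V Z : Scheme.{0}} (f : V ⟶ Y.obj.left)
    (i : Z ⟶ V) [LocallyOfFiniteType f] [QuasiCompact f] [IsSeparated f]
    [IsClosedImmersion i] [hs : Surjective i] : cls (Y.sub (i ≫ f)) = cls (Y.sub f) := by
  rw [← cls_sub_sub]
  exact @cls_sub_of_surjective _ _ _ (Y.sub f) Z i ‹_› hs

lemma cls_sub_comp_add (Y : RelVar 𝔐) {V Z U : Scheme.{0}} (f : V ⟶ Y.obj.left)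
    [LocallyOfFiniteType f] [QuasiCompact f] [IsSeparated f] (i : Z ⟶ V)
    (j : U ⟶ V) [IsClosedImmersion i] [IsOpenImmersion j]
    [hj : QuasiCompact j] (h : IsCompl (Set.range i) (Set.range j)) :
    cls (Y.sub f) = cls (Y.sub (i ≫ f)) + cls (Y.sub (j ≫ f)) := by
  rw [← cls_sub_sub, ← cls_sub_sub]
  exact @cls_eq_sub_add_sub _ _ _ (Y.sub f) Z U i j ‹_› ‹_› hj h

end Classes

/-! ### Universally injective and surjective morphisms -/

section BijectiveMorphisms

instance {X Y Z : Scheme.{0}} (f : X ⟶ Z) (g : Y ⟶ Z) [UniversallyInjective f] :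
    UniversallyInjective (pullback.snd f g) := by
  have h : MorphismProperty.IsStableUnderBaseChange
      (@UniversallyInjective : MorphismProperty Scheme.{0}) := inferInstance
  exact h.of_isPullback (IsPullback.of_hasPullback f g) ‹_›

variable {𝔐 : Over SpecC} [MonObj 𝔐] [IsCommMonObj 𝔐]

lemma range_pullback_fst_of_isClosedImmersion {V Z C : Scheme.{0}} (f : V ⟶ Z) (c : C ⟶ Z) :
    Set.range (pullback.fst f c) = f ⁻¹' Set.range c := by
  ext v
  constructor
  · rintro ⟨p, rfl⟩
    exact ⟨pullback.snd f c p, by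
      rw [← Scheme.Hom.comp_apply, ← Scheme.Hom.comp_apply, pullback.condition]⟩
  · rintro ⟨p, hp⟩
    obtain ⟨q, hq, -⟩ := Scheme.Pullback.exists_preimage_pullback v p hp.symm
    exact ⟨q, hq⟩

/-- One step of a Noetherian induction. Over a nonempty open `U` the morphism `f` has a section. As
a map to the preimage of `U` it is a closed immersion because `f` is separated, and it is surjective
because `f` is injective, so both sides agree over `U`. The complement of `U` is a smaller closed
subset, where `ih` applies to the base change of `f`. -/
lemma cls_sub_eq_of_reduced_step (Y : RelVar 𝔐) {Z V : Scheme.{0}} (i : Z ⟶ Y.obj.left)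
    [IsClosedImmersion i] (f : V ⟶ Z) [LocallyOfFiniteType f] [QuasiCompact f] [IsSeparated f]
    [UniversallyInjective f] [Surjective f] [IsReduced Z]
    (ih : ∀ (C : Scheme.{0}) (c : C ⟶ Z) [IsClosedImmersion c] (W : Scheme.{0}) (g : W ⟶ C)
      [LocallyOfFiniteType g] [QuasiCompact g] [IsSeparated g] [UniversallyInjective g]
      [Surjective g], Set.range c ≠ Set.univ →
      cls (Y.sub (g ≫ c ≫ i)) = cls (Y.sub (c ≫ i))) :
    cls (Y.sub (f ≫ i)) = cls (Y.sub i) := by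
  have hN : TopologicalSpace.NoetherianSpace Z :=
    i.isClosedEmbedding.isInducing.noetherianSpace
  rcases isEmpty_or_nonempty Z with hZ | hZ
  · have : IsEmpty V := Function.isEmpty f
    have : IsIso f := inferInstance
    exact cls_sub_congr Y _ _ (asIso f) rfl
  obtain ⟨U, hne, s, hs⟩ := exists_section_of_isReduced (i ≫ Y.obj.hom) f
  obtain ⟨C, c, -, hc, hcr⟩ := exists_reduced_closedImmersion Z (U : Set Z)ᶜ
    U.isOpen.isClosed_compl
  have hNU : TopologicalSpace.NoetherianSpace U.toScheme :=
    U.ι.isOpenEmbedding.isInducing.noetherianSpace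
  have hU : QuasiCompact U.ι := inferInstance
  have hV : QuasiCompact (f ⁻¹ᵁ U).ι := by
    have : QuasiCompact (pullback.fst f U.ι) := inferInstance
    have h := pullbackRestrictIsoRestrict_inv_fst f U
    rw [← h]
    infer_instance
  have h1 : IsCompl (Set.range c) (Set.range U.ι) := by
    rw [hcr, Scheme.Opens.range_ι]
    exact isCompl_compl.symm
  have h2 : IsCompl (Set.range (pullback.fst f c)) (Set.range (f ⁻¹ᵁ U).ι) := by
    rw [range_pullback_fst_of_isClosedImmersion, hcr, Scheme.Opens.range_ι]
    exact isCompl_compl.symm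
  rw [cls_sub_comp_add Y (f ≫ i) (pullback.fst f c) (f ⁻¹ᵁ U).ι h2, cls_sub_comp_add Y i c U.ι h1]
  congr 1
  · have := ih C c (pullback f c) (pullback.snd f c) (by
      rw [hcr]
      intro h
      obtain ⟨u, hu⟩ := hne
      exact (h ▸ Set.mem_univ u : u ∈ (U : Set Z)ᶜ) hu)
    rw [← this]
    exact cls_sub_congr Y _ _ (Iso.refl _) (by simp [pullback.condition_assoc])
  · have hle : Set.range s ⊆ Set.range (f ⁻¹ᵁ U).ι := by
      rw [Scheme.Opens.range_ι]
      rintro _ ⟨u, rfl⟩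
      change f (s u) ∈ U
      rw [← Scheme.Hom.comp_apply, hs]
      exact u.2
    let s' := IsOpenImmersion.lift (f ⁻¹ᵁ U).ι s hle
    have hs' : s' ≫ (f ⁻¹ᵁ U).ι = s := IsOpenImmersion.lift_fac _ _ _
    have hr : s' ≫ (f ∣_ U) = 𝟙 _ := by
      rw [← cancel_mono U.ι, Category.assoc, morphismRestrict_ι, reassoc_of% hs', hs,
        Category.id_comp]
    have hci : IsClosedImmersion s' := by
      have : IsClosedImmersion (s' ≫ (f ∣_ U)) := by rw [hr]; infer_instance
      exact .of_comp s' (f ∣_ U)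
    have hsurj : Surjective s' := by
      refine ⟨fun v => ⟨(f ∣_ U) v, ?_⟩⟩
      have hinj : UniversallyInjective (f ∣_ U) := IsZariskiLocalAtTarget.restrict ‹_› U
      apply (f ∣_ U).injective
      rw [← Scheme.Hom.comp_apply, ← Scheme.Hom.comp_apply, hr, Category.comp_id]
    rw [← cls_sub_comp_of_surjective Y ((f ⁻¹ᵁ U).ι ≫ f ≫ i) s']
    exact cls_sub_congr Y _ _ (Iso.refl _) (by
      rw [Iso.refl_hom, Category.id_comp, reassoc_of% hs', reassoc_of% hs])

/-- A universally injective and surjective morphism identifies classes in `K₀(Var/𝔐)`. -/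
lemma cls_sub_eq_of_bijective (Y : RelVar 𝔐) {V : Scheme.{0}} (f : V ⟶ Y.obj.left)
    [LocallyOfFiniteType f] [QuasiCompact f] [IsSeparated f]
    [UniversallyInjective f] [Surjective f] : cls (Y.sub f) = cls Y := by
  -- Noetherian induction on the closed subset `T`. The scheme structure `Z` on `T` is arbitrary,
  -- and it is replaced by its reduction, together with the base change of `W`, before the inductive
  -- step; this changes neither class.
  suffices H : ∀ T : TopologicalSpace.Closeds Y.obj.left, ∀ (Z : Scheme.{0}) (i : Z ⟶ Y.obj.left)
      [IsClosedImmersion i] (W : Scheme.{0}) (g : W ⟶ Z) [LocallyOfFiniteType g] [QuasiCompact g]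
      [IsSeparated g] [UniversallyInjective g] [Surjective g], Set.range i = T →
      cls (Y.sub (g ≫ i)) = cls (Y.sub i) by
    have h := H ⊤ _ (𝟙 _) _ f (by simp)
    rw [cls_sub_of_surjective Y (𝟙 _)] at h
    rw [← h]
    exact cls_sub_congr Y _ _ (Iso.refl _) (by simp)
  intro T
  induction T using WellFoundedLT.induction with
  | ind T ih =>
  intro Z i _ W g _ _ _ _ _ hT
  obtain ⟨Z', r, hred, hr, hrr⟩ := exists_reduced_closedImmersion Z Set.univ isClosed_univ
  have hrs : Surjective r := ⟨Set.range_eq_univ.mp hrr⟩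
  have hs1 : Surjective (pullback.fst g r) := inferInstance
  have key := cls_sub_eq_of_reduced_step Y (r ≫ i) (pullback.snd g r) (by
    intro C c _ W g _ _ _ _ _ hne
    have hcl : IsClosedImmersion (c ≫ r ≫ i) := inferInstance
    refine ih ⟨Set.range (c ≫ r ≫ i), (c ≫ r ≫ i).isClosedEmbedding.isClosed_range⟩ ?_
      C (c ≫ r ≫ i) W g rfl
    refine lt_of_le_of_ne ?_ ?_
    · change Set.range (c ≫ r ≫ i) ⊆ T
      rw [← hT]
      rintro _ ⟨x, rfl⟩
      exact ⟨r (c x), rfl⟩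
    · intro h
      have h' : Set.range (c ≫ r ≫ i) = T := congrArg (SetLike.coe) h
      apply hne
      rw [Set.eq_univ_iff_forall]
      intro z
      have hz : i (r z) ∈ Set.range (c ≫ r ≫ i) := by
        rw [h', ← hT]
        exact ⟨_, rfl⟩
      obtain ⟨x, hx⟩ := hz
      exact ⟨x, (r ≫ i).isClosedEmbedding.injective hx⟩)
  rw [cls_sub_comp_of_surjective Y i r] at key
  rw [← key, ← cls_sub_comp_of_surjective Y (g ≫ i) (pullback.fst g r)]
  exact cls_sub_congr Y _ _ (Iso.refl _) (by simp [pullback.condition_assoc])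

lemma cls_eq_of_bijective {X Y : RelVar 𝔐} (f : X.obj ⟶ Y.obj) (hf : f ≫ Y.str = X.str)
    (hu : UniversallyInjective f.left) (hs : Surjective f.left) : cls X = cls Y := by
  obtain ⟨_, _, _⟩ := RelVar.hom_properties f
  rw [← cls_sub_hom f hf, cls_sub_eq_of_bijective]

end BijectiveMorphisms

/-! ### Finite disjoint unions -/

/-- A separated scheme of finite type over `ℂ`. -/
class IsVariety (V : Over SpecC) : Prop where
  locallyOfFiniteType : LocallyOfFiniteType V.hom
  quasiCompact : QuasiCompact V.hom
  isSeparated : IsSeparated V.hom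

attribute [instance] IsVariety.locallyOfFiniteType IsVariety.quasiCompact IsVariety.isSeparated

instance {𝔐 : Over SpecC} (X : RelVar 𝔐) : IsVariety X.obj := ⟨inferInstance, inferInstance, inferInstance⟩

section

instance (X Y : Over SpecC) [IsVariety X] [IsVariety Y] : IsVariety (X ⊗ Y) where
  locallyOfFiniteType := by rw [Over.tensorObj_hom]; infer_instance
  quasiCompact := by rw [Over.tensorObj_hom]; infer_instance
  isSeparated := by rw [Over.tensorObj_hom]; infer_instance

variable {X Y : Over SpecC} [IsVariety X] (f : X ⟶ Y)

lemma locallyOfFiniteType_left : LocallyOfFiniteType f.left := by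
  have h1 : LocallyOfFiniteType (f.left ≫ Y.hom) := by rw [Over.w f]; infer_instance
  exact locallyOfFiniteType_of_comp f.left Y.hom

lemma quasiCompact_left [IsVariety Y] : QuasiCompact f.left := by
  have h1 : QuasiCompact (f.left ≫ Y.hom) := by rw [Over.w f]; infer_instance
  exact .of_comp f.left Y.hom

lemma isSeparated_left : IsSeparated f.left := by
  have h1 : IsSeparated (f.left ≫ Y.hom) := by rw [Over.w f]; infer_instance
  exact .of_comp f.left Y.hom

lemma IsVariety.of_hom {W Y : Over SpecC} [IsVariety Y] (f : W ⟶ Y) [LocallyOfFiniteType f.left]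
    [QuasiCompact f.left] [IsSeparated f.left] : IsVariety W where
  locallyOfFiniteType := by rw [← Over.w f]; infer_instance
  quasiCompact := by rw [← Over.w f]; infer_instance
  isSeparated := by rw [← Over.w f]; infer_instance

instance (X : Over SpecC) [IsVariety X] : CompactSpace X.left :=
  QuasiCompact.compactSpace_of_compactSpace X.hom

instance (X : Over SpecC) [IsVariety X] : IsLocallyNoetherian X.left :=
  LocallyOfFiniteType.isLocallyNoetherian X.hom

lemma KPt.exists_lift' {K : Type} [Field K] [Algebra ℂ K] [IsAlgClosed K]
    (y : KPt K Y) (hy : y.pt ∈ Set.range f.left) : ∃ v : KPt K X, v ≫ f = y := by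
  have := locallyOfFiniteType_left f
  obtain ⟨x, hx⟩ := hy
  exact KPt.exists_lift f y x hx

end

namespace RelVar

variable {𝔐 : Over SpecC}

/-- The first inclusion into a disjoint union. -/
def inl (X Y : RelVar 𝔐) : X.obj ⟶ (X.coprod Y).obj :=
  Over.homMk coprod.inl (coprod.inl_desc _ _)

/-- The second inclusion into a disjoint union. -/
def inr (X Y : RelVar 𝔐) : Y.obj ⟶ (X.coprod Y).obj :=
  Over.homMk coprod.inr (coprod.inr_desc _ _)

variable (X Y : RelVar 𝔐)

lemma inl_str : inl X Y ≫ (X.coprod Y).str = X.str := by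
  ext1
  exact coprod.inl_desc _ _

lemma inr_str : inr X Y ≫ (X.coprod Y).str = Y.str := by
  ext1
  exact coprod.inr_desc _ _

instance : Mono (inl X Y) :=
  have _h : Mono (inl X Y).left := inferInstanceAs (Mono (coprod.inl : _ ⟶ X.obj.left ⨿ Y.obj.left))
  Over.mono_of_mono_left _

instance : Mono (inr X Y) :=
  have _h : Mono (inr X Y).left := inferInstanceAs (Mono (coprod.inr : _ ⟶ X.obj.left ⨿ Y.obj.left))
  Over.mono_of_mono_left _

variable {X Y} in
/-- The morphism from a disjoint union given by its restrictions. -/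
def coprodDesc {T : Over SpecC} (f : X.obj ⟶ T) (g : Y.obj ⟶ T) : (X.coprod Y).obj ⟶ T :=
  Over.homMk (Limits.coprod.desc f.left g.left) (by
    change Limits.coprod.desc f.left g.left ≫ T.hom = Limits.coprod.desc X.obj.hom Y.obj.hom
    apply Limits.coprod.hom_ext
    · rw [coprod.inl_desc_assoc, coprod.inl_desc, Over.w]
    · rw [coprod.inr_desc_assoc, coprod.inr_desc, Over.w])

variable {X Y} in
lemma inl_coprodDesc {T : Over SpecC} (f : X.obj ⟶ T) (g : Y.obj ⟶ T) :
    inl X Y ≫ coprodDesc f g = f := by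
  ext1
  exact coprod.inl_desc _ _

variable {X Y} in
lemma inr_coprodDesc {T : Over SpecC} (f : X.obj ⟶ T) (g : Y.obj ⟶ T) :
    inr X Y ≫ coprodDesc f g = g := by
  ext1
  exact coprod.inr_desc _ _

variable {K : Type} [Field K] [Algebra ℂ K]

lemma kpt_inl_ne_inr (x : KPt K X.obj) (y : KPt K Y.obj) : x ≫ inl X Y ≠ y ≫ inr X Y := by
  intro h
  have h1 : KPt.pt (x ≫ inl X Y : KPt K _) = KPt.pt (y ≫ inr X Y : KPt K _) := by rw [h]
  exact (isCompl_range_inl_inr X.obj.left Y.obj.left).disjoint.le_bot ⟨⟨x.pt, rfl⟩, ⟨y.pt, h1.symm⟩⟩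

lemma kpt_coprod [IsAlgClosed K] (v : KPt K (X.coprod Y).obj) :
    (∃ x : KPt K X.obj, x ≫ inl X Y = v) ∨ ∃ y : KPt K Y.obj, y ≫ inr X Y = v := by
  have h := (isCompl_range_inl_inr X.obj.left Y.obj.left).codisjoint.top_le (Set.mem_univ v.pt)
  exact h.imp (fun h => KPt.exists_lift' (inl X Y) v h) (fun h => KPt.exists_lift' (inr X Y) v h)

end RelVar

/-- `S` is the disjoint union of the finite family `X` of varieties over `𝔐`. -/
structure IsSum {𝔐 : Over SpecC} {I : Type} (X : I → RelVar 𝔐) (S : RelVar 𝔐)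
    (inj : ∀ i, (X i).obj ⟶ S.obj) : Prop where
  inj_str : ∀ i, inj i ≫ S.str = (X i).str
  bijective : ∀ (K : Type) [Field K] [Algebra ℂ K] [IsAlgClosed K],
    Function.Bijective fun x : Σ i, KPt K (X i).obj => x.2 ≫ inj x.1
  desc : ∀ {T : Over SpecC} (f : ∀ i, (X i).obj ⟶ T), ∃ g : S.obj ⟶ T, ∀ i, inj i ≫ g = f i

/-- The additive function `F` is arbitrary so that a single disjoint union can serve several
invariants at once, as it does in `exists_convolution`. -/
lemma exists_isSum_additive {𝔐 : Over SpecC} {I : Type} [Fintype I] (X : I → RelVar 𝔐) {G : Type*}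
    [AddCommMonoid G] (F : RelVar 𝔐 → G) (hF : F (RelVar.empty 𝔐) = 0)
    (hadd : ∀ X Y : RelVar 𝔐, F (X.coprod Y) = F X + F Y) :
    ∃ (S : RelVar 𝔐) (inj : ∀ i, (X i).obj ⟶ S.obj), IsSum X S inj ∧ F S = ∑ i, F (X i) ∧
      ((∀ i, IsAffine (X i).obj.left) → IsAffine S.obj.left) := by
  classical
  refine Fintype.induction_empty_option (P := fun I [Fintype I] => ∀ X : I → RelVar 𝔐,
    ∃ (S : RelVar 𝔐) (inj : ∀ i, (X i).obj ⟶ S.obj), IsSum X S inj ∧ F S = ∑ i, F (X i) ∧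
      ((∀ i, IsAffine (X i).obj.left) → IsAffine S.obj.left)) ?_ ?_ ?_ I X
  · intro α β _ e ih X
    let _ : Fintype α := Fintype.ofEquiv β e.symm
    obtain ⟨S, inj, hS, hc, ha⟩ := ih fun a => X (e a)
    obtain ⟨f, hf⟩ : ∃ f : ∀ b, (X b).obj ⟶ S.obj, ∀ a, f (e a) = inj a :=
      ⟨fun b => eqToHom (by rw [e.apply_symm_apply]) ≫ inj (e.symm b), fun a => by
        have : ∀ b (_ : b = a) (h : (X (e a)).obj = (X (e b)).obj),
            eqToHom h ≫ inj b = inj a := by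
          rintro _ rfl _
          simp
        exact this _ (e.symm_apply_apply a) _⟩
    refine ⟨S, f, ⟨fun b => ?_, fun K _ _ _ => ?_, fun {T} g => ?_⟩, ?_,
      fun h => ha fun a => h (e a)⟩
    · obtain ⟨a, rfl⟩ := e.surjective b
      rw [hf, hS.inj_str]
    · constructor
      · rintro ⟨b, x⟩ ⟨b', x'⟩ h
        obtain ⟨a, rfl⟩ := e.surjective b
        obtain ⟨a', rfl⟩ := e.surjective b'
        dsimp only at h
        rw [hf, hf] at h
        have := (hS.bijective K).1 (a₁ := ⟨a, x⟩) (a₂ := ⟨a', x'⟩) h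
        cases this
        rfl
      · intro v
        obtain ⟨⟨a, x⟩, hx⟩ := (hS.bijective K).2 v
        exact ⟨⟨e a, x⟩, by dsimp only; rw [hf]; exact hx⟩
    · obtain ⟨φ, hφ⟩ := hS.desc fun a => g (e a)
      refine ⟨φ, fun b => ?_⟩
      obtain ⟨a, rfl⟩ := e.surjective b
      rw [hf, hφ]
    · rw [hc]
      exact e.sum_comp fun b => F (X b)
  · intro X
    have hE : IsEmpty (RelVar.empty 𝔐).obj.left := inferInstanceAs (IsEmpty PEmpty)
    refine ⟨RelVar.empty 𝔐, fun i => i.elim, ⟨fun i => i.elim, fun K _ _ _ => ?_, fun {T} _ => ?_⟩,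
      by simp [hF], fun _ => inferInstance⟩
    · exact ⟨fun x => x.1.elim, fun v => hE.elim (KPt.pt (K := K) v)⟩
    · exact ⟨Over.homMk (Scheme.emptyTo T.left) (Scheme.empty_ext _ _), fun i => i.elim⟩
  · intro α _ ih X
    obtain ⟨S, inj, hS, hc, ha⟩ := ih fun a => X (some a)
    refine ⟨(X none).coprod S, fun
      | none => RelVar.inl _ _
      | some a => inj a ≫ RelVar.inr _ _, ⟨?_, fun K _ _ _ => ⟨?_, ?_⟩, ?_⟩, ?_, ?_⟩
    · rintro (_ | a)
      · exact RelVar.inl_str _ _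
      · dsimp only
        rw [Category.assoc, RelVar.inr_str, hS.inj_str]
    · rintro ⟨_ | a, x⟩ ⟨_ | a', x'⟩ h
      · change x ≫ _ = x' ≫ _ at h
        have h' : x = x' := (cancel_mono (RelVar.inl (X none) S)).mp h
        rw [h']
      · dsimp only at h
        rw [← Category.assoc] at h
        exact (RelVar.kpt_inl_ne_inr _ _ _ _ h).elim
      · dsimp only at h
        rw [← Category.assoc] at h
        exact (RelVar.kpt_inl_ne_inr _ _ _ _ h.symm).elim
      · dsimp only at h
        rw [← Category.assoc, ← Category.assoc, cancel_mono] at h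
        have := (hS.bijective K).1 (a₁ := ⟨a, x⟩) (a₂ := ⟨a', x'⟩) h
        cases this
        rfl
    · intro v
      rcases RelVar.kpt_coprod _ _ v with ⟨x, hx⟩ | ⟨y, hy⟩
      · exact ⟨⟨none, x⟩, hx⟩
      · obtain ⟨⟨a, x⟩, hx⟩ := (hS.bijective K).2 y
        refine ⟨⟨some a, x⟩, ?_⟩
        dsimp only at hx ⊢
        rw [← Category.assoc, hx, hy]
    · intro T f
      obtain ⟨g, hg⟩ := hS.desc fun a => f (some a)
      refine ⟨RelVar.coprodDesc (f none) g, ?_⟩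
      rintro (_ | a)
      · exact RelVar.inl_coprodDesc _ _
      · dsimp only
        rw [Category.assoc, RelVar.inr_coprodDesc, hg]
    · rw [hadd, hc, Fintype.sum_option]
    · intro h
      have h1 := h none
      have h2 := ha fun a => h (some a)
      exact inferInstanceAs (IsAffine ((X none).obj.left ⨿ S.obj.left))

lemma exists_isSum {𝔐 : Over SpecC} [MonObj 𝔐] [IsCommMonObj 𝔐] {I : Type} [Fintype I]
    (X : I → RelVar 𝔐) : ∃ (S : RelVar 𝔐) (inj : ∀ i, (X i).obj ⟶ S.obj),
      IsSum X S inj ∧ cls S = ∑ i, cls (X i) ∧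
      ((∀ i, IsAffine (X i).obj.left) → IsAffine S.obj.left) :=
  exists_isSum_additive X cls cls_empty cls_coprod

/-! ### Constructible decompositions -/

/-- `f` is injective on geometric points. -/
def KInjective {X Y : Over SpecC} (f : X ⟶ Y) : Prop :=
  ∀ (K : Type) [Field K] [Algebra ℂ K] [IsAlgClosed K],
    Function.Injective fun v : KPt K X => v ≫ f

/-- `f` is bijective on geometric points. -/
def KBijective {X Y : Over SpecC} (f : X ⟶ Y) : Prop :=
  ∀ (K : Type) [Field K] [Algebra ℂ K] [IsAlgClosed K],
    Function.Bijective fun v : KPt K X => v ≫ f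

lemma KInjective.of_mono {X Y : Over SpecC} (f : X ⟶ Y) [Mono f.left] : KInjective f := by
  intro K _ _ _ v w h
  have : Mono f := Over.mono_of_mono_left f
  exact (cancel_mono f).mp h

lemma cls_eq_of_kBijective {𝔐 : Over SpecC} [MonObj 𝔐] [IsCommMonObj 𝔐] {X Y : RelVar 𝔐}
    (f : X.obj ⟶ Y.obj) (hf : f ≫ Y.str = X.str) (h : KBijective f) : cls X = cls Y :=
  cls_eq_of_bijective f hf (universallyInjective_of_kpts fun K _ _ _ _ _ e => (h K).1 e)
    (surjective_of_kpts fun K _ _ _ y => (h K).2 y)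

/-- Finite disjoint unions of locally closed sets. -/
inductive IsDisjointUnionLocallyClosed {X : Type*} [TopologicalSpace X] : Set X → Prop
  | empty : IsDisjointUnionLocallyClosed ∅
  | union {s t : Set X} : IsLocallyClosed s → IsDisjointUnionLocallyClosed t → Disjoint s t →
      IsDisjointUnionLocallyClosed (s ∪ t)

namespace IsDisjointUnionLocallyClosed

variable {X : Type*} [TopologicalSpace X] {s t : Set X}

lemma _root_.IsLocallyClosed.isDisjointUnionLocallyClosed (hs : IsLocallyClosed s) :
    IsDisjointUnionLocallyClosed s := by
  simpa using union hs empty (Set.disjoint_empty s)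

lemma disjoint_union (hs : IsDisjointUnionLocallyClosed s)
    (ht : IsDisjointUnionLocallyClosed t) (h : Disjoint s t) :
    IsDisjointUnionLocallyClosed (s ∪ t) := by
  induction hs with
  | empty => simpa using ht
  | union h1 _ h2 ih =>
    rw [Set.union_assoc]
    rw [Set.disjoint_union_left] at h
    exact union h1 (ih h.2) (Set.disjoint_union_right.mpr ⟨h2, h.1⟩)

lemma inter_isLocallyClosed (hs : IsDisjointUnionLocallyClosed s) (ht : IsLocallyClosed t) :
    IsDisjointUnionLocallyClosed (s ∩ t) := by
  induction hs with
  | empty => simpa using empty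
  | union h1 _ h2 ih =>
    rw [Set.union_inter_distrib_right]
    exact union (h1.inter ht) ih (h2.mono Set.inter_subset_left Set.inter_subset_left)

lemma inter (hs : IsDisjointUnionLocallyClosed s) (ht : IsDisjointUnionLocallyClosed t) :
    IsDisjointUnionLocallyClosed (s ∩ t) := by
  induction ht with
  | empty => simpa using empty
  | union h1 _ h2 ih =>
    rw [Set.inter_union_distrib_left]
    exact disjoint_union (hs.inter_isLocallyClosed h1) ih
      (h2.mono Set.inter_subset_right Set.inter_subset_right)

lemma compl (hs : IsDisjointUnionLocallyClosed s) : IsDisjointUnionLocallyClosed sᶜ := by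
  induction hs with
  | empty => simpa using (isOpen_univ.isLocallyClosed).isDisjointUnionLocallyClosed
  | union h1 _ _ ih =>
    rw [Set.compl_union]
    refine inter ?_ ih
    obtain ⟨U, Z, hU, hZ, rfl⟩ := h1
    have : (U ∩ Z)ᶜ = Zᶜ ∪ (Z ∩ Uᶜ) := by
      ext x
      simp only [Set.mem_compl_iff, Set.mem_inter_iff, Set.mem_union]
      tauto
    rw [this]
    refine union hZ.isOpen_compl.isLocallyClosed
      (hZ.inter hU.isClosed_compl).isLocallyClosed.isDisjointUnionLocallyClosed ?_
    exact Set.disjoint_left.mpr fun x h h' => h h'.1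

lemma of_isConstructible (hs : Topology.IsConstructible s) : IsDisjointUnionLocallyClosed s := by
  induction hs using Topology.IsConstructible.empty_union_induction with
  | open_retrocompact U hU _ => exact hU.isLocallyClosed.isDisjointUnionLocallyClosed
  | union s _ t _ h1 h2 =>
    rw [← compl_compl (s ∪ t), Set.compl_union]
    exact (h1.compl.inter h2.compl).compl
  | compl s _ h => exact h.compl

end IsDisjointUnionLocallyClosed

/-! ### Constructible subsets as varieties -/

section Pieces

variable {𝔐 : Over SpecC} {P : RelVar 𝔐}

/-- `j` presents the subset `s` of `P` as a reduced variety, up to a bijection of geometric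
points. -/
structure IsPiece {P V : RelVar 𝔐} (j : V.obj ⟶ P.obj) (s : Set P.obj.left) : Prop where
  str : j ≫ P.str = V.str
  reduced : IsReduced V.obj.left
  range : Set.range j.left = s
  inj : KInjective j

lemma IsPiece.empty : IsPiece (P := P) (V := .empty 𝔐)
    (Over.homMk (Scheme.emptyTo _) (Scheme.empty_ext _ _)) ∅ where
  str := by
    ext1
    exact Scheme.empty_ext _ _
  reduced :=
    have : IsEmpty (RelVar.empty 𝔐).obj.left := inferInstanceAs (IsEmpty PEmpty)
    have : ∀ x : (RelVar.empty 𝔐).obj.left,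
        _root_.IsReduced ((RelVar.empty 𝔐).obj.left.presheaf.stalk x) := fun x => isEmptyElim x
    isReduced_of_isReduced_stalk _
  range :=
    have : IsEmpty (RelVar.empty 𝔐).obj.left := inferInstanceAs (IsEmpty PEmpty)
    Set.range_eq_empty _
  inj := fun K _ _ _ v _ _ =>
    have hE : IsEmpty (RelVar.empty 𝔐).obj.left := inferInstanceAs (IsEmpty PEmpty)
    hE.elim (KPt.pt (K := K) v)

lemma IsPiece.union {V W : RelVar 𝔐} {i : V.obj ⟶ P.obj} {j : W.obj ⟶ P.obj}
    {s t : Set P.obj.left} (hi : IsPiece i s) (hj : IsPiece j t) (hst : Disjoint s t) :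
    IsPiece (P := P) (V := V.coprod W) (RelVar.coprodDesc i j) (s ∪ t) where
  str := by
    ext1
    apply Limits.coprod.hom_ext
    · have h := congrArg (·.left) hi.str
      dsimp at h
      change coprod.inl ≫ Limits.coprod.desc i.left j.left ≫ P.str.left =
        coprod.inl ≫ Limits.coprod.desc V.str.left W.str.left
      rw [coprod.inl_desc_assoc, coprod.inl_desc, h]
    · have h := congrArg (·.left) hj.str
      dsimp at h
      change coprod.inr ≫ Limits.coprod.desc i.left j.left ≫ P.str.left =
        coprod.inr ≫ Limits.coprod.desc V.str.left W.str.left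
      rw [coprod.inr_desc_assoc, coprod.inr_desc, h]
  reduced := by
    have h1 := hi.reduced
    have h2 := hj.reduced
    refine @IsReduced.of_openCover _ (coprodOpenCover.{0, 0} V.obj.left W.obj.left) ?_
    rintro (⟨⟨⟩⟩ | ⟨⟨⟩⟩)
    · exact h1
    · exact h2
  range := by
    ext x
    constructor
    · rintro ⟨v, rfl⟩
      have h := (isCompl_range_inl_inr V.obj.left W.obj.left).codisjoint.top_le (Set.mem_univ v)
      rcases h with ⟨a, rfl⟩ | ⟨a, rfl⟩
      · left
        rw [← hi.range]
        refine ⟨a, ?_⟩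
        change _ = (Limits.coprod.desc i.left j.left) _
        rw [← Scheme.Hom.comp_apply, coprod.inl_desc]
      · right
        rw [← hj.range]
        refine ⟨a, ?_⟩
        change _ = (Limits.coprod.desc i.left j.left) _
        rw [← Scheme.Hom.comp_apply, coprod.inr_desc]
    · rw [← hi.range, ← hj.range]
      rintro (⟨a, rfl⟩ | ⟨a, rfl⟩)
      · refine ⟨(RelVar.inl V W).left a, ?_⟩
        rw [← Scheme.Hom.comp_apply, ← Over.comp_left, RelVar.inl_coprodDesc]
      · refine ⟨(RelVar.inr V W).left a, ?_⟩
        rw [← Scheme.Hom.comp_apply, ← Over.comp_left, RelVar.inr_coprodDesc]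
  inj := by
    have key : ∀ (K : Type) [Field K] [Algebra ℂ K] (x : KPt K V.obj) (y : KPt K W.obj),
        x ≫ i ≠ y ≫ j := by
      intro K _ _ x y h
      have h1 : KPt.pt (x ≫ i : KPt K _) = KPt.pt (y ≫ j : KPt K _) := by rw [h]
      have h2 : KPt.pt (x ≫ i : KPt K _) ∈ s := hi.range ▸ ⟨x.pt, rfl⟩
      have h3 : KPt.pt (y ≫ j : KPt K _) ∈ t := hj.range ▸ ⟨y.pt, rfl⟩
      exact Set.disjoint_left.mp hst h2 (h1 ▸ h3)
    intro K _ _ _ v w h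
    dsimp only at h
    rcases RelVar.kpt_coprod _ _ v with ⟨x, rfl⟩ | ⟨x, rfl⟩ <;>
    rcases RelVar.kpt_coprod _ _ w with ⟨y, rfl⟩ | ⟨y, rfl⟩ <;>
    simp only [Category.assoc, RelVar.inl_coprodDesc, RelVar.inr_coprodDesc] at h
    · rw [hi.inj K h]
    · exact (key K _ _ h).elim
    · exact (key K _ _ h.symm).elim
    · rw [hj.inj K h]

/-- The piece is the reduced closed subscheme of `U` supported on the trace of `Z`, which is affine
when `U` is. -/
lemma exists_isPiece_inter {U : Scheme.{0}} (u : U ⟶ P.obj.left) [IsOpenImmersion u]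
    {Z : Set P.obj.left} (hZ : IsClosed Z) :
    ∃ (V : RelVar 𝔐) (j : V.obj ⟶ P.obj), IsPiece j (Set.range u ∩ Z) ∧
      (IsAffine U → IsAffine V.obj.left) := by
  obtain ⟨Y, i, hY, hi, hr⟩ := exists_reduced_closedImmersion U (u ⁻¹' Z) (hZ.preimage u.continuous)
  have : LocallyOfFiniteType (i ≫ u) := inferInstance
  have : QuasiCompact u := inferInstance
  have : QuasiCompact (i ≫ u) := inferInstance
  have : IsSeparated (i ≫ u) := inferInstance
  refine ⟨P.sub (i ≫ u), P.subι (i ≫ u), ⟨rfl, hY, ?_, ?_⟩, fun h => ?_⟩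
  · change Set.range (i ≫ u) = _
    have h1 : Set.range (i ≫ u) = u '' Set.range i := by
      rw [← Set.range_comp]
      rfl
    rw [h1, hr, Set.image_preimage_eq_inter_range, Set.inter_comm]
  · have : Mono (P.subι (i ≫ u)).left := inferInstanceAs (Mono (i ≫ u))
    exact .of_mono _
  · have : IsAffine Y := isAffine_of_isAffineHom i
    exact this

lemma exists_isPiece {s : Set P.obj.left} (hs : IsDisjointUnionLocallyClosed s) :
    ∃ (V : RelVar 𝔐) (j : V.obj ⟶ P.obj), IsPiece j s := by
  induction hs with
  | empty => exact ⟨_, _, .empty⟩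
  | union h1 _ h2 ih =>
    obtain ⟨V, j, hj⟩ := ih
    obtain ⟨U, Z, hU, hZ, rfl⟩ := h1
    obtain ⟨W, i, hi, -⟩ := exists_isPiece_inter (P := P) (Scheme.Opens.ι ⟨U, hU⟩) hZ
    rw [Scheme.Opens.range_ι] at hi
    exact ⟨_, _, hi.union hj h2⟩

/-- Every variety receives a morphism from an affine variety that is bijective on geometric
points. -/
lemma exists_affine_model (P : RelVar 𝔐) : ∃ (V : RelVar 𝔐) (j : V.obj ⟶ P.obj),
    IsAffine V.obj.left ∧ j ≫ P.str = V.str ∧ KBijective j := by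
  -- Affine open subsets are added one at a time. Each contributes the closed part of itself that is
  -- not yet covered, which is an affine scheme, and finite disjoint unions of affine schemes are
  -- affine.
  have key : ∀ t : Set P.obj.left.affineOpens, t.Finite →
      ∃ (V : RelVar 𝔐) (j : V.obj ⟶ P.obj), IsPiece j (⋃ U ∈ t, (U.1 : Set P.obj.left)) ∧
        IsAffine V.obj.left := by
    intro t ht
    induction t, ht using Set.Finite.induction_on with
    | empty => exact ⟨.empty 𝔐, _, by simpa using IsPiece.empty, inferInstanceAs (IsAffine ∅)⟩
    | @insert U t _ _ ih =>
      obtain ⟨V, j, hj, hV⟩ := ih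
      have hU : IsAffine U.1.toScheme := U.2
      obtain ⟨W, i, hi, hW⟩ := exists_isPiece_inter (P := P) U.1.ι
        (Z := (⋃ U ∈ t, (U.1 : Set P.obj.left))ᶜ)
        (isOpen_biUnion fun V _ => V.1.isOpen).isClosed_compl
      have hW' := hW hU
      have h := hi.union hj (Set.disjoint_left.mpr fun x h h' => h.2 h')
      rw [Scheme.Opens.range_ι] at h
      refine ⟨W.coprod V, RelVar.coprodDesc i j, ?_, inferInstanceAs (IsAffine (W.obj.left ⨿ V.obj.left))⟩
      convert h using 1
      rw [Set.biUnion_insert, Set.inter_union_distrib_right, Set.compl_union_self, Set.inter_univ]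
  obtain ⟨t, h⟩ := (CompactSpace.isCompact_univ (X := P.obj.left)).elim_finite_subcover
    (fun U : P.obj.left.affineOpens => (U.1 : Set P.obj.left)) (fun U => U.1.isOpen) fun x _ => by
      obtain ⟨_, ⟨U, hU, rfl⟩, hx, -⟩ := P.obj.left.isBasis_affineOpens.exists_subset_of_mem_open
        (Set.mem_univ x) isOpen_univ
      exact Set.mem_iUnion.mpr ⟨⟨U, hU⟩, hx⟩
  obtain ⟨V, j, hj, hV⟩ := key t t.finite_toSet
  refine ⟨V, j, hV, hj.str, fun K _ _ _ => ⟨hj.inj K, fun y => ?_⟩⟩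
  refine KPt.exists_lift' j y ?_
  rw [hj.range]
  exact h (Set.mem_univ _)

end Pieces

/-! ### Constructible correspondences -/

section Comparison

variable {𝔐 : Over SpecC} [MonObj 𝔐] [IsCommMonObj 𝔐]

/-- Two varieties over `𝔐` have the same class if their geometric points are put in bijection by a
constructible correspondence. -/
lemma cls_eq_of_correspondence (X Y : RelVar 𝔐) {L : Type} [Finite L] (V : L → Over SpecC)
    [∀ l, IsVariety (V l)] (f : ∀ l, V l ⟶ X.obj) (g : ∀ l, V l ⟶ Y.obj)
    (hf : ∀ (K : Type) [Field K] [Algebra ℂ K] [IsAlgClosed K] (x : KPt K X.obj),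
      ∃ l, ∃ v : KPt K (V l), v ≫ f l = x)
    (hg : ∀ (K : Type) [Field K] [Algebra ℂ K] [IsAlgClosed K] (y : KPt K Y.obj),
      ∃ l, ∃ v : KPt K (V l), v ≫ g l = y)
    (hfg : ∀ (K : Type) [Field K] [Algebra ℂ K] [IsAlgClosed K] (l l' : L) (v : KPt K (V l))
      (v' : KPt K (V l')), v ≫ f l = v' ≫ f l' ↔ v ≫ g l = v' ≫ g l')
    (hstr : ∀ (K : Type) [Field K] [Algebra ℂ K] [IsAlgClosed K] (l : L) (v : KPt K (V l)),
      v ≫ f l ≫ X.str = v ≫ g l ≫ Y.str) : cls X = cls Y := by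
  -- The product is given the weight of its first factor. On the graph `C` constructed below, this
  -- agrees with the weight of the second factor by `hstr`.
  let P : RelVar 𝔐 :=
    { obj := X.obj ⊗ Y.obj
      str := fst _ _ ≫ X.str
      locallyOfFiniteType := inferInstance
      quasiCompact := inferInstance
      isSeparated := inferInstance }
  let h : ∀ l, V l ⟶ P.obj := fun l => lift (f l) (g l)
  -- Chevalley's theorem. The union of the images is the graph of the bijection between geometric
  -- points of `X` and `Y`.
  have hC : Topology.IsConstructible (⋃ l, Set.range (h l).left) := by
    refine .iUnion fun l => ?_
    have h1 : LocallyOfFiniteType (h l).left := locallyOfFiniteType_left _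
    have h2 : QuasiCompact (h l).left := quasiCompact_left _
    rw [← Set.image_univ]
    exact (h l).left.isConstructible_image .univ
  obtain ⟨C, j, hj⟩ := exists_isPiece (P := P) (.of_isConstructible hC)
  have hCl : ∀ (K : Type) [Field K] [Algebra ℂ K] [IsAlgClosed K] (c : KPt K C.obj),
      ∃ l, ∃ v : KPt K (V l), v ≫ h l = c ≫ j := by
    intro K _ _ _ c
    have : KPt.pt (c ≫ j : KPt K _) ∈ ⋃ l, Set.range (h l).left := hj.range ▸ ⟨c.pt, rfl⟩
    obtain ⟨l, hl⟩ := Set.mem_iUnion.mp this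
    exact ⟨l, KPt.exists_lift' (h l) (c ≫ j : KPt K _) hl⟩
  have hlC : ∀ (K : Type) [Field K] [Algebra ℂ K] [IsAlgClosed K] (l : L) (v : KPt K (V l)),
      ∃ c : KPt K C.obj, c ≫ j = v ≫ h l := by
    intro K _ _ _ l v
    refine KPt.exists_lift' j (v ≫ h l : KPt K _) ?_
    rw [hj.range]
    exact Set.mem_iUnion.mpr ⟨l, v.pt, rfl⟩
  have hf' : ∀ l, h l ≫ fst X.obj Y.obj = f l := fun l => lift_fst _ _
  have hg' : ∀ l, h l ≫ snd X.obj Y.obj = g l := fun l => lift_snd _ _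
  have e1 : cls C = cls X := by
    refine cls_eq_of_kBijective (j ≫ fst X.obj Y.obj) ((Category.assoc _ _ _).trans hj.str)
      fun K _ _ _ => ⟨fun c c' hc => ?_, fun x => ?_⟩
    · obtain ⟨l, v, hv⟩ := hCl K c
      obtain ⟨l', v', hv'⟩ := hCl K c'
      dsimp only at hc
      rw [← Category.assoc, ← Category.assoc, ← hv, ← hv', Category.assoc, Category.assoc, hf',
        hf'] at hc
      refine hj.inj K ?_
      dsimp only
      rw [← hv, ← hv']
      refine CartesianMonoidalCategory.hom_ext _ _ ?_ ?_
      · rw [Category.assoc, Category.assoc, hf', hf', hc]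
      · rw [Category.assoc, Category.assoc, hg', hg', (hfg K l l' v v').mp hc]
    · obtain ⟨l, v, rfl⟩ := hf K x
      obtain ⟨c, hc⟩ := hlC K l v
      refine ⟨c, ?_⟩
      dsimp only
      rw [← Category.assoc, hc, Category.assoc, hf']
  have e2 : cls C = cls Y := by
    -- Since `C` is reduced, the two maps to `𝔐` may be compared on geometric points.
    have := hj.reduced
    refine cls_eq_of_kBijective (j ≫ snd X.obj Y.obj) ?_
      fun K _ _ _ => ⟨fun c c' hc => ?_, fun x => ?_⟩
    · rw [← hj.str]
      refine hom_ext_of_kpts fun K _ _ _ c => ?_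
      obtain ⟨l, v, hv⟩ := hCl K c
      rw [Category.assoc, ← Category.assoc c, ← Category.assoc c, ← hv, Category.assoc, Category.assoc]
      change v ≫ h l ≫ _ = v ≫ h l ≫ fst X.obj Y.obj ≫ X.str
      rw [← Category.assoc (h l), ← Category.assoc (h l), hf', hg', hstr]
    · obtain ⟨l, v, hv⟩ := hCl K c
      obtain ⟨l', v', hv'⟩ := hCl K c'
      dsimp only at hc
      rw [← Category.assoc, ← Category.assoc, ← hv, ← hv', Category.assoc, Category.assoc, hg',
        hg'] at hc
      refine hj.inj K ?_
      dsimp only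
      rw [← hv, ← hv']
      refine CartesianMonoidalCategory.hom_ext _ _ ?_ ?_
      · rw [Category.assoc, Category.assoc, hf', hf', (hfg K l l' v v').mpr hc]
      · rw [Category.assoc, Category.assoc, hg', hg', hc]
    · obtain ⟨l, v, rfl⟩ := hg K x
      obtain ⟨c, hc⟩ := hlC K l v
      refine ⟨c, ?_⟩
      dsimp only
      rw [← Category.assoc, hc, Category.assoc, hg']
  rw [← e1, e2]

/-- Sums of classes agree if the geometric points are put in bijection by a constructible
correspondence. -/
lemma sum_cls_eq_of_correspondence {I J : Type} [Fintype I] [Fintype J] (X : I → RelVar 𝔐)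
    (Y : J → RelVar 𝔐) {L : Type} [Finite L] (V : L → Over SpecC)
    [∀ l, IsVariety (V l)] (a : L → I) (b : L → J) (f : ∀ l, V l ⟶ (X (a l)).obj)
    (g : ∀ l, V l ⟶ (Y (b l)).obj)
    (hf : ∀ (K : Type) [Field K] [Algebra ℂ K] [IsAlgClosed K] (x : Σ i, KPt K (X i).obj),
      ∃ l, ∃ v : KPt K (V l), (⟨a l, v ≫ f l⟩ : Σ i, KPt K (X i).obj) = x)
    (hg : ∀ (K : Type) [Field K] [Algebra ℂ K] [IsAlgClosed K] (y : Σ j, KPt K (Y j).obj),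
      ∃ l, ∃ v : KPt K (V l), (⟨b l, v ≫ g l⟩ : Σ i, KPt K (Y i).obj) = y)
    (hfg : ∀ (K : Type) [Field K] [Algebra ℂ K] [IsAlgClosed K] (l l' : L) (v : KPt K (V l))
      (v' : KPt K (V l')),
      ((⟨a l, v ≫ f l⟩ : Σ i, KPt K (X i).obj) = ⟨a l', v' ≫ f l'⟩) ↔
      ((⟨b l, v ≫ g l⟩ : Σ i, KPt K (Y i).obj) = ⟨b l', v' ≫ g l'⟩))
    (hstr : ∀ (K : Type) [Field K] [Algebra ℂ K] [IsAlgClosed K] (l : L) (v : KPt K (V l)),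
      v ≫ f l ≫ (X (a l)).str = v ≫ g l ≫ (Y (b l)).str) :
    ∑ i, cls (X i) = ∑ j, cls (Y j) := by
  obtain ⟨S, s, hS, hSc, -⟩ := exists_isSum X
  obtain ⟨T, t, hT, hTc, -⟩ := exists_isSum Y
  rw [← hSc, ← hTc]
  refine cls_eq_of_correspondence S T V (fun l => f l ≫ s (a l)) (fun l => g l ≫ t (b l))
    ?_ ?_ ?_ ?_
  · intro K _ _ _ x
    obtain ⟨x, rfl⟩ := (hS.bijective K).2 x
    obtain ⟨l, v, rfl⟩ := hf K x
    exact ⟨l, v, (Category.assoc _ _ _).symm⟩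
  · intro K _ _ _ x
    obtain ⟨x, rfl⟩ := (hT.bijective K).2 x
    obtain ⟨l, v, rfl⟩ := hg K x
    exact ⟨l, v, (Category.assoc _ _ _).symm⟩
  · intro K _ _ _ l l' v v'
    rw [← Category.assoc, ← Category.assoc, ← Category.assoc, ← Category.assoc]
    exact ((hS.bijective K).1.eq_iff (a := ⟨a l, v ≫ f l⟩) (b := ⟨a l', v' ≫ f l'⟩)).trans
      ((hfg K l l' v v').trans
        ((hT.bijective K).1.eq_iff (a := ⟨b l, v ≫ g l⟩) (b := ⟨b l', v' ≫ g l'⟩)).symm)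
  · intro K _ _ _ l v
    rw [Category.assoc, Category.assoc, hS.inj_str, hT.inj_str, hstr]

end Comparison

/-! ### Functions invariant under a finite group -/

section Invariants

lemma appLE_eq_of_eq {X Y : Scheme.{0}} {f f' : X ⟶ Y} (e : f = f') {U : Y.Opens} {V : X.Opens}
    (h : V ≤ f ⁻¹ᵁ U) (h' : V ≤ f' ⁻¹ᵁ U) (s : Γ(Y, U)) :
    f.appLE U V h s = f'.appLE U V h' s := by
  subst e
  rfl

variable {X : Scheme.{0}} {G : Type} [Group G] (ρ : G →* End X)

/-- The endomorphism given by an element of the group. -/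
abbrev actHom (g : G) : X ⟶ X := ρ g

/-- An open subset stable under the action. -/
def IsInvariantOpen (U : X.Opens) : Prop := ∀ g : G, U ≤ (actHom ρ g) ⁻¹ᵁ U

/-- The subring of invariant functions. -/
def invariantSubring (U : X.Opens) : Subring Γ(X, U) where
  carrier := {s | ∀ (g : G) (h : U ≤ (actHom ρ g) ⁻¹ᵁ U), (actHom ρ g).appLE U U h s = s}
  mul_mem' ha hb g h := by rw [map_mul, ha g h, hb g h]
  one_mem' g h := map_one _
  add_mem' ha hb g h := by rw [map_add, ha g h, hb g h]
  zero_mem' g h := map_zero _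
  neg_mem' ha g h := by rw [map_neg, ha g h]

variable {ρ}

lemma end_hom_mul (g h : G) : actHom ρ (g * h) = actHom ρ h ≫ actHom ρ g :=
  map_mul ρ g h

lemma end_hom_one : actHom ρ 1 = 𝟙 X :=
  map_one ρ

lemma isIso_end (g : G) : IsIso (actHom ρ g) :=
  ⟨(actHom ρ g⁻¹), by rw [← end_hom_mul, inv_mul_cancel, end_hom_one],
    by rw [← end_hom_mul, mul_inv_cancel, end_hom_one]⟩

/-- The action on the functions on a stable open subset. -/
abbrev invariantOpenAction {U : X.Opens} (hU : IsInvariantOpen ρ U) :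
    MulSemiringAction G Γ(X, U) where
  -- A left action on points becomes a right action on functions; the inverse turns it back into a
  -- left action.
  smul g s := (actHom ρ g⁻¹).appLE U U (hU _) s
  one_smul s := by
    change (actHom ρ 1⁻¹).appLE U U (hU _) s = s
    have : ∀ (f : X ⟶ X) (_ : f = 𝟙 X) (h : U ≤ f ⁻¹ᵁ U), f.appLE U U h s = s := by
      rintro _ rfl h
      have h1 : (𝟙 X : X ⟶ X).appLE U U h = 𝟙 _ := by
        rw [Scheme.Hom.appLE, Scheme.Hom.id_app]
        exact (Category.id_comp _).trans (X.presheaf.map_id _)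
      rw [h1]
      rfl
    exact this _ (by rw [inv_one, end_hom_one]) _
  mul_smul g h s := by
    change (actHom ρ (g * h)⁻¹).appLE U U (hU _) s =
      (actHom ρ g⁻¹).appLE U U (hU _) ((actHom ρ h⁻¹).appLE U U (hU _) s)
    have e := Scheme.Hom.appLE_comp_appLE (actHom ρ g⁻¹) (actHom ρ h⁻¹) U U U (hU _) (hU _)
    have e' := congrArg (fun φ => φ.hom s) e
    dsimp at e'
    refine (appLE_eq_of_eq ?_ _ _ s).trans e'.symm
    rw [mul_inv_rev, end_hom_mul]
  smul_zero g := map_zero ((actHom ρ g⁻¹).appLE U U (hU _)).hom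
  smul_add g a b := map_add ((actHom ρ g⁻¹).appLE U U (hU _)).hom a b
  smul_one g := map_one ((actHom ρ g⁻¹).appLE U U (hU _)).hom
  smul_mul g a b := map_mul ((actHom ρ g⁻¹).appLE U U (hU _)).hom a b

lemma mem_invariantSubring_iff {U : X.Opens} (hU : IsInvariantOpen ρ U) (s : Γ(X, U)) :
    letI := invariantOpenAction hU
    s ∈ invariantSubring ρ U ↔ ∀ g : G, g • s = s := by
  let _ := invariantOpenAction hU
  refine ⟨fun h g => h g⁻¹ _, fun h g hg => ?_⟩
  have h1 : (actHom ρ g⁻¹⁻¹).appLE U U (hU _) s = s := h g⁻¹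
  exact (appLE_eq_of_eq (by rw [inv_inv]) _ _ s).trans h1

lemma isInvariant_invariantSubring {U : X.Opens} (hU : IsInvariantOpen ρ U) :
    letI := invariantOpenAction hU
    Algebra.IsInvariant (invariantSubring ρ U) Γ(X, U) G :=
  letI := invariantOpenAction hU
  ⟨fun b hb => ⟨⟨b, (mem_invariantSubring_iff hU b).mpr hb⟩, rfl⟩⟩

lemma smulCommClass_invariantSubring {U : X.Opens} (hU : IsInvariantOpen ρ U) :
    letI := invariantOpenAction hU
    SMulCommClass G (invariantSubring ρ U) Γ(X, U) := by
  let _ := invariantOpenAction hU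
  refine ⟨fun g a b => ?_⟩
  rw [Algebra.smul_def, Algebra.smul_def, MulSemiringAction.smul_mul]
  congr 1
  exact (mem_invariantSubring_iff hU a.1).mp a.2 g

lemma isIntegral_invariantSubring [Finite G] {U : X.Opens} (hU : IsInvariantOpen ρ U) :
    Algebra.IsIntegral (invariantSubring ρ U) Γ(X, U) := by
  let _ := invariantOpenAction hU
  have := isInvariant_invariantSubring hU
  exact Algebra.IsInvariant.isIntegral (invariantSubring ρ U) Γ(X, U) G

lemma map_mem_invariantSubring {U V : X.Opens} (hU : IsInvariantOpen ρ U) (i : V ≤ U)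
    {s : Γ(X, U)} (hs : s ∈ invariantSubring ρ U) :
    X.presheaf.map (homOfLE i).op s ∈ invariantSubring ρ V := by
  intro g h
  have h1 := congrArg (X.presheaf.map (homOfLE i).op) (hs g (hU g))
  have e1 := Scheme.Hom.map_appLE (actHom ρ g) (U := V) (V := V) h (homOfLE i).op
  have e2 := Scheme.Hom.appLE_map (actHom ρ g) (U := U) (V := U) (hU g) (homOfLE i).op
  have e := congrArg (fun φ => φ.hom s) (e1.trans e2.symm)
  exact e.trans h1

end Invariants

/-! ### Affine charts of a quotient -/

section Charts

variable {X : Scheme.{0}} {G : Type} [Group G] (ρ : G →* End X)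

/-- The quotient of an affine stable open subset: the spectrum of the invariant functions. -/
abbrev invariantChart (U : X.Opens) : Scheme.{0} := Spec (.of (invariantSubring ρ U))

/-- The quotient map of an affine stable open subset. -/
def invariantChartπ (U : X.Opens) : U.toScheme ⟶ invariantChart ρ U :=
  U.toSpecΓ ≫ Spec.map (CommRingCat.ofHom (invariantSubring ρ U).subtype)

variable {ρ}

/-- The restriction of invariant functions. -/
def invariantRestrict {U V : X.Opens} (hU : IsInvariantOpen ρ U) (i : V ≤ U) :
    invariantSubring ρ U →+* invariantSubring ρ V :=
  ((X.presheaf.map (homOfLE i).op).hom.comp (invariantSubring ρ U).subtype).codRestrict _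
    fun s => map_mem_invariantSubring hU i s.2

/-- The transition map between quotients of stable open subsets. -/
def invariantChartMap {U V : X.Opens} (hU : IsInvariantOpen ρ U) (i : V ≤ U) :
    invariantChart ρ V ⟶ invariantChart ρ U :=
  Spec.map (CommRingCat.ofHom (invariantRestrict hU i))

lemma invariantChartπ_map {U V : X.Opens} (hU : IsInvariantOpen ρ U) (i : V ≤ U) :
    invariantChartπ ρ V ≫ invariantChartMap hU i = X.homOfLE i ≫ invariantChartπ ρ U := by
  rw [invariantChartπ, invariantChartπ, ← Category.assoc (X.homOfLE i),
    ← Scheme.Opens.toSpecΓ_SpecMap_presheaf_map V U i, Category.assoc, Category.assoc,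
    invariantChartMap, ← Spec.map_comp, ← Spec.map_comp]
  rfl

lemma invariantChartMap_id {U : X.Opens} (hU : IsInvariantOpen ρ U) (i : U ≤ U) :
    invariantChartMap hU i = 𝟙 _ := by
  have : CommRingCat.ofHom (invariantRestrict hU i) = 𝟙 _ := by
    ext s
    exact congrArg (fun φ => φ.hom s.1) (X.presheaf.map_id _)
  rw [invariantChartMap, this, Spec.map_id]

lemma invariantChartMap_comp {U V W : X.Opens} (hU : IsInvariantOpen ρ U)
    (hV : IsInvariantOpen ρ V) (i : V ≤ U) (j : W ≤ V) :
    invariantChartMap hV j ≫ invariantChartMap hU i = invariantChartMap hU (j.trans i) := by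
  rw [invariantChartMap, invariantChartMap, invariantChartMap, ← Spec.map_comp]
  congr 1
  ext s
  exact (congrArg (fun φ => φ.hom s.1)
    (X.presheaf.map_comp (homOfLE i).op (homOfLE j).op)).symm

lemma invariantChartπ_preimage_basicOpen (U : X.Opens) (f : invariantSubring ρ U) :
    invariantChartπ ρ U ⁻¹ᵁ (PrimeSpectrum.basicOpen f : (Spec (.of _)).Opens) =
      U.ι ⁻¹ᵁ X.basicOpen f.1 := by
  rw [← Scheme.Opens.toSpecΓ_preimage_basicOpen]
  rfl

lemma mem_invariantChartπ_basicOpen (U : X.Opens) (f : invariantSubring ρ U) (x : U) :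
    invariantChartπ ρ U x ∈ (PrimeSpectrum.basicOpen f : (Spec (.of _)).Opens) ↔
      x.1 ∈ X.basicOpen f.1 := by
  have := invariantChartπ_preimage_basicOpen U f
  exact iff_of_eq congr(x ∈ $this)

section Affine

variable {U : X.Opens}

lemma invariantSubring_basicOpen_isInvariantOpen (hU : IsInvariantOpen ρ U)
    (f : invariantSubring ρ U) : IsInvariantOpen ρ (X.basicOpen f.1) := by
  intro g
  have h := Scheme.basicOpen_appLE (actHom ρ g) U U (hU g) f.1
  rw [f.2 g] at h
  exact h.le.trans inf_le_right

lemma invariantChartπ_eq_of_eq (hU : IsInvariantOpen ρ U) (x y : U) (g : G) (h : (actHom ρ g) x.1 = y.1) :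
    invariantChartπ ρ U x = invariantChartπ ρ U y := by
  refine PrimeSpectrum.ext (Ideal.ext fun f => ?_)
  refine not_iff_not.mp ?_
  refine (mem_invariantChartπ_basicOpen U f x).trans
    (Iff.trans ?_ (mem_invariantChartπ_basicOpen U f y).symm)
  have h1 := Scheme.basicOpen_appLE (actHom ρ g) U U (hU g) f.1
  rw [f.2 g] at h1
  rw [← h]
  refine ⟨fun hx => ?_, fun hx => ?_⟩
  · rw [h1] at hx
    exact hx.2
  · rw [h1]
    exact ⟨x.2, hx⟩

variable [Finite G]

lemma isIntegralHom_invariantChartπ (hU : IsInvariantOpen ρ U) (hUa : IsAffineOpen U) :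
    IsIntegralHom (invariantChartπ ρ U) := by
  have := isIntegral_invariantSubring hU
  have h : IsIntegralHom (Spec.map (CommRingCat.ofHom (invariantSubring ρ U).subtype)) := by
    rw [IsIntegralHom.SpecMap_iff]
    exact algebraMap_isIntegral_iff.mpr this
  have : IsIso U.toSpecΓ := (inferInstance : IsIso hUa.isoSpec.hom)
  unfold invariantChartπ invariantChart
  infer_instance

/-- Lying over for the integral inclusion of the invariants. -/
lemma surjective_invariantChartπ (hU : IsInvariantOpen ρ U) (hUa : IsAffineOpen U) :
    Function.Surjective (invariantChartπ ρ U) := by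
  have := isIntegral_invariantSubring hU
  have : IsIso U.toSpecΓ := (inferInstance : IsIso hUa.isoSpec.hom)
  have h : Function.Surjective
      (PrimeSpectrum.comap (algebraMap (invariantSubring ρ U) Γ(X, U))) := by
    have : FaithfulSMul (invariantSubring ρ U) Γ(X, U) :=
      (faithfulSMul_iff_algebraMap_injective _ _).mpr Subtype.val_injective
    exact Algebra.IsIntegral.comap_surjective _ _
  have h2 : Function.Surjective U.toSpecΓ := U.toSpecΓ.surjective
  exact h.comp h2

/-- A finite group permutes transitively the primes with a given contraction to the ring of
invariants. -/
lemma exists_eq_of_invariantChartπ_eq (hU : IsInvariantOpen ρ U) (hUa : IsAffineOpen U)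
    (x y : U) (h : invariantChartπ ρ U x = invariantChartπ ρ U y) :
    ∃ g : G, (actHom ρ g) x.1 = y.1 := by
  let _ := invariantOpenAction hU
  have := isInvariant_invariantSubring hU
  have := smulCommClass_invariantSubring hU
  have hI : (hUa.primeIdealOf x).asIdeal.under (invariantSubring ρ U) =
      (hUa.primeIdealOf y).asIdeal.under (invariantSubring ρ U) :=
    congrArg PrimeSpectrum.asIdeal h
  obtain ⟨g, hg⟩ := Algebra.IsInvariant.exists_smul_of_under_eq (invariantSubring ρ U) Γ(X, U) G
    _ _ hI
  refine ⟨g, ?_⟩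
  have h1 := IsAffineOpen.comap_primeIdealOf_appLE U hUa U hUa (hU g) x.2
  have h2 : hUa.primeIdealOf ⟨(actHom ρ g) x.1, hU g x.2⟩ = hUa.primeIdealOf y := by
    rw [← h1]
    ext1
    rw [hg]
    ext s
    rw [Ideal.mem_pointwise_smul_iff_inv_smul_mem]
    change (actHom ρ g).appLE U U _ s ∈ (hUa.primeIdealOf x).asIdeal ↔
      (actHom ρ g⁻¹⁻¹).appLE U U _ s ∈ (hUa.primeIdealOf x).asIdeal
    rw [appLE_eq_of_eq (show actHom ρ g = actHom ρ g⁻¹⁻¹ by rw [inv_inv])]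
  have h3 := congrArg hUa.fromSpec h2
  rwa [IsAffineOpen.fromSpec_primeIdealOf, IsAffineOpen.fromSpec_primeIdealOf] at h3

/-- The chart projection is integral, hence closed, so the part of `U` outside `V` has closed image.
The image of `x` is not in it, because the fibres are orbits and `V` is stable; a basic open subset
of the quotient separates the two. -/
lemma exists_invariant_basicOpen (hU : IsInvariantOpen ρ U) (hUa : IsAffineOpen U) {V : X.Opens} (hV : IsInvariantOpen ρ V) (x : X) (hxU : x ∈ U)
    (hxV : x ∈ V) :
    ∃ f : invariantSubring ρ U, x ∈ X.basicOpen f.1 ∧ X.basicOpen f.1 ≤ V := by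
  have h1 := isIntegralHom_invariantChartπ hU hUa
  have hc : IsClosed (invariantChartπ ρ U '' {y : U | y.1 ∉ V}) :=
    (invariantChartπ ρ U).isClosedMap _ ((V.isOpen.preimage U.ι.continuous).isClosed_compl)
  have hx : invariantChartπ ρ U ⟨x, hxU⟩ ∉ invariantChartπ ρ U '' {y : U | y.1 ∉ V} := by
    rintro ⟨y, hy, hxy⟩
    obtain ⟨g, hg⟩ := exists_eq_of_invariantChartπ_eq hU hUa ⟨x, hxU⟩ y hxy.symm
    apply hy
    rw [← hg]
    exact hV g hxV
  obtain ⟨_, ⟨f, rfl⟩, hf, hf'⟩ :=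
    (PrimeSpectrum.isTopologicalBasis_basic_opens (R := invariantSubring ρ U)).exists_subset_of_mem_open
      (Set.mem_compl hx) hc.isOpen_compl
  refine ⟨f, (mem_invariantChartπ_basicOpen U f ⟨x, hxU⟩).mp hf, fun y hy => ?_⟩
  have hyU : y ∈ U := X.basicOpen_le f.1 hy
  by_contra hyV
  exact hf' ((mem_invariantChartπ_basicOpen U f ⟨y, hyU⟩).mpr hy) ⟨⟨y, hyU⟩, hyV, rfl⟩

end Affine

end Charts

/-! ### Invariants and localization -/

section Localization

variable {X : Scheme.{0}} {G : Type} [Group G] {ρ : G →* End X} {U : X.Opens}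

lemma homOfLE_val {U V : X.Opens} (i : V ≤ U) (y : V) : (X.homOfLE i y).1 = y.1 :=
  congr($(X.homOfLE_ι i) y)

lemma invariantChartMap_eq_of_le (hU : IsInvariantOpen ρ U) {V W : X.Opens} (h : V = W) (i : V ≤ U)
    (j : W ≤ U) (hi : IsOpenImmersion (invariantChartMap hU i)) :
    IsOpenImmersion (invariantChartMap hU j) := by
  subst h
  exact hi

variable [Finite G]

/-- Clearing the denominator of an invariant fraction gives a numerator `a` that need not be
invariant, but `a` and each of its translates agree after multiplication by a power of `f`. As the
group is finite, the sum of the exponents works for all translates. -/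
lemma exists_pow_mul_eq_map (hU : IsInvariantOpen ρ U) (hUa : IsAffineOpen U)
    (f : invariantSubring ρ U) (s : invariantSubring ρ (X.basicOpen f.1)) :
    ∃ (n : ℕ) (t : invariantSubring ρ U),
      s * invariantRestrict hU (X.basicOpen_le f.1) f ^ n =
        invariantRestrict hU (X.basicOpen_le f.1) t := by
  cases nonempty_fintype G
  let φ := (X.presheaf.map (homOfLE (X.basicOpen_le f.1)).op).hom
  have hloc := hUa.isLocalization_basicOpen f.1
  obtain ⟨n, a, ha⟩ := IsLocalization.Away.surj f.1 s.1
  replace ha : s.1 * φ f.1 ^ n = φ a := ha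
  have hm : ∀ g : G, ∃ m : ℕ, f.1 ^ m * (actHom ρ g).appLE U U (hU g) a = f.1 ^ m * a := by
    intro g
    have hs := s.2 g (invariantSubring_basicOpen_isInvariantOpen hU f g)
    have hf := (invariantRestrict hU (X.basicOpen_le f.1) f).2 g
      (invariantSubring_basicOpen_isInvariantOpen hU f g)
    have e1 := Scheme.Hom.map_appLE (actHom ρ g) (U := X.basicOpen f.1) (V := X.basicOpen f.1)
      (invariantSubring_basicOpen_isInvariantOpen hU f g) (homOfLE (X.basicOpen_le f.1)).op
    have e2 := Scheme.Hom.appLE_map (actHom ρ g) (U := U) (V := U) (hU g)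
      (homOfLE (X.basicOpen_le f.1)).op
    have e : (actHom ρ g).appLE _ _ (invariantSubring_basicOpen_isInvariantOpen hU f g) (φ a) =
        φ ((actHom ρ g).appLE U U (hU g) a) :=
      congrArg (fun ψ => ψ.hom a) (e1.trans e2.symm)
    have h : φ ((actHom ρ g).appLE U U (hU g) a) = φ a := by
      rw [← e, ← ha, map_mul, map_pow]
      exact congr($hs * $hf ^ n)
    obtain ⟨⟨_, m, rfl⟩, hm⟩ := (IsLocalization.eq_iff_exists (Submonoid.powers f.1)
      Γ(X, X.basicOpen f.1)).mp h
    exact ⟨m, hm⟩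
  choose m hm using hm
  let N := ∑ g, m g
  have hN : ∀ g : G, f.1 ^ N * (actHom ρ g).appLE U U (hU g) a = f.1 ^ N * a := by
    intro g
    obtain ⟨k, hk⟩ := Nat.exists_eq_add_of_le (Finset.single_le_sum (f := m) (fun _ _ => Nat.zero_le _)
      (Finset.mem_univ g))
    have : N = k + m g := by rw [add_comm]; exact hk
    rw [this, pow_add, _root_.mul_assoc, hm, _root_.mul_assoc]
  refine ⟨n + N, ⟨f.1 ^ N * a, fun g h => ?_⟩, Subtype.ext ?_⟩
  · rw [map_mul, map_pow, f.2 g h, hN]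
  · change s.1 * φ f.1 ^ (n + N) = φ (f.1 ^ N * a)
    rw [map_mul, map_pow, ← ha, pow_add]
    ring

lemma isLocalization_invariantRestrict (hU : IsInvariantOpen ρ U) (hUa : IsAffineOpen U)
    (f : invariantSubring ρ U) :
    letI := (invariantRestrict hU (X.basicOpen_le f.1)).toAlgebra
    IsLocalization.Away f (invariantSubring ρ (X.basicOpen f.1)) := by
  let _ := (invariantRestrict hU (X.basicOpen_le f.1)).toAlgebra
  have hloc := hUa.isLocalization_basicOpen f.1
  refine ⟨?_, ?_, ?_⟩
  · rintro ⟨_, n, rfl⟩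
    rw [map_pow]
    refine IsUnit.pow n ?_
    have hu : IsUnit (X.presheaf.map (homOfLE (X.basicOpen_le f.1)).op f.1) :=
      RingedSpace.isUnit_res_basicOpen X.toRingedSpace f.1
    obtain ⟨b, hb⟩ := hu.exists_right_inv
    have hb' : b ∈ invariantSubring ρ (X.basicOpen f.1) := by
      intro g h
      have h1 := congrArg ((actHom ρ g).appLE _ _ h) hb
      have h2 : (actHom ρ g).appLE _ _ h (X.presheaf.map (homOfLE (X.basicOpen_le f.1)).op f.1) =
          X.presheaf.map (homOfLE (X.basicOpen_le f.1)).op f.1 :=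
        (invariantRestrict hU (X.basicOpen_le f.1) f).2 g h
      rw [map_mul, map_one, h2] at h1
      exact hu.mul_left_cancel (h1.trans hb.symm)
    exact IsUnit.of_mul_eq_one ⟨b, hb'⟩ (Subtype.ext hb)
  · intro s
    obtain ⟨n, t, h⟩ := exists_pow_mul_eq_map hU hUa f s
    exact ⟨(t, ⟨f ^ n, n, rfl⟩), by rw [map_pow]; exact h⟩
  · intro a b h
    obtain ⟨⟨_, m, rfl⟩, hm⟩ := (IsLocalization.eq_iff_exists (Submonoid.powers f.1)
      Γ(X, X.basicOpen f.1)).mp (congrArg Subtype.val h)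
    exact ⟨⟨f ^ m, m, rfl⟩, Subtype.ext hm⟩

lemma isOpenImmersion_invariantChartMap_basicOpen (hU : IsInvariantOpen ρ U) (hUa : IsAffineOpen U)
    (f : invariantSubring ρ U) :
    IsOpenImmersion (invariantChartMap hU (X.basicOpen_le f.1)) := by
  let _ := (invariantRestrict hU (X.basicOpen_le f.1)).toAlgebra
  have := isLocalization_invariantRestrict hU hUa f
  exact IsOpenImmersion.of_isLocalization (S := invariantSubring ρ (X.basicOpen f.1)) f

lemma range_invariantChartMap_basicOpen (hU : IsInvariantOpen ρ U) (hUa : IsAffineOpen U)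
    (f : invariantSubring ρ U) :
    Set.range (invariantChartMap hU (X.basicOpen_le f.1)) =
      (PrimeSpectrum.basicOpen f : Set (PrimeSpectrum (invariantSubring ρ U))) := by
  let _ := (invariantRestrict hU (X.basicOpen_le f.1)).toAlgebra
  have := isLocalization_invariantRestrict hU hUa f
  exact PrimeSpectrum.localization_away_comap_range (invariantSubring ρ (X.basicOpen f.1)) f

/-- Stable affine open subsets of stable affine open subsets give open subsets of the quotient. -/
lemma isOpenImmersion_invariantChartMap (hU : IsInvariantOpen ρ U) (hUa : IsAffineOpen U)
    {V : X.Opens} (hV : IsInvariantOpen ρ V) (hVa : IsAffineOpen V) (i : V ≤ U) :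
    IsOpenImmersion (invariantChartMap hU i) := by
  -- Injectivity holds since the fibres of both projections are orbits. Locally on the source, the
  -- map is compared with a basic open subset of an invariant function on `U` contained in `V`; it
  -- is also the basic open subset of the restricted function on `V`.
  refine .of_forall_source_exists _ ?_ ?_
  · intro a b hab
    obtain ⟨x, rfl⟩ := surjective_invariantChartπ hV hVa a
    obtain ⟨y, rfl⟩ := surjective_invariantChartπ hV hVa b
    rw [← Scheme.Hom.comp_apply, ← Scheme.Hom.comp_apply, invariantChartπ_map,
      Scheme.Hom.comp_apply, Scheme.Hom.comp_apply] at hab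
    obtain ⟨g, hg⟩ := exists_eq_of_invariantChartπ_eq hU hUa _ _ hab
    exact invariantChartπ_eq_of_eq hV x y g
      (((congrArg (actHom ρ g) (homOfLE_val i x)).symm.trans hg).trans (homOfLE_val i y))
  · intro a
    obtain ⟨x, rfl⟩ := surjective_invariantChartπ hV hVa a
    obtain ⟨f, hxf, hf⟩ := exists_invariant_basicOpen hU hUa hV x.1 (i x.2) x.2
    have e : X.basicOpen (invariantRestrict hU i f).1 = X.basicOpen f.1 :=
      (X.basicOpen_res f.1 (homOfLE i).op).trans (inf_eq_right.mpr hf)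
    have h1 := isOpenImmersion_invariantChartMap_basicOpen hU hUa f
    have h2 := isOpenImmersion_invariantChartMap_basicOpen hV hVa (invariantRestrict hU i f)
    refine ⟨_, _, h2, ?_, ?_⟩
    · rw [← SetLike.mem_coe, Scheme.Hom.coe_opensRange, range_invariantChartMap_basicOpen hV hVa]
      refine (mem_invariantChartπ_basicOpen V _ x).mpr ?_
      rw [e]
      exact hxf
    · rw [invariantChartMap_comp]
      exact invariantChartMap_eq_of_le hU e.symm _ _ h1

/-- The image of a stable open subset determines it. -/
lemma mem_of_invariantChartMap_eq (hU : IsInvariantOpen ρ U) (hUa : IsAffineOpen U)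
    {V : X.Opens} (hV : IsInvariantOpen ρ V) (hVa : IsAffineOpen V) (i : V ≤ U) (x : U)
    (h : invariantChartπ ρ U x ∈ Set.range (invariantChartMap hU i)) : x.1 ∈ V := by
  obtain ⟨a, ha⟩ := h
  obtain ⟨y, rfl⟩ := surjective_invariantChartπ hV hVa a
  rw [← Scheme.Hom.comp_apply, invariantChartπ_map, Scheme.Hom.comp_apply] at ha
  obtain ⟨g, hg⟩ := exists_eq_of_invariantChartπ_eq hU hUa _ _ ha
  have h := (congrArg (actHom ρ g) (homOfLE_val i y)).symm.trans hg
  rw [← h]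
  exact hV g y.2

end Localization

/-! ### Gluing quotients -/

section Gluing

variable {X : Scheme.{0}} {G : Type} [Group G]

/-- A family of stable affine open subsets suitable for gluing a quotient. -/
structure IsChartFamily (ρ : G →* End X) (𝒥 : Set X.Opens) : Prop where
  invariant : ∀ U ∈ 𝒥, IsInvariantOpen ρ U
  affine : ∀ U ∈ 𝒥, IsAffineOpen U
  inf : ∀ U ∈ 𝒥, ∀ V ∈ 𝒥, U ⊓ V ∈ 𝒥
  basicOpen : ∀ U ∈ 𝒥, ∀ f : invariantSubring ρ U, X.basicOpen f.1 ∈ 𝒥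
  cover : ∀ x : X, ∃ U ∈ 𝒥, x ∈ U

namespace IsChartFamily

variable {ρ : G →* End X} {𝒥 : Set X.Opens} (h : IsChartFamily ρ 𝒥)

/-- The diagram of quotients of the charts. -/
def functor : 𝒥 ⥤ Scheme.{0} where
  obj U := invariantChart ρ U.1
  map {_ U} f := invariantChartMap (h.invariant U.1 U.2) (leOfHom f)
  map_id _ := invariantChartMap_id _ _
  map_comp {_ V _} _ _ := (invariantChartMap_comp _ (h.invariant V.1 V.2) _ _).symm

variable [Finite G]

instance {V U : 𝒥} (f : V ⟶ U) : IsOpenImmersion (h.functor.map f) :=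
  isOpenImmersion_invariantChartMap (h.invariant U.1 U.2) (h.affine U.1 U.2) (h.invariant V.1 V.2)
    (h.affine V.1 V.2) (leOfHom f)

/-- This condition lets the colimit of the charts be a gluing along open subschemes. Points of two
charts with the same image in the chart of `U` lift to a common point of `U`, which lies in both `V`
and `W` by stability, so both come from the chart of the intersection. -/
instance : (h.functor ⋙ Scheme.forget).IsLocallyDirected where
  cond {V W U} i j a b hab := by
    replace hab : h.functor.map i a = h.functor.map j b := hab
    obtain ⟨x, hx⟩ := surjective_invariantChartπ (h.invariant U.1 U.2) (h.affine U.1 U.2)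
      (h.functor.map i a)
    have hV : x.1 ∈ V.1 := mem_of_invariantChartMap_eq (h.invariant U.1 U.2) (h.affine U.1 U.2)
      (h.invariant V.1 V.2) (h.affine V.1 V.2) (leOfHom i) x ⟨a, hx.symm⟩
    have hW : x.1 ∈ W.1 := mem_of_invariantChartMap_eq (h.invariant U.1 U.2) (h.affine U.1 U.2)
      (h.invariant W.1 W.2) (h.affine W.1 W.2) (leOfHom j) x ⟨b, (hx.trans hab).symm⟩
    let L : 𝒥 := ⟨V.1 ⊓ W.1, h.inf _ V.2 _ W.2⟩
    let l1 : L ⟶ V := homOfLE (show L.1 ≤ V.1 from inf_le_left)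
    let l2 : L ⟶ W := homOfLE (show L.1 ≤ W.1 from inf_le_right)
    let y : invariantChart ρ L.1 := invariantChartπ ρ L.1 ⟨x.1, hV, hW⟩
    have key : ∀ (D : 𝒥) (l : L.1 ≤ D.1) (k : D.1 ≤ U.1),
        invariantChartMap (h.invariant U.1 U.2) k (invariantChartMap (h.invariant D.1 D.2) l y) =
          invariantChartπ ρ U.1 x := by
      intro D l k
      rw [← Scheme.Hom.comp_apply, invariantChartMap_comp]
      have e := invariantChartπ_map (h.invariant U.1 U.2) (l.trans k)
      exact (congr($e ⟨x.1, hV, hW⟩)).trans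
        (congrArg (invariantChartπ ρ U.1) (Subtype.ext (homOfLE_val _ _)))
    refine ⟨L, l1, l2, y, ?_, ?_⟩
    · refine (h.functor.map i).isOpenEmbedding.injective ?_
      exact (key V (leOfHom l1) (leOfHom i)).trans hx
    · refine (h.functor.map j).isOpenEmbedding.injective ?_
      exact (key W (leOfHom l2) (leOfHom j)).trans (hx.trans hab)

/-- The glued quotient. -/
def quotient : Scheme.{0} := colimit h.functor

/-- The inclusion of the quotient of a chart. -/
def chartι (U : 𝒥) : invariantChart ρ U.1 ⟶ h.quotient := colimit.ι h.functor U

instance (U : 𝒥) : IsOpenImmersion (h.chartι U) :=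
  inferInstanceAs (IsOpenImmersion (colimit.ι h.functor U))

lemma map_chartι {V U : 𝒥} (i : V.1 ≤ U.1) :
    invariantChartMap (h.invariant U.1 U.2) i ≫ h.chartι U = h.chartι V :=
  colimit.w h.functor (homOfLE i : V ⟶ U)

lemma exists_chartι_eq (b : h.quotient) : ∃ (U : 𝒥) (a : invariantChart ρ U.1), h.chartι U a = b :=
  (Scheme.IsLocallyDirected.openCover h.functor).exists_eq b

/-- A cover of the glued quotient by the quotients of the charts. -/
def chartCover : h.quotient.OpenCover := Scheme.IsLocallyDirected.openCover h.functor

/-- The cover of the scheme by the charts. -/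
def sourceCover : X.OpenCover :=
  X.openCoverOfIsOpenCover (fun U : 𝒥 => U.1) (by
    refine TopologicalSpace.IsOpenCover.mk (top_le_iff.mp fun x _ => ?_)
    obtain ⟨U, hU, hx⟩ := h.cover x
    exact TopologicalSpace.Opens.mem_iSup.mpr ⟨⟨U, hU⟩, hx⟩)

lemma chartπ_compatible (U V : 𝒥) :
    pullback.fst U.1.ι V.1.ι ≫ invariantChartπ ρ U.1 ≫ h.chartι U =
      pullback.snd U.1.ι V.1.ι ≫ invariantChartπ ρ V.1 ≫ h.chartι V := by
  let L : 𝒥 := ⟨U.1 ⊓ V.1, h.inf _ U.2 _ V.2⟩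
  obtain ⟨m, hm⟩ : ∃ m : pullback U.1.ι V.1.ι ⟶ L.1.toScheme,
      m ≫ L.1.ι = pullback.fst U.1.ι V.1.ι ≫ U.1.ι := by
    refine ⟨IsOpenImmersion.lift L.1.ι (pullback.fst U.1.ι V.1.ι ≫ U.1.ι) ?_,
      IsOpenImmersion.lift_fac _ _ _⟩
    rintro _ ⟨z, rfl⟩
    rw [Scheme.Opens.range_ι]
    refine ⟨(pullback.fst U.1.ι V.1.ι z).2, ?_⟩
    rw [pullback.condition]
    exact (pullback.snd U.1.ι V.1.ι z).2
  have e1 : pullback.fst U.1.ι V.1.ι = m ≫ X.homOfLE (show L.1 ≤ U.1 from inf_le_left) := by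
    rw [← cancel_mono U.1.ι, Category.assoc, Scheme.homOfLE_ι, hm]
  have e2 : pullback.snd U.1.ι V.1.ι = m ≫ X.homOfLE (show L.1 ≤ V.1 from inf_le_right) := by
    rw [← cancel_mono V.1.ι, Category.assoc, Scheme.homOfLE_ι, hm, pullback.condition]
  have k : ∀ (D : 𝒥) (i : L.1 ≤ D.1), X.homOfLE i ≫ invariantChartπ ρ D.1 ≫ h.chartι D =
      invariantChartπ ρ L.1 ≫ h.chartι L := by
    intro D i
    rw [← Category.assoc, ← invariantChartπ_map (h.invariant D.1 D.2), Category.assoc,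
      h.map_chartι (V := L)]
  rw [e1, e2, Category.assoc, Category.assoc, k, k]

/-- The quotient map. -/
def quotientMap : X ⟶ h.quotient :=
  h.sourceCover.glueMorphisms (fun U : 𝒥 => invariantChartπ ρ U.1 ≫ h.chartι U) h.chartπ_compatible

lemma ι_quotientMap (U : 𝒥) : U.1.ι ≫ h.quotientMap = invariantChartπ ρ U.1 ≫ h.chartι U :=
  h.sourceCover.ι_glueMorphisms _ _ U

lemma quotientMap_apply (U : 𝒥) (x : U.1) :
    h.quotientMap x.1 = h.chartι U (invariantChartπ ρ U.1 x) :=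
  congr($(h.ι_quotientMap U) x)

lemma mem_of_quotientMap_mem (U : 𝒥) (x : X) (hx : h.quotientMap x ∈ Set.range (h.chartι U)) :
    x ∈ U.1 := by
  obtain ⟨V, hV, hxV⟩ := h.cover x
  obtain ⟨a, ha⟩ := hx
  have e := ha.trans (h.quotientMap_apply ⟨V, hV⟩ ⟨x, hxV⟩)
  obtain ⟨W, i, j, w, hw1, hw2⟩ := (Scheme.IsLocallyDirected.ι_eq_ι_iff h.functor).mp e
  have := mem_of_invariantChartMap_eq (h.invariant V hV) (h.affine V hV) (h.invariant W.1 W.2)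
    (h.affine W.1 W.2) (leOfHom j) ⟨x, hxV⟩ ⟨w, hw2⟩
  exact leOfHom i this

lemma preimage_opensRange (U : 𝒥) : h.quotientMap ⁻¹ᵁ (h.chartι U).opensRange = U.1 := by
  ext x
  refine ⟨fun hx => h.mem_of_quotientMap_mem U x hx, fun hx => ?_⟩
  exact ⟨_, (h.quotientMap_apply U ⟨x, hx⟩).symm⟩

lemma surjective_quotientMap : Function.Surjective h.quotientMap := by
  intro b
  obtain ⟨U, a, rfl⟩ := h.exists_chartι_eq b
  obtain ⟨x, rfl⟩ := surjective_invariantChartπ (h.invariant U.1 U.2) (h.affine U.1 U.2) a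
  exact ⟨x.1, h.quotientMap_apply U x⟩

lemma exists_eq_of_quotientMap_eq (x y : X) (hxy : h.quotientMap x = h.quotientMap y) :
    ∃ g : G, actHom ρ g x = y := by
  obtain ⟨U, hU, hx⟩ := h.cover x
  have hy : y ∈ U := h.mem_of_quotientMap_mem ⟨U, hU⟩ y
    ⟨_, (h.quotientMap_apply ⟨U, hU⟩ ⟨x, hx⟩).symm.trans hxy⟩
  have e := (h.quotientMap_apply ⟨U, hU⟩ ⟨x, hx⟩).symm.trans
    (hxy.trans (h.quotientMap_apply ⟨U, hU⟩ ⟨y, hy⟩))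
  exact exists_eq_of_invariantChartπ_eq (h.invariant U hU) (h.affine U hU) ⟨x, hx⟩ ⟨y, hy⟩
    ((h.chartι ⟨U, hU⟩).isOpenEmbedding.injective e)

lemma isPullback_chart (U : 𝒥) :
    IsPullback (invariantChartπ ρ U.1) U.1.ι (h.chartι U) h.quotientMap :=
  IsOpenImmersion.isPullback _ _ _ _ (h.ι_quotientMap U)
    ((h.preimage_opensRange U).trans (Scheme.Opens.opensRange_ι U.1).symm)

lemma actHom_quotientMap (g : G) : actHom ρ g ≫ h.quotientMap = h.quotientMap := by
  refine h.sourceCover.hom_ext _ _ fun U => ?_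
  change 𝒥 at U
  change U.1.ι ≫ actHom ρ g ≫ h.quotientMap = U.1.ι ≫ h.quotientMap
  have e1 : U.1.ι ≫ actHom ρ g = (actHom ρ g).resLE U.1 U.1 (h.invariant U.1 U.2 g) ≫ U.1.ι :=
    (Scheme.Hom.resLE_comp_ι _ _).symm
  have e2 : (actHom ρ g).resLE U.1 U.1 (h.invariant U.1 U.2 g) ≫ invariantChartπ ρ U.1 =
      invariantChartπ ρ U.1 := by
    rw [invariantChartπ, ← Category.assoc, ← Scheme.Opens.toSpecΓ_SpecMap_appLE, Category.assoc,
      ← Spec.map_comp]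
    congr 2
    ext s
    exact s.2 g _
  rw [← Category.assoc, e1, Category.assoc, ι_quotientMap, ← Category.assoc, e2]

end IsChartFamily

end Gluing

/-! ### Functions on the glued quotient -/

section Sections

variable {X : Scheme.{0}} {G : Type} [Group G] [Finite G] {ρ : G →* End X} {𝒥 : Set X.Opens}

namespace IsChartFamily

variable (h : IsChartFamily ρ 𝒥)

/-- On the image of a chart, pulling functions back is the inclusion of the invariants, once
functions on a spectrum are identified with its ring. -/
lemma chart_appLE (U : 𝒥) (e : U.1 ≤ h.quotientMap ⁻¹ᵁ (h.chartι U).opensRange) :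
    Function.Injective (h.quotientMap.appLE (h.chartι U).opensRange U.1 e) ∧
    ∀ s ∈ invariantSubring ρ U.1, ∃ t, h.quotientMap.appLE (h.chartι U).opensRange U.1 e t = s := by
  have h1 : (⊤ : (invariantChart ρ U.1).Opens) ≤ h.chartι U ⁻¹ᵁ (h.chartι U).opensRange :=
    fun x _ => ⟨x, rfl⟩
  have h2 : (⊤ : U.1.toScheme.Opens) ≤ U.1.ι ⁻¹ᵁ U.1 := fun x _ => x.2
  have e1 := Scheme.Hom.appLE_comp_appLE U.1.ι h.quotientMap (h.chartι U).opensRange U.1 ⊤ e h2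
  have e2 := Scheme.Hom.appLE_comp_appLE (invariantChartπ ρ U.1) (h.chartι U)
    (h.chartι U).opensRange ⊤ ⊤ h1 le_top
  have e3 : h.quotientMap.appLE (h.chartι U).opensRange U.1 e ≫ U.1.ι.appLE U.1 ⊤ h2 =
      (h.chartι U).appLE (h.chartι U).opensRange ⊤ h1 ≫
        (invariantChartπ ρ U.1).appLE ⊤ ⊤ le_top := by
    rw [e1, e2]
    congr 1
    exact h.ι_quotientMap U
  have i1 : IsIso ((h.chartι U).appLE (h.chartι U).opensRange ⊤ h1) := by
    have a1 := (h.chartι U).isIso_app (h.chartι U).opensRange le_rfl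
    have a2 : (h.chartι U) ⁻¹ᵁ (h.chartι U).opensRange = ⊤ := top_le_iff.mp h1
    have a3 : IsIso (homOfLE h1) := ⟨homOfLE a2.le, Subsingleton.elim _ _, Subsingleton.elim _ _⟩
    rw [Scheme.Hom.appLE]
    infer_instance
  have e4 : U.1.ι.appLE U.1 ⊤ h2 = U.1.topIso.inv := by
    rw [Scheme.Opens.ι_appLE]
    rfl
  have e5 : (invariantChartπ ρ U.1).appLE ⊤ ⊤ le_top =
      (Scheme.ΓSpecIso _).hom ≫ CommRingCat.ofHom (invariantSubring ρ U.1).subtype ≫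
        U.1.topIso.inv := by
    have : (invariantChartπ ρ U.1).appLE ⊤ ⊤ le_top = (invariantChartπ ρ U.1).appTop :=
      Scheme.Hom.appLE_eq_app _
    rw [this, invariantChartπ, Scheme.Hom.comp_appTop, Scheme.Opens.toSpecΓ_appTop,
      Scheme.ΓSpecIso_naturality_assoc]
  rw [e4, e5, ← Category.assoc, ← Category.assoc, cancel_mono] at e3
  have e6 : ∀ t, h.quotientMap.appLE (h.chartι U).opensRange U.1 e t =
      ((((h.chartι U).appLE (h.chartι U).opensRange ⊤ h1 ≫
        (Scheme.ΓSpecIso (.of (invariantSubring ρ U.1))).hom).hom t : invariantSubring ρ U.1)).1 :=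
    fun t => congr($e3 t)
  have hb := ConcreteCategory.bijective_of_isIso ((h.chartι U).appLE (h.chartι U).opensRange ⊤ h1 ≫
        (Scheme.ΓSpecIso (.of (invariantSubring ρ U.1))).hom)
  refine ⟨fun t t' htt => ?_, fun s hs => ?_⟩
  · rw [e6, e6] at htt
    exact hb.1 (Subtype.ext htt)
  · obtain ⟨t, ht⟩ := hb.2 ⟨s, hs⟩
    exact ⟨t, (e6 t).trans (congrArg Subtype.val ht)⟩

/-- The charts form a basis, since basic open subsets of invariant functions are again charts. -/
lemma exists_chart_subset (O : h.quotient.Opens) (b : h.quotient) (hb : b ∈ O) :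
    ∃ U : 𝒥, b ∈ (h.chartι U).opensRange ∧ (h.chartι U).opensRange ≤ O := by
  obtain ⟨U, a, rfl⟩ := h.exists_chartι_eq b
  obtain ⟨_, ⟨f, rfl⟩, hf, hf'⟩ :=
    (PrimeSpectrum.isTopologicalBasis_basic_opens
      (R := invariantSubring ρ U.1)).exists_subset_of_mem_open
      (show a ∈ (↑(h.chartι U ⁻¹ᵁ O) : Set (invariantChart ρ U.1)) from hb)
      (h.chartι U ⁻¹ᵁ O).isOpen
  let D : 𝒥 := ⟨X.basicOpen f.1, h.basicOpen U.1 U.2 f⟩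
  have hD := range_invariantChartMap_basicOpen (h.invariant U.1 U.2) (h.affine U.1 U.2) f
  have hm := h.map_chartι (V := D) (U := U) (X.basicOpen_le f.1)
  refine ⟨D, ?_, ?_⟩
  · obtain ⟨d, hd⟩ := hD.ge hf
    exact ⟨d, by rw [← hm, Scheme.Hom.comp_apply, hd]⟩
  · rintro _ ⟨d, rfl⟩
    rw [← hm, Scheme.Hom.comp_apply]
    exact hf' (hD.le ⟨d, rfl⟩)

end IsChartFamily

/-- Whether functions on the target are the invariant functions on the source can be tested on a
basis of open subsets. -/
lemma sections_of_basis {X B : Scheme.{0}} {G : Type} [Group G] {ρ : G →* End X} (q : X ⟶ B)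
    (hq : ∀ g, actHom ρ g ≫ q = q) {κ : Type} (W : κ → B.Opens)
    (hW : ∀ (O : B.Opens), ∀ b ∈ O, ∃ i, b ∈ W i ∧ W i ≤ O)
    (hinj : ∀ i, Function.Injective (q.app (W i)))
    (hsec : ∀ i, ∀ s ∈ invariantSubring ρ (q ⁻¹ᵁ W i), ∃ t, q.app (W i) t = s) (O : B.Opens) :
    Function.Injective (q.app O) ∧
      ∀ s ∈ invariantSubring ρ (q ⁻¹ᵁ O), ∃ t, q.app O t = s := by
  have hinv : ∀ O, IsInvariantOpen ρ (q ⁻¹ᵁ O) := by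
    intro O g
    have h : actHom ρ g ⁻¹ᵁ q ⁻¹ᵁ O = (actHom ρ g ≫ q) ⁻¹ᵁ O := rfl
    rw [h, hq]
  have hnat : ∀ {O V : B.Opens} (i : V ≤ O) (t : Γ(B, O)),
      q.app V (B.presheaf.map (homOfLE i).op t) =
        X.presheaf.map (homOfLE (q.preimage_mono i)).op (q.app O t) :=
    fun i t => congr($(q.naturality (homOfLE i).op) t)
  have hI : ∀ O, Function.Injective (q.app O) := by
    intro O t t' htt
    refine TopCat.Sheaf.eq_of_locally_eq' B.sheaf (fun i : {i // W i ≤ O} => W i.1) O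
      (fun i => homOfLE i.2) ?_ _ _ ?_
    · intro b hb
      obtain ⟨i, hi, hi'⟩ := hW O b hb
      exact TopologicalSpace.Opens.mem_iSup.mpr ⟨⟨i, hi'⟩, hi⟩
    · rintro ⟨i, hi⟩
      refine hinj i ((hnat hi t).trans (Eq.trans ?_ (hnat hi t').symm))
      rw [htt]
  refine ⟨hI O, fun s hs => ?_⟩
  have ht : ∀ i : {i // W i ≤ O}, ∃ t, q.app (W i.1) t =
      X.presheaf.map (homOfLE (q.preimage_mono i.2)).op s :=
    fun i => hsec i.1 _ (map_mem_invariantSubring (hinv O) _ hs)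
  choose t ht using ht
  obtain ⟨t', ht', -⟩ := TopCat.Sheaf.existsUnique_gluing' B.sheaf (fun i : {i // W i ≤ O} => W i.1)
    O (fun i => homOfLE i.2) (by
      intro b hb
      obtain ⟨i, hi, hi'⟩ := hW O b hb
      exact TopologicalSpace.Opens.mem_iSup.mpr ⟨⟨i, hi'⟩, hi⟩) t (by
      intro i j
      refine hI (W i.1 ⊓ W j.1) ?_
      refine (hnat inf_le_left (t i)).trans (Eq.trans ?_ (hnat inf_le_right (t j)).symm)
      rw [ht, ht]
      have c1 := X.presheaf.map_comp (homOfLE (q.preimage_mono i.2)).op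
        (homOfLE (q.preimage_mono (inf_le_left : W i.1 ⊓ W j.1 ≤ W i.1))).op
      have c2 := X.presheaf.map_comp (homOfLE (q.preimage_mono j.2)).op
        (homOfLE (q.preimage_mono (inf_le_right : W i.1 ⊓ W j.1 ≤ W j.1))).op
      exact congr($(c1.symm.trans c2) s))
  refine ⟨t', ?_⟩
  refine TopCat.Sheaf.eq_of_locally_eq' X.sheaf (fun i : {i // W i ≤ O} => q ⁻¹ᵁ W i.1) (q ⁻¹ᵁ O)
    (fun i => homOfLE (q.preimage_mono i.2)) ?_ _ _ ?_
  · intro x hx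
    obtain ⟨i, hi, hi'⟩ := hW O (q x) hx
    exact TopologicalSpace.Opens.mem_iSup.mpr ⟨⟨i, hi'⟩, hi⟩
  · rintro i
    refine (hnat i.2 t').symm.trans (Eq.trans ?_ (ht i))
    exact congrArg _ (ht' i)

lemma IsChartFamily.sections (h : IsChartFamily ρ 𝒥) (O : h.quotient.Opens) :
    Function.Injective (h.quotientMap.app O) ∧
      ∀ s ∈ invariantSubring ρ (h.quotientMap ⁻¹ᵁ O), ∃ t, h.quotientMap.app O t = s := by
  -- `V` is kept as a variable because the preimage of the image of a chart equals `U.1` only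
  -- propositionally.
  have key : ∀ (U : 𝒥) (V : X.Opens) (_ : V = U.1)
      (e : V ≤ h.quotientMap ⁻¹ᵁ (h.chartι U).opensRange),
      Function.Injective (h.quotientMap.appLE (h.chartι U).opensRange V e) ∧
      ∀ s ∈ invariantSubring ρ V, ∃ t, h.quotientMap.appLE (h.chartι U).opensRange V e t = s := by
    rintro U _ rfl e
    exact h.chart_appLE U e
  have hk := fun U => key U _ (h.preimage_opensRange U) le_rfl
  simp only [Scheme.Hom.appLE_eq_app] at hk
  exact sections_of_basis h.quotientMap h.actHom_quotientMap (fun U => (h.chartι U).opensRange)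
    h.exists_chart_subset (fun U => (hk U).1) (fun U => (hk U).2) O

end Sections

/-! ### Universal property of the glued quotient -/

section Universal

/-- Surjectivity determines the maps on points and injectivity on functions determines the maps of
sheaves. Most of the work is transport between the preimages under `a` and `b`, which are equal only
after the first step. -/
lemma eq_of_comp_eq {X Y T : Scheme.{0}} (p : X ⟶ Y) (hs : Function.Surjective p)
    (hi : ∀ U : Y.Opens, Function.Injective (p.app U)) {a b : Y ⟶ T} (h : p ≫ a = p ≫ b) :
    a = b := by
  have hbase : a.base = b.base := by
    ext y
    obtain ⟨x, rfl⟩ := hs y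
    exact congr($h x)
  refine Scheme.Hom.ext hbase fun U => ?_
  ext s
  apply hi
  have h1 := Scheme.Hom.congr_app h U
  rw [Scheme.Hom.comp_app, Scheme.Hom.comp_app] at h1
  have h2 := congr($h1 s)
  have h3 : b ⁻¹ᵁ U = a ⁻¹ᵁ U := by
    ext y
    change b y ∈ U ↔ a y ∈ U
    rw [show b y = a y from congr($hbase.symm y)]
  have key : ∀ (V W : Y.Opens) (e : V = W) (i : V ⟶ W) (j : p ⁻¹ᵁ V ⟶ p ⁻¹ᵁ W) (t : Γ(Y, W)),
      p.app V (Y.presheaf.map i.op t) = X.presheaf.map j.op (p.app W t) := by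
    intro V W e i j t
    exact congr($(p.naturality i.op) t)
  refine (key _ _ h3 _ (eqToHom (by rw [h3])) (a.app U s)).trans ?_
  have h4 := congrArg (X.presheaf.map (eqToHom (show p ⁻¹ᵁ b ⁻¹ᵁ U = p ⁻¹ᵁ a ⁻¹ᵁ U by rw [h3])).op) h2
  refine h4.trans ?_
  have hid : ∀ {W W' : X.Opens} (i : W ⟶ W') (j : W' ⟶ W) (t : Γ(X, W)),
      X.presheaf.map i.op (X.presheaf.map j.op t) = t := by
    intro W W' i j t
    have e := X.presheaf.map_comp j.op i.op
    rw [show j.op ≫ i.op = 𝟙 (Opposite.op W) from Subsingleton.elim _ _, X.presheaf.map_id] at e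
    exact congr($e.symm t)
  exact hid _ _ _

lemma isSchemeTheoreticallyDominant_SpecMap {R S : CommRingCat.{0}} (f : R ⟶ S)
    (hf : Function.Injective f) : IsSchemeTheoreticallyDominant (Spec.map f) := by
  rw [isSchemeTheoreticallyDominant_iff]
  refine Scheme.IdealSheafData.ext_of_isAffine ?_
  rw [Scheme.Hom.ker_apply]
  refine ((RingHom.injective_iff_ker_eq_bot _).mp ?_).trans (by simp)
  have h := Scheme.ΓSpecIso_naturality f
  have h' : (Spec.map f).appTop = (Scheme.ΓSpecIso R).hom ≫ f ≫ (Scheme.ΓSpecIso S).inv := by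
    rw [← Category.assoc, ← h, Category.assoc, Iso.hom_inv_id, Category.comp_id]
  change Function.Injective (Spec.map f).appTop
  rw [h']
  exact ((ConcreteCategory.bijective_of_isIso (Scheme.ΓSpecIso S).inv).1.comp hf).comp
    (ConcreteCategory.bijective_of_isIso (Scheme.ΓSpecIso R).hom).1

variable {X : Scheme.{0}} {G : Type} [Group G] {ρ : G →* End X} {𝒥 : Set X.Opens}

/-- Functions pulled back along an invariant morphism are invariant, so the ring map given by `φ`
lands in the invariants. -/
lemma exists_chart_desc {T : Scheme.{0}} (φ : X ⟶ T) (hφ : ∀ g, actHom ρ g ≫ φ = φ) {U : X.Opens}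
    {T' : T.Opens} (hT' : IsAffineOpen T') (hU : U ≤ φ ⁻¹ᵁ T') :
    ∃ ψ : invariantChart ρ U ⟶ T, invariantChartπ ρ U ≫ ψ = U.ι ≫ φ := by
  have hinv : ∀ s, φ.appLE T' U hU s ∈ invariantSubring ρ U := by
    intro s g hg
    have e := Scheme.Hom.appLE_comp_appLE (actHom ρ g) φ T' U U hU hg
    exact congr($e s).trans (appLE_eq_of_eq (hφ g) _ _ s)
  refine ⟨Spec.map (CommRingCat.ofHom ((φ.appLE T' U hU).hom.codRestrict _ hinv)) ≫ hT'.fromSpec, ?_⟩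
  have e : CommRingCat.ofHom ((φ.appLE T' U hU).hom.codRestrict _ hinv) ≫
    CommRingCat.ofHom (invariantSubring ρ U).subtype = φ.appLE T' U hU := rfl
  rw [invariantChartπ, Category.assoc, ← Spec.map_comp_assoc, e, ← Category.assoc,
    Scheme.Opens.toSpecΓ_SpecMap_appLE, Category.assoc, IsAffineOpen.toSpecΓ_fromSpec,
    Scheme.Hom.resLE_comp_ι]

variable [Finite G]

lemma invariantChartπ_hom_ext {U : X.Opens} (hU : IsInvariantOpen ρ U) (hUa : IsAffineOpen U)
    {T : Scheme.{0}} {a b : invariantChart ρ U ⟶ T}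
    (h : invariantChartπ ρ U ≫ a = invariantChartπ ρ U ≫ b) : a = b := by
  refine eq_of_comp_eq (invariantChartπ ρ U) (surjective_invariantChartπ hU hUa) (fun V => ?_) h
  have := isSchemeTheoreticallyDominant_SpecMap
    (CommRingCat.ofHom (invariantSubring ρ U).subtype) Subtype.val_injective
  have : IsIso U.toSpecΓ := (inferInstance : IsIso hUa.isoSpec.hom)
  have h1 : IsSchemeTheoreticallyDominant (invariantChartπ ρ U) := by
    unfold invariantChartπ
    infer_instance
  have h2 := isIntegralHom_invariantChartπ hU hUa
  exact Scheme.Hom.app_injective _ V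

namespace IsChartFamily

variable (h : IsChartFamily ρ 𝒥)

lemma hom_ext {T : Scheme.{0}} {a b : h.quotient ⟶ T}
    (hab : h.quotientMap ≫ a = h.quotientMap ≫ b) : a = b :=
  eq_of_comp_eq h.quotientMap h.surjective_quotientMap (fun O => (h.sections O).1) hab

/-- `T` need not be affine. The hypothesis `hT` reduces each chart to an affine target, and the maps
from the charts are compatible by uniqueness. -/
lemma exists_desc {T : Scheme.{0}} (φ : X ⟶ T) (hφ : ∀ g, actHom ρ g ≫ φ = φ)
    (hT : ∀ U ∈ 𝒥, ∃ T' : T.Opens, IsAffineOpen T' ∧ U ≤ φ ⁻¹ᵁ T') :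
    ∃ ψ : h.quotient ⟶ T, h.quotientMap ≫ ψ = φ := by
  have key : ∀ U : 𝒥, ∃ ψ : invariantChart ρ U.1 ⟶ T, invariantChartπ ρ U.1 ≫ ψ = U.1.ι ≫ φ := by
    intro U
    obtain ⟨T', hT', hU⟩ := hT U.1 U.2
    exact exists_chart_desc φ hφ hT' hU
  choose ψ hψ using key
  have hnat : ∀ {V U : 𝒥} (i : V.1 ≤ U.1),
      invariantChartMap (h.invariant U.1 U.2) i ≫ ψ U = ψ V := by
    intro V U i
    refine invariantChartπ_hom_ext (h.invariant V.1 V.2) (h.affine V.1 V.2) ?_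
    rw [← Category.assoc, invariantChartπ_map, Category.assoc, hψ, hψ, Scheme.homOfLE_ι_assoc]
  let c : Cocone h.functor :=
    Cocone.mk T
      { app := ψ
        naturality := fun V U i => (hnat (leOfHom i)).trans (Category.comp_id _).symm }
  have hc : ∀ U : 𝒥, h.chartι U ≫ colimit.desc h.functor c = ψ U := fun U => colimit.ι_desc c U
  obtain ⟨d, hd⟩ : ∃ d : h.quotient ⟶ T, ∀ U : 𝒥, h.chartι U ≫ d = ψ U := ⟨_, hc⟩
  refine ⟨d, h.sourceCover.hom_ext _ _ fun U => ?_⟩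
  change 𝒥 at U
  have e : U.1.ι ≫ h.quotientMap ≫ d = U.1.ι ≫ φ := by
    rw [← Category.assoc, h.ι_quotientMap, ← hψ, Category.assoc, hd]
  exact e

lemma isIntegralHom_quotientMap : IsIntegralHom h.quotientMap := by
  have hloc : IsZariskiLocalAtTarget (@IsIntegralHom : MorphismProperty Scheme.{0}) :=
    (HasAffineProperty.iff.mp IsIntegralHom.hasAffineProperty).1
  refine IsZariskiLocalAtTarget.of_openCover (P := (@IsIntegralHom : MorphismProperty Scheme.{0})) h.chartCover fun U => ?_
  change 𝒥 at U
  have h1 := isIntegralHom_invariantChartπ (h.invariant U.1 U.2) (h.affine U.1 U.2)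
  have e := (h.isPullback_chart U).flip
  change IsIntegralHom (pullback.snd h.quotientMap (h.chartι U))
  rw [← e.isoPullback_inv_snd]
  infer_instance

end IsChartFamily

end Universal

/-! ### Existence of quotients by finite groups -/

section QuotientExistence

/-- Every finite set of points lies in an affine open subset. -/
def HasAffineNeighborhoods (X : Scheme.{0}) : Prop :=
  ∀ s : Set X, s.Finite → ∃ U : X.Opens, IsAffineOpen U ∧ s ⊆ U

/-- Prime avoidance: on an affine neighbourhood `U` of `s`, some function vanishes on the part
outside `O` but at no point of `s`, and its basic open subset is the required one. -/
lemma HasAffineNeighborhoods.exists_le {X : Scheme.{0}} (hX : HasAffineNeighborhoods X) {s : Set X}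
    (hs : s.Finite) {O : X.Opens} (hsO : s ⊆ O) :
    ∃ U : X.Opens, IsAffineOpen U ∧ s ⊆ U ∧ U ≤ O := by
  obtain ⟨U, hU, hsU⟩ := hX s hs
  let Z : Set (PrimeSpectrum Γ(X, U)) := {p | hU.fromSpec p ∉ O}
  have hZ : IsClosed Z := 
    (hU.fromSpec ⁻¹ᵁ O).isOpen.isClosed_compl
  let P : Set (PrimeSpectrum Γ(X, U)) := hU.fromSpec ⁻¹' s
  have hP : P.Finite := hs.preimage hU.fromSpec.isOpenEmbedding.injective.injOn
  have hPrime : ∀ p : PrimeSpectrum Γ(X, U), p.asIdeal.IsPrime := fun p => p.isPrime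
  have hnot : ¬ ((PrimeSpectrum.vanishingIdeal Z : Set Γ(X, U)) ⊆ ⋃ p ∈ P, (p.asIdeal : Set Γ(X, U))) := by
    intro hsub
    by_cases hne : P.Nonempty
    · obtain ⟨a, -⟩ := hne
      obtain ⟨p, hp, hle⟩ := (Ideal.subset_union_prime_finite hP a a
        (fun p _ _ _ => hPrime p)).mp hsub
      have h1 : p ∈ PrimeSpectrum.zeroLocus (PrimeSpectrum.vanishingIdeal Z : Set Γ(X, U)) := hle
      rw [PrimeSpectrum.zeroLocus_vanishingIdeal_eq_closure, hZ.closure_eq] at h1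
      exact h1 (hsO hp)
    · obtain ⟨p, hp, -⟩ := Set.mem_iUnion₂.mp (hsub (show (0 : Γ(X, U)) ∈ _ from zero_mem _))
      exact hne ⟨p, hp⟩
  obtain ⟨f, hf, hfP⟩ := Set.not_subset.mp hnot
  have hD : ∀ p : PrimeSpectrum Γ(X, U), hU.fromSpec p ∈ X.basicOpen f ↔ f ∉ p.asIdeal := by
    intro p
    have h1 : p ∈ hU.fromSpec ⁻¹ᵁ X.basicOpen f ↔ p ∈ PrimeSpectrum.basicOpen f := by
      rw [hU.fromSpec_preimage_basicOpen f]
      exact Iff.rfl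
    exact h1
  refine ⟨X.basicOpen f, hU.basicOpen f, fun x hx => ?_, fun x hx => ?_⟩
  · have e := hU.fromSpec_primeIdealOf ⟨x, hsU hx⟩
    change hU.fromSpec (hU.primeIdealOf ⟨x, hsU hx⟩) = x at e
    rw [← e]
    refine (hD _).mpr fun hmem => hfP (Set.mem_iUnion₂.mpr ⟨_, ?_, hmem⟩)
    change hU.fromSpec _ ∈ s
    rwa [e]
  · have hxU := X.basicOpen_le f hx
    have e := hU.fromSpec_primeIdealOf ⟨x, hxU⟩
    change hU.fromSpec (hU.primeIdealOf ⟨x, hxU⟩) = x at e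
    rw [← e] at hx ⊢
    by_contra hmem
    exact (hD _).mp hx ((PrimeSpectrum.mem_vanishingIdeal _ _).mp hf _ hmem)

/-- The Artin–Tate lemma: `S` is integral and of finite type over `R`, hence finite. -/
lemma finiteType_of_isIntegral {C R S : Type} [CommRing C] [CommRing R] [CommRing S]
    [IsNoetherianRing C] (f : C →+* R) (i : R →+* S) (hi : Function.Injective i)
    (hint : i.IsIntegral) (hft : (i.comp f).FiniteType) : f.FiniteType := by
  algebraize [f, i, i.comp f]
  have h1 : Algebra.FiniteType R S := Algebra.FiniteType.of_restrictScalars_finiteType C R S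
  have h2 : Module.Finite R S := Algebra.IsIntegral.finite
  exact ⟨fg_of_fg_of_fg C R S (Algebra.FiniteType.out) (Module.Finite.fg_top) hi⟩

/-- The diagonal of `B` is the image of the diagonal of `X` under the map of fibre products induced
by `q`, which is closed. -/
lemma isSeparated_of_surjective {X B S : Scheme.{0}} (q : X ⟶ B) (s : B ⟶ S) [Surjective q]
    [UniversallyClosed q] [IsSeparated (q ≫ s)] : IsSeparated s := by
  obtain ⟨m, hm, h1, h2⟩ : ∃ m : pullback (q ≫ s) (q ≫ s) ⟶ pullback s s, UniversallyClosed m ∧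
      m ≫ pullback.fst s s = pullback.fst (q ≫ s) (q ≫ s) ≫ q ∧
      m ≫ pullback.snd s s = pullback.snd (q ≫ s) (q ≫ s) ≫ q :=
    ⟨_, MorphismProperty.pullbackMap (P := @UniversallyClosed) ‹_› ‹_› rfl rfl,
      pullback.lift_fst _ _ _, pullback.lift_snd _ _ _⟩
  have e : q ≫ pullback.diagonal s = pullback.diagonal (q ≫ s) ≫ m := by
    apply pullback.hom_ext
    · rw [Category.assoc, Category.assoc, h1, pullback.diagonal_fst, Category.comp_id,
        pullback.diagonal_fst_assoc]
    · rw [Category.assoc, Category.assoc, h2, pullback.diagonal_snd, Category.comp_id,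
        pullback.diagonal_snd_assoc]
  refine ⟨IsClosedImmersion.of_isPreimmersion _ ?_⟩
  have hr : Set.range (pullback.diagonal s) =
      m '' Set.range (pullback.diagonal (q ≫ s)) := by
    rw [← Set.range_comp]
    have e' := congrArg (fun f : X ⟶ pullback s s => Set.range f) e
    refine Eq.trans ?_ e'
    change _ = Set.range ((q ≫ pullback.diagonal s) : X ⟶ _)
    ext y
    constructor
    · rintro ⟨b, rfl⟩
      obtain ⟨x, rfl⟩ := q.surjective b
      exact ⟨x, rfl⟩
    · rintro ⟨x, rfl⟩
      exact ⟨q x, rfl⟩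
  rw [hr]
  exact Scheme.Hom.isClosedMap _ _ (pullback.diagonal (q ≫ s)).isClosedEmbedding.isClosed_range

variable {X : Scheme.{0}} {G : Type} [Group G] [Finite G] {ρ : G →* End X} {𝒥 : Set X.Opens}

lemma IsChartFamily.locallyOfFiniteType (h : IsChartFamily ρ 𝒥) {s : h.quotient ⟶ SpecC}
    (hs : LocallyOfFiniteType (h.quotientMap ≫ s)) : LocallyOfFiniteType s := by
  have hloc : IsZariskiLocalAtSource (@LocallyOfFiniteType : MorphismProperty Scheme.{0}) :=
    HasRingHomProperty.instIsZariskiLocalAtSource (Q := @RingHom.FiniteType)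
  rw [IsZariskiLocalAtSource.iff_of_openCover
    (P := (@LocallyOfFiniteType : MorphismProperty Scheme.{0})) h.chartCover]
  intro U
  change 𝒥 at U
  change LocallyOfFiniteType (h.chartι U ≫ s)
  obtain ⟨f, hf⟩ := Spec.map_surjective (h.chartι U ≫ s)
  rw [← hf, HasRingHomProperty.Spec_iff (P := @LocallyOfFiniteType)]
  refine finiteType_of_isIntegral _ (invariantSubring ρ U.1).subtype Subtype.val_injective
    (isIntegral_invariantSubring (h.invariant U.1 U.2)).isIntegral ?_
  have h1 : LocallyOfFiniteType (Spec.map (f ≫ CommRingCat.ofHom (invariantSubring ρ U.1).subtype)) := by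
    have : IsIso U.1.toSpecΓ := (inferInstance : IsIso (h.affine U.1 U.2).isoSpec.hom)
    have e : Spec.map (f ≫ CommRingCat.ofHom (invariantSubring ρ U.1).subtype) =
        inv U.1.toSpecΓ ≫ U.1.ι ≫ h.quotientMap ≫ s := by
      rw [← Category.assoc U.1.ι, h.ι_quotientMap, Category.assoc, ← hf, invariantChartπ,
        Category.assoc, IsIso.inv_hom_id_assoc, Spec.map_comp]
    rw [e]
    infer_instance
  rw [HasRingHomProperty.Spec_iff (P := @LocallyOfFiniteType)] at h1
  exact h1

/-- A finite orbit has an affine neighbourhood mapping into an affine open subset of `T`. The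
intersection of its translates is stable, and it is affine because `X` is separated. The charts are
made subordinate to affine open subsets of `T` so that `φ` descends. -/
lemma exists_isChartFamily [X.IsSeparated] (hX : HasAffineNeighborhoods X) {T : Scheme.{0}}
    (φ : X ⟶ T) (hφ : ∀ g, actHom ρ g ≫ φ = φ) :
    IsChartFamily ρ {U | IsInvariantOpen ρ U ∧ IsAffineOpen U ∧
      ∃ T' : T.Opens, IsAffineOpen T' ∧ U ≤ φ ⁻¹ᵁ T'} where
  invariant U hU := hU.1
  affine U hU := hU.2.1
  inf := by
    rintro U ⟨h1, h2, T', hT', hU⟩ V ⟨h3, h4, -⟩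
    exact ⟨fun g x hx => ⟨h1 g hx.1, h3 g hx.2⟩, h2.inf h4, T', hT', inf_le_left.trans hU⟩
  basicOpen := by
    rintro U ⟨h1, h2, T', hT', hU⟩ f
    refine ⟨fun g => ?_, h2.basicOpen _, T', hT', (X.basicOpen_le _).trans hU⟩
    have e := f.2 g (h1 g)
    have e2 := Scheme.basicOpen_appLE (actHom ρ g) U U (h1 g) f.1
    intro x hx
    have hx' : x ∈ X.basicOpen ((actHom ρ g).appLE U U (h1 g) f.1) := by
      rw [e]; exact hx
    rw [e2] at hx'
    exact hx'.2
  cover := by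
    intro x
    obtain ⟨T', hT', hxT', -⟩ := exists_isAffineOpen_mem_and_subset (x := φ x) (U := ⊤) trivial
    have horb : ∀ g, φ (actHom ρ g x) = φ x := fun g => congr($(hφ g) x)
    obtain ⟨V, hV, hsV, hVO⟩ := hX.exists_le (s := Set.range fun g => actHom ρ g x)
      (Set.finite_range _) (O := φ ⁻¹ᵁ T') (by
        rintro _ ⟨g, rfl⟩
        change φ (actHom ρ g x) ∈ T'
        rw [horb]
        exact hxT')
    have hV' : ∀ g, IsAffineOpen (actHom ρ g ⁻¹ᵁ V) := fun g =>
      haveI := isIso_end (ρ := ρ) g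
      hV.preimage_of_isIso _
    have := Fintype.ofFinite G
    have hfin : ∀ s : Finset G, IsAffineOpen (V ⊓ s.inf fun g => actHom ρ g ⁻¹ᵁ V) := by
      classical
      intro s
      induction s using Finset.induction_on with
      | empty => simpa using hV
      | insert a s ha ih =>
        rw [Finset.inf_insert, inf_left_comm]
        exact (hV' a).inf ih
    have hmem : ∀ y, y ∈ V ⊓ Finset.univ.inf (fun g => actHom ρ g ⁻¹ᵁ V) ↔
        ∀ g, actHom ρ g y ∈ V := by
      intro y
      have h0 : y ∈ Finset.univ.inf (fun g => actHom ρ g ⁻¹ᵁ V) ↔ ∀ g, actHom ρ g y ∈ V := by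
        rw [← SetLike.mem_coe, TopologicalSpace.Opens.coe_finset_inf]
        simp
      constructor
      · exact fun hy => h0.mp hy.2
      · intro hy
        refine ⟨?_, h0.mpr hy⟩
        have := hy 1
        rwa [end_hom_one] at this
    refine ⟨V ⊓ Finset.univ.inf fun g => actHom ρ g ⁻¹ᵁ V, ⟨fun g y hy => ?_, hfin _, T', hT',
      inf_le_left.trans hVO⟩, (hmem x).mpr fun g => hsV ⟨g, rfl⟩⟩
    refine (hmem _).mpr fun k => ?_
    have := (hmem y).mp hy (k * g)
    rwa [end_hom_mul] at this

/-- One chart family, adapted to `φ`, is used to descend both `φ` and the structure morphism to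
`Spec ℂ`; the latter needs no refinement because its target is affine. -/
lemma exists_geometricQuotient {X T : Over SpecC} [IsVariety X] (hX : HasAffineNeighborhoods X.left)
    (ρ : G →* End X) (φ : X ⟶ T) (hφ : ∀ g, (ρ g : X ⟶ X) ≫ φ = φ) :
    ∃ (B : Over SpecC) (q : X ⟶ B) (ψ : B ⟶ T), IsVariety B ∧ IsGeometricQuotient ρ q ∧
      q ≫ ψ = φ := by
  let ρ' : G →* End X.left := ((Over.forget _).mapEnd X).comp ρ
  have hρ : ∀ g, actHom ρ' g = (ρ g : X ⟶ X).left := fun g => rfl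
  have hφ' : ∀ g, actHom ρ' g ≫ φ.left = φ.left := fun g => by
    rw [hρ, ← Over.comp_left, hφ]
  have hsep : X.left.IsSeparated := by
    rw [Scheme.isSeparated_iff, show terminal.from X.left = X.hom ≫ terminal.from SpecC from
      terminal.hom_ext _ _]
    infer_instance
  have hc := exists_isChartFamily hX φ.left hφ'
  have hX' : ∀ g, actHom ρ' g ≫ X.hom = X.hom := fun g => Over.w (ρ g : X ⟶ X)
  obtain ⟨s, hs⟩ := hc.exists_desc X.hom hX' fun U hU => ⟨⊤, isAffineOpen_top _, le_top⟩
  obtain ⟨ψ, hψ⟩ := hc.exists_desc φ.left hφ' fun U hU => hU.2.2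
  have hint := hc.isIntegralHom_quotientMap
  have hsurj : Surjective hc.quotientMap := ⟨hc.surjective_quotientMap⟩
  have hlft : LocallyOfFiniteType s := hc.locallyOfFiniteType (by rw [hs]; infer_instance)
  have hcomp : CompactSpace hc.quotient := by
    rw [← isCompact_univ_iff, ← hc.surjective_quotientMap.range_eq]
    exact isCompact_range hc.quotientMap.continuous
  have hsepq : IsSeparated s := by
    have : IsSeparated (hc.quotientMap ≫ s) := by rw [hs]; infer_instance
    exact isSeparated_of_surjective hc.quotientMap s
  have hqft : LocallyOfFiniteType hc.quotientMap := by
    have : LocallyOfFiniteType (hc.quotientMap ≫ s) := by rw [hs]; infer_instance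
    exact locallyOfFiniteType_of_comp _ s
  refine ⟨Over.mk s, Over.homMk hc.quotientMap hs, Over.homMk ψ ?_, ⟨hlft, ?_, hsepq⟩,
    ⟨fun g => ?_, ?_, hsurj, ?_, ?_, ?_⟩, ?_⟩
  · refine hc.hom_ext ?_
    rw [← Category.assoc, hψ, Over.w]
    exact hs.symm
  · change QuasiCompact s
    infer_instance
  · ext1
    exact hc.actHom_quotientMap g
  · exact (IsFinite.iff_isIntegralHom_and_locallyOfFiniteType _).mpr ⟨hint, hqft⟩
  · exact fun x y hxy => hc.exists_eq_of_quotientMap_eq x y hxy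
  · exact fun U => (hc.sections U).1
  · exact fun U s hs => (hc.sections U).2 s hs
  · ext1
    exact hψ

end QuotientExistence

/-! ### Existence of configuration spaces -/

section FiniteProducts

/-- Applied to being a variety and to having affine neighbourhoods of finite sets. -/
lemma prop_piObj {P : Over SpecC → Prop} (hiso : ∀ {X Y : Over SpecC}, (X ≅ Y) → P X → P Y)
    (hone : P (𝟙_ (Over SpecC))) (htensor : ∀ {X Y : Over SpecC}, P X → P Y → P (X ⊗ Y))
    {κ : Type} [Finite κ] (F : κ → Over SpecC) (hF : ∀ k, P (F k)) : P (∏ᶜ F) := by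
  have := Fintype.ofFinite κ
  refine Fintype.induction_empty_option
    (P := fun α _ => ∀ F : α → Over SpecC, (∀ k, P (F k)) → P (∏ᶜ F)) ?_ ?_ ?_ κ F hF
  · intro α β _ e ih F hF
    have : Finite α := Finite.of_equiv β e.symm
    exact hiso (Pi.reindex e F) (ih _ fun k => hF (e k))
  · intro F _
    exact hiso ⟨Pi.lift fun k => k.elim, toUnit _, toUnit_unique _ _, Pi.hom_ext _ _ fun k => k.elim⟩
      hone
  · intro α _ ih F hF
    refine hiso ⟨Pi.lift fun k => match k with
      | none => fst (F none) (∏ᶜ fun a => F (some a))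
      | some a => snd (F none) (∏ᶜ fun a => F (some a)) ≫ Pi.π (fun a => F (some a)) a,
      lift (Pi.π F none) (Pi.lift fun a => Pi.π F (some a)), ?_, ?_⟩
      (htensor (hF none) (ih (fun a => F (some a)) fun a => hF (some a)))
    · apply CartesianMonoidalCategory.hom_ext
      · simp
      · refine Pi.hom_ext _ _ fun a => ?_
        simp
    · refine Pi.hom_ext _ _ fun k => ?_
      cases k <;> simp

lemma isIso_left {X Y : Over SpecC} (f : X ⟶ Y) [IsIso f] : IsIso f.left :=
  inferInstanceAs (IsIso ((Over.forget _).map f))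

lemma IsVariety.of_iso {X Y : Over SpecC} (_ : IsVariety X) (e : X ≅ Y) : IsVariety Y :=
  haveI := isIso_left e.inv
  .of_hom e.inv

instance : IsVariety (𝟙_ (Over SpecC)) where
  locallyOfFiniteType := inferInstanceAs (LocallyOfFiniteType (𝟙 SpecC))
  quasiCompact := inferInstanceAs (QuasiCompact (𝟙 SpecC))
  isSeparated := inferInstanceAs (IsSeparated (𝟙 SpecC))

instance {κ : Type} [Finite κ] (F : κ → Over SpecC) [hF : ∀ k, IsVariety (F k)] : IsVariety (∏ᶜ F) :=
  prop_piObj (P := IsVariety) (fun e h => h.of_iso e) inferInstance (fun _ _ => inferInstance) F hF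

lemma HasAffineNeighborhoods.of_isOpenImmersion {X Y : Scheme.{0}} (f : X ⟶ Y) [IsOpenImmersion f]
    (hY : HasAffineNeighborhoods Y) : HasAffineNeighborhoods X := by
  intro s hs
  obtain ⟨U, hU, hsU, hUO⟩ := hY.exists_le (hs.image f) (O := f.opensRange) (by
    rintro _ ⟨x, -, rfl⟩
    exact ⟨x, rfl⟩)
  exact ⟨f ⁻¹ᵁ U, hU.preimage_of_isOpenImmersion f hUO, fun x hx => hsU ⟨x, hx, rfl⟩⟩

lemma HasAffineNeighborhoods.of_isAffine (X : Scheme.{0}) [IsAffine X] : HasAffineNeighborhoods X :=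
  fun _ _ => ⟨⊤, isAffineOpen_top X, fun _ _ => trivial⟩

/-- The product of affine neighbourhoods of the two projections of the finite set is affine. -/
lemma HasAffineNeighborhoods.tensorObj {X Y : Over SpecC} (hX : HasAffineNeighborhoods X.left)
    (hY : HasAffineNeighborhoods Y.left) : HasAffineNeighborhoods (X ⊗ Y).left := by
  intro s hs
  obtain ⟨U, hU, hsU⟩ := hX _ (hs.image (pullback.fst X.hom Y.hom))
  obtain ⟨V, hV, hsV⟩ := hY _ (hs.image (pullback.snd X.hom Y.hom))
  let m : pullback (U.ι ≫ X.hom) (V.ι ≫ Y.hom) ⟶ pullback X.hom Y.hom :=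
    pullback.map _ _ X.hom Y.hom U.ι V.ι (𝟙 _) (by simp) (by simp)
  have hm : IsOpenImmersion m := inferInstance
  have : IsAffine U.toScheme := hU
  have : IsAffine V.toScheme := hV
  have hr : Set.range m = _ := Scheme.Pullback.range_map _ _ X.hom Y.hom U.ι V.ι (𝟙 _) _ _
  refine ⟨m.opensRange, isAffineOpen_opensRange m, fun z hz => ?_⟩
  change z ∈ Set.range m
  rw [hr, Scheme.Opens.range_ι, Scheme.Opens.range_ι]
  exact ⟨hsU ⟨z, hz, rfl⟩, hsV ⟨z, hz, rfl⟩⟩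

lemma HasAffineNeighborhoods.piObj {κ : Type} [Finite κ] (F : κ → Over SpecC)
    (hF : ∀ k, HasAffineNeighborhoods (F k).left) : HasAffineNeighborhoods (∏ᶜ F).left := by
  refine prop_piObj (P := fun X => HasAffineNeighborhoods X.left) (fun e h => ?_) ?_
    (fun h1 h2 => h1.tensorObj h2) F hF
  · have := isIso_left e.inv
    exact h.of_isOpenImmersion e.inv.left
  · have : IsAffine (𝟙_ (Over SpecC)).left := inferInstanceAs (IsAffine SpecC)
    exact .of_isAffine _

end FiniteProducts

/-! ### The group of part permutations and the ordered configurations -/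

section Existence

variable {n : ℕ} (α : n.Partition)

lemma le_of_part (p : α.parts) : p.1 ≤ n := by
  have h : p.1 ∈ α.parts := Multiset.count_pos.mp (Fin.pos p.2)
  have := Multiset.le_sum_of_mem h
  rwa [α.parts_sum] at this

/-- `PartPerm α` is a product over all natural numbers, but the factors beyond `n` are trivial since
no part exceeds `n`. -/
instance : Finite (PartPerm α) := by
  have hs : ∀ i, n < i → Subsingleton (Equiv.Perm (Fin (α.parts.count i))) := by
    intro i hi
    have h0 : IsEmpty (Fin (α.parts.count i)) := ⟨fun k => by
      have : i ≤ n := le_of_part α (α.parts.mkToType i k)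
      omega⟩
    infer_instance
  refine Finite.of_injective
    (fun (σ : PartPerm α) (i : Fin (n + 1)) => σ i) fun σ τ h => ?_
  funext i
  by_cases hi : i < n + 1
  · exact congrFun h ⟨i, hi⟩
  · have := hs i (by omega)
    exact Subsingleton.elim _ _

variable (M : Over SpecC) (A : ℕ → Over SpecC)

instance [IsVariety M] : IsVariety (powObj α M) := by unfold powObj; infer_instance

instance [∀ i, IsVariety (A i)] : IsVariety (stateObj α A) := by unfold stateObj; infer_instance

instance [IsSeparated M.hom] : IsOpenImmersion (confι α M).left :=
  inferInstanceAs (IsOpenImmersion (confOpen α M).ι)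

instance [IsVariety M] : IsVariety (confObj α M) := by
  exact IsVariety.of_hom (confι α M)

instance [IsVariety M] [∀ i, IsVariety (A i)] : IsVariety (orderedObj α M A) := by
  unfold orderedObj; infer_instance

lemma hasAffineNeighborhoods_orderedObj [IsSeparated M.hom] (hM : HasAffineNeighborhoods M.left)
    (hA : ∀ i, HasAffineNeighborhoods (A i).left) :
    HasAffineNeighborhoods (orderedObj α M A).left :=
  .tensorObj (.of_isOpenImmersion (confι α M).left (.piObj _ fun _ => hM)) (.piObj _ fun _ => hA _)

variable [IsSeparated M.hom]

variable {α} in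
lemma orderedAct_position (σ : PartPerm α) (p : α.parts) :
    (orderedAct α M A σ : orderedObj α M A ⟶ orderedObj α M A) ≫ position α M A p =
      position α M A (σ⁻¹.act p) := by
  change (permConf M σ ⊗ₘ permState A σ) ≫ fst _ _ ≫ confι α M ≫ powπ α M p = _
  rw [tensorHom_fst_assoc, ← Category.assoc (permConf M σ), permConf_ι, Category.assoc, permPow_π]
  rfl

variable {α} in
lemma orderedAct_internalState (σ : PartPerm α) (p : α.parts) :
    (orderedAct α M A σ : orderedObj α M A ⟶ orderedObj α M A) ≫ internalState α M A p =
      internalState α M A (σ⁻¹.act p) := by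
  change (permConf M σ ⊗ₘ permState A σ) ≫ snd _ _ ≫ stateπ α A p = _
  rw [tensorHom_snd_assoc, permState_π]
  rfl

end Existence

/-! ### Invariance of the total weight and existence of the `B_α` -/

section WeightInvariance

variable {𝔐 : Over SpecC} [MonObj 𝔐] [IsCommMonObj 𝔐]

/-- Composition with a morphism, as a homomorphism of monoids of morphisms to `𝔐`. -/
def precomp {X Y : Over SpecC} (f : X ⟶ Y) : (Y ⟶ 𝔐) →* (X ⟶ 𝔐) where
  toFun g := f ≫ g
  map_one' := MonObj.comp_one f
  map_mul' _ _ := MonObj.comp_mul f _ _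

lemma comp_prod {X Y : Over SpecC} (f : X ⟶ Y) {κ : Type*} (s : Finset κ) (g : κ → (Y ⟶ 𝔐)) :
    f ≫ ∏ k ∈ s, g k = ∏ k ∈ s, f ≫ g k :=
  map_prod (precomp f) g s

/-- The permutation of the parts given by an element of `S_α`. -/
def PartPerm.equiv {n : ℕ} {α : n.Partition} (σ : PartPerm α) : α.parts ≃ α.parts where
  toFun := σ.act
  invFun := σ⁻¹.act
  left_inv p := by rw [← act_mul, inv_mul_cancel, act_one]
  right_inv p := by rw [← act_mul, mul_inv_cancel, act_one]

lemma comp_totalWeight {n : ℕ} (α : n.Partition) (M : RelVar 𝔐) (A : ℕ → RelVar 𝔐) {V : Over SpecC}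
    (f : V ⟶ orderedObj α M.obj fun i => (A i).obj) :
    f ≫ totalWeight α M A =
      ∏ p : α.parts, ((f ≫ position α M.obj (fun i => (A i).obj) p) ≫ M.str) ^ p.1 *
        ((f ≫ internalState α M.obj (fun i => (A i).obj) p) ≫ (A p.1).str) := by
  rw [totalWeight, comp_prod]
  refine Finset.prod_congr rfl fun p _ => ?_
  rw [MonObj.comp_mul, MonObj.comp_pow, Category.assoc, Category.assoc]

lemma orderedAct_totalWeight {n : ℕ} (α : n.Partition) (M : RelVar 𝔐) (A : ℕ → RelVar 𝔐)
    (σ : PartPerm α) :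
    (orderedAct α M.obj (fun i => (A i).obj) σ : orderedObj α M.obj (fun i => (A i).obj) ⟶ _) ≫
      totalWeight α M A = totalWeight α M A := by
  rw [comp_totalWeight]
  refine Fintype.prod_equiv (σ⁻¹).equiv _ _ fun p => ?_
  rw [orderedAct_position, orderedAct_internalState]
  rfl

lemma exists_isConfigurationSpace (A : ℕ → RelVar 𝔐) (M : RelVar 𝔐)
    (hA : ∀ i, HasAffineNeighborhoods (A i).obj.left) (hM : HasAffineNeighborhoods M.obj.left)
    {n : ℕ} (α : n.Partition) : ∃ B : RelVar 𝔐, IsConfigurationSpace α M A B := by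
  obtain ⟨B, q, ψ, hB, hq, hψ⟩ := exists_geometricQuotient
    (hasAffineNeighborhoods_orderedObj α M.obj (fun i => (A i).obj) hM hA)
    (orderedAct α M.obj fun i => (A i).obj) (totalWeight α M A) (orderedAct_totalWeight α M A)
  exact ⟨⟨B, ψ, hB.1, hB.2, hB.3⟩, q, hq, hψ⟩

end WeightInvariance

/-! ### Geometric points of quotients -/

section QuotientPoints

/-- The polynomial `∏ (T - g • s)` has invariant coefficients, so its images under `v` and `w`
coincide and `w s = v (g • s)` for some `g` depending on `s`. For fixed `g` this holds on an
additive subgroup of `S`. Finitely many of these cover `S`, so one has finite index, and as `K` has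
characteristic zero one can divide by the index to get the equality everywhere. -/
lemma exists_eq_comp_smul {S K G : Type*} [CommRing S] [Field K] [CharZero K] [Group G] [Finite G]
    [MulSemiringAction G S] (v w : S →+* K) (h : ∀ s, (∀ g : G, g • s = s) → v s = w s) :
    ∃ g : G, ∀ s, w s = v (g • s) := by
  have := Fintype.ofFinite G
  have h1 : ∀ s, ∃ g : G, w s = v (g • s) := by
    intro s
    have e : (MulSemiringAction.charpoly G s).map v = (MulSemiringAction.charpoly G s).map w := by
      ext n
      rw [Polynomial.coeff_map, Polynomial.coeff_map]
      exact h _ fun g => MulSemiringAction.smul_coeff_charpoly s n g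
    have e' := congrArg (Polynomial.eval (w s)) e
    rw [MulSemiringAction.charpoly_eq, Polynomial.map_prod, Polynomial.map_prod,
      Polynomial.eval_prod, Polynomial.eval_prod] at e'
    replace e' := e'.trans (Finset.prod_eq_zero (Finset.mem_univ (1 : G)) (by simp))
    rw [Finset.prod_eq_zero_iff] at e'
    obtain ⟨g, -, hg⟩ := e'
    refine ⟨g, ?_⟩
    simpa [sub_eq_zero] using hg
  let H : G → AddSubgroup S := fun g =>
    (w.toAddMonoidHom - v.toAddMonoidHom.comp (DistribSMul.toAddMonoidHom S g)).ker
  have hH : ∀ g s, s ∈ H g ↔ w s = v (g • s) := fun g s => by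
    rw [AddMonoidHom.mem_ker, AddMonoidHom.sub_apply, sub_eq_zero]
    rfl
  obtain ⟨g, -, hg⟩ := AddSubgroup.exists_finiteIndex_of_leftCoset_cover (H := H) (g := fun _ => 0)
    (s := Finset.univ) (by
      refine Set.eq_univ_of_forall fun s => ?_
      obtain ⟨g, hg⟩ := h1 s
      simp only [Finset.mem_univ, Set.iUnion_true, Set.mem_iUnion]
      exact ⟨g, s, (hH g s).mpr hg, zero_add s⟩)
  refine ⟨g, fun s => ?_⟩
  have h2 := (hH g _).mp ((H g).nsmul_index_mem s)
  have h3 : g • ((H g).index • s) = (H g).index • (g • s) :=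
    map_nsmul (DistribSMul.toAddMonoidHom S g) _ _
  rw [h3, map_nsmul, map_nsmul] at h2
  exact smul_right_injective K hg.index_ne_zero h2

lemma hom_ext_of_appLE {Z X : Scheme.{0}} [IsAffine Z] {f g : Z ⟶ X} {U : X.Opens}
    (hU : IsAffineOpen U) (hf : ⊤ ≤ f ⁻¹ᵁ U) (hg : ⊤ ≤ g ⁻¹ᵁ U)
    (h : f.appLE U ⊤ hf = g.appLE U ⊤ hg) : f = g := by
  have e1 := IsAffineOpen.SpecMap_appLE_fromSpec f hU (isAffineOpen_top Z) hf
  have e2 := IsAffineOpen.SpecMap_appLE_fromSpec g hU (isAffineOpen_top Z) hg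
  rw [h, e2, IsAffineOpen.fromSpec_top] at e1
  exact ((cancel_epi _).mp e1).symm

/-- The common image lies in an affine open subset of `B`, whose preimage is affine because `q` is
finite. There both points are ring homomorphisms to `K` agreeing on the invariants, and
`exists_eq_comp_smul` applies. -/
lemma IsGeometricQuotient.exists_kpt_eq {G : Type} [Group G] [Finite G] {X B : Over SpecC}
    {ρ : G →* End X} {q : X ⟶ B} (hq : IsGeometricQuotient ρ q) {K : Type} [Field K] [Algebra ℂ K]
    (v w : KPt K X) (h : v ≫ q = w ≫ q) : ∃ g : G, v ≫ (ρ g : X ⟶ X) = w := by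
  let ρ' : G →* End X.left := ((Over.forget _).mapEnd X).comp ρ
  have := hq.finite
  have : CharZero K := charZero_of_injective_algebraMap (algebraMap ℂ K).injective
  obtain ⟨W, hW, hbW, -⟩ := exists_isAffineOpen_mem_and_subset
    (x := KPt.pt (v ≫ q : KPt K B)) (U := ⊤) trivial
  have hU : IsAffineOpen (q.left ⁻¹ᵁ W) := hW.preimage q.left
  have hinv : IsInvariantOpen ρ' (q.left ⁻¹ᵁ W) := by
    intro g x hx
    change q.left ((ρ g : X ⟶ X).left x) ∈ W
    have e := congr($(hq.invariant g).left x)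
    exact e.symm ▸ hx
  have hvU : ⊤ ≤ v.left ⁻¹ᵁ q.left ⁻¹ᵁ W := by
    intro z _
    change v.left z ∈ q.left ⁻¹ᵁ W
    rw [KPt.left_apply]
    exact hbW
  have hwU : ⊤ ≤ w.left ⁻¹ᵁ q.left ⁻¹ᵁ W := by
    intro z _
    change w.left z ∈ q.left ⁻¹ᵁ W
    rw [KPt.left_apply]
    rw [h] at hbW
    exact hbW
  let _ := invariantOpenAction hinv
  let j : Γ((SpecK K).left, ⊤) →+* K := (Scheme.ΓSpecIso (.of K)).hom.hom
  have hj : Function.Injective j :=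
    (ConcreteCategory.bijective_of_isIso (Scheme.ΓSpecIso (.of K)).hom).1
  obtain ⟨g, hg⟩ := exists_eq_comp_smul (G := G) (j.comp (v.left.appLE _ ⊤ hvU).hom)
    (j.comp (w.left.appLE _ ⊤ hwU).hom) (by
      intro s hs
      obtain ⟨t, rfl⟩ := hq.sections W s ((mem_invariantSubring_iff hinv s).mpr hs)
      refine congrArg j ?_
      have key : ∀ (u : KPt K X) (hu : ⊤ ≤ u.left ⁻¹ᵁ q.left ⁻¹ᵁ W),
          u.left.appLE _ ⊤ hu (q.left.app W t) = (u.left ≫ q.left).appLE W ⊤ hu t := by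
        intro u hu
        have e := Scheme.Hom.appLE_comp_appLE u.left q.left W (q.left ⁻¹ᵁ W) ⊤ le_rfl hu
        rw [Scheme.Hom.appLE_eq_app] at e
        exact congr($e t)
      exact (key v hvU).trans ((appLE_eq_of_eq congr($(h).left) _ _ t).trans (key w hwU).symm))
  have hvg : ⊤ ≤ (v ≫ (ρ g⁻¹ : X ⟶ X)).left ⁻¹ᵁ q.left ⁻¹ᵁ W := fun z hz => hinv g⁻¹ (hvU hz)
  -- Group elements act on functions by pullback along their inverse.
  refine ⟨g⁻¹, ?_⟩
  have : IsAffine (SpecK K).left := inferInstanceAs (IsAffine (Spec (.of K)))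
  ext1
  refine hom_ext_of_appLE hU hvg hwU ?_
  ext s
  refine hj (Eq.trans ?_ (hg s).symm)
  refine congrArg j ?_
  have e := Scheme.Hom.appLE_comp_appLE v.left (actHom ρ' g⁻¹) (q.left ⁻¹ᵁ W) (q.left ⁻¹ᵁ W) ⊤
    (hinv _) hvU
  exact congr($e s).symm

end QuotientPoints

/-! ### Points of configuration spaces -/

section ConfigurationPoints

variable {n : ℕ} (α : n.Partition) (M : Over SpecC) (A : ℕ → Over SpecC)

/-- Since `K` is algebraically closed, a `K`-point of `M × M` whose underlying point is on the
diagonal lifts to a `K`-point of the diagonal. -/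
lemma mem_largeDiagonal_iff [IsVariety M] {K : Type} [Field K] [Algebra ℂ K] [IsAlgClosed K]
    (v : KPt K (powObj α M)) :
    v.pt ∈ largeDiagonal α M ↔ ∃ p q : α.parts, p ≠ q ∧ v ≫ powπ α M p = v ≫ powπ α M q := by
  simp only [largeDiagonal, Set.mem_iUnion]
  refine exists_congr fun p => exists_congr fun q => ?_
  rw [exists_prop]
  refine and_congr_right fun _ => ⟨fun h => ?_, fun h => ?_⟩
  · obtain ⟨u, hu⟩ := KPt.exists_lift' (lift (𝟙 M) (𝟙 M)) (v ≫ lift (powπ α M p) (powπ α M q)) h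
    rw [comp_lift, comp_lift, Category.comp_id] at hu
    have h1 := congr($hu ≫ fst M M)
    have h2 := congr($hu ≫ snd M M)
    rw [lift_fst, lift_fst] at h1
    rw [lift_snd, lift_snd] at h2
    exact h1.symm.trans h2
  · have e : v ≫ lift (powπ α M p) (powπ α M q) = (v ≫ powπ α M p) ≫ lift (𝟙 M) (𝟙 M) := by
      rw [comp_lift, comp_lift, Category.comp_id, ← h]
    exact ⟨KPt.pt (K := K) (v ≫ powπ α M p), congr(KPt.pt (K := K) $e).symm⟩

/-- The variety of ordered configurations of distinct points of `M`, indexed by the parts of `α`,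
with internal states in varieties depending on the part. -/
abbrev confState [IsSeparated M.hom] (F : α.parts → Over SpecC) : Over SpecC := confObj α M ⊗ ∏ᶜ F

variable {M} in
/-- The morphism to a power of `M` with given coordinates. -/
def powLift {V : Over SpecC} (pos : α.parts → (V ⟶ M)) : V ⟶ powObj α M := Pi.lift pos

variable {α M} in
lemma powLift_π {V : Over SpecC} (pos : α.parts → (V ⟶ M)) (p : α.parts) :
    powLift α pos ≫ powπ α M p = pos p := Pi.lift_π _ _

variable [IsVariety M]

section

variable {α M} {F : α.parts → Over SpecC}

/-- The position of a particle. -/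
def confPos (p : α.parts) : confState α M F ⟶ M := fst _ _ ≫ confι α M ≫ powπ α M p

/-- The internal state of a particle. -/
def confSt (p : α.parts) : confState α M F ⟶ F p := snd _ _ ≫ Pi.π F p

lemma confState_hom_ext {T : Over SpecC} {f g : T ⟶ confState α M F}
    (h1 : ∀ p, f ≫ confPos p = g ≫ confPos p) (h2 : ∀ p, f ≫ confSt p = g ≫ confSt p) : f = g := by
  refine CartesianMonoidalCategory.hom_ext _ _ ?_ (Pi.hom_ext _ _ fun p => ?_)
  · rw [← cancel_mono (confι α M)]
    refine pow_hom_ext M fun p => ?_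
    have := h1 p
    rw [confPos, ← Category.assoc, ← Category.assoc] at this
    simpa only [Category.assoc] using this
  · have := h2 p
    rw [confSt] at this
    simpa only [Category.assoc] using this

lemma confPos_injective {K : Type} [Field K] [Algebra ℂ K] [IsAlgClosed K]
    (v : KPt K (confState α M F)) : Function.Injective fun p => v ≫ confPos (F := F) p := by
  intro p q h
  by_contra hpq
  have h1 := (mem_largeDiagonal_iff α M (v ≫ fst _ _ ≫ confι α M : KPt K _)).mpr
    ⟨p, q, hpq, by simpa only [confPos, Category.assoc] using h⟩
  exact (KPt.pt (K := K) (v ≫ fst _ _ : KPt K (confObj α M)) : (confOpen α M).toScheme).2 h1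

lemma exists_hom_confState_aux {V : Over SpecC} (pos : α.parts → (V ⟶ M)) (st : ∀ p, V ⟶ F p)
    (h : ∀ x : V.left, (powLift α pos).left x ∉ largeDiagonal α M) :
    ∃ f : V ⟶ confState α M F, (∀ p, f ≫ confPos p = pos p) ∧ ∀ p, f ≫ confSt p = st p := by
  obtain ⟨f, hf⟩ : ∃ f : V ⟶ confObj α M, f ≫ confι α M = powLift α pos := by
    let l : V.left ⟶ (confOpen α M).toScheme :=
      IsOpenImmersion.lift (confOpen α M).ι (powLift α pos).left (by
        rintro _ ⟨x, rfl⟩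
        rw [Scheme.Opens.range_ι]
        exact h x)
    have hl : l ≫ (confOpen α M).ι = (powLift α pos).left :=
      IsOpenImmersion.lift_fac _ _ _
    refine ⟨Over.homMk l ?_, ?_⟩
    · change l ≫ (confOpen α M).ι ≫ (powObj α M).hom = _
      rw [← Category.assoc, hl, Over.w]
    · ext1
      exact hl
  refine ⟨lift f (Pi.lift st), fun p => ?_, fun p => ?_⟩
  · rw [confPos, lift_fst_assoc, ← Category.assoc, hf, powLift_π]
  · rw [confSt, lift_snd_assoc]
    exact Pi.lift_π _ _

lemma exists_kpt_confState {K : Type} [Field K] [Algebra ℂ K] [IsAlgClosed K]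
    (pos : α.parts → KPt K M) (hpos : Function.Injective pos) (st : ∀ p, KPt K (F p)) :
    ∃ v : KPt K (confState α M F), (∀ p, v ≫ confPos p = pos p) ∧ ∀ p, v ≫ confSt p = st p := by
  refine exists_hom_confState_aux pos st fun x => ?_
  have e := KPt.left_apply (powLift α pos : KPt K (powObj α M)) x
  rw [e, mem_largeDiagonal_iff]
  rintro ⟨p, q, hpq, h⟩
  rw [powLift_π, powLift_π] at h
  exact hpq (hpos h)

lemma exists_hom_confState {V : Over SpecC} (pos : α.parts → (V ⟶ M)) (st : ∀ p, V ⟶ F p)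
    (h : ∀ (K : Type) [Field K] [Algebra ℂ K] [IsAlgClosed K] (v : KPt K V),
      Function.Injective fun p => v ≫ pos p) :
    ∃ f : V ⟶ confState α M F, (∀ p, f ≫ confPos p = pos p) ∧ ∀ p, f ≫ confSt p = st p := by
  refine exists_hom_confState_aux pos st fun x => ?_
  obtain ⟨K, _, _, _, v, rfl⟩ := exists_kpt_pt V x
  intro hx
  obtain ⟨p, q, hpq, e⟩ := (mem_largeDiagonal_iff α M (v ≫ powLift α pos : KPt K (powObj α M))).mp hx
  refine hpq (h K v ?_)
  rwa [Category.assoc, Category.assoc, powLift_π, powLift_π] at e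

end

variable {α M A}

/-- The position and the internal state, with its degree, of a particle of an ordered
configuration. -/
def particle {T : Over SpecC} (o : T ⟶ orderedObj α M A) (p : α.parts) :
    (T ⟶ M) × Σ i, T ⟶ A i :=
  (o ≫ position α M A p, ⟨p.1, o ≫ internalState α M A p⟩)

lemma orderedObj_hom_ext {T : Over SpecC} {o o' : T ⟶ orderedObj α M A}
    (h : ∀ p, particle o p = particle o' p) : o = o' := by
  refine confState_hom_ext (F := fun p => A p.1) (fun p => congrArg Prod.fst (h p)) fun p => ?_
  have := congrArg Prod.snd (h p)
  exact eq_of_heq (Sigma.mk.inj this).2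

lemma particle_act {T : Over SpecC} (o : T ⟶ orderedObj α M A) (σ : PartPerm α) (p : α.parts) :
    particle (o ≫ (orderedAct α M A σ : orderedObj α M A ⟶ orderedObj α M A)) p =
      particle o (σ⁻¹.act p) := by
  unfold particle
  rw [Category.assoc, Category.assoc, orderedAct_position, orderedAct_internalState]
  rfl

lemma particle_fst_injective {K : Type} [Field K] [Algebra ℂ K] [IsAlgClosed K]
    (o : KPt K (orderedObj α M A)) : Function.Injective fun p => (particle o p).1 :=
  confPos_injective (F := fun p => A p.1) o

lemma particle_injective {K : Type} [Field K] [Algebra ℂ K] [IsAlgClosed K]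
    (o : KPt K (orderedObj α M A)) : Function.Injective (particle o) :=
  fun _ _ h => particle_fst_injective o (congrArg Prod.fst h)

end ConfigurationPoints

/-! ### Parts of partitions -/

section Parts

variable {n : ℕ}

lemma sum_parts (α : n.Partition) : ∑ p : α.parts, p.1 = n :=
  (congrArg Multiset.sum (Multiset.map_univ_coe α.parts)).trans α.parts_sum

lemma part_pos {α : n.Partition} (p : α.parts) : 0 < p.1 :=
  α.parts_pos (Multiset.count_pos.mp (Fin.pos p.2))

/-- This allows particles to be indexed by any finite set with positive degrees instead of by the
parts of a partition. -/
lemma exists_partition {κ : Type} [Fintype κ] (d : κ → ℕ) (hd : ∀ k, 0 < d k) (hn : ∑ k, d k = n) :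
    ∃ (α : n.Partition) (e : α.parts ≃ κ), ∀ p, d (e p) = p.1 := by
  classical
  let α : n.Partition := ⟨Finset.univ.val.map d, by
    intro i hi
    obtain ⟨k, -, rfl⟩ := Multiset.mem_map.mp hi
    exact hd k, hn⟩
  have hc : ∀ i, Fintype.card (Fin (α.parts.count i)) = Fintype.card {k // d k = i} := by
    intro i
    rw [Fintype.card_fin, Fintype.card_subtype]
    change Multiset.count i (Finset.univ.val.map d) = _
    rw [Multiset.count_map]
    simp only [Finset.card, Finset.filter_val, eq_comm]
  let e : α.parts ≃ κ :=
    (Equiv.sigmaCongrRight fun i => Fintype.equivOfCardEq (hc i)).trans (Equiv.sigmaFiberEquiv d)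
  exact ⟨α, e, fun p => (Fintype.equivOfCardEq (hc p.1) p.2).2⟩

lemma partition_eq_of_equiv {m : ℕ} {α : n.Partition} {β : m.Partition} (e : α.parts ≃ β.parts)
    (he : ∀ p, (e p).1 = p.1) : α.parts = β.parts := by
  rw [← Multiset.map_univ_coe α.parts, ← Multiset.map_univ_coe β.parts]
  have h : (Finset.univ : Finset β.parts).val = (Finset.univ : Finset α.parts).val.map e := by
    rw [← Finset.map_univ_equiv e]
    rfl
  rw [h, Multiset.map_map]
  exact Multiset.map_congr rfl fun p _ => (he p).symm

/-- `S_α` consists of all degree-preserving permutations, so two orderings of the same set of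
particles lie in one orbit. -/
lemma exists_partPerm {α : n.Partition} (e : α.parts ≃ α.parts) (he : ∀ p, (e p).1 = p.1) :
    ∃ σ : PartPerm α, ∀ p, σ.act p = e p := by
  let f : ∀ i, Fin (α.parts.count i) → Fin (α.parts.count i) := fun i k =>
    Fin.cast (by rw [he]) (e (α.parts.mkToType i k)).2
  have hf : ∀ i k, α.parts.mkToType i (f i k) = e (α.parts.mkToType i k) := by
    intro i k
    refine Sigma.ext (he (α.parts.mkToType i k)).symm ?_
    exact (Fin.heq_ext_iff (by rw [he])).mpr rfl
  refine ⟨fun i => Equiv.ofBijective (f i) (Finite.injective_iff_bijective.mp fun k l h => ?_),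
    fun p => hf p.1 p.2⟩
  have h1 : e (α.parts.mkToType i k) = e (α.parts.mkToType i l) := by rw [← hf, ← hf, h]
  have h2 := e.injective h1
  exact eq_of_heq (Sigma.mk.inj h2).2

end Parts

/-! ### The particles of a configuration -/

section Code

lemma sigma_comp_cast {A : ℕ → Over SpecC} {V T : Over SpecC} (t : T ⟶ V) {i j : ℕ} (h : i = j)
    (s : V ⟶ A i) :
    (⟨j, t ≫ (h ▸ s : V ⟶ A j)⟩ : Σ i, T ⟶ A i) = ⟨i, t ≫ s⟩ := by
  subst h
  rfl

section

variable {n : ℕ} {M : Over SpecC} [IsVariety M] {A : ℕ → Over SpecC}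

lemma eq_of_range_particle_eq {K : Type} [Field K] [Algebra ℂ K] [IsAlgClosed K] {m : ℕ}
    {α : n.Partition} {β : m.Partition} {o : KPt K (orderedObj α M A)}
    {o' : KPt K (orderedObj β M A)} (h : Set.range (particle o) = Set.range (particle o')) :
    n = m := by
  let e : α.parts ≃ β.parts := (Equiv.ofInjective _ (particle_injective o)).trans
    ((Equiv.setCongr h).trans (Equiv.ofInjective _ (particle_injective o')).symm)
  have he : ∀ p, particle o' (e p) = particle o p := fun p =>
    Equiv.apply_ofInjective_symm (particle_injective o') _
  rw [← sum_parts α, ← sum_parts β]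
  exact Fintype.sum_equiv e _ _ fun p => congr(($(he p)).2.1).symm

lemma nonempty_parts (hn : 0 < n) (α : n.Partition) : Nonempty α.parts := by
  by_contra h
  rw [not_nonempty_iff] at h
  have := sum_parts α
  rw [Fintype.sum_empty] at this
  omega

end

section

variable {n : ℕ} {M : Over SpecC} [IsVariety M] {A : ℕ → Over SpecC} {κ : Type} [Fintype κ]
  (d : κ → ℕ)

lemma exists_hom_orderedObj (hd : ∀ k, 0 < d k) (hn : ∑ k, d k = n) {V : Over SpecC}
    (pos : κ → (V ⟶ M)) (st : ∀ k, V ⟶ A (d k))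
    (hpos : ∀ (K : Type) [Field K] [Algebra ℂ K] [IsAlgClosed K] (v : KPt K V),
      Function.Injective fun k => v ≫ pos k) :
    ∃ (α : n.Partition) (f : V ⟶ orderedObj α M A) (e : α.parts ≃ κ),
      ∀ {T : Over SpecC} (t : T ⟶ V) (p : α.parts),
        particle (t ≫ f) p = (t ≫ pos (e p), ⟨d (e p), t ≫ st (e p)⟩) := by
  obtain ⟨α, e, he⟩ := exists_partition d hd hn
  obtain ⟨f, hf, hf'⟩ := exists_hom_confState (F := fun p : α.parts => A p.1)
    (fun p => pos (e p)) (fun p => he p ▸ st (e p)) fun K _ _ _ v p q h => e.injective (hpos K v h)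
  refine ⟨α, f, e, fun t p => Prod.ext ?_ ?_⟩
  · exact (Category.assoc _ _ _).trans congr(t ≫ $(hf p))
  · refine Eq.trans ?_ (sigma_comp_cast t (he p) (st (e p)))
    exact congrArg (Sigma.mk p.1) ((Category.assoc _ _ _).trans congr(t ≫ $(hf' p)))

lemma exists_kpt_orderedObj (hd : ∀ k, 0 < d k) (hn : ∑ k, d k = n) {K : Type} [Field K]
    [Algebra ℂ K] [IsAlgClosed K] (pos : κ → KPt K M) (st : ∀ k, KPt K (A (d k)))
    (hpos : Function.Injective pos) :
    ∃ (α : n.Partition) (o : KPt K (orderedObj α M A)) (e : α.parts ≃ κ),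
      ∀ p : α.parts, particle o p = (pos (e p), ⟨d (e p), st (e p)⟩) := by
  obtain ⟨α, e, he⟩ := exists_partition d hd hn
  obtain ⟨f, hf, hf'⟩ := exists_kpt_confState (F := fun p : α.parts => A p.1)
    (fun p => pos (e p)) (hpos.comp e.injective) (fun p => he p ▸ st (e p))
  refine ⟨α, f, e, fun p => Prod.ext (hf p) ?_⟩
  have := sigma_comp_cast (𝟙 _) (he p) (st (e p))
  rw [Category.id_comp, Category.id_comp] at this
  exact (congrArg (Sigma.mk p.1) (hf' p)).trans this

end

variable {𝔐 : Over SpecC} [MonObj 𝔐] [IsCommMonObj 𝔐] {n : ℕ}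

/-- The weight of a particle. -/
def particleWeight (M : RelVar 𝔐) (A : ℕ → RelVar 𝔐) {T : Over SpecC}
    (x : (T ⟶ M.obj) × Σ i, T ⟶ (A i).obj) : T ⟶ 𝔐 :=
  (x.1 ≫ M.str) ^ x.2.1 * (x.2.2 ≫ (A x.2.1).str)

lemma comp_totalWeight_eq (α : n.Partition) (M : RelVar 𝔐) (A : ℕ → RelVar 𝔐) {T : Over SpecC}
    (o : T ⟶ orderedObj α M.obj fun i => (A i).obj) :
    o ≫ totalWeight α M A = ∏ p, particleWeight M A (particle o p) :=
  comp_totalWeight α M A o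

namespace IsConfigurationSpace

variable {α : n.Partition} {M B : RelVar 𝔐} {A : ℕ → RelVar 𝔐} (hB : IsConfigurationSpace α M A B)

/-- The quotient map from the variety of ordered configurations. -/
def map : orderedObj α M.obj (fun i => (A i).obj) ⟶ B.obj := hB.choose

lemma isGeometricQuotient :
    IsGeometricQuotient (orderedAct α M.obj (fun i => (A i).obj)) hB.map := hB.choose_spec.1

lemma map_str : hB.map ≫ B.str = totalWeight α M A := hB.choose_spec.2

variable {K : Type} [Field K] [Algebra ℂ K]

/-- The set of particles of a configuration. -/
def code (b : KPt K B.obj) : Set (KPt K M.obj × Σ i, KPt K (A i).obj) :=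
  {x | ∃ o : KPt K (orderedObj α M.obj fun i => (A i).obj), o ≫ hB.map = b ∧
    x ∈ Set.range (particle o)}

/-- Lifts of one `K`-point of the quotient are conjugate under `S_α`, which only permutes the
particles. -/
lemma code_comp (o : KPt K (orderedObj α M.obj fun i => (A i).obj)) :
    hB.code (o ≫ hB.map) = Set.range (particle o) := by
  ext x
  constructor
  · rintro ⟨o', h, p, rfl⟩
    obtain ⟨σ, rfl⟩ := hB.isGeometricQuotient.exists_kpt_eq o o' h.symm
    exact ⟨_, (particle_act o σ p).symm⟩
  · exact fun hx => ⟨o, rfl, hx⟩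

variable [IsAlgClosed K]

lemma exists_lift (b : KPt K B.obj) :
    ∃ o : KPt K (orderedObj α M.obj fun i => (A i).obj), o ≫ hB.map = b :=
  KPt.exists_lift' hB.map b (hB.isGeometricQuotient.surjective.surj _)

/-- The particles of a lift are pairwise distinct, so equal codes give a bijection of parts. It
preserves degrees, which forces the partitions to agree and makes the bijection an element of `S_α`.
Hence a geometric point of the disjoint union of the `B_α` is determined by its set of particles. -/
lemma eq_of_code_eq {β : n.Partition} {B' : n.Partition → RelVar 𝔐}
    (hB : ∀ α, IsConfigurationSpace α M A (B' α)) {b : KPt K (B' α).obj} {b' : KPt K (B' β).obj}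
    (h : (hB α).code b = (hB β).code b') : (⟨α, b⟩ : Σ α, KPt K (B' α).obj) = ⟨β, b'⟩ := by
  obtain ⟨o, rfl⟩ := (hB α).exists_lift b
  obtain ⟨o', rfl⟩ := (hB β).exists_lift b'
  rw [code_comp, code_comp] at h
  let e : α.parts ≃ β.parts := (Equiv.ofInjective _ (particle_injective o)).trans
    ((Equiv.setCongr h).trans (Equiv.ofInjective _ (particle_injective o')).symm)
  have he : ∀ p, particle o' (e p) = particle o p := fun p =>
    Equiv.apply_ofInjective_symm (particle_injective o') _
  have he1 : ∀ p, (e p).1 = p.1 := fun p => congr(($(he p)).2.1)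
  obtain rfl : α = β := Nat.Partition.ext (partition_eq_of_equiv e he1)
  obtain ⟨σ, hσ⟩ := exists_partPerm e he1
  have : o ≫ (orderedAct α M.obj (fun i => (A i).obj) σ :
      orderedObj α M.obj (fun i => (A i).obj) ⟶ _) = o' := by
    refine orderedObj_hom_ext fun p => ?_
    obtain ⟨p, rfl⟩ := e.surjective p
    rw [particle_act, he, ← hσ, ← PartPerm.act_mul, inv_mul_cancel, PartPerm.act_one]
  rw [← this, Category.assoc, (hB α).isGeometricQuotient.invariant]

lemma parts_eq_of_code_eq {m : ℕ} {β : m.Partition} {B' : RelVar 𝔐}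
    (hB' : IsConfigurationSpace β M A B') {b : KPt K B.obj} {b' : KPt K B'.obj}
    (h : hB.code b = hB'.code b') : n = m := by
  obtain ⟨o, rfl⟩ := hB.exists_lift b
  obtain ⟨o', rfl⟩ := hB'.exists_lift b'
  rw [code_comp, code_comp] at h
  let e : α.parts ≃ β.parts := (Equiv.ofInjective _ (particle_injective o)).trans
    ((Equiv.setCongr h).trans (Equiv.ofInjective _ (particle_injective o')).symm)
  have he : ∀ p, particle o' (e p) = particle o p := fun p =>
    Equiv.apply_ofInjective_symm (particle_injective o') _
  rw [← sum_parts α, ← sum_parts β]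
  exact Fintype.sum_equiv e _ _ fun p => congr(($(he p)).2.1).symm

lemma code_nonempty (hn : 0 < n) (b : KPt K B.obj) : (hB.code b).Nonempty := by
  obtain ⟨o, rfl⟩ := hB.exists_lift b
  rw [code_comp]
  have := nonempty_parts hn α
  exact Set.range_nonempty _

end IsConfigurationSpace

variable {M : RelVar 𝔐} {A : ℕ → RelVar 𝔐} {B : n.Partition → RelVar 𝔐}
  (hB : ∀ α, IsConfigurationSpace α M A (B α)) {κ : Type} [Fintype κ] (d : κ → ℕ)

/-- The source of all the maps to configuration spaces used below: it suffices to give positions,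
distinct on geometric points, and states. -/
lemma exists_hom_configurationSpace (hd : ∀ k, 0 < d k) (hn : ∑ k, d k = n) {V : Over SpecC}
    (pos : κ → (V ⟶ M.obj)) (st : ∀ k, V ⟶ (A (d k)).obj)
    (hpos : ∀ (K : Type) [Field K] [Algebra ℂ K] [IsAlgClosed K] (v : KPt K V),
      Function.Injective fun k => v ≫ pos k) :
    ∃ (α : n.Partition) (f : V ⟶ (B α).obj),
      ∀ (K : Type) [Field K] [Algebra ℂ K] [IsAlgClosed K] (v : KPt K V),
        (hB α).code (v ≫ f) = Set.range (fun k => (v ≫ pos k,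
          (⟨d k, v ≫ st k⟩ : Σ i, KPt K (A i).obj))) ∧
        v ≫ f ≫ (B α).str = ∏ k, particleWeight M A (v ≫ pos k, ⟨d k, v ≫ st k⟩) := by
  obtain ⟨α, f, e, he⟩ := exists_hom_orderedObj (A := fun i => (A i).obj) d hd hn pos st hpos
  refine ⟨α, f ≫ (hB α).map, fun K _ _ _ v => ⟨?_, ?_⟩⟩
  · rw [← Category.assoc, IsConfigurationSpace.code_comp]
    rw [show particle (v ≫ f) = _ from funext fun p => he v p]
    exact e.surjective.range_comp fun k => (v ≫ pos k, (⟨d k, v ≫ st k⟩ : Σ i, KPt K (A i).obj))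
  · rw [Category.assoc, (hB α).map_str, ← Category.assoc, comp_totalWeight_eq]
    exact Fintype.prod_equiv e _ _ fun p => congrArg _ (he v p)

lemma exists_kpt_configurationSpace (hd : ∀ k, 0 < d k) (hn : ∑ k, d k = n) {K : Type} [Field K]
    [Algebra ℂ K] [IsAlgClosed K] (pos : κ → KPt K M.obj) (st : ∀ k, KPt K (A (d k)).obj)
    (hpos : Function.Injective pos) :
    ∃ (α : n.Partition) (b : KPt K (B α).obj),
      (hB α).code b = Set.range (fun k => (pos k, (⟨d k, st k⟩ : Σ i, KPt K (A i).obj))) := by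
  obtain ⟨α, o, e, he⟩ := exists_kpt_orderedObj (A := fun i => (A i).obj) d hd hn pos st hpos
  refine ⟨α, o ≫ (hB α).map, ?_⟩
  rw [IsConfigurationSpace.code_comp, show particle o = _ from funext fun p => he p]
  exact e.surjective.range_comp fun k => (pos k, (⟨d k, st k⟩ : Σ i, KPt K (A i).obj))

end Code

/-! ### Comparison of configuration spaces -/

section Comparison

variable {n : ℕ}

lemma part_mem {α : n.Partition} (p : α.parts) : 0 < p.1 ∧ p.1 ≤ n :=
  ⟨part_pos p, le_of_part α p⟩

variable {𝔐 : Over SpecC} [MonObj 𝔐] [IsCommMonObj 𝔐]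

namespace IsConfigurationSpace

variable {α : n.Partition} {M B : RelVar 𝔐} {A : ℕ → RelVar 𝔐} (hB : IsConfigurationSpace α M A B)
  {K : Type} [Field K] [Algebra ℂ K]

lemma degree_mem_of_mem_code {b : KPt K B.obj} {x : KPt K M.obj × Σ i, KPt K (A i).obj}
    (hx : x ∈ hB.code b) : 0 < x.2.1 ∧ x.2.1 ≤ n := by
  obtain ⟨o, rfl, p, rfl⟩ := hx
  exact part_mem p

lemma degree_pos_of_mem_code {b : KPt K B.obj} {x : KPt K M.obj × Σ i, KPt K (A i).obj}
    (hx : x ∈ hB.code b) : 0 < x.2.1 := by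
  exact (hB.degree_mem_of_mem_code hx).1

lemma injOn_code [IsAlgClosed K] (b : KPt K B.obj) : Set.InjOn Prod.fst (hB.code b) := by
  obtain ⟨o, rfl⟩ := hB.exists_lift b
  rw [code_comp]
  rintro _ ⟨p, rfl⟩ _ ⟨q, rfl⟩ h
  rw [particle_fst_injective o h]

end IsConfigurationSpace

/-- Common pattern of the comparisons. The configurations with states in `C` are covered by the
varieties `confState`, one for each partition and each choice `χ` of a piece `F` of the states of
every part. Points of the `Y j` are recorded faithfully by `c`, and `Φ` translates sets of particles
into such records. What is left to supply is a morphism realizing `Φ` with the right weight on each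
piece, and that `Φ` is injective on codes and reaches every record. -/
lemma sum_cls_configurationSpace_eq {M : RelVar 𝔐} {C : ℕ → RelVar 𝔐} {B : n.Partition → RelVar 𝔐}
    (hB : ∀ δ, IsConfigurationSpace δ M C (B δ)) {E : ℕ → Type} [∀ k, Finite (E k)]
    (F : ∀ k, E k → Over SpecC) [∀ k e, IsVariety (F k e)] (u : ∀ k e, F k e ⟶ (C k).obj)
    (hu : ∀ (K : Type) [Field K] [Algebra ℂ K] [IsAlgClosed K] (k : ℕ), 0 < k →
      ∀ z : KPt K (C k).obj, ∃ (e : E k) (x : KPt K (F k e)), x ≫ u k e = z)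
    {J : Type} [Fintype J] (Y : J → RelVar 𝔐) (T : ∀ (K : Type) [Field K] [Algebra ℂ K], Type)
    (c : ∀ (K : Type) [Field K] [Algebra ℂ K], (Σ j, KPt K (Y j).obj) → T K)
    (hc : ∀ (K : Type) [Field K] [Algebra ℂ K] [IsAlgClosed K], Function.Injective (c K))
    (Φ : ∀ (K : Type) [Field K] [Algebra ℂ K],
      Set (KPt K M.obj × Σ k, KPt K (C k).obj) → T K)
    (hmap : ∀ (δ : n.Partition) (χ : ∀ p : δ.parts, E p.1),
      ∃ (j : J) (g : confState δ M.obj (fun p => F p.1 (χ p)) ⟶ (Y j).obj),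
        ∀ (K : Type) [Field K] [Algebra ℂ K] [IsAlgClosed K]
          (v : KPt K (confState δ M.obj (fun p => F p.1 (χ p)))),
          c K ⟨j, v ≫ g⟩ = Φ K (Set.range fun p => (v ≫ confPos p,
            (⟨p.1, (v ≫ confSt p) ≫ u p.1 (χ p)⟩ : Σ i, KPt K (C i).obj))) ∧
          v ≫ g ≫ (Y j).str = ∏ p, particleWeight M C (v ≫ confPos p,
            ⟨p.1, (v ≫ confSt p) ≫ u p.1 (χ p)⟩))
    (hinj : ∀ (K : Type) [Field K] [Algebra ℂ K] [IsAlgClosed K] (δ δ' : n.Partition)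
      (b : KPt K (B δ).obj) (b' : KPt K (B δ').obj),
      Φ K ((hB δ).code b) = Φ K ((hB δ').code b') → (hB δ).code b = (hB δ').code b')
    (hsurj : ∀ (K : Type) [Field K] [Algebra ℂ K] [IsAlgClosed K] (y : Σ j, KPt K (Y j).obj),
      ∃ (δ : n.Partition) (b : KPt K (B δ).obj), Φ K ((hB δ).code b) = c K y) :
    ∑ δ, cls (B δ) = ∑ j, cls (Y j) := by
  choose j g hg using hmap
  have hf0 : ∀ (δ : n.Partition) (χ : ∀ p : δ.parts, E p.1),
      ∃ f : confState δ M.obj (fun p => F p.1 (χ p)) ⟶ orderedObj δ M.obj (fun i => (C i).obj),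
        ∀ (T : Over SpecC) (t : T ⟶ confState δ M.obj (fun p => F p.1 (χ p))) p,
          particle (t ≫ f) p = (t ≫ confPos p, ⟨p.1, (t ≫ confSt p) ≫ u p.1 (χ p)⟩) := by
    intro δ χ
    obtain ⟨f, h1, h2⟩ := exists_hom_confState (F := fun p : δ.parts => (C p.1).obj)
      (V := confState δ M.obj (fun p => F p.1 (χ p))) (fun p => confPos p)
      (fun p => confSt p ≫ u p.1 (χ p)) (fun K _ _ _ v => confPos_injective v)
    refine ⟨f, fun T t p => Prod.ext ?_ ?_⟩
    · exact (Category.assoc _ _ _).trans congr(t ≫ $(h1 p))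
    · refine congrArg (Sigma.mk p.1) ?_
      exact ((Category.assoc _ _ _).trans congr(t ≫ $(h2 p))).trans (Category.assoc _ _ _).symm
  choose f hf using hf0
  have hcode : ∀ (K : Type) [Field K] [Algebra ℂ K] [IsAlgClosed K] (l : Σ δ : n.Partition, ∀ p : δ.parts, E p.1)
      (v : KPt K (confState l.1 M.obj (fun p => F p.1 (l.2 p)))),
      (hB l.1).code (v ≫ f l.1 l.2 ≫ (hB l.1).map) = Set.range fun p => (v ≫ confPos p,
        (⟨p.1, (v ≫ confSt p) ≫ u p.1 (l.2 p)⟩ : Σ i, KPt K (C i).obj)) := by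
    intro K _ _ _ l v
    rw [← Category.assoc, IsConfigurationSpace.code_comp,
      show particle (v ≫ f l.1 l.2) = _ from funext fun p => hf l.1 l.2 _ v p]
  have hcf : ∀ (K : Type) [Field K] [Algebra ℂ K] [IsAlgClosed K] (l : Σ δ : n.Partition, ∀ p : δ.parts, E p.1)
      (v : KPt K (confState l.1 M.obj (fun p => F p.1 (l.2 p)))),
      c K ⟨j l.1 l.2, v ≫ g l.1 l.2⟩ = Φ K ((hB l.1).code (v ≫ f l.1 l.2 ≫ (hB l.1).map)) := by
    intro K _ _ _ l v
    rw [hcode]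
    exact (hg l.1 l.2 K v).1
  have hfs : ∀ (K : Type) [Field K] [Algebra ℂ K] [IsAlgClosed K] (x : Σ δ, KPt K (B δ).obj),
      ∃ (l : Σ δ : n.Partition, ∀ p : δ.parts, E p.1) (v : KPt K (confState l.1 M.obj (fun p => F p.1 (l.2 p)))),
        (⟨l.1, v ≫ f l.1 l.2 ≫ (hB l.1).map⟩ : Σ δ, KPt K (B δ).obj) = x := by
    rintro K _ _ _ ⟨δ, b⟩
    obtain ⟨o, rfl⟩ := (hB δ).exists_lift b
    choose χ x hx using fun p : δ.parts =>
      hu K p.1 (part_pos p) (o ≫ internalState δ M.obj (fun i => (C i).obj) p)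
    obtain ⟨v, h1, h2⟩ := exists_kpt_confState (F := fun p => F p.1 (χ p))
      (fun p => o ≫ position δ M.obj (fun i => (C i).obj) p) (particle_fst_injective o) x
    refine ⟨⟨δ, χ⟩, v, congrArg (Sigma.mk δ) ?_⟩
    change v ≫ f δ χ ≫ (hB δ).map = _
    rw [← Category.assoc]
    refine congr($(?_) ≫ (hB δ).map)
    refine orderedObj_hom_ext fun p => ?_
    rw [hf, h1, h2, hx]
    rfl
  refine sum_cls_eq_of_correspondence B Y
    (fun l : Σ δ : n.Partition, ∀ p : δ.parts, E p.1 => confState l.1 M.obj (fun p => F p.1 (l.2 p))) (fun l => l.1)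
    (fun l => j l.1 l.2) (fun l => f l.1 l.2 ≫ (hB l.1).map) (fun l => g l.1 l.2) hfs ?_ ?_ ?_
  · intro K _ _ _ y
    obtain ⟨δ, b, hb⟩ := hsurj K y
    obtain ⟨l, v, hv⟩ := hfs K ⟨δ, b⟩
    have e := congrArg (fun x : Σ δ, KPt K (B δ).obj => Φ K ((hB x.1).code x.2)) hv
    have e1 := (hcf K l v).trans (e.trans hb)
    have e2 := hc K e1
    exact ⟨l, v, e2⟩
  · intro K _ _ _ l l' v v'
    constructor
    · intro h
      have e := congrArg (fun x : Σ δ, KPt K (B δ).obj => Φ K ((hB x.1).code x.2)) h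
      have e1 := (hcf K l v).trans (e.trans (hcf K l' v').symm)
      exact hc K e1
    · intro h
      have e := (hcf K l v).symm.trans ((congrArg (c K) h).trans (hcf K l' v'))
      have e1 := hinj K _ _ _ _ e
      exact IsConfigurationSpace.eq_of_code_eq hB e1
  · intro K _ _ _ l v
    refine Eq.trans ?_ (hg l.1 l.2 K v).2.symm
    rw [Category.assoc, (hB l.1).map_str, ← Category.assoc, comp_totalWeight_eq]
    exact Finset.prod_congr rfl fun p _ => congrArg _ (hf l.1 l.2 _ v p)

/-- Moving positions by `φ` and states by `ψ` is a bijection on sets of particles. Only degrees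
between `1` and `n` occur, so `ψ` is needed only there; restricting the range matters later, when
families agree only in low degrees. -/
lemma sum_cls_eq_of_kBijective {M M' : RelVar 𝔐} {A A' : ℕ → RelVar 𝔐}
    {B B' : n.Partition → RelVar 𝔐} (hB : ∀ α, IsConfigurationSpace α M A (B α))
    (hB' : ∀ α, IsConfigurationSpace α M' A' (B' α)) (φ : M'.obj ⟶ M.obj) (hφ : φ ≫ M.str = M'.str)
    (hφb : KBijective φ) (ψ : ∀ i, 0 < i ∧ i ≤ n → ((A' i).obj ⟶ (A i).obj))
    (hψ : ∀ i hi, ψ i hi ≫ (A i).str = (A' i).str) (hψb : ∀ i hi, KBijective (ψ i hi)) :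
    ∑ α, cls (B' α) = ∑ α, cls (B α) := by
  refine sum_cls_configurationSpace_eq hB' (E := fun _ => Unit) (fun k _ => (A' k).obj)
    (fun k _ => 𝟙 _) (fun K _ _ _ k _ z => ⟨(), z, Category.comp_id _⟩) B
    (fun K _ _ => Set (KPt K M.obj × Σ i, KPt K (A i).obj)) (fun K _ _ x => (hB x.1).code x.2)
    (fun K _ _ _ x y h => IsConfigurationSpace.eq_of_code_eq hB h)
    (fun K _ _ c => {x | ∃ y ∈ c, ∃ h : 0 < y.2.1 ∧ y.2.1 ≤ n,
      (y.1 ≫ φ, (⟨y.2.1, y.2.2 ≫ ψ y.2.1 h⟩ : Σ i, KPt K (A i).obj)) = x}) ?_ ?_ ?_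
  · intro δ χ
    obtain ⟨α, f, hf⟩ := exists_hom_configurationSpace hB (fun p : δ.parts => p.1) part_pos
      (sum_parts δ) (V := confState δ M'.obj (fun p => (A' p.1).obj)) (fun p => confPos p ≫ φ)
      (fun p => confSt p ≫ ψ p.1 (part_mem p)) (fun K _ _ _ v p q h => confPos_injective v
        ((hφb K).1 (by simpa only [Category.assoc] using h)))
    refine ⟨α, f, fun K _ _ _ v => ⟨(hf K v).1.trans ?_, (hf K v).2.trans ?_⟩⟩
    · ext x
      constructor
      · rintro ⟨p, rfl⟩
        refine ⟨_, ⟨p, rfl⟩, part_mem p, ?_⟩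
        simp only [Category.assoc, Category.id_comp]
      · rintro ⟨_, ⟨p, rfl⟩, _, rfl⟩
        refine ⟨p, ?_⟩
        simp only [Category.assoc, Category.id_comp]
    · refine Finset.prod_congr rfl fun p _ => ?_
      simp only [particleWeight, Category.assoc, hφ, hψ, Category.id_comp]
  · intro K _ _ _ δ δ' b b' h
    have key : ∀ (δ δ' : n.Partition) (b : KPt K (B' δ).obj) (b' : KPt K (B' δ').obj),
        {x | ∃ y ∈ (hB' δ).code b, ∃ h : 0 < y.2.1 ∧ y.2.1 ≤ n,
          (y.1 ≫ φ, (⟨y.2.1, y.2.2 ≫ ψ y.2.1 h⟩ : Σ i, KPt K (A i).obj)) = x} ⊆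
        {x | ∃ y ∈ (hB' δ').code b', ∃ h : 0 < y.2.1 ∧ y.2.1 ≤ n,
          (y.1 ≫ φ, (⟨y.2.1, y.2.2 ≫ ψ y.2.1 h⟩ : Σ i, KPt K (A i).obj)) = x} →
        (hB' δ).code b ⊆ (hB' δ').code b' := by
      rintro δ δ' b b' h ⟨x, i, a⟩ hx
      have hi : 0 < i ∧ i ≤ n := (hB' δ).degree_mem_of_mem_code hx
      obtain ⟨⟨x', i', a'⟩, hx', hi', e⟩ := h ⟨_, hx, hi, rfl⟩
      obtain rfl : x' = x := (hφb K).1 (congrArg Prod.fst e)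
      have e2 := congrArg Prod.snd e
      obtain rfl : i' = i := congrArg Sigma.fst e2
      obtain rfl : a' = a := (hψb i' hi K).1 (eq_of_heq (Sigma.mk.inj e2).2)
      exact hx'
    exact (key _ _ _ _ h.le).antisymm (key _ _ _ _ h.ge)
  · rintro K _ _ _ ⟨α, b⟩
    obtain ⟨o, rfl⟩ := (hB α).exists_lift b
    choose pos hpos using fun p : α.parts => (hφb K).2 (o ≫ position α M.obj (fun i => (A i).obj) p)
    choose st hst using fun p : α.parts =>
      (hψb p.1 (part_mem p) K).2 (o ≫ internalState α M.obj (fun i => (A i).obj) p)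
    dsimp only at hpos hst
    obtain ⟨δ, b', hb'⟩ := exists_kpt_configurationSpace hB' (fun p : α.parts => p.1) part_pos
      (sum_parts α) pos st (fun p q h => particle_fst_injective o (by
        change o ≫ _ = o ≫ _
        rw [← hpos, ← hpos, h]))
    refine ⟨δ, b', ?_⟩
    dsimp only
    rw [hb', IsConfigurationSpace.code_comp]
    ext x
    constructor
    · rintro ⟨_, ⟨p, rfl⟩, hp, rfl⟩
      refine ⟨p, Prod.ext (hpos p).symm ?_⟩
      exact congrArg (Sigma.mk p.1) (hst p).symm
    · rintro ⟨p, rfl⟩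
      refine ⟨_, ⟨p, rfl⟩, part_mem p, Prod.ext (hpos p) ?_⟩
      exact congrArg (Sigma.mk p.1) (hst p)

end Comparison

/-! ### Degree zero, empty base and one-point base -/

section Values

variable {𝔐 : Over SpecC} [MonObj 𝔐]

variable (𝔐) in
/-- The projection to the point. -/
def RelVar.toPoint (X : Over SpecC) : X ⟶ (RelVar.point 𝔐).obj := toUnit X

lemma RelVar.hom_point_ext {X : Over SpecC} (f g : X ⟶ (RelVar.point 𝔐).obj) : f = g :=
  toUnit_unique (X := X) f g

lemma RelVar.comp_point_str {X : Over SpecC} (f : X ⟶ (RelVar.point 𝔐).obj) :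
    f ≫ (RelVar.point 𝔐).str = 1 := by
  rw [hom_point_ext f (toPoint 𝔐 X)]
  rfl

variable [IsCommMonObj 𝔐] {n : ℕ}

/-- The only configuration of degree zero has no particles, and its weight is the empty product. -/
lemma sum_cls_degree_zero {M : RelVar 𝔐} {A : ℕ → RelVar 𝔐} {B : Nat.Partition 0 → RelVar 𝔐}
    (hB : ∀ α, IsConfigurationSpace α M A (B α)) : ∑ α, cls (B α) = 1 := by
  obtain ⟨α, f, hf⟩ := exists_hom_configurationSpace hB (κ := Empty) (fun k => k.elim)
    (fun k => k.elim) (Fintype.sum_empty _) (V := (RelVar.point 𝔐).obj) (fun k => k.elim)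
    (fun k => k.elim) (fun K _ _ _ v k => k.elim)
  have key : ∀ (K : Type) [Field K] [Algebra ℂ K] [IsAlgClosed K] (x : Σ α, KPt K (B α).obj)
      (v : KPt K (RelVar.point 𝔐).obj), (⟨α, v ≫ f⟩ : Σ α, KPt K (B α).obj) = x := by
    rintro K _ _ _ ⟨β, b⟩ v
    refine IsConfigurationSpace.eq_of_code_eq hB ?_
    rw [(hf K v).1, Set.range_eq_empty]
    obtain ⟨o, rfl⟩ := (hB β).exists_lift b
    have : IsEmpty β.parts := ⟨fun p => by
      have := le_of_part β p
      have := part_pos p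
      omega⟩
    rw [IsConfigurationSpace.code_comp, Set.range_eq_empty]
  have h := sum_cls_eq_of_correspondence B (fun _ : Unit => RelVar.point 𝔐) (L := Unit)
    (fun _ => (RelVar.point 𝔐).obj) (fun _ => α) (fun _ => ()) (fun _ => f) (fun _ => 𝟙 _)
    (fun K _ _ _ x => ⟨(), RelVar.toPoint 𝔐 _, key K x _⟩)
    (fun K _ _ _ y => ⟨(), RelVar.toPoint 𝔐 _, congrArg (Sigma.mk ()) (RelVar.hom_point_ext _ _)⟩)
    (fun K _ _ _ l l' v v' => ⟨fun _ => congrArg (Sigma.mk ()) (RelVar.hom_point_ext _ _),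
      fun _ => key K _ v⟩) ?_
  · rw [h, Fintype.sum_unique, cls_point]
  · intro K _ _ _ l v
    rw [(hf K v).2, Fintype.prod_empty, Category.id_comp, RelVar.comp_point_str]

/-- A configuration of positive degree has a particle, and there is no position for it. -/
lemma sum_cls_empty {M : RelVar 𝔐} (hM : IsEmpty M.obj.left) {A : ℕ → RelVar 𝔐}
    {B : n.Partition → RelVar 𝔐} (hB : ∀ α, IsConfigurationSpace α M A (B α)) (hn : 0 < n) :
    ∑ α, cls (B α) = 0 := by
  have h := sum_cls_eq_of_correspondence B (fun k : Empty => (k.elim : RelVar 𝔐)) (L := Empty)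
    (fun _ => M.obj) (fun k => k.elim) (fun k => k) (fun k => k.elim) (fun k => k.elim)
    (fun K _ _ _ x => ?_) (fun K _ _ _ y => y.1.elim) (fun K _ _ _ l => l.elim)
    (fun K _ _ _ l => l.elim)
  · rw [h, Fintype.sum_empty]
  · obtain ⟨y, -⟩ := (hB x.1).code_nonempty hn x.2
    exact hM.elim (KPt.pt (K := K) y.1)

/-- On a point there is room for a single particle, which then has degree `n`; its position has
trivial weight, so only the state in `A n` remains. -/
lemma sum_cls_point {A : ℕ → RelVar 𝔐} {B : n.Partition → RelVar 𝔐}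
    (hB : ∀ α, IsConfigurationSpace α (RelVar.point 𝔐) A (B α)) (hn : 0 < n) :
    ∑ α, cls (B α) = cls (A n) := by
  obtain ⟨α, f, hf⟩ := exists_hom_configurationSpace hB (κ := Unit) (fun _ => n)
    (fun _ => hn) (by simp) (V := (A n).obj) (fun _ => RelVar.toPoint 𝔐 _)
    (fun _ => 𝟙 _) (fun K _ _ _ v k l _ => Subsingleton.elim _ _)
  have hcode : ∀ (K : Type) [Field K] [Algebra ℂ K] [IsAlgClosed K] (v : KPt K (A n).obj),
      (hB α).code (v ≫ f) = {(RelVar.toPoint 𝔐 _, (⟨n, v⟩ : Σ i, KPt K (A i).obj))} := by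
    intro K _ _ _ v
    rw [(hf K v).1, Set.range_const, Category.comp_id]
    exact congrArg _ (Prod.ext (RelVar.hom_point_ext _ _) rfl)
  have h := sum_cls_eq_of_correspondence B (fun _ : Unit => A n) (L := Unit)
    (fun _ => (A n).obj) (fun _ => α) (fun _ => ()) (fun _ => f) (fun _ => 𝟙 _)
    ?_ (fun K _ _ _ y => ⟨(), y.2, congrArg (Sigma.mk ()) (Category.comp_id _)⟩) ?_ ?_
  · rw [h, Fintype.sum_unique]
  · rintro K _ _ _ ⟨β, b⟩
    obtain ⟨o, rfl⟩ := (hB β).exists_lift b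
    have hs : Subsingleton β.parts := ⟨fun p q => particle_fst_injective o (RelVar.hom_point_ext _ _)⟩
    have hne : Nonempty β.parts := by
      by_contra h
      rw [not_nonempty_iff] at h
      have := sum_parts β
      rw [Fintype.sum_empty] at this
      omega
    obtain ⟨p⟩ := hne
    have hp : p.1 = n := by
      have := sum_parts β
      rwa [Fintype.sum_subsingleton _ p] at this
    have hex : ∀ {i : ℕ} (_ : i = n) (s : KPt K (A i).obj),
        ∃ a : KPt K (A n).obj, (⟨n, a⟩ : Σ i, KPt K (A i).obj) = ⟨i, s⟩ := by
      rintro _ rfl s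
      exact ⟨s, rfl⟩
    obtain ⟨a, ha⟩ := hex hp (particle o p).2.2
    refine ⟨(), a, IsConfigurationSpace.eq_of_code_eq hB ?_⟩
    rw [hcode, IsConfigurationSpace.code_comp, ha]
    have : Unique β.parts := ⟨⟨p⟩, fun _ => Subsingleton.elim _ _⟩
    rw [Set.range_unique]
    rw [show (default : β.parts) = p from Subsingleton.elim _ _]
    exact congrArg _ (Prod.ext (RelVar.hom_point_ext _ _) rfl)
  · intro K _ _ _ l l' v v'
    rw [Category.comp_id, Category.comp_id]
    constructor
    · intro h
      have e := congrArg (fun x : Σ α, KPt K (B α).obj => (hB x.1).code x.2) h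
      dsimp only at e
      rw [hcode, hcode, Set.singleton_eq_singleton_iff] at e
      have e' := congrArg Prod.snd e
      rw [show v = v' from eq_of_heq (Sigma.mk.inj e').2]
    · intro h
      rw [show v = v' from eq_of_heq (Sigma.mk.inj h).2]
  · intro K _ _ _ l v
    rw [(hf K v).2, Category.id_comp, Fintype.prod_unique]
    dsimp only [particleWeight]
    rw [RelVar.comp_point_str, one_pow, _root_.one_mul, Category.comp_id]

end Values

/-! ### Products of varieties over `𝔐` -/

namespace RelVar

variable {𝔐 : Over SpecC} [MonObj 𝔐] (X Y : RelVar 𝔐)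

/-- The first projection from a product. -/
def prodFst : (X.prod Y).obj ⟶ X.obj := fst X.obj Y.obj

/-- The second projection from a product. -/
def prodSnd : (X.prod Y).obj ⟶ Y.obj := snd X.obj Y.obj

variable {X Y} {T : Over SpecC}

/-- The morphism to a product with given components. -/
def prodLift (f : T ⟶ X.obj) (g : T ⟶ Y.obj) : T ⟶ (X.prod Y).obj := lift f g

lemma prodLift_fst (f : T ⟶ X.obj) (g : T ⟶ Y.obj) : prodLift f g ≫ prodFst X Y = f :=
  lift_fst f g

lemma prodLift_snd (f : T ⟶ X.obj) (g : T ⟶ Y.obj) : prodLift f g ≫ prodSnd X Y = g :=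
  lift_snd f g

lemma prod_hom_ext {f g : T ⟶ (X.prod Y).obj} (h1 : f ≫ prodFst X Y = g ≫ prodFst X Y)
    (h2 : f ≫ prodSnd X Y = g ≫ prodSnd X Y) : f = g :=
  CartesianMonoidalCategory.hom_ext (X := X.obj) (Y := Y.obj) f g h1 h2

lemma comp_prod_str (t : T ⟶ (X.prod Y).obj) :
    t ≫ (X.prod Y).str = ((t ≫ prodFst X Y) ≫ X.str) * ((t ≫ prodSnd X Y) ≫ Y.str) := by
  have h : (X.prod Y).str = (prodFst X Y ≫ X.str) * (prodSnd X Y ≫ Y.str) := prod_str X Y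
  rw [h, MonObj.comp_mul, Category.assoc, Category.assoc]

end RelVar

/-! ### Pairs of configurations -/

section Pairs

variable {𝔐 : Over SpecC} [MonObj 𝔐] [IsCommMonObj 𝔐] (n : ℕ)

/-- Pairs of partitions of numbers with sum `n`. -/
abbrev PairIndex : Type :=
  Σ x : Finset.HasAntidiagonal.antidiagonal n, Nat.Partition x.1.1 × Nat.Partition x.1.2

variable {n} {M₁ M₂ : RelVar 𝔐} {A₁ A₂ : ℕ → RelVar 𝔐} {B₁ B₂ : ∀ i, Nat.Partition i → RelVar 𝔐}

/-- Products of members of two families indexed by partitions. -/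
abbrev pairFamily (B₁ B₂ : ∀ i, Nat.Partition i → RelVar 𝔐) (l : PairIndex n) : RelVar 𝔐 :=
  (B₁ _ l.2.1).prod (B₂ _ l.2.2)

lemma sum_pairFamily :
    ∑ l : PairIndex n, cls (pairFamily B₁ B₂ l) =
      ∑ x ∈ Finset.HasAntidiagonal.antidiagonal n, (∑ α, cls (B₁ x.1 α)) * ∑ β, cls (B₂ x.2 β) := by
  rw [Fintype.sum_sigma]
  refine Eq.trans ?_ (Finset.sum_coe_sort (Finset.HasAntidiagonal.antidiagonal n)
    fun x => (∑ α, cls (B₁ x.1 α)) * ∑ β, cls (B₂ x.2 β))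
  refine Finset.sum_congr rfl fun x _ => ?_
  rw [Fintype.sum_prod_type, Finset.sum_mul_sum]
  exact Finset.sum_congr rfl fun α _ => Finset.sum_congr rfl fun β _ => cls_prod _ _

variable (h₁ : ∀ i α, IsConfigurationSpace α M₁ A₁ (B₁ i α))
  (h₂ : ∀ i α, IsConfigurationSpace α M₂ A₂ (B₂ i α))

/-- The two sets of particles of a pair of configurations. -/
def pairCode {K : Type} [Field K] [Algebra ℂ K]
    (x : Σ l : PairIndex n, KPt K (pairFamily B₁ B₂ l).obj) :
    Set (KPt K M₁.obj × Σ i, KPt K (A₁ i).obj) × Set (KPt K M₂.obj × Σ i, KPt K (A₂ i).obj) :=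
  ((h₁ _ x.1.2.1).code (x.2 ≫ RelVar.prodFst _ _), (h₂ _ x.1.2.2).code (x.2 ≫ RelVar.prodSnd _ _))

/-- A code determines the total degree of its configuration, so the splitting of `n` need not be
recorded separately. -/
lemma pairCode_injective {K : Type} [Field K] [Algebra ℂ K] [IsAlgClosed K] :
    Function.Injective (pairCode (n := n) (K := K) h₁ h₂) := by
  rintro ⟨⟨⟨⟨i, j⟩, hij⟩, α, β⟩, b⟩ ⟨⟨⟨⟨i', j'⟩, hij'⟩, α', β'⟩, b'⟩ h
  have e1 := congrArg Prod.fst h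
  have e2 := congrArg Prod.snd h
  dsimp only [pairCode] at e1 e2
  obtain rfl := (h₁ i α).parts_eq_of_code_eq (h₁ i' α') e1
  obtain rfl := (h₂ j β).parts_eq_of_code_eq (h₂ j' β') e2
  have e3 := IsConfigurationSpace.eq_of_code_eq (h₁ i) e1
  have e4 := IsConfigurationSpace.eq_of_code_eq (h₂ j) e2
  obtain rfl : α = α' := congrArg Sigma.fst e3
  obtain rfl : β = β' := congrArg Sigma.fst e4
  obtain rfl : b = b' := RelVar.prod_hom_ext
    (eq_of_heq (Sigma.mk.inj e3).2) (eq_of_heq (Sigma.mk.inj e4).2)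
  rfl

end Pairs

/-! ### Configurations on a disjoint union -/

section Additivity

variable {𝔐 : Over SpecC}

/-- The union of two sets of particles, as a set of particles in a disjoint union. -/
def coprodCode {M₁ M₂ : RelVar 𝔐} {K : Type} [Field K] [Algebra ℂ K] {S : Type}
    (c₁ : Set (KPt K M₁.obj × S)) (c₂ : Set (KPt K M₂.obj × S)) :
    Set (KPt K (M₁.coprod M₂).obj × S) :=
  {x | (∃ y ∈ c₁, (y.1 ≫ RelVar.inl M₁ M₂, y.2) = x) ∨ ∃ y ∈ c₂, (y.1 ≫ RelVar.inr M₁ M₂, y.2) = x}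

lemma coprodCode_subset {M₁ M₂ : RelVar 𝔐} {K : Type} [Field K] [Algebra ℂ K] {S : Type}
    {c₁ c₁' : Set (KPt K M₁.obj × S)} {c₂ c₂' : Set (KPt K M₂.obj × S)}
    (h : coprodCode c₁ c₂ ⊆ coprodCode c₁' c₂') : c₁ ⊆ c₁' ∧ c₂ ⊆ c₂' := by
  constructor
  · rintro ⟨x, s⟩ hx
    obtain ⟨y, hy, e⟩ | ⟨y, -, e⟩ := h (Or.inl ⟨_, hx, rfl⟩)
    · have e1 : y.1 = x := (cancel_mono (RelVar.inl M₁ M₂)).mp (congrArg Prod.fst e)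
      have e2 : y.2 = s := congrArg Prod.snd e
      rwa [← e1, ← e2]
    · exact (RelVar.kpt_inl_ne_inr _ _ _ _ (congrArg Prod.fst e).symm).elim
  · rintro ⟨x, s⟩ hx
    obtain ⟨y, -, e⟩ | ⟨y, hy, e⟩ := h (Or.inr ⟨_, hx, rfl⟩)
    · exact (RelVar.kpt_inl_ne_inr _ _ _ _ (congrArg Prod.fst e)).elim
    · have e1 : y.1 = x := (cancel_mono (RelVar.inr M₁ M₂)).mp (congrArg Prod.fst e)
      have e2 : y.2 = s := congrArg Prod.snd e
      rwa [← e1, ← e2]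

lemma coprodCode_eq_iff {M₁ M₂ : RelVar 𝔐} {K : Type} [Field K] [Algebra ℂ K] {S : Type}
    {c₁ c₁' : Set (KPt K M₁.obj × S)} {c₂ c₂' : Set (KPt K M₂.obj × S)} :
    coprodCode c₁ c₂ = coprodCode c₁' c₂' ↔ (c₁, c₂) = (c₁', c₂') := by
  constructor
  · intro h
    exact Prod.ext ((coprodCode_subset h.le).1.antisymm (coprodCode_subset h.ge).1)
      ((coprodCode_subset h.le).2.antisymm (coprodCode_subset h.ge).2)
  · intro h
    rw [show c₁ = c₁' from congrArg Prod.fst h, show c₂ = c₂' from congrArg Prod.snd h]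

variable [MonObj 𝔐] [IsCommMonObj 𝔐] {n : ℕ}

/-- The particles of a configuration on a disjoint union are distributed over the two components,
and particles in different components never collide. So pairs of ordered configurations map to both
sides and give the correspondence, the degrees adding up to `n` and the weights multiplying. -/
lemma sum_cls_coprod {M₁ M₂ : RelVar 𝔐} {A : ℕ → RelVar 𝔐} {B : n.Partition → RelVar 𝔐}
    {B₁ B₂ : ∀ i, Nat.Partition i → RelVar 𝔐}
    (hB : ∀ ξ, IsConfigurationSpace ξ (M₁.coprod M₂) A (B ξ))
    (h₁ : ∀ i α, IsConfigurationSpace α M₁ A (B₁ i α))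
    (h₂ : ∀ i α, IsConfigurationSpace α M₂ A (B₂ i α)) :
    ∑ ξ, cls (B ξ) = ∑ x ∈ Finset.HasAntidiagonal.antidiagonal n,
      (∑ α, cls (B₁ x.1 α)) * ∑ β, cls (B₂ x.2 β) := by
  rw [← sum_pairFamily]
  let V : PairIndex n → Over SpecC := fun l =>
    orderedObj l.2.1 M₁.obj (fun i => (A i).obj) ⊗ orderedObj l.2.2 M₂.obj (fun i => (A i).obj)
  have hg : ∀ l : PairIndex n, ∃ (ξ : n.Partition) (g : V l ⟶ (B ξ).obj),
      ∀ (K : Type) [Field K] [Algebra ℂ K] [IsAlgClosed K] (v : KPt K (V l)),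
        (hB ξ).code (v ≫ g) = coprodCode (Set.range (particle (v ≫ fst _ _)))
            (Set.range (particle (v ≫ snd _ _))) ∧
        v ≫ g ≫ (B ξ).str = (∏ p, particleWeight M₁ A (particle (v ≫ fst _ _) p)) *
          ∏ p, particleWeight M₂ A (particle (v ≫ snd _ _) p) := by
    intro l
    obtain ⟨ξ, g, hg⟩ := exists_hom_configurationSpace hB
      (κ := l.2.1.parts ⊕ l.2.2.parts) (Sum.elim (fun p => p.1) (fun p => p.1))
      (by rintro (p | p) <;> exact part_pos p)
      (by
        rw [Fintype.sum_sum_type]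
        simp only [Sum.elim_inl, Sum.elim_inr]
        rw [sum_parts, sum_parts]
        exact Finset.HasAntidiagonal.mem_antidiagonal.mp l.1.2)
      (V := V l)
      (Sum.elim (fun p => (fst _ _ ≫ position l.2.1 M₁.obj (fun i => (A i).obj) p) ≫ RelVar.inl M₁ M₂)
        (fun p => (snd _ _ ≫ position l.2.2 M₂.obj (fun i => (A i).obj) p) ≫ RelVar.inr M₁ M₂))
      (fun
        | .inl p => fst _ _ ≫ internalState l.2.1 M₁.obj (fun i => (A i).obj) p
        | .inr p => snd _ _ ≫ internalState l.2.2 M₂.obj (fun i => (A i).obj) p)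
      (by
        rintro K _ _ _ v (p | p) (q | q) h
        · simp only [Sum.elim_inl, ← Category.assoc, cancel_mono] at h
          exact congrArg _ (particle_fst_injective (v ≫ fst _ _) h)
        · simp only [Sum.elim_inl, Sum.elim_inr, ← Category.assoc] at h
          exact (RelVar.kpt_inl_ne_inr _ _ _ _ h).elim
        · simp only [Sum.elim_inl, Sum.elim_inr, ← Category.assoc] at h
          exact (RelVar.kpt_inl_ne_inr _ _ _ _ h.symm).elim
        · simp only [Sum.elim_inr, ← Category.assoc, cancel_mono] at h
          exact congrArg _ (particle_fst_injective (v ≫ snd _ _) h))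
    refine ⟨ξ, g, fun K _ _ _ v => ⟨(hg K v).1.trans ?_, (hg K v).2.trans ?_⟩⟩
    · ext x
      constructor
      · rintro ⟨p | p, rfl⟩
        · refine Or.inl ⟨_, ⟨p, rfl⟩, ?_⟩
          simp only [particle, Sum.elim_inl, Category.assoc]
        · refine Or.inr ⟨_, ⟨p, rfl⟩, ?_⟩
          simp only [particle, Sum.elim_inr, Category.assoc]
      · rintro (⟨_, ⟨p, rfl⟩, rfl⟩ | ⟨_, ⟨p, rfl⟩, rfl⟩)
        · refine ⟨.inl p, ?_⟩
          simp only [particle, Sum.elim_inl, Category.assoc]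
        · refine ⟨.inr p, ?_⟩
          simp only [particle, Sum.elim_inr, Category.assoc]
    · rw [Fintype.prod_sum_type]
      congr 1
      · refine Finset.prod_congr rfl fun p _ => ?_
        simp only [particleWeight, particle, Sum.elim_inl, Category.assoc, RelVar.inl_str]
      · refine Finset.prod_congr rfl fun p _ => ?_
        simp only [particleWeight, particle, Sum.elim_inr, Category.assoc, RelVar.inr_str]
  choose ξ g hg using hg
  let f : ∀ l : PairIndex n, V l ⟶ (pairFamily B₁ B₂ l).obj := fun l =>
    RelVar.prodLift (fst _ _ ≫ (h₁ _ l.2.1).map) (snd _ _ ≫ (h₂ _ l.2.2).map)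
  have hf1 : ∀ l, f l ≫ RelVar.prodFst _ _ = fst _ _ ≫ (h₁ _ l.2.1).map :=
    fun l => RelVar.prodLift_fst _ _
  have hf2 : ∀ l, f l ≫ RelVar.prodSnd _ _ = snd _ _ ≫ (h₂ _ l.2.2).map :=
    fun l => RelVar.prodLift_snd _ _
  have hcode : ∀ (K : Type) [Field K] [Algebra ℂ K] [IsAlgClosed K] (l : PairIndex n)
      (v : KPt K (V l)), pairCode h₁ h₂ ⟨l, v ≫ f l⟩ =
        (Set.range (particle (v ≫ fst _ _)), Set.range (particle (v ≫ snd _ _))) := by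
    intro K _ _ _ l v
    dsimp only [pairCode]
    rw [Category.assoc, Category.assoc, hf1, hf2, ← Category.assoc, ← Category.assoc,
      IsConfigurationSpace.code_comp, IsConfigurationSpace.code_comp]
  refine (sum_cls_eq_of_correspondence (pairFamily B₁ B₂) B V (fun l => l) ξ f g ?_ ?_ ?_ ?_).symm
  · rintro K _ _ _ ⟨l, b⟩
    obtain ⟨o₁, ho₁⟩ := (h₁ _ l.2.1).exists_lift (b ≫ RelVar.prodFst _ _)
    obtain ⟨o₂, ho₂⟩ := (h₂ _ l.2.2).exists_lift (b ≫ RelVar.prodSnd _ _)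
    refine ⟨l, lift o₁ o₂, congrArg (Sigma.mk l) (RelVar.prod_hom_ext ?_ ?_)⟩
    · rw [Category.assoc, hf1, lift_fst_assoc, ho₁]
    · rw [Category.assoc, hf2, lift_snd_assoc, ho₂]
  · rintro K _ _ _ ⟨β, b⟩
    obtain ⟨o, rfl⟩ := (hB β).exists_lift b
    classical
    -- The particles located in `M₁`; the remaining ones are located in `M₂`.
    let P : β.parts → Prop := fun p => ∃ x : KPt K M₁.obj, x ≫ RelVar.inl M₁ M₂ = (particle o p).1
    have hP : ∀ p, ¬ P p → ∃ x : KPt K M₂.obj, x ≫ RelVar.inr M₁ M₂ = (particle o p).1 :=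
      fun p hp => (RelVar.kpt_coprod _ _ (particle o p).1).resolve_left hp
    choose x₁ hx₁ using fun p : {p // P p} => p.2
    choose x₂ hx₂ using fun p : {p // ¬ P p} => hP p.1 p.2
    obtain ⟨i, hi⟩ : ∃ i, ∑ p : {p // P p}, p.1.1 = i := ⟨_, rfl⟩
    obtain ⟨j, hj⟩ : ∃ j, ∑ p : {p // ¬ P p}, p.1.1 = j := ⟨_, rfl⟩
    obtain ⟨α₁, o₁, e₁, he₁⟩ := exists_kpt_orderedObj (M := M₁.obj) (A := fun i => (A i).obj)
      (fun p : {p // P p} => p.1.1) (fun p => part_pos p.1) hi x₁ (fun p => (particle o p.1).2.2)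
      (fun p q h => Subtype.ext (particle_fst_injective o (by
        dsimp only; rw [← hx₁ p, ← hx₁ q, h])))
    obtain ⟨α₂, o₂, e₂, he₂⟩ := exists_kpt_orderedObj (M := M₂.obj) (A := fun i => (A i).obj)
      (fun p : {p // ¬ P p} => p.1.1) (fun p => part_pos p.1) hj x₂ (fun p => (particle o p.1).2.2)
      (fun p q h => Subtype.ext (particle_fst_injective o (by
        dsimp only; rw [← hx₂ p, ← hx₂ q, h])))
    have hsum : i + j = n := by
      rw [← hi, ← hj, Fintype.sum_subtype_add_sum_subtype P fun p : β.parts => p.1, sum_parts]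
    obtain ⟨l, v, hv₁, hv₂⟩ : ∃ (l : PairIndex n) (v : KPt K (V l)),
        Set.range (particle (v ≫ fst _ _)) = Set.range (particle o₁) ∧
        Set.range (particle (v ≫ snd _ _)) = Set.range (particle o₂) :=
      ⟨⟨⟨(i, j), Finset.HasAntidiagonal.mem_antidiagonal.mpr hsum⟩, α₁, α₂⟩, lift o₁ o₂,
        congrArg (fun o => Set.range (particle o)) (lift_fst o₁ o₂),
        congrArg (fun o => Set.range (particle o)) (lift_snd o₁ o₂)⟩
    refine ⟨l, v, IsConfigurationSpace.eq_of_code_eq hB ?_⟩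
    rw [(hg l K v).1, hv₁, hv₂, IsConfigurationSpace.code_comp]
    ext x
    constructor
    · rintro (⟨_, ⟨p, rfl⟩, rfl⟩ | ⟨_, ⟨p, rfl⟩, rfl⟩)
      · refine ⟨(e₁ p).1, ?_⟩
        rw [he₁, hx₁]
        rfl
      · refine ⟨(e₂ p).1, ?_⟩
        rw [he₂, hx₂]
        rfl
    · rintro ⟨p, rfl⟩
      by_cases hp : P p
      · refine Or.inl ⟨_, ⟨e₁.symm ⟨p, hp⟩, rfl⟩, ?_⟩
        rw [he₁, e₁.apply_symm_apply, hx₁]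
        rfl
      · refine Or.inr ⟨_, ⟨e₂.symm ⟨p, hp⟩, rfl⟩, ?_⟩
        rw [he₂, e₂.apply_symm_apply, hx₂]
        rfl
  · intro K _ _ _ l l' v v'
    rw [← (pairCode_injective h₁ h₂).eq_iff, hcode, hcode, ← coprodCode_eq_iff, ← (hg l K v).1,
      ← (hg l' K v').1]
    constructor
    · exact fun h => IsConfigurationSpace.eq_of_code_eq hB h
    · intro h
      have e := congrArg (fun x : Σ α, KPt K (B α).obj => (hB x.1).code x.2) h
      exact e
  · intro K _ _ _ l v
    rw [(hg l K v).2, ← Category.assoc, RelVar.comp_prod_str]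
    congr 1
    · rw [Category.assoc v, hf1, Category.assoc, Category.assoc, (h₁ _ l.2.1).map_str,
        ← Category.assoc, comp_totalWeight_eq]
    · rw [Category.assoc v, hf2, Category.assoc, Category.assoc, (h₂ _ l.2.2).map_str,
        ← Category.assoc, comp_totalWeight_eq]

end Additivity

/-! ### Products of series -/

section Multiplicativity

/-- The first components of the states of a set of particles, where they have positive degree. -/
def fstCode {X S₁ S₂ S : Type} (d₁ : S₁ → ℕ) (comb : S₁ × S₂ → S) (c : Set (X × S)) : Set (X × S₁) :=
  {x | 0 < d₁ x.2 ∧ ∃ b, (x.1, comb (x.2, b)) ∈ c}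

/-- The second components of the states of a set of particles, where they have positive degree. -/
def sndCode {X S₁ S₂ S : Type} (d₂ : S₂ → ℕ) (comb : S₁ × S₂ → S) (c : Set (X × S)) : Set (X × S₂) :=
  {x | 0 < d₂ x.2 ∧ ∃ a, (x.1, comb (a, x.2)) ∈ c}

/-- A component of positive degree is visible in its code, and one of degree zero is unique by `h₁`
or `h₂`, so the two codes determine the state at each position. By `hpos` at least one of the
components is visible, so no position is lost. -/
lemma subset_of_fstCode_of_sndCode {X S₁ S₂ S : Type} {d₁ : S₁ → ℕ} {d₂ : S₂ → ℕ}
    (h₁ : ∀ a a', d₁ a = 0 → d₁ a' = 0 → a = a') (h₂ : ∀ a a', d₂ a = 0 → d₂ a' = 0 → a = a')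
    {comb : S₁ × S₂ → S} (hcomb : Function.Bijective comb) {c c' : Set (X × S)}
    (hc : Set.InjOn Prod.fst c) (hc' : Set.InjOn Prod.fst c')
    (hpos : ∀ x a b, (x, comb (a, b)) ∈ c → 0 < d₁ a + d₂ b)
    (e₁ : fstCode d₁ comb c = fstCode d₁ comb c') (e₂ : sndCode d₂ comb c = sndCode d₂ comb c') :
    c ⊆ c' := by
  have inj : ∀ {c : Set (X × S)} (_ : Set.InjOn Prod.fst c) {x a b a' b'}, (x, comb (a, b)) ∈ c →
      (x, comb (a', b')) ∈ c → a = a' ∧ b = b' := by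
    intro c hc x a b a' b' h h'
    have := hcomb.1 (congrArg Prod.snd (hc h h' rfl))
    exact ⟨congrArg Prod.fst this, congrArg Prod.snd this⟩
  have key₁ : ∀ {x a b a' b'}, (x, comb (a, b)) ∈ c → (x, comb (a', b')) ∈ c' → a = a' := by
    intro x a b a' b' h h'
    by_cases ha : 0 < d₁ a
    · have hm : (x, a) ∈ fstCode d₁ comb c := ⟨ha, b, h⟩
      rw [e₁] at hm
      obtain ⟨-, b'', h''⟩ := hm
      exact (inj hc' h'' h').1
    · by_cases ha' : 0 < d₁ a'
      · have hm : (x, a') ∈ fstCode d₁ comb c' := ⟨ha', b', h'⟩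
        rw [← e₁] at hm
        obtain ⟨-, b'', h''⟩ := hm
        exact (inj hc h h'').1
      · exact h₁ _ _ (by omega) (by omega)
  have key₂ : ∀ {x a b a' b'}, (x, comb (a, b)) ∈ c → (x, comb (a', b')) ∈ c' → b = b' := by
    intro x a b a' b' h h'
    by_cases hb : 0 < d₂ b
    · have hm : (x, b) ∈ sndCode d₂ comb c := ⟨hb, a, h⟩
      rw [e₂] at hm
      obtain ⟨-, b'', h''⟩ := hm
      exact (inj hc' h'' h').2
    · by_cases hb' : 0 < d₂ b'
      · have hm : (x, b') ∈ sndCode d₂ comb c' := ⟨hb', a', h'⟩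
        rw [← e₂] at hm
        obtain ⟨-, b'', h''⟩ := hm
        exact (inj hc h h'').2
      · exact h₂ _ _ (by omega) (by omega)
  rintro ⟨x, s⟩ hx
  obtain ⟨⟨a, b⟩, rfl⟩ := hcomb.2 s
  have h0 := hpos x a b hx
  obtain ⟨a', b', h'⟩ : ∃ a' b', (x, comb (a', b')) ∈ c' := by
    by_cases ha : 0 < d₁ a
    · have hm : (x, a) ∈ fstCode d₁ comb c := ⟨ha, b, hx⟩
      rw [e₁] at hm
      obtain ⟨-, b'', h''⟩ := hm
      exact ⟨_, _, h''⟩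
    · have hm : (x, b) ∈ sndCode d₂ comb c := ⟨by dsimp only; omega, a, hx⟩
      rw [e₂] at hm
      obtain ⟨-, b'', h''⟩ := hm
      exact ⟨_, _, h''⟩
  rwa [key₁ hx h', key₂ hx h']

lemma prod_subtype_eq {κ W : Type*} [Fintype κ] [CommMonoid W] (P : κ → Prop) [DecidablePred P]
    (f : κ → W) (h : ∀ k, ¬ P k → f k = 1) : ∏ k : {k // P k}, f k = ∏ k, f k := by
  rw [← Fintype.prod_subtype_mul_prod_subtype P f,
    Fintype.prod_eq_one (fun k : {k // ¬ P k} => f k) fun k => h k.1 k.2, _root_.mul_one]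

lemma sum_subtype_pos {κ : Type*} [Fintype κ] (f : κ → ℕ) :
    ∑ k : {k // 0 < f k}, f k = ∑ k, f k := by
  rw [← Fintype.sum_subtype_add_sum_subtype (fun k => 0 < f k) f,
    Fintype.sum_eq_zero (fun k : {k // ¬ 0 < f k} => f k) fun k => by have := k.2; omega, add_zero]

variable {𝔐 : Over SpecC} [MonObj 𝔐]

/-- The pairs `(i, j)` with `i + j = k`. -/
abbrev AntidiagIndex (k : ℕ) : Type := Finset.HasAntidiagonal.antidiagonal k

variable {M : RelVar 𝔐} {A₁ A₂ C : ℕ → RelVar 𝔐}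
  {inj : ∀ (k : ℕ) (x : AntidiagIndex k), ((A₁ x.1.1).prod (A₂ x.1.2)).obj ⟶ (C k).obj}

/-- The pair of states in the product family given by two states. -/
def combineStates
    (inj : ∀ (k : ℕ) (x : AntidiagIndex k), ((A₁ x.1.1).prod (A₂ x.1.2)).obj ⟶ (C k).obj)
    (K : Type) [Field K] [Algebra ℂ K]
    (s : (Σ i, KPt K (A₁ i).obj) × Σ j, KPt K (A₂ j).obj) : Σ k, KPt K (C k).obj :=
  ⟨s.1.1 + s.2.1, RelVar.prodLift s.1.2 s.2.2 ≫
    inj _ ⟨(s.1.1, s.2.1), Finset.HasAntidiagonal.mem_antidiagonal.mpr rfl⟩⟩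

lemma combineStates_prod {K : Type} [Field K] [Algebra ℂ K] {k : ℕ} (x : AntidiagIndex k)
    (w : KPt K ((A₁ x.1.1).prod (A₂ x.1.2)).obj) :
    combineStates inj K (⟨x.1.1, w ≫ RelVar.prodFst _ _⟩, ⟨x.1.2, w ≫ RelVar.prodSnd _ _⟩) =
      ⟨k, w ≫ inj k x⟩ := by
  obtain ⟨⟨i, j⟩, hij⟩ := x
  obtain rfl : i + j = k := Finset.HasAntidiagonal.mem_antidiagonal.mp hij
  refine congrArg (Sigma.mk (i + j)) ?_
  congr 1
  exact RelVar.prod_hom_ext (RelVar.prodLift_fst _ _) (RelVar.prodLift_snd _ _)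

lemma combineStates_bijective
    (hC : ∀ k, IsSum (fun x : AntidiagIndex k => (A₁ x.1.1).prod (A₂ x.1.2)) (C k) (inj k))
    {K : Type} [Field K] [Algebra ℂ K] [IsAlgClosed K] :
    Function.Bijective (combineStates inj K) := by
  constructor
  · have key : ∀ {k k' : ℕ} (x : AntidiagIndex k) (x' : AntidiagIndex k')
        (w : KPt K ((A₁ x.1.1).prod (A₂ x.1.2)).obj) (w' : KPt K ((A₁ x'.1.1).prod (A₂ x'.1.2)).obj),
        (⟨k, w ≫ inj k x⟩ : Σ k, KPt K (C k).obj) = ⟨k', w' ≫ inj k' x'⟩ →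
        ((⟨x.1.1, w ≫ RelVar.prodFst _ _⟩, ⟨x.1.2, w ≫ RelVar.prodSnd _ _⟩) :
          (Σ i, KPt K (A₁ i).obj) × Σ j, KPt K (A₂ j).obj) =
        (⟨x'.1.1, w' ≫ RelVar.prodFst _ _⟩, ⟨x'.1.2, w' ≫ RelVar.prodSnd _ _⟩) := by
      intro k k' x x' w w' h
      obtain rfl : k = k' := congrArg Sigma.fst h
      have h1 := ((hC k).bijective K).1 (a₁ := ⟨x, w⟩) (a₂ := ⟨x', w'⟩)
        (eq_of_heq (Sigma.mk.inj h).2)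
      cases h1
      rfl
    rintro ⟨⟨i, a⟩, ⟨j, b⟩⟩ ⟨⟨i', a'⟩, ⟨j', b'⟩⟩ h
    have := key (k := i + j) (k' := i' + j')
      ⟨(i, j), Finset.HasAntidiagonal.mem_antidiagonal.mpr rfl⟩
      ⟨(i', j'), Finset.HasAntidiagonal.mem_antidiagonal.mpr rfl⟩
      (RelVar.prodLift a b) (RelVar.prodLift a' b') h
    rw [RelVar.prodLift_fst, RelVar.prodLift_fst, RelVar.prodLift_snd, RelVar.prodLift_snd] at this
    exact this
  · rintro ⟨k, z⟩
    obtain ⟨⟨x, w⟩, rfl⟩ := ((hC k).bijective K).2 z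
    exact ⟨_, combineStates_prod x w⟩

variable [IsCommMonObj 𝔐] {n : ℕ}

/-- A particle with state in `A₁ i × A₂ j` is split into particles of degrees `i` and `j` at the
same position, and those of degree zero are dropped. As `A₁ 0` and `A₂ 0` are the point itself, a
dropped particle carries neither information nor weight. -/
lemma sum_cls_mul (hC : ∀ k, IsSum (fun x : AntidiagIndex k => (A₁ x.1.1).prod (A₂ x.1.2)) (C k) (inj k))
    (hA₁ : A₁ 0 = RelVar.point 𝔐) (hA₂ : A₂ 0 = RelVar.point 𝔐) {B : n.Partition → RelVar 𝔐}
    {B₁ B₂ : ∀ i, Nat.Partition i → RelVar 𝔐} (hB : ∀ ξ, IsConfigurationSpace ξ M C (B ξ))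
    (h₁ : ∀ i α, IsConfigurationSpace α M A₁ (B₁ i α))
    (h₂ : ∀ i α, IsConfigurationSpace α M A₂ (B₂ i α)) :
    ∑ ξ, cls (B ξ) = ∑ x ∈ Finset.HasAntidiagonal.antidiagonal n,
      (∑ α, cls (B₁ x.1 α)) * ∑ β, cls (B₂ x.2 β) := by
  have hpt : ∀ {X : RelVar 𝔐} (_ : X = RelVar.point 𝔐) {T : Over SpecC} (f g : T ⟶ X.obj), f = g := by
    rintro _ rfl T f g
    exact RelVar.hom_point_ext f g
  have hpt' : ∀ {X : RelVar 𝔐} (_ : X = RelVar.point 𝔐) (T : Over SpecC), Nonempty (T ⟶ X.obj) := by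
    rintro _ rfl T
    exact ⟨RelVar.toPoint 𝔐 T⟩
  have hptw : ∀ {X : RelVar 𝔐} (_ : X = RelVar.point 𝔐) {T : Over SpecC} (f : T ⟶ X.obj),
      f ≫ X.str = 1 := by
    rintro _ rfl T f
    exact RelVar.comp_point_str f
  have hd₁ : ∀ (K : Type) [Field K] [Algebra ℂ K] (a a' : Σ i, KPt K (A₁ i).obj), a.1 = 0 →
      a'.1 = 0 → a = a' := by
    rintro K _ _ ⟨i, a⟩ ⟨i', a'⟩ (rfl : i = 0) (rfl : i' = 0)
    rw [hpt hA₁ a a']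
  have hd₂ : ∀ (K : Type) [Field K] [Algebra ℂ K] (a a' : Σ i, KPt K (A₂ i).obj), a.1 = 0 →
      a'.1 = 0 → a = a' := by
    rintro K _ _ ⟨i, a⟩ ⟨i', a'⟩ (rfl : i = 0) (rfl : i' = 0)
    rw [hpt hA₂ a a']
  rw [← sum_pairFamily]
  refine sum_cls_configurationSpace_eq hB (E := AntidiagIndex)
    (fun k x => ((A₁ x.1.1).prod (A₂ x.1.2)).obj) inj (fun K _ _ _ k _ z => ?_) (pairFamily B₁ B₂)
    (fun K _ _ => Set (KPt K M.obj × Σ i, KPt K (A₁ i).obj) × Set (KPt K M.obj × Σ i, KPt K (A₂ i).obj))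
    (fun K _ _ => pairCode h₁ h₂) (fun K _ _ _ => pairCode_injective h₁ h₂)
    (fun K _ _ c => (fstCode Sigma.fst (combineStates inj K) c,
      sndCode Sigma.fst (combineStates inj K) c)) ?_ ?_ ?_
  · obtain ⟨⟨x, w⟩, hw⟩ := ((hC k).bijective K).2 z
    exact ⟨x, w, hw⟩
  · intro δ χ
    -- Only the parts whose component in the respective family has positive degree give particles;
    -- the sums over them are the degrees of the two configurations.
    obtain ⟨i, hi⟩ : ∃ i, ∑ p : {p : δ.parts // 0 < (χ p).1.1}, (χ p.1).1.1 = i := ⟨_, rfl⟩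
    obtain ⟨j, hj⟩ : ∃ j, ∑ p : {p : δ.parts // 0 < (χ p).1.2}, (χ p.1).1.2 = j := ⟨_, rfl⟩
    have hij : i + j = n := by
      rw [← hi, ← hj, sum_subtype_pos fun p => (χ p).1.1, sum_subtype_pos fun p => (χ p).1.2,
        ← Finset.sum_add_distrib]
      exact (Finset.sum_congr rfl fun p _ =>
        Finset.HasAntidiagonal.mem_antidiagonal.mp (χ p).2).trans (sum_parts δ)
    obtain ⟨α, f₁, hf₁⟩ := exists_hom_configurationSpace (h₁ i)
      (fun p : {p : δ.parts // 0 < (χ p).1.1} => (χ p.1).1.1) (fun p => p.2) hi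
      (V := confState δ M.obj (fun p => ((A₁ (χ p).1.1).prod (A₂ (χ p).1.2)).obj))
      (fun p => confPos p.1) (fun p => confSt p.1 ≫ RelVar.prodFst _ _)
      (fun K _ _ _ v p q h => Subtype.ext (confPos_injective v h))
    obtain ⟨β, f₂, hf₂⟩ := exists_hom_configurationSpace (h₂ j)
      (fun p : {p : δ.parts // 0 < (χ p).1.2} => (χ p.1).1.2) (fun p => p.2) hj
      (V := confState δ M.obj (fun p => ((A₁ (χ p).1.1).prod (A₂ (χ p).1.2)).obj))
      (fun p => confPos p.1) (fun p => confSt p.1 ≫ RelVar.prodSnd _ _)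
      (fun K _ _ _ v p q h => Subtype.ext (confPos_injective v h))
    have hcomb : ∀ (K : Type) [Field K] [Algebra ℂ K]
        (v : KPt K (confState δ M.obj (fun p => ((A₁ (χ p).1.1).prod (A₂ (χ p).1.2)).obj)))
        (p : δ.parts), combineStates inj K (⟨(χ p).1.1, v ≫ confSt p ≫ RelVar.prodFst _ _⟩,
          ⟨(χ p).1.2, v ≫ confSt p ≫ RelVar.prodSnd _ _⟩) =
        ⟨p.1, (v ≫ confSt p) ≫ inj p.1 (χ p)⟩ := by
      intro K _ _ v p
      rw [← Category.assoc, ← Category.assoc]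
      exact combineStates_prod (χ p) (v ≫ confSt p)
    refine ⟨⟨⟨(i, j), Finset.HasAntidiagonal.mem_antidiagonal.mpr hij⟩, α, β⟩,
      RelVar.prodLift f₁ f₂, fun K _ _ _ v => ⟨?_, ?_⟩⟩
    · dsimp only [pairCode]
      rw [Category.assoc, Category.assoc, RelVar.prodLift_fst, RelVar.prodLift_snd, (hf₁ K v).1,
        (hf₂ K v).1]
      refine Prod.ext ?_ ?_
      · ext x
        constructor
        · rintro ⟨p, rfl⟩
          exact ⟨p.2, _, p.1, Prod.ext rfl (hcomb K v p.1).symm⟩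
        · rintro ⟨h0, b, p, hp⟩
          have e := (combineStates_bijective hC).1
            ((congrArg Prod.snd hp).symm.trans (hcomb K v p).symm)
          have e1 : x.2 = (⟨(χ p).1.1, v ≫ confSt p ≫ RelVar.prodFst _ _⟩ :
            Σ i, KPt K (A₁ i).obj) := congrArg Prod.fst e
          have e0 : v ≫ confPos p = x.1 := congrArg Prod.fst hp
          have hp' : 0 < (χ p).1.1 := by
            rw [e1] at h0
            exact h0
          exact ⟨⟨p, hp'⟩, Prod.ext e0 e1.symm⟩
      · ext x
        constructor
        · rintro ⟨p, rfl⟩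
          exact ⟨p.2, _, p.1, Prod.ext rfl (hcomb K v p.1).symm⟩
        · rintro ⟨h0, b, p, hp⟩
          have e := (combineStates_bijective hC).1
            ((congrArg Prod.snd hp).symm.trans (hcomb K v p).symm)
          have e1 : x.2 = (⟨(χ p).1.2, v ≫ confSt p ≫ RelVar.prodSnd _ _⟩ :
            Σ i, KPt K (A₂ i).obj) := congrArg Prod.snd e
          have e0 : v ≫ confPos p = x.1 := congrArg Prod.fst hp
          have hp' : 0 < (χ p).1.2 := by
            rw [e1] at h0
            exact h0
          exact ⟨⟨p, hp'⟩, Prod.ext e0 e1.symm⟩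
    · have hz₁ : ∀ {i : ℕ} (_ : ¬ 0 < i) (x : KPt K M.obj) (a : KPt K (A₁ i).obj),
          particleWeight M A₁ (x, ⟨i, a⟩) = 1 := by
        intro i hi x a
        obtain rfl : i = 0 := by omega
        rw [particleWeight, pow_zero, _root_.one_mul, hptw hA₁]
      have hz₂ : ∀ {i : ℕ} (_ : ¬ 0 < i) (x : KPt K M.obj) (a : KPt K (A₂ i).obj),
          particleWeight M A₂ (x, ⟨i, a⟩) = 1 := by
        intro i hi x a
        obtain rfl : i = 0 := by omega
        rw [particleWeight, pow_zero, _root_.one_mul, hptw hA₂]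
      have hw : v ≫ RelVar.prodLift f₁ f₂ ≫ ((B₁ i α).prod (B₂ j β)).str =
          (v ≫ f₁ ≫ (B₁ i α).str) * (v ≫ f₂ ≫ (B₂ j β).str) := by
        rw [RelVar.comp_prod_str, RelVar.prodLift_fst, RelVar.prodLift_snd, MonObj.comp_mul]
      refine hw.trans ?_
      rw [(hf₁ K v).2, (hf₂ K v).2]
      rw [prod_subtype_eq (fun p : δ.parts => 0 < (χ p).1.1) (fun p => particleWeight M A₁
          (v ≫ confPos p, ⟨(χ p).1.1, v ≫ confSt p ≫ RelVar.prodFst _ _⟩)) fun p hp => hz₁ hp _ _,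
        prod_subtype_eq (fun p : δ.parts => 0 < (χ p).1.2) (fun p => particleWeight M A₂
          (v ≫ confPos p, ⟨(χ p).1.2, v ≫ confSt p ≫ RelVar.prodSnd _ _⟩)) fun p hp => hz₂ hp _ _,
        ← Finset.prod_mul_distrib]
      refine Finset.prod_congr rfl fun p _ => ?_
      have hp : (χ p).1.1 + (χ p).1.2 = p.1 := Finset.HasAntidiagonal.mem_antidiagonal.mp (χ p).2
      have e : ((v ≫ confSt p) ≫ inj p.1 (χ p)) ≫ (C p.1).str =
          ((v ≫ confSt p ≫ RelVar.prodFst _ _) ≫ (A₁ (χ p).1.1).str) *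
          ((v ≫ confSt p ≫ RelVar.prodSnd _ _) ≫ (A₂ (χ p).1.2).str) := by
        rw [Category.assoc, (hC p.1).inj_str, RelVar.comp_prod_str]
        simp only [Category.assoc]
      dsimp only [particleWeight]
      have hpow : ((v ≫ confPos p) ≫ M.str) ^ (p.1 : ℕ) =
          ((v ≫ confPos p) ≫ M.str) ^ (χ p).1.1 * ((v ≫ confPos p) ≫ M.str) ^ (χ p).1.2 := by
        rw [← pow_add, hp]
      rw [e, hpow, _root_.mul_mul_mul_comm]
  · intro K _ _ _ δ δ' b b' h
    have key : ∀ (δ δ' : n.Partition) (b : KPt K (B δ).obj) (b' : KPt K (B δ').obj),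
        (fstCode Sigma.fst (combineStates inj K) ((hB δ).code b),
          sndCode Sigma.fst (combineStates inj K) ((hB δ).code b)) =
        (fstCode Sigma.fst (combineStates inj K) ((hB δ').code b'),
          sndCode Sigma.fst (combineStates inj K) ((hB δ').code b')) →
        (hB δ).code b ⊆ (hB δ').code b' := fun δ δ' b b' h =>
      subset_of_fstCode_of_sndCode (hd₁ K) (hd₂ K) (combineStates_bijective hC)
        ((hB δ).injOn_code b) ((hB δ').injOn_code b')
        (fun x a a' hx => (hB δ).degree_pos_of_mem_code hx)
        (congrArg Prod.fst h) (congrArg Prod.snd h)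
    exact (key _ _ _ _ h).antisymm (key _ _ _ _ h.symm)
  · rintro K _ _ _ ⟨⟨⟨⟨i, j⟩, hij⟩, α, β⟩, b⟩
    replace hij : i + j = n := Finset.HasAntidiagonal.mem_antidiagonal.mp hij
    obtain ⟨o₁, ho₁⟩ := (h₁ i α).exists_lift (b ≫ RelVar.prodFst _ _)
    obtain ⟨o₂, ho₂⟩ := (h₂ j β).exists_lift (b ≫ RelVar.prodSnd _ _)
    obtain ⟨z₁⟩ := hpt' hA₁ (SpecK K)
    obtain ⟨z₂⟩ := hpt' hA₂ (SpecK K)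
    -- Positions not occupied in one of the configurations receive there the unique state of degree
    -- zero. The combined configuration lives on the set `Y` of positions occupied in at least one
    -- of them.
    let a₁ : KPt K M.obj → Σ i, KPt K (A₁ i).obj :=
      Function.extend (fun p => (particle o₁ p).1) (fun p => (particle o₁ p).2) fun _ => ⟨0, z₁⟩
    let a₂ : KPt K M.obj → Σ i, KPt K (A₂ i).obj :=
      Function.extend (fun p => (particle o₂ p).1) (fun p => (particle o₂ p).2) fun _ => ⟨0, z₂⟩
    have ha₁ : ∀ p, a₁ (particle o₁ p).1 = (particle o₁ p).2 := fun p =>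
      (particle_fst_injective o₁).extend_apply _ _ p
    have ha₂ : ∀ p, a₂ (particle o₂ p).1 = (particle o₂ p).2 := fun p =>
      (particle_fst_injective o₂).extend_apply _ _ p
    have hz₁ : ∀ x, x ∉ Set.range (fun p => (particle o₁ p).1) → (a₁ x).1 = 0 := fun x hx =>
      congrArg Sigma.fst (Function.extend_apply' _ _ x hx)
    have hz₂ : ∀ x, x ∉ Set.range (fun p => (particle o₂ p).1) → (a₂ x).1 = 0 := fun x hx =>
      congrArg Sigma.fst (Function.extend_apply' _ _ x hx)
    let Y : Set (KPt K M.obj) :=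
      Set.range (fun p => (particle o₁ p).1) ∪ Set.range fun p => (particle o₂ p).1
    have hY : Finite Y := ((Set.finite_range _).union (Set.finite_range _)).to_subtype
    have := Fintype.ofFinite Y
    have hs₁ : ∑ y : Y, (a₁ y.1).1 = i := by
      refine Eq.trans ?_ (sum_parts α)
      refine (Fintype.sum_of_injective (fun p => (⟨(particle o₁ p).1, Or.inl ⟨p, rfl⟩⟩ : Y))
        (fun p q h => particle_fst_injective o₁ (congrArg Subtype.val h)) _ _ (fun y hy => ?_)
        fun p => ?_).symm
      · refine hz₁ y.1 fun hy' => hy ?_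
        obtain ⟨p, hp⟩ := hy'
        exact ⟨p, Subtype.ext hp⟩
      · rw [ha₁]
        rfl
    have hs₂ : ∑ y : Y, (a₂ y.1).1 = j := by
      refine Eq.trans ?_ (sum_parts β)
      refine (Fintype.sum_of_injective (fun p => (⟨(particle o₂ p).1, Or.inr ⟨p, rfl⟩⟩ : Y))
        (fun p q h => particle_fst_injective o₂ (congrArg Subtype.val h)) _ _ (fun y hy => ?_)
        fun p => ?_).symm
      · refine hz₂ y.1 fun hy' => hy ?_
        obtain ⟨p, hp⟩ := hy'
        exact ⟨p, Subtype.ext hp⟩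
      · rw [ha₂]
        rfl
    obtain ⟨δ, b', hb'⟩ := exists_kpt_configurationSpace hB
      (fun y : Y => (combineStates inj K (a₁ y.1, a₂ y.1)).1) (by
        rintro ⟨_, ⟨p, rfl⟩ | ⟨p, rfl⟩⟩
        · have : (a₁ (particle o₁ p).1).1 = p.1 := congrArg Sigma.fst (ha₁ p)
          have := part_pos p
          change 0 < (a₁ (particle o₁ p).1).1 + (a₂ (particle o₁ p).1).1
          omega
        · have : (a₂ (particle o₂ p).1).1 = p.1 := congrArg Sigma.fst (ha₂ p)
          have := part_pos p
          change 0 < (a₁ (particle o₂ p).1).1 + (a₂ (particle o₂ p).1).1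
          omega)
      (by
        change ∑ y : Y, ((a₁ y.1).1 + (a₂ y.1).1) = n
        rw [Finset.sum_add_distrib, hs₁, hs₂, hij])
      (fun y => y.1) (fun y => (combineStates inj K (a₁ y.1, a₂ y.1)).2) Subtype.val_injective
    refine ⟨δ, b', ?_⟩
    dsimp only [pairCode]
    rw [← ho₁, ← ho₂, IsConfigurationSpace.code_comp, IsConfigurationSpace.code_comp, hb']
    refine Prod.ext ?_ ?_
    · ext x
      constructor
      · rintro ⟨h0, s, y, hy⟩
        have e := (combineStates_bijective hC).1 (congrArg Prod.snd hy)
        have e1 : a₁ y.1 = x.2 := congrArg Prod.fst e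
        have e2 : y.1 = x.1 := congrArg Prod.fst hy
        by_cases hx : x.1 ∈ Set.range fun p => (particle o₁ p).1
        · obtain ⟨p, hp⟩ := hx
          dsimp only at hp
          refine ⟨p, Prod.ext hp ?_⟩
          rw [← ha₁, hp, ← e2, e1]
        · have := hz₁ _ hx
          rw [← e2, e1] at this
          omega
      · rintro ⟨p, rfl⟩
        refine ⟨part_pos p, a₂ (particle o₁ p).1, ⟨_, Or.inl ⟨p, rfl⟩⟩, Prod.ext rfl ?_⟩
        dsimp only
        rw [ha₁]
    · ext x
      constructor
      · rintro ⟨h0, s, y, hy⟩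
        have e := (combineStates_bijective hC).1 (congrArg Prod.snd hy)
        have e1 : a₂ y.1 = x.2 := congrArg Prod.snd e
        have e2 : y.1 = x.1 := congrArg Prod.fst hy
        by_cases hx : x.1 ∈ Set.range fun p => (particle o₂ p).1
        · obtain ⟨p, hp⟩ := hx
          dsimp only at hp
          refine ⟨p, Prod.ext hp ?_⟩
          rw [← ha₂, hp, ← e2, e1]
        · have := hz₂ _ hx
          rw [← e2, e1] at this
          omega
      · rintro ⟨p, rfl⟩
        refine ⟨part_pos p, a₁ (particle o₂ p).1, ⟨_, Or.inr ⟨p, rfl⟩⟩, Prod.ext rfl ?_⟩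
        dsimp only
        rw [ha₂]

end Multiplicativity

/-! ### Configurations in a product -/

section Product

variable {𝔐 : Over SpecC} [MonObj 𝔐] [IsCommMonObj 𝔐]

/-- The varieties `C k` parametrize the configurations of degree `k` on `N` with states in `A`:
there are varieties `P k ξ` over `C k` and over the ordered configurations which identify the
points of `C k` with the configurations. -/
structure IsConfigurationFamily (N : RelVar 𝔐) (A C : ℕ → RelVar 𝔐)
    (P : ∀ k : ℕ, k.Partition → Over SpecC)
    (o : ∀ k ξ, P k ξ ⟶ orderedObj ξ N.obj fun i => (A i).obj)
    (w : ∀ k ξ, P k ξ ⟶ (C k).obj) : Prop where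
  surj : ∀ (K : Type) [Field K] [Algebra ℂ K] [IsAlgClosed K] (k : ℕ) (z : KPt K (C k).obj),
    ∃ (ξ : k.Partition) (x : KPt K (P k ξ)), x ≫ w k ξ = z
  surj_ordered : ∀ (K : Type) [Field K] [Algebra ℂ K] [IsAlgClosed K] (k : ℕ) (ξ : k.Partition)
    (y : KPt K (orderedObj ξ N.obj fun i => (A i).obj)), ∃ x : KPt K (P k ξ), x ≫ o k ξ = y
  eq_iff : ∀ (K : Type) [Field K] [Algebra ℂ K] [IsAlgClosed K] (k : ℕ) (ξ ξ' : k.Partition)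
    (x : KPt K (P k ξ)) (x' : KPt K (P k ξ')), x ≫ w k ξ = x' ≫ w k ξ' ↔
      Set.range (particle (x ≫ o k ξ)) = Set.range (particle (x' ≫ o k ξ'))
  weight : ∀ k ξ, w k ξ ≫ (C k).str = o k ξ ≫ totalWeight ξ N A

variable {N M : RelVar 𝔐} {A C : ℕ → RelVar 𝔐} {P : ∀ k : ℕ, k.Partition → Over SpecC}
  {o : ∀ k ξ, P k ξ ⟶ orderedObj ξ N.obj fun i => (A i).obj} {w : ∀ k ξ, P k ξ ⟶ (C k).obj}

/-- The set of particles of the configuration parametrized by a point of `C k`. -/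
def stateCode (o : ∀ k ξ, P k ξ ⟶ orderedObj ξ N.obj fun i => (A i).obj)
    (w : ∀ k ξ, P k ξ ⟶ (C k).obj) {K : Type} [Field K] [Algebra ℂ K] {k : ℕ}
    (z : KPt K (C k).obj) : Set (KPt K N.obj × Σ i, KPt K (A i).obj) :=
  {y | ∃ (ξ : k.Partition) (x : KPt K (P k ξ)), x ≫ w k ξ = z ∧ y ∈ Set.range (particle (x ≫ o k ξ))}

/-- The particles in `N × M` obtained by grouping particles by their position in `M`. -/
def ungroup (M : RelVar 𝔐) (o : ∀ k ξ, P k ξ ⟶ orderedObj ξ N.obj fun i => (A i).obj)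
    (w : ∀ k ξ, P k ξ ⟶ (C k).obj) (K : Type) [Field K] [Algebra ℂ K]
    (c : Set (KPt K M.obj × Σ k, KPt K (C k).obj)) :
    Set (KPt K (N.prod M).obj × Σ i, KPt K (A i).obj) :=
  {y | ∃ (k : ℕ) (z : KPt K (C k).obj), (y.1 ≫ RelVar.prodSnd N M, (⟨k, z⟩ : Σ k, KPt K (C k).obj)) ∈ c ∧
    (y.1 ≫ RelVar.prodFst N M, y.2) ∈ stateCode o w z}

namespace IsConfigurationFamily

variable {K : Type} [Field K] [Algebra ℂ K] [IsAlgClosed K]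

lemma stateCode_comp (h : IsConfigurationFamily N A C P o w)
    {k : ℕ} {ξ : k.Partition} (x : KPt K (P k ξ)) :
    stateCode o w (x ≫ w k ξ) = Set.range (particle (x ≫ o k ξ)) := by
  ext y
  constructor
  · rintro ⟨ξ', x', hx', hy⟩
    rwa [(h.eq_iff K k ξ' ξ x' x).mp hx'] at hy
  · intro hy
    exact ⟨ξ, x, rfl, hy⟩

lemma stateCode_nonempty (h : IsConfigurationFamily N A C P o w)
    {k : ℕ} (hk : 0 < k) (z : KPt K (C k).obj) : (stateCode o w z).Nonempty := by
  obtain ⟨ξ, x, rfl⟩ := h.surj K k z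
  rw [h.stateCode_comp]
  have := nonempty_parts hk ξ
  exact Set.range_nonempty _

lemma stateCode_injective (h : IsConfigurationFamily N A C P o w)
    {k k' : ℕ} {z : KPt K (C k).obj} {z' : KPt K (C k').obj}
    (e : stateCode o w z = stateCode o w z') : (⟨k, z⟩ : Σ k, KPt K (C k).obj) = ⟨k', z'⟩ := by
  obtain ⟨ξ, x, rfl⟩ := h.surj K k z
  obtain ⟨ξ', x', rfl⟩ := h.surj K k' z'
  rw [h.stateCode_comp, h.stateCode_comp] at e
  obtain rfl := eq_of_range_particle_eq e
  rw [(h.eq_iff K k ξ ξ' x x').mpr e]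

/-- A state of positive degree is a nonempty configuration on `N`, so every occupied position in `M`
is seen after ungrouping. The particles over that position recover the configuration, and hence the
state by `stateCode_injective`. -/
lemma subset_of_ungroup_eq (h : IsConfigurationFamily N A C P o w)
    {c c' : Set (KPt K M.obj × Σ k, KPt K (C k).obj)}
    (hc : Set.InjOn Prod.fst c) (hc' : Set.InjOn Prod.fst c') (hpos : ∀ x ∈ c, 0 < x.2.1)
    (e : ungroup M o w K c = ungroup M o w K c') : c ⊆ c' := by
  have key : ∀ {c c' : Set (KPt K M.obj × Σ k, KPt K (C k).obj)} (_ : Set.InjOn Prod.fst c')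
      (_ : ungroup M o w K c ⊆ ungroup M o w K c') {y k k'} {z : KPt K (C k).obj}
      {z' : KPt K (C k').obj} (_ : (y, ⟨k, z⟩) ∈ c) (_ : (y, ⟨k', z'⟩) ∈ c'),
      stateCode o w z ⊆ stateCode o w z' := by
    intro c c' hc' hs y k k' z z' hz hz' q hq
    have hm : (RelVar.prodLift q.1 y, q.2) ∈ ungroup M o w K c :=
      ⟨k, z, by rw [RelVar.prodLift_snd]; exact hz, by rw [RelVar.prodLift_fst]; exact hq⟩
    obtain ⟨k'', z'', h1, h2⟩ := hs hm
    rw [RelVar.prodLift_snd] at h1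
    rw [RelVar.prodLift_fst] at h2
    cases hc' h1 hz' rfl
    exact h2
  rintro ⟨y, k, z⟩ hz
  obtain ⟨q, hq⟩ := h.stateCode_nonempty (hpos _ hz) z
  have hm : (RelVar.prodLift q.1 y, q.2) ∈ ungroup M o w K c :=
    ⟨k, z, by rw [RelVar.prodLift_snd]; exact hz, by rw [RelVar.prodLift_fst]; exact hq⟩
  rw [e] at hm
  obtain ⟨k', z', h1, -⟩ := hm
  rw [RelVar.prodLift_snd] at h1
  have := h.stateCode_injective ((key hc' e.le hz h1).antisymm (key hc e.ge h1 hz))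
  rwa [this]

end IsConfigurationFamily

lemma particleWeight_prod {T : Over SpecC} (x : T ⟶ (N.prod M).obj) (a : Σ i, T ⟶ (A i).obj) :
    particleWeight (N.prod M) A (x, a) = ((x ≫ RelVar.prodSnd N M) ≫ M.str) ^ a.1 *
      particleWeight N A (x ≫ RelVar.prodFst N M, a) := by
  dsimp only [particleWeight]
  rw [RelVar.comp_prod_str, mul_pow, ← _root_.mul_assoc,
    mul_comm (((x ≫ RelVar.prodSnd N M) ≫ M.str) ^ a.1)]

variable {n : ℕ} [∀ k ξ, IsVariety (P k ξ)]

/-- A particle on `M` whose state is a configuration on `N` is a cluster of particles on `N × M`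
with the same coordinate in `M`, its degree being the total degree of the cluster. Clusters at
distinct positions of `M` are disjoint, so the union over all of them is a configuration on `N × M`,
and every configuration arises in this way. -/
lemma sum_cls_prod (h : IsConfigurationFamily N A C P o w) {B B' : n.Partition → RelVar 𝔐}
    (hB : ∀ δ, IsConfigurationSpace δ M C (B δ))
    (hB' : ∀ α, IsConfigurationSpace α (N.prod M) A (B' α)) :
    ∑ δ, cls (B δ) = ∑ α, cls (B' α) := by
  refine sum_cls_configurationSpace_eq hB (E := fun k => k.Partition) P w
    (fun K _ _ _ k _ z => h.surj K k z) B'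
    (fun K _ _ => Set (KPt K (N.prod M).obj × Σ i, KPt K (A i).obj))
    (fun K _ _ x => (hB' x.1).code x.2) (fun K _ _ _ x y e => IsConfigurationSpace.eq_of_code_eq hB' e)
    (fun K _ _ c => ungroup M o w K c) ?_ ?_ ?_
  · intro δ χ
    have hn : ∑ q : Σ p : δ.parts, (χ p).parts, q.2.1 = n := by
      rw [Fintype.sum_sigma]
      exact (Finset.sum_congr rfl fun p _ => sum_parts (χ p)).trans (sum_parts δ)
    obtain ⟨pos, hfst, hsnd⟩ : ∃ pos : (Σ p : δ.parts, (χ p).parts) →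
        (confState δ M.obj (fun p => P p.1 (χ p)) ⟶ (N.prod M).obj),
        (∀ p r, pos ⟨p, r⟩ ≫ RelVar.prodFst N M = (confSt p ≫ o p.1 (χ p)) ≫
          position (χ p) N.obj (fun i => (A i).obj) r) ∧
        ∀ p r, pos ⟨p, r⟩ ≫ RelVar.prodSnd N M = confPos p :=
      ⟨fun q => RelVar.prodLift ((confSt q.1 ≫ o q.1.1 (χ q.1)) ≫
        position (χ q.1) N.obj (fun i => (A i).obj) q.2) (confPos q.1),
        fun _ _ => RelVar.prodLift_fst _ _, fun _ _ => RelVar.prodLift_snd _ _⟩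
    have hpos : ∀ (K : Type) [Field K] [Algebra ℂ K] [IsAlgClosed K]
        (v : KPt K (confState δ M.obj (fun p => P p.1 (χ p)))),
        Function.Injective fun q => v ≫ pos q := by
      rintro K _ _ _ v ⟨p, r⟩ ⟨p', r'⟩ e
      have e2 : v ≫ confPos p = v ≫ confPos p' := by
        rw [← hsnd p r, ← hsnd p' r', ← Category.assoc, ← Category.assoc]
        exact congr($e ≫ RelVar.prodSnd N M)
      obtain rfl := confPos_injective v e2
      have e1 : ((v ≫ confSt p) ≫ o p.1 (χ p)) ≫ position (χ p) N.obj (fun i => (A i).obj) r =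
          ((v ≫ confSt p) ≫ o p.1 (χ p)) ≫ position (χ p) N.obj (fun i => (A i).obj) r' := by
        rw [Category.assoc v, Category.assoc v, Category.assoc v, ← hfst p r, ← hfst p r',
          ← Category.assoc, ← Category.assoc]
        exact congr($e ≫ RelVar.prodFst N M)
      rw [particle_fst_injective ((v ≫ confSt p) ≫ o p.1 (χ p)) e1]
    obtain ⟨α, f, hf⟩ := exists_hom_configurationSpace hB'
      (fun q : Σ p : δ.parts, (χ p).parts => q.2.1) (fun q => part_pos q.2) hn
      (V := confState δ M.obj (fun p => P p.1 (χ p))) pos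
      (fun q => (confSt q.1 ≫ o q.1.1 (χ q.1)) ≫
        internalState (χ q.1) N.obj (fun i => (A i).obj) q.2) hpos
    have hfst' : ∀ (K : Type) [Field K] [Algebra ℂ K]
        (v : KPt K (confState δ M.obj (fun p => P p.1 (χ p)))) (p : δ.parts) (r : (χ p).parts),
        (v ≫ pos ⟨p, r⟩) ≫ RelVar.prodFst N M =
          v ≫ (confSt p ≫ o p.1 (χ p)) ≫ position (χ p) N.obj (fun i => (A i).obj) r := by
      intro K _ _ v p r
      rw [Category.assoc, hfst]
    have hsnd' : ∀ (K : Type) [Field K] [Algebra ℂ K]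
        (v : KPt K (confState δ M.obj (fun p => P p.1 (χ p)))) (p : δ.parts) (r : (χ p).parts),
        (v ≫ pos ⟨p, r⟩) ≫ RelVar.prodSnd N M = v ≫ confPos p := by
      intro K _ _ v p r
      rw [Category.assoc, hsnd]
    have hpart : ∀ (K : Type) [Field K] [Algebra ℂ K]
        (v : KPt K (confState δ M.obj (fun p => P p.1 (χ p)))) (p : δ.parts) (r : (χ p).parts),
        particle ((v ≫ confSt p) ≫ o p.1 (χ p)) r =
          (v ≫ (confSt p ≫ o p.1 (χ p)) ≫ position (χ p) N.obj (fun i => (A i).obj) r,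
            ⟨r.1, v ≫ (confSt p ≫ o p.1 (χ p)) ≫ internalState (χ p) N.obj (fun i => (A i).obj) r⟩) := by
      intro K _ _ v p r
      simp only [particle, Category.assoc]
    refine ⟨α, f, fun K _ _ _ v => ⟨(hf K v).1.trans ?_, (hf K v).2.trans ?_⟩⟩
    · ext y
      constructor
      · rintro ⟨⟨p, r⟩, rfl⟩
        refine ⟨p.1, _, ⟨p, Prod.ext (hsnd' K v p r).symm rfl⟩, χ p, v ≫ confSt p,
          rfl, r, (hpart K v p r).trans (Prod.ext (hfst' K v p r).symm rfl)⟩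
      · rintro ⟨k, z, ⟨p, hp⟩, hy⟩
        have e1 : v ≫ confPos p = y.1 ≫ RelVar.prodSnd N M := congrArg Prod.fst hp
        have e2 := congrArg Prod.snd hp
        dsimp only at e2
        cases e2
        rw [h.stateCode_comp] at hy
        obtain ⟨r, hr⟩ := hy
        rw [hpart] at hr
        have e3 := congrArg Prod.fst hr
        have e4 := congrArg Prod.snd hr
        exact ⟨⟨p, r⟩, Prod.ext (RelVar.prod_hom_ext ((hfst' K v p r).trans e3)
          ((hsnd' K v p r).trans e1)) e4⟩
    · rw [Fintype.prod_sigma]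
      refine Finset.prod_congr rfl fun p _ => ?_
      have e : ((v ≫ confSt p) ≫ w p.1 (χ p)) ≫ (C p.1).str = ∏ r : (χ p).parts,
          particleWeight N A (particle ((v ≫ confSt p) ≫ o p.1 (χ p)) r) := by
        rw [Category.assoc, h.weight, ← Category.assoc, comp_totalWeight_eq]
      change _ = ((v ≫ confPos p) ≫ M.str) ^ (p.1 : ℕ) * (((v ≫ confSt p) ≫ w p.1 (χ p)) ≫ (C p.1).str)
      rw [e]
      -- The position in `M` counts with the degree of the particle, which is the sum of the degrees
      -- in its cluster.
      have e' : ((v ≫ confPos p) ≫ M.str) ^ (p.1 : ℕ) =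
          ∏ r : (χ p).parts, ((v ≫ confPos p) ≫ M.str) ^ (r.1 : ℕ) := by
        rw [Finset.prod_pow_eq_pow_sum]
        exact congrArg _ (sum_parts (χ p)).symm
      rw [e', ← Finset.prod_mul_distrib]
      refine Finset.prod_congr rfl fun r _ => ?_
      rw [hpart]
      refine (particleWeight_prod _ _).trans ?_
      exact congr(($(hsnd' K v p r) ≫ M.str) ^ (r.1 : ℕ) *
        particleWeight N A ($(hfst' K v p r), _))
  · intro K _ _ _ δ δ' b b' e
    exact (h.subset_of_ungroup_eq ((hB δ).injOn_code b) ((hB δ').injOn_code b')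
      (fun x hx => (hB δ).degree_pos_of_mem_code hx) e).antisymm
      (h.subset_of_ungroup_eq ((hB δ').injOn_code b') ((hB δ).injOn_code b)
      (fun x hx => (hB δ').degree_pos_of_mem_code hx) e.symm)
  · rintro K _ _ _ ⟨α, b⟩
    obtain ⟨t, rfl⟩ := (hB' α).exists_lift b
    -- Conversely, the particles are grouped by their coordinate in `M`; the fibre over `y` has
    -- total degree `d y` and is itself a configuration on `N`.
    let s : α.parts → KPt K M.obj := fun p => (particle t p).1 ≫ RelVar.prodSnd N M
    have hfin : Finite (Set.range s) := (Set.finite_range s).to_subtype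
    have := Fintype.ofFinite (Set.range s)
    classical
    let d : Set.range s → ℕ := fun y => ∑ p : {p // s p = y.1}, p.1.1
    have hd : ∀ y, 0 < d y := by
      rintro ⟨_, p, rfl⟩
      exact (part_pos p).trans_le (Finset.single_le_sum (f := fun q : {q // s q = s p} => q.1.1)
        (fun _ _ => Nat.zero_le _) (Finset.mem_univ (⟨p, rfl⟩ : {q // s q = s p})))
    have hz : ∀ y : Set.range s, ∃ z : KPt K (C (d y)).obj, stateCode o w z =
        Set.range fun p : {p // s p = y.1} =>
          ((particle t p.1).1 ≫ RelVar.prodFst N M, (particle t p.1).2) := by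
      intro y
      obtain ⟨ξ, q, e, he⟩ := exists_kpt_orderedObj (n := d y) (M := N.obj)
        (A := fun i => (A i).obj) (fun p : {p // s p = y.1} => p.1.1) (fun p => part_pos p.1) rfl
        (fun p => (particle t p.1).1 ≫ RelVar.prodFst N M) (fun p => (particle t p.1).2.2) (by
          rintro ⟨p, hp⟩ ⟨p', hp'⟩ e
          exact Subtype.ext (particle_fst_injective t (RelVar.prod_hom_ext e (hp.trans hp'.symm))))
      obtain ⟨x, hx⟩ := h.surj_ordered K (d y) ξ q
      refine ⟨x ≫ w (d y) ξ, ?_⟩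
      rw [h.stateCode_comp, hx, show particle q = _ from funext he]
      exact e.surjective.range_comp fun p : {p // s p = y.1} =>
          ((particle t p.1).1 ≫ RelVar.prodFst N M, (particle t p.1).2)
    choose z hz using hz
    have hn : ∑ y, d y = n := by
      refine Eq.trans ?_ (sum_parts α)
      refine (Fintype.sum_sigma' fun (y : Set.range s) (p : {p // s p = y.1}) => p.1.1).symm.trans ?_
      exact Fintype.sum_equiv ((Equiv.sigmaCongrRight fun y => Equiv.subtypeEquivRight
        fun p => Subtype.ext_iff.symm).trans (Equiv.sigmaFiberEquiv (Set.rangeFactorization s))) _ _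
        fun _ => rfl
    obtain ⟨δ, b', hb'⟩ := exists_kpt_configurationSpace hB d hd hn (fun y => y.1) z
      Subtype.val_injective
    refine ⟨δ, b', ?_⟩
    dsimp only
    rw [hb', IsConfigurationSpace.code_comp]
    ext q
    constructor
    · rintro ⟨k, z', ⟨y, hy⟩, hq⟩
      have e1 : y.1 = q.1 ≫ RelVar.prodSnd N M := congrArg Prod.fst hy
      have e2 := congrArg Prod.snd hy
      dsimp only at e2
      cases e2
      rw [hz] at hq
      obtain ⟨⟨p, hp⟩, hpq⟩ := hq
      have e3 := congrArg Prod.fst hpq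
      have e4 := congrArg Prod.snd hpq
      exact ⟨p, Prod.ext (RelVar.prod_hom_ext e3 (hp.trans e1)) e4⟩
    · rintro ⟨p, rfl⟩
      refine ⟨_, _, ⟨⟨s p, p, rfl⟩, rfl⟩, ?_⟩
      rw [hz]
      exact ⟨⟨p, rfl⟩, rfl⟩

end Product

/-! ### Families of configurations -/

section Families

lemma exists_pullback {X Y Z : Over SpecC} [IsVariety X] [IsVariety Y] [IsVariety Z] (f : X ⟶ Z)
    (g : Y ⟶ Z) : ∃ (P : Over SpecC) (a : P ⟶ X) (b : P ⟶ Y), IsVariety P ∧ a ≫ f = b ≫ g ∧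
      (∀ {T : Over SpecC} (x : T ⟶ X) (y : T ⟶ Y), x ≫ f = y ≫ g → ∃ t, t ≫ a = x ∧ t ≫ b = y) ∧
      ∀ {T : Over SpecC} (t t' : T ⟶ P), t ≫ a = t' ≫ a → t ≫ b = t' ≫ b → t = t' := by
  have := locallyOfFiniteType_left g
  have := quasiCompact_left g
  have := isSeparated_left g
  let P : Over SpecC := Over.mk (pullback.fst f.left g.left ≫ X.hom)
  let a : P ⟶ X := Over.homMk (pullback.fst f.left g.left) rfl
  let b : P ⟶ Y := Over.homMk (pullback.snd f.left g.left) (by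
    change pullback.snd f.left g.left ≫ Y.hom = pullback.fst f.left g.left ≫ X.hom
    rw [← Over.w g, ← Over.w f, pullback.condition_assoc])
  have h1 : LocallyOfFiniteType a.left :=
    inferInstanceAs (LocallyOfFiniteType (pullback.fst f.left g.left))
  have h2 : QuasiCompact a.left := inferInstanceAs (QuasiCompact (pullback.fst f.left g.left))
  have h3 : IsSeparated a.left := inferInstanceAs (IsSeparated (pullback.fst f.left g.left))
  refine ⟨P, a, b, IsVariety.of_hom a, Over.OverMorphism.ext pullback.condition, ?_, ?_⟩
  · intro T x y h
    have h' : x.left ≫ f.left = y.left ≫ g.left := congrArg CommaMorphism.left h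
    refine ⟨Over.homMk (pullback.lift x.left y.left h') ?_, ?_, ?_⟩
    · change pullback.lift x.left y.left h' ≫ pullback.fst f.left g.left ≫ X.hom = T.hom
      rw [pullback.lift_fst_assoc, Over.w]
    · exact Over.OverMorphism.ext (pullback.lift_fst _ _ _)
    · exact Over.OverMorphism.ext (pullback.lift_snd _ _ _)
  · intro T t t' h h'
    exact Over.OverMorphism.ext (pullback.hom_ext (congrArg CommaMorphism.left h)
      (congrArg CommaMorphism.left h'))

variable {𝔐 : Over SpecC} [MonObj 𝔐] [IsCommMonObj 𝔐]

/-- `C k` is the disjoint union of affine models of the spaces `B k ξ`, so that configurations with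
states in `C` exist again as varieties. `P k ξ` is the fibre product, over `B k ξ`, of the ordered
configurations and the affine model. -/
lemma exists_isConfigurationFamily {N : RelVar 𝔐} {A : ℕ → RelVar 𝔐}
    {B : ∀ k : ℕ, k.Partition → RelVar 𝔐} (hB : ∀ k ξ, IsConfigurationSpace ξ N A (B k ξ)) :
    ∃ (C : ℕ → RelVar 𝔐) (P : ∀ k : ℕ, k.Partition → Over SpecC)
      (o : ∀ k ξ, P k ξ ⟶ orderedObj ξ N.obj fun i => (A i).obj) (w : ∀ k ξ, P k ξ ⟶ (C k).obj),
      (∀ k ξ, IsVariety (P k ξ)) ∧ IsConfigurationFamily N A C P o w ∧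
      (∀ k, IsAffine (C k).obj.left) ∧ ∀ k, cls (C k) = ∑ ξ, cls (B k ξ) := by
  choose V j hV hj hjb using fun k ξ => exists_affine_model (B k ξ)
  choose C inj hC hcls hCa using fun k => exists_isSum (V k)
  choose P a b hP hab hlift hext using fun k ξ => exists_pullback (hB k ξ).map (j k ξ)
  have hcode : ∀ (K : Type) [Field K] [Algebra ℂ K] [IsAlgClosed K] (k : ℕ) (ξ : k.Partition)
      (x : KPt K (P k ξ)),
      (hB k ξ).code ((x ≫ b k ξ) ≫ j k ξ) = Set.range (particle (x ≫ a k ξ)) := by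
    intro K _ _ _ k ξ x
    rw [Category.assoc, ← hab, ← Category.assoc, IsConfigurationSpace.code_comp]
  refine ⟨C, P, a, fun k ξ => b k ξ ≫ inj k ξ, hP, ⟨?_, ?_, ?_, ?_⟩, fun k => hCa k (hV k), fun k => ?_⟩
  · intro K _ _ _ k z
    obtain ⟨⟨ξ, v⟩, rfl⟩ := ((hC k).bijective K).2 z
    obtain ⟨y, hy⟩ := (hB k ξ).exists_lift (v ≫ j k ξ)
    obtain ⟨x, -, hx⟩ := hlift k ξ y v hy
    refine ⟨ξ, x, ?_⟩
    rw [← Category.assoc, hx]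
  · intro K _ _ _ k ξ y
    obtain ⟨v, hv⟩ := (hjb k ξ K).2 (y ≫ (hB k ξ).map)
    obtain ⟨x, hx, -⟩ := hlift k ξ y v hv.symm
    exact ⟨x, hx⟩
  · intro K _ _ _ k ξ ξ' x x'
    rw [← hcode, ← hcode, ← Category.assoc, ← Category.assoc]
    constructor
    · intro e
      have e1 : (⟨ξ, x ≫ b k ξ⟩ : Σ ξ, KPt K (V k ξ).obj) = ⟨ξ', x' ≫ b k ξ'⟩ :=
        ((hC k).bijective K).1 e
      have e2 := congrArg (fun s : Σ ξ, KPt K (V k ξ).obj => (hB k s.1).code (s.2 ≫ j k s.1)) e1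
      exact e2
    · intro e
      have e1 := IsConfigurationSpace.eq_of_code_eq (hB k) e
      obtain rfl : ξ = ξ' := congrArg Sigma.fst e1
      have e2 := (hjb k ξ K).1 (eq_of_heq (Sigma.mk.inj e1).2)
      rw [e2]
  · intro k ξ
    rw [Category.assoc, (hC k).inj_str, ← hj, ← Category.assoc, ← hab, Category.assoc,
      (hB k ξ).map_str]
  · rw [hcls]
    exact Finset.sum_congr rfl fun ξ _ => cls_eq_of_kBijective (j k ξ) (hj k ξ) (hjb k ξ)

end Families

/-! ### Additive invariants -/

section Additive

section

variable {𝔐 : Over SpecC} [MonObj 𝔐]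

/-- The product of two morphisms. -/
def RelVar.prodMap {X X' Y Y' : RelVar 𝔐} (f : X.obj ⟶ X'.obj) (g : Y.obj ⟶ Y'.obj) :
    (X.prod Y).obj ⟶ (X'.prod Y').obj :=
  RelVar.prodLift (RelVar.prodFst X Y ≫ f) (RelVar.prodSnd X Y ≫ g)

lemma RelVar.comp_prodMap_fst {T : Over SpecC} {X X' Y Y' : RelVar 𝔐} (f : X.obj ⟶ X'.obj)
    (g : Y.obj ⟶ Y'.obj) (t : T ⟶ (X.prod Y).obj) :
    (t ≫ RelVar.prodMap f g) ≫ RelVar.prodFst X' Y' = (t ≫ RelVar.prodFst X Y) ≫ f := by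
  rw [RelVar.prodMap, Category.assoc, RelVar.prodLift_fst, Category.assoc]

lemma RelVar.comp_prodMap_snd {T : Over SpecC} {X X' Y Y' : RelVar 𝔐} (f : X.obj ⟶ X'.obj)
    (g : Y.obj ⟶ Y'.obj) (t : T ⟶ (X.prod Y).obj) :
    (t ≫ RelVar.prodMap f g) ≫ RelVar.prodSnd X' Y' = (t ≫ RelVar.prodSnd X Y) ≫ g := by
  rw [RelVar.prodMap, Category.assoc, RelVar.prodLift_snd, Category.assoc]

lemma RelVar.prodMap_str {X X' Y Y' : RelVar 𝔐} {f : X.obj ⟶ X'.obj} {g : Y.obj ⟶ Y'.obj}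
    (hf : f ≫ X'.str = X.str) (hg : g ≫ Y'.str = Y.str) :
    RelVar.prodMap f g ≫ (X'.prod Y').str = (X.prod Y).str := by
  have h1 := RelVar.comp_prodMap_fst f g (𝟙 _)
  have h2 := RelVar.comp_prodMap_snd f g (𝟙 _)
  rw [Category.id_comp] at h1 h2
  have h3 := RelVar.comp_prod_str (𝟙 (X.prod Y).obj)
  rw [Category.id_comp] at h3
  rw [RelVar.comp_prod_str, h1, h2, h3]
  simp only [Category.assoc, hf, hg]

lemma RelVar.kInjective_prodMap {X X' Y Y' : RelVar 𝔐} {f : X.obj ⟶ X'.obj} {g : Y.obj ⟶ Y'.obj}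
    (hf : KInjective f) (hg : KInjective g) : KInjective (RelVar.prodMap f g) := by
  intro K _ _ _ v w h
  refine RelVar.prod_hom_ext (hf K ?_) (hg K ?_)
  · exact (RelVar.comp_prodMap_fst f g v).symm.trans
      (congr($h ≫ RelVar.prodFst X' Y').trans (RelVar.comp_prodMap_fst f g w))
  · exact (RelVar.comp_prodMap_snd f g v).symm.trans
      (congr($h ≫ RelVar.prodSnd X' Y').trans (RelVar.comp_prodMap_snd f g w))

lemma KInjective.id (X : Over SpecC) : KInjective (𝟙 X) := by
  intro K _ _ _ v w h
  simpa using h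

lemma RelVar.comp_inl_coprodDesc {𝔐 T V : Over SpecC} {X Y : RelVar 𝔐} (f : X.obj ⟶ T)
    (g : Y.obj ⟶ T) (x : V ⟶ X.obj) : (x ≫ RelVar.inl X Y) ≫ RelVar.coprodDesc f g = x ≫ f := by
  rw [Category.assoc, RelVar.inl_coprodDesc]

lemma RelVar.comp_inr_coprodDesc {𝔐 T V : Over SpecC} {X Y : RelVar 𝔐} (f : X.obj ⟶ T)
    (g : Y.obj ⟶ T) (y : V ⟶ Y.obj) : (y ≫ RelVar.inr X Y) ≫ RelVar.coprodDesc f g = y ≫ g := by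
  rw [Category.assoc, RelVar.inr_coprodDesc]

lemma RelVar.kInjective_coprodDesc {𝔐 T : Over SpecC} {X Y : RelVar 𝔐} {f : X.obj ⟶ T}
    {g : Y.obj ⟶ T} (hf : KInjective f) (hg : KInjective g)
    (hne : ∀ (K : Type) [Field K] [Algebra ℂ K] [IsAlgClosed K] (x : KPt K X.obj) (y : KPt K Y.obj),
      x ≫ f ≠ y ≫ g) :
    KInjective (RelVar.coprodDesc f g) := by
  intro K _ _ _ v w h
  dsimp only at h
  obtain ⟨x, rfl⟩ | ⟨y, rfl⟩ := RelVar.kpt_coprod X Y v <;>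
    obtain ⟨x', rfl⟩ | ⟨y', rfl⟩ := RelVar.kpt_coprod X Y w <;>
    simp only [RelVar.comp_inl_coprodDesc, RelVar.comp_inr_coprodDesc] at h
  · rw [hf K h]
  · exact (hne K _ _ h).elim
  · exact (hne K _ _ h.symm).elim
  · rw [hg K h]

lemma RelVar.kBijective_coprodDesc {𝔐 T : Over SpecC} {X Y : RelVar 𝔐} {f : X.obj ⟶ T}
    {g : Y.obj ⟶ T} (hf : KInjective f) (hg : KInjective g)
    (hne : ∀ (K : Type) [Field K] [Algebra ℂ K] [IsAlgClosed K] (x : KPt K X.obj) (y : KPt K Y.obj),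
      x ≫ f ≠ y ≫ g)
    (hs : ∀ (K : Type) [Field K] [Algebra ℂ K] [IsAlgClosed K] (t : KPt K T),
      (∃ x : KPt K X.obj, x ≫ f = t) ∨ ∃ y : KPt K Y.obj, y ≫ g = t) :
    KBijective (RelVar.coprodDesc f g) := by
  refine fun K _ _ _ => ⟨RelVar.kInjective_coprodDesc hf hg hne K, fun t => ?_⟩
  obtain ⟨x, rfl⟩ | ⟨y, rfl⟩ := hs K t
  · exact ⟨_, RelVar.comp_inl_coprodDesc f g x⟩
  · exact ⟨_, RelVar.comp_inr_coprodDesc f g y⟩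

lemma RelVar.coprodDesc_str {𝔐 : Over SpecC} {X Y Z : RelVar 𝔐} {f : X.obj ⟶ Z.obj}
    {g : Y.obj ⟶ Z.obj} (hf : f ≫ Z.str = X.str) (hg : g ≫ Z.str = Y.str) :
    RelVar.coprodDesc f g ≫ Z.str = (X.coprod Y).str := by
  have key : ∀ {T : Over SpecC} {u v : (X.coprod Y).obj ⟶ T},
      RelVar.inl X Y ≫ u = RelVar.inl X Y ≫ v → RelVar.inr X Y ≫ u = RelVar.inr X Y ≫ v → u = v := by
    intro T u v h h'
    exact Over.OverMorphism.ext (Limits.coprod.hom_ext (congrArg CommaMorphism.left h)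
      (congrArg CommaMorphism.left h'))
  apply key
  · rw [← Category.assoc, RelVar.inl_coprodDesc, hf, RelVar.inl_str]
  · rw [← Category.assoc, RelVar.inr_coprodDesc, hg, RelVar.inr_str]

/-- The relations of `K0` form an ideal. To show that an invariant which is merely additive respects
them, products of cut and paste relations with arbitrary varieties must be treated as well. -/
lemma exists_scissors_prod {X Z U : RelVar 𝔐} (i : Z.obj ⟶ X.obj) (j : U.obj ⟶ X.obj)
    (hi : IsClosedImmersion i.left) (hj : IsOpenImmersion j.left)
    (hij : IsCompl (Set.range i.left) (Set.range j.left))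
    (hZ : i ≫ X.str = Z.str) (hU : j ≫ X.str = U.str) (Y : RelVar 𝔐) :
    ∃ f : ((Y.prod Z).coprod (Y.prod U)).obj ⟶ (Y.prod X).obj,
      f ≫ (Y.prod X).str = ((Y.prod Z).coprod (Y.prod U)).str ∧ KBijective f := by
  have lift : ∀ (K : Type) [Field K] [Algebra ℂ K] {W : RelVar 𝔐} (g : W.obj ⟶ X.obj)
      (t : KPt K (Y.prod X).obj) (z : KPt K W.obj), z ≫ g = t ≫ RelVar.prodSnd Y X →
      ∃ z' : KPt K (Y.prod W).obj, z' ≫ RelVar.prodMap (𝟙 _) g = t := by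
    intro K _ _ W g t z hz
    refine ⟨RelVar.prodLift (t ≫ RelVar.prodFst Y X) z, RelVar.prod_hom_ext ?_ ?_⟩
    · rw [RelVar.comp_prodMap_fst, RelVar.prodLift_fst, Category.comp_id]
    · rw [RelVar.comp_prodMap_snd, RelVar.prodLift_snd, hz]
  refine ⟨RelVar.coprodDesc (RelVar.prodMap (𝟙 _) i) (RelVar.prodMap (𝟙 _) j),
    RelVar.coprodDesc_str (RelVar.prodMap_str (Category.id_comp _) hZ)
      (RelVar.prodMap_str (Category.id_comp _) hU),
    RelVar.kBijective_coprodDesc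
      (RelVar.kInjective_prodMap (KInjective.id _) (KInjective.of_mono i))
      (RelVar.kInjective_prodMap (KInjective.id _) (KInjective.of_mono j)) ?_ ?_⟩
  · intro K _ _ _ x y h
    have e := (RelVar.comp_prodMap_snd (𝟙 _) i x).symm.trans
      (congr($h ≫ RelVar.prodSnd Y X).trans (RelVar.comp_prodMap_snd (𝟙 _) j y))
    have e' : KPt.pt (K := K) ((x ≫ RelVar.prodSnd Y Z) ≫ i) =
      KPt.pt (K := K) ((y ≫ RelVar.prodSnd Y U) ≫ j) := by rw [e]
    exact hij.disjoint.le_bot ⟨⟨KPt.pt (K := K) (x ≫ RelVar.prodSnd Y Z), rfl⟩,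
      ⟨KPt.pt (K := K) (y ≫ RelVar.prodSnd Y U), e'.symm⟩⟩
  · intro K _ _ _ t
    have ht := hij.codisjoint.top_le (Set.mem_univ (KPt.pt (K := K) (t ≫ RelVar.prodSnd Y X)))
    refine ht.imp (fun h => ?_) fun h => ?_
    · obtain ⟨z, hz⟩ := KPt.exists_lift' i (t ≫ RelVar.prodSnd Y X) h
      exact lift K i t z hz
    · obtain ⟨z, hz⟩ := KPt.exists_lift' j (t ≫ RelVar.prodSnd Y X) h
      exact lift K j t z hz

end

variable {𝔐 : Over SpecC} [MonObj 𝔐] [IsCommMonObj 𝔐]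

/-- No cut and paste hypothesis on `F` is needed: the disjoint union of a closed subscheme and its
complement maps bijectively on geometric points to the whole. Nor is any compatibility with products
needed, by `exists_scissors_prod`. -/
lemma eq_of_cls_eq {G : Type*} [AddCommGroup G] (F : RelVar 𝔐 → G)
    (hF : ∀ (X Y : RelVar 𝔐) (f : X.obj ⟶ Y.obj), f ≫ Y.str = X.str → KBijective f → F X = F Y)
    (hadd : ∀ X Y : RelVar 𝔐, F (X.coprod Y) = F X + F Y) {X Y : RelVar 𝔐} (h : cls X = cls Y) :
    F X = F Y := by
  let φ : FreeAbelianGroup (IsoClass 𝔐) →+ G := FreeAbelianGroup.lift (Quotient.lift F (by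
    rintro X Y ⟨e, he⟩
    refine hF X Y e.hom he fun K _ _ _ => ⟨fun v w h => (cancel_mono e.hom).mp h, fun y => ?_⟩
    refine ⟨y ≫ e.inv, ?_⟩
    change (y ≫ e.inv) ≫ e.hom = y
    rw [Category.assoc, e.inv_hom_id, Category.comp_id]))
  have hφ : ∀ X : RelVar 𝔐, φ (.of (.mk X)) = F X := fun X => FreeAbelianGroup.lift_apply_of _ _
  have hmul : ∀ (r : FreeAbelianGroup (IsoClass 𝔐)), ∀ s ∈ scissors (𝔐 := 𝔐), φ (r * s) = 0 := by
    rintro r _ ⟨X, Z, U, i, j, hi, hj, hij, hZ, hU, rfl⟩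
    induction r using FreeAbelianGroup.induction_on with
    | zero => rw [zero_mul, map_zero]
    | of Y =>
      obtain ⟨Y, rfl⟩ := Quotient.exists_rep Y
      change φ (.of (.mk Y) * _) = 0
      rw [mul_sub, mul_sub, ← FreeAbelianGroup.of_mul, ← FreeAbelianGroup.of_mul,
        ← FreeAbelianGroup.of_mul]
      change φ (.of (.mk (Y.prod X)) - .of (.mk (Y.prod Z)) - .of (.mk (Y.prod U))) = 0
      obtain ⟨f, hf, hfb⟩ := exists_scissors_prod i j hi hj hij hZ hU Y
      rw [map_sub, map_sub, hφ, hφ, hφ, ← hF _ _ f hf hfb, hadd, sub_sub, sub_self]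
    | neg Y hY => rw [neg_mul, map_neg, hY, neg_zero]
    | add r r' hr hr' => rw [add_mul, map_add, hr, hr', add_zero]
  have hspan : ∀ r ∈ Ideal.span (scissors (𝔐 := 𝔐)), φ r = 0 := by
    intro r hr
    -- All multiples are treated at once because `φ` is only additive, so vanishing at `r` alone
    -- would not pass to scalar multiples.
    suffices h : ∀ a, φ (a * r) = 0 by simpa using h 1
    induction hr using Submodule.span_induction with
    | mem s hs => exact fun a => hmul a s hs
    | zero => exact fun a => by rw [mul_zero, map_zero]
    | add r r' _ _ hr hr' => exact fun a => by rw [mul_add, map_add, hr, hr', add_zero]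
    | smul b r _ h => exact fun a => by rw [smul_eq_mul, ← _root_.mul_assoc, h]
  have e := hspan _ (Ideal.Quotient.eq.mp h)
  rwa [map_sub, hφ, hφ, sub_eq_zero] at e

end Additive

/-! ### Varieties up to bijections on geometric points -/

section PieceEquiv

lemma KBijective.id (X : Over SpecC) : KBijective (𝟙 X) := fun K _ _ _ => by
  simp only [Category.comp_id]
  exact Function.bijective_id

lemma KInjective.comp {X Y Z : Over SpecC} {f : X ⟶ Y} {g : Y ⟶ Z} (hf : KInjective f)
    (hg : KInjective g) : KInjective (f ≫ g) := fun K _ _ _ => by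
  simp only [← Category.assoc]
  exact (hg K).comp (hf K)

lemma KBijective.comp {X Y Z : Over SpecC} {f : X ⟶ Y} {g : Y ⟶ Z} (hf : KBijective f)
    (hg : KBijective g) : KBijective (f ≫ g) := fun K _ _ _ => by
  simp only [← Category.assoc]
  exact (hg K).comp (hf K)

lemma KBijective.kInjective {X Y : Over SpecC} {f : X ⟶ Y} (hf : KBijective f) : KInjective f :=
  fun K _ _ _ => (hf K).1

variable {𝔐 : Over SpecC}

lemma RelVar.kInjective_inl (X Y : RelVar 𝔐) : KInjective (RelVar.inl X Y) :=
  fun _ _ _ _ _ _ h => (cancel_mono _).mp h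

lemma RelVar.kInjective_inr (X Y : RelVar 𝔐) : KInjective (RelVar.inr X Y) :=
  fun _ _ _ _ _ _ h => (cancel_mono _).mp h

lemma isEmpty_kpt_empty (K : Type) [Field K] [Algebra ℂ K] : IsEmpty (KPt K (RelVar.empty 𝔐).obj) :=
  ⟨fun v => (inferInstanceAs (IsEmpty PEmpty) : IsEmpty (RelVar.empty 𝔐).obj.left).elim
    (KPt.pt (K := K) v)⟩

/-- Two varieties over `𝔐` are piecewise equivalent if they are related by morphisms which are
bijective on geometric points. -/
def PieceEquiv (X Y : RelVar 𝔐) : Prop :=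
  ∃ (W : RelVar 𝔐) (f : W.obj ⟶ X.obj) (g : W.obj ⟶ Y.obj),
    f ≫ X.str = W.str ∧ g ≫ Y.str = W.str ∧ KBijective f ∧ KBijective g

namespace PieceEquiv

variable {X Y Z X' Y' : RelVar 𝔐}

lemma of_hom (f : X.obj ⟶ Y.obj) (hf : f ≫ Y.str = X.str) (hb : KBijective f) : PieceEquiv X Y :=
  ⟨X, 𝟙 _, f, Category.id_comp _, hf, .id _, hb⟩

lemma refl (X : RelVar 𝔐) : PieceEquiv X X := of_hom (𝟙 _) (Category.id_comp _) (.id _)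

lemma symm (h : PieceEquiv X Y) : PieceEquiv Y X := by
  obtain ⟨W, f, g, hf, hg, hfb, hgb⟩ := h
  exact ⟨W, g, f, hg, hf, hgb, hfb⟩

lemma trans (h : PieceEquiv X Y) (h' : PieceEquiv Y Z) : PieceEquiv X Z := by
  obtain ⟨W, f, g, hf, hg, hfb, hgb⟩ := h
  obtain ⟨W', f', g', hf', hg', hfb', hgb'⟩ := h'
  obtain ⟨P, a, b, hP, hab, hlift, hext⟩ := exists_pullback g f'
  have ha : KBijective a := by
    refine fun K _ _ _ => ⟨fun t t' h => hext _ _ h ((hfb' K).1 ?_), fun x => ?_⟩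
    · dsimp only at h ⊢
      rw [Category.assoc, Category.assoc, ← hab, ← Category.assoc, h, Category.assoc]
    · obtain ⟨y, hy⟩ := (hfb' K).2 (x ≫ g)
      obtain ⟨t, ht, -⟩ := hlift x y hy.symm
      exact ⟨t, ht⟩
  have hb : KBijective b := by
    refine fun K _ _ _ => ⟨fun t t' h => hext _ _ ((hgb K).1 ?_) h, fun y => ?_⟩
    · dsimp only at h ⊢
      rw [Category.assoc, Category.assoc, hab, ← Category.assoc, h, Category.assoc]
    · obtain ⟨x, hx⟩ := (hgb K).2 (y ≫ f')
      obtain ⟨t, -, ht⟩ := hlift x y hx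
      exact ⟨t, ht⟩
  let V : RelVar 𝔐 := ⟨P, a ≫ W.str, hP.1, hP.2, hP.3⟩
  refine ⟨V, a ≫ f, b ≫ g', ?_, ?_, ha.comp hfb, hb.comp hgb'⟩
  · change (a ≫ f) ≫ X.str = a ≫ W.str
    rw [Category.assoc, hf]
  · change (b ≫ g') ≫ Z.str = a ≫ W.str
    rw [Category.assoc, hg', ← hf', ← Category.assoc, ← hab, Category.assoc, hg]

lemma exists_affine (h : PieceEquiv X Y) : ∃ (W : RelVar 𝔐) (f : W.obj ⟶ X.obj) (g : W.obj ⟶ Y.obj),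
    IsAffine W.obj.left ∧ f ≫ X.str = W.str ∧ g ≫ Y.str = W.str ∧ KBijective f ∧ KBijective g := by
  obtain ⟨W, f, g, hf, hg, hfb, hgb⟩ := h
  obtain ⟨V, j, hV, hj, hjb⟩ := exists_affine_model W
  refine ⟨V, j ≫ f, j ≫ g, hV, ?_, ?_, hjb.comp hfb, hjb.comp hgb⟩
  · rw [Category.assoc, hf, hj]
  · rw [Category.assoc, hg, hj]

lemma coprod (h : PieceEquiv X X') (h' : PieceEquiv Y Y') :
    PieceEquiv (X.coprod Y) (X'.coprod Y') := by
  obtain ⟨W, f, g, hf, hg, hfb, hgb⟩ := h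
  obtain ⟨W', f', g', hf', hg', hfb', hgb'⟩ := h'
  have key : ∀ {W X W' Y : RelVar 𝔐} {f : W.obj ⟶ X.obj} {f' : W'.obj ⟶ Y.obj}
      (_ : f ≫ X.str = W.str) (_ : f' ≫ Y.str = W'.str) (_ : KBijective f) (_ : KBijective f'),
      ∃ u : (W.coprod W').obj ⟶ (X.coprod Y).obj, u ≫ (X.coprod Y).str = (W.coprod W').str ∧
        KBijective u := by
    intro W X W' Y f f' hf hf' hfb hfb'
    refine ⟨RelVar.coprodDesc (f ≫ RelVar.inl X Y) (f' ≫ RelVar.inr X Y),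
      RelVar.coprodDesc_str ?_ ?_, RelVar.kBijective_coprodDesc
      (hfb.kInjective.comp (RelVar.kInjective_inl X Y))
      (hfb'.kInjective.comp (RelVar.kInjective_inr X Y)) ?_ ?_⟩
    · rw [Category.assoc, RelVar.inl_str, hf]
    · rw [Category.assoc, RelVar.inr_str, hf']
    · intro K _ _ _ x y h
      rw [← Category.assoc, ← Category.assoc] at h
      exact RelVar.kpt_inl_ne_inr X Y _ _ h
    · intro K _ _ _ t
      refine (RelVar.kpt_coprod X Y t).imp ?_ ?_
      · rintro ⟨x, rfl⟩
        obtain ⟨w, rfl⟩ := (hfb K).2 x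
        exact ⟨w, (Category.assoc _ _ _).symm⟩
      · rintro ⟨x, rfl⟩
        obtain ⟨w, rfl⟩ := (hfb' K).2 x
        exact ⟨w, (Category.assoc _ _ _).symm⟩
  obtain ⟨u, hu, hub⟩ := key hf hf' hfb hfb'
  obtain ⟨v, hv, hvb⟩ := key hg hg' hgb hgb'
  exact ⟨W.coprod W', u, v, hu, hv, hub, hvb⟩

lemma coprod_comm (X Y : RelVar 𝔐) : PieceEquiv (X.coprod Y) (Y.coprod X) :=
  of_hom (RelVar.coprodDesc (RelVar.inr Y X) (RelVar.inl Y X))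
    (RelVar.coprodDesc_str (RelVar.inr_str Y X) (RelVar.inl_str Y X))
    (RelVar.kBijective_coprodDesc (RelVar.kInjective_inr Y X) (RelVar.kInjective_inl Y X)
      (fun _ _ _ _ x y h => RelVar.kpt_inl_ne_inr Y X y x h.symm)
      fun _ _ _ _ t => (RelVar.kpt_coprod Y X t).symm)

lemma empty_coprod (X : RelVar 𝔐) : PieceEquiv ((RelVar.empty 𝔐).coprod X) X := by
  refine (of_hom (RelVar.inr _ X) (RelVar.inr_str _ X) fun K _ _ _ =>
    ⟨RelVar.kInjective_inr _ X K, fun t => ?_⟩).symm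
  exact (RelVar.kpt_coprod _ X t).resolve_left fun ⟨x, _⟩ => (isEmpty_kpt_empty K).elim x

lemma coprod_assoc (X Y Z : RelVar 𝔐) :
    PieceEquiv ((X.coprod Y).coprod Z) (X.coprod (Y.coprod Z)) := by
  refine of_hom (RelVar.coprodDesc (RelVar.coprodDesc (RelVar.inl X (Y.coprod Z))
    (RelVar.inl Y Z ≫ RelVar.inr X (Y.coprod Z))) (RelVar.inr Y Z ≫ RelVar.inr X (Y.coprod Z)))
    (RelVar.coprodDesc_str (RelVar.coprodDesc_str (RelVar.inl_str _ _) ?_) ?_)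
    (RelVar.kBijective_coprodDesc (RelVar.kInjective_coprodDesc (RelVar.kInjective_inl _ _)
      ((RelVar.kInjective_inl _ _).comp (RelVar.kInjective_inr _ _)) ?_)
      ((RelVar.kInjective_inr _ _).comp (RelVar.kInjective_inr _ _)) ?_ ?_)
  · rw [Category.assoc, RelVar.inr_str, RelVar.inl_str]
  · rw [Category.assoc, RelVar.inr_str, RelVar.inr_str]
  · intro K _ _ _ x y h
    rw [← Category.assoc] at h
    exact RelVar.kpt_inl_ne_inr _ _ _ _ h
  · intro K _ _ _ x y h
    rw [← Category.assoc y] at h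
    obtain ⟨x, rfl⟩ | ⟨x, rfl⟩ := RelVar.kpt_coprod X Y x
    · rw [RelVar.comp_inl_coprodDesc] at h
      exact RelVar.kpt_inl_ne_inr _ _ _ _ h
    · rw [RelVar.comp_inr_coprodDesc, ← Category.assoc x] at h
      exact RelVar.kpt_inl_ne_inr _ _ _ _ (RelVar.kInjective_inr _ _ K h)
  · intro K _ _ _ t
    obtain ⟨x, rfl⟩ | ⟨x, rfl⟩ := RelVar.kpt_coprod _ _ t
    · exact Or.inl ⟨x ≫ RelVar.inl X Y, RelVar.comp_inl_coprodDesc _ _ x⟩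
    · obtain ⟨y, rfl⟩ | ⟨z, rfl⟩ := RelVar.kpt_coprod _ _ x
      · exact Or.inl ⟨y ≫ RelVar.inr X Y,
          (RelVar.comp_inr_coprodDesc _ _ y).trans (Category.assoc _ _ _).symm⟩
      · exact Or.inr ⟨z, (Category.assoc _ _ _).symm⟩

end PieceEquiv

lemma exists_isAffine_pieceEquiv (X : RelVar 𝔐) :
    ∃ V : RelVar 𝔐, IsAffine V.obj.left ∧ PieceEquiv V X := by
  obtain ⟨V, j, hV, hj, hjb⟩ := exists_affine_model X
  exact ⟨V, hV, .of_hom j hj hjb⟩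

/-- Piecewise equivalence as an equivalence relation. -/
def pieceSetoid (𝔐 : Over SpecC) : Setoid (RelVar 𝔐) where
  r := PieceEquiv
  iseqv := ⟨.refl, .symm, .trans⟩

/-- Piecewise equivalence classes of varieties over `𝔐`. -/
def PieceClass (𝔐 : Over SpecC) : Type 1 := Quotient (pieceSetoid 𝔐)

/-- The piecewise equivalence class of a variety over `𝔐`. -/
def PieceClass.mk (X : RelVar 𝔐) : PieceClass 𝔐 := Quotient.mk (pieceSetoid 𝔐) X

lemma PieceClass.mk_eq_mk {X Y : RelVar 𝔐} : PieceClass.mk X = PieceClass.mk Y ↔ PieceEquiv X Y :=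
  Quotient.eq (r := pieceSetoid 𝔐)

instance : Add (PieceClass 𝔐) :=
  ⟨Quotient.map₂ RelVar.coprod fun _ _ h _ _ h' => PieceEquiv.coprod h h'⟩

instance : Zero (PieceClass 𝔐) := ⟨.mk (.empty 𝔐)⟩

instance : AddCommMonoid (PieceClass 𝔐) where
  add_assoc := by
    rintro ⟨X⟩ ⟨Y⟩ ⟨Z⟩
    exact Quotient.sound (PieceEquiv.coprod_assoc X Y Z)
  zero_add := by
    rintro ⟨X⟩
    exact Quotient.sound (PieceEquiv.empty_coprod X)
  add_zero := by
    rintro ⟨X⟩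
    exact Quotient.sound ((PieceEquiv.coprod_comm X _).trans (PieceEquiv.empty_coprod X))
  add_comm := by
    rintro ⟨X⟩ ⟨Y⟩
    exact Quotient.sound (PieceEquiv.coprod_comm X Y)
  nsmul := nsmulRec

lemma PieceClass.mk_coprod (X Y : RelVar 𝔐) :
    PieceClass.mk (X.coprod Y) = PieceClass.mk X + PieceClass.mk Y := rfl

lemma PieceClass.mk_empty : PieceClass.mk (RelVar.empty 𝔐) = 0 := rfl

variable [MonObj 𝔐]

lemma PieceEquiv.prod {X X' Y Y' : RelVar 𝔐} (h : PieceEquiv X X') (h' : PieceEquiv Y Y') :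
    PieceEquiv (X.prod Y) (X'.prod Y') := by
  have key : ∀ {W X W' Y : RelVar 𝔐} {f : W.obj ⟶ X.obj} {f' : W'.obj ⟶ Y.obj}
      (_ : KBijective f) (_ : KBijective f'), KBijective (RelVar.prodMap f f') := by
    intro W X W' Y f f' hf hf' K _ _ _
    refine ⟨RelVar.kInjective_prodMap hf.kInjective hf'.kInjective K, fun t => ?_⟩
    obtain ⟨x, hx⟩ := (hf K).2 (t ≫ RelVar.prodFst X Y)
    obtain ⟨y, hy⟩ := (hf' K).2 (t ≫ RelVar.prodSnd X Y)
    refine ⟨RelVar.prodLift x y, RelVar.prod_hom_ext ?_ ?_⟩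
    · exact (RelVar.comp_prodMap_fst _ _ _).trans (by rw [RelVar.prodLift_fst, ← hx])
    · exact (RelVar.comp_prodMap_snd _ _ _).trans (by rw [RelVar.prodLift_snd, ← hy])
  obtain ⟨W, f, g, hf, hg, hfb, hgb⟩ := h
  obtain ⟨W', f', g', hf', hg', hfb', hgb'⟩ := h'
  exact ⟨W.prod W', RelVar.prodMap f f', RelVar.prodMap g g', RelVar.prodMap_str hf hf',
    RelVar.prodMap_str hg hg', key hfb hfb', key hgb hgb'⟩

lemma PieceEquiv.prod_point (X : RelVar 𝔐) : PieceEquiv (X.prod (.point 𝔐)) X := by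
  refine of_hom (RelVar.prodFst X _) ?_ fun K _ _ _ => ⟨fun v w h =>
    RelVar.prod_hom_ext h (RelVar.hom_point_ext _ _), fun x =>
    ⟨RelVar.prodLift x (RelVar.toPoint 𝔐 _), RelVar.prodLift_fst _ _⟩⟩
  have h := RelVar.comp_prod_str (𝟙 (X.prod (.point 𝔐)).obj)
  rw [RelVar.comp_point_str, _root_.mul_one, Category.id_comp, Category.id_comp] at h
  exact h.symm

lemma PieceEquiv.point_prod (X : RelVar 𝔐) : PieceEquiv ((RelVar.point 𝔐).prod X) X := by
  refine of_hom (RelVar.prodSnd _ X) ?_ fun K _ _ _ => ⟨fun v w h =>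
    RelVar.prod_hom_ext (RelVar.hom_point_ext _ _) h, fun x =>
    ⟨RelVar.prodLift (RelVar.toPoint 𝔐 _) x, RelVar.prodLift_snd _ _⟩⟩
  have h := RelVar.comp_prod_str (𝟙 ((RelVar.point 𝔐).prod X).obj)
  rw [RelVar.comp_point_str, _root_.one_mul, Category.id_comp, Category.id_comp] at h
  exact h.symm

variable [IsCommMonObj 𝔐]

/-- Varieties with the same class become piecewise equivalent after adding a variety. -/
lemma exists_pieceEquiv_coprod {X Y : RelVar 𝔐} (h : cls X = cls Y) :
    ∃ C : RelVar 𝔐, PieceEquiv (C.coprod X) (C.coprod Y) := by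
  -- The image in the group completion of the monoid of piecewise classes is an additive invariant,
  -- hence depends only on `cls`. Equality in a group completion means equality in the monoid after
  -- adding some element.
  have e := eq_of_cls_eq (fun X : RelVar 𝔐 => Algebra.GrothendieckAddGroup.of (PieceClass.mk X))
    (fun X Y f hf hb => congrArg _ (PieceClass.mk_eq_mk.mpr (.of_hom f hf hb)))
    (fun X Y => by rw [PieceClass.mk_coprod, map_add]) h
  obtain ⟨⟨c, _⟩, hc⟩ := (AddLocalization.addMonoidOf ⊤).eq_iff_exists.mp e
  obtain ⟨C, rfl⟩ := Quotient.exists_rep c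
  exact ⟨C, PieceClass.mk_eq_mk.mp hc⟩

end PieceEquiv

/-! ### The generating series of the configuration spaces -/

section ConfigurationSeries

section

variable {𝔐 : Over SpecC} [MonObj 𝔐]

instance : IsAffine (RelVar.point 𝔐).obj.left := inferInstanceAs (IsAffine SpecC)

instance (X Y : RelVar 𝔐) [IsAffine X.obj.left] [IsAffine Y.obj.left] :
    IsAffine (X.prod Y).obj.left :=
  inferInstanceAs (IsAffine (pullback X.obj.hom Y.obj.hom))

instance (X Y : RelVar 𝔐) [IsAffine X.obj.left] [IsAffine Y.obj.left] :
    IsAffine (X.coprod Y).obj.left :=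
  inferInstanceAs (IsAffine (X.obj.left ⨿ Y.obj.left))

/-- The degree zero term stays equal to the point, as `sum_cls_mul` requires. -/
lemma exists_isAffine_family (A : ℕ → RelVar 𝔐) (hA : A 0 = RelVar.point 𝔐) :
    ∃ V : ℕ → RelVar 𝔐, V 0 = RelVar.point 𝔐 ∧ (∀ i, IsAffine (V i).obj.left) ∧
      ∀ i, PieceEquiv (V i) (A i) := by
  choose V hV h using fun i => exists_isAffine_pieceEquiv (A i)
  refine ⟨Function.update V 0 (.point 𝔐), Function.update_self _ _ _, fun i => ?_, fun i => ?_⟩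
  · obtain rfl | hi := eq_or_ne i 0
    · rw [Function.update_self]
      infer_instance
    · rw [Function.update_of_ne hi]
      exact hV i
  · obtain rfl | hi := eq_or_ne i 0
    · rw [Function.update_self, hA]
      exact .refl _
    · rw [Function.update_of_ne hi]
      exact h i

end

variable {𝔐 : Over SpecC} [MonObj 𝔐] [IsCommMonObj 𝔐] {n : ℕ}

lemma exists_configurationSpaces_of_isAffine (M : RelVar 𝔐) (A : ℕ → RelVar 𝔐)
    (hM : IsAffine M.obj.left) (hA : ∀ i, IsAffine (A i).obj.left) :
    ∃ B : ∀ n : ℕ, n.Partition → RelVar 𝔐, ∀ n α, IsConfigurationSpace α M A (B n α) := by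
  choose B hB using fun (n : ℕ) (α : n.Partition) => exists_isConfigurationSpace A M
    (fun i => .of_isAffine (A i).obj.left) (.of_isAffine M.obj.left) α
  exact ⟨B, hB⟩

/-- Both sides are compared with a common affine model of all the data, for which the configuration
spaces exist. -/
lemma sum_cls_eq_of_pieceEquiv {M M' : RelVar 𝔐} {A A' : ℕ → RelVar 𝔐}
    {B B' : n.Partition → RelVar 𝔐} (hB : ∀ α, IsConfigurationSpace α M A (B α))
    (hB' : ∀ α, IsConfigurationSpace α M' A' (B' α)) (hM : PieceEquiv M M')
    (hA : ∀ i, 0 < i ∧ i ≤ n → PieceEquiv (A i) (A' i)) :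
    ∑ α, cls (B α) = ∑ α, cls (B' α) := by
  obtain ⟨W, f, g, hW, hf, hg, hfb, hgb⟩ := hM.exists_affine
  have key : ∀ i, ∃ V : RelVar 𝔐, IsAffine V.obj.left ∧ (0 < i ∧ i ≤ n →
      ∃ (f : V.obj ⟶ (A i).obj) (g : V.obj ⟶ (A' i).obj), f ≫ (A i).str = V.str ∧
        g ≫ (A' i).str = V.str ∧ KBijective f ∧ KBijective g) := by
    intro i
    by_cases hi : 0 < i ∧ i ≤ n
    · obtain ⟨V, f, g, hV, h⟩ := (hA i hi).exists_affine
      exact ⟨V, hV, fun _ => ⟨f, g, h⟩⟩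
    -- No particle has such a degree, so any affine variety will do.
    · exact ⟨RelVar.point 𝔐, inferInstance, fun h => (hi h).elim⟩
  choose V hV h using key
  choose φ ψ hφ hψ hφb hψb using h
  obtain ⟨E, hE⟩ := exists_configurationSpaces_of_isAffine W V hW hV
  exact (sum_cls_eq_of_kBijective hB (hE n) f hf hfb φ hφ hφb).symm.trans
    (sum_cls_eq_of_kBijective hB' (hE n) g hg hgb ψ hψ hψb)

/-- The value is computed on affine models, and it is shared by all piecewise equivalent data for
which the quotients exist. This makes `confSeries` meaningful even when the quotients for `M` and
`A` themselves do not exist. -/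
lemma exists_confSum (M : RelVar 𝔐) (A : ℕ → RelVar 𝔐) : ∃ c : ℕ → K0 𝔐,
    ∀ (n : ℕ) (M' : RelVar 𝔐) (A' : ℕ → RelVar 𝔐) (B : n.Partition → RelVar 𝔐), PieceEquiv M' M →
      (∀ i, 0 < i ∧ i ≤ n → PieceEquiv (A' i) (A i)) → (∀ α, IsConfigurationSpace α M' A' (B α)) →
      ∑ α, cls (B α) = c n := by
  obtain ⟨W, hW, hWM⟩ := exists_isAffine_pieceEquiv M
  choose V hV h using fun i => exists_isAffine_pieceEquiv (A i)
  obtain ⟨E, hE⟩ := exists_configurationSpaces_of_isAffine W V hW hV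
  exact ⟨fun n => ∑ α, cls (E n α), fun n M' A' B hM hA hB =>
    sum_cls_eq_of_pieceEquiv hB (hE n) (hM.trans hWM.symm) fun i hi => (hA i hi).trans (h i).symm⟩

/-- The generating series of the configuration spaces of particles on `M` with states in `A`. -/
def confSeries (M : RelVar 𝔐) (A : ℕ → RelVar 𝔐) : (K0 𝔐)⟦X⟧ :=
  PowerSeries.mk (exists_confSum M A).choose

variable {M M' N : RelVar 𝔐} {A A' : ℕ → RelVar 𝔐}

lemma coeff_confSeries' {B : n.Partition → RelVar 𝔐} (hM : PieceEquiv M' M)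
    (hA : ∀ i, 0 < i ∧ i ≤ n → PieceEquiv (A' i) (A i))
    (hB : ∀ α, IsConfigurationSpace α M' A' (B α)) :
    PowerSeries.coeff n (confSeries M A) = ∑ α, cls (B α) := by
  rw [confSeries, PowerSeries.coeff_mk]
  exact ((exists_confSum M A).choose_spec n M' A' B hM hA hB).symm

lemma coeff_confSeries {B : n.Partition → RelVar 𝔐} (hB : ∀ α, IsConfigurationSpace α M A (B α)) :
    PowerSeries.coeff n (confSeries M A) = ∑ α, cls (B α) :=
  coeff_confSeries' (.refl M) (fun _ _ => .refl _) hB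

lemma coeff_confSeries_congr (hM : PieceEquiv M M')
    (hA : ∀ i, 0 < i ∧ i ≤ n → PieceEquiv (A i) (A' i)) :
    PowerSeries.coeff n (confSeries M A) = PowerSeries.coeff n (confSeries M' A') := by
  obtain ⟨W, hW, hWM⟩ := exists_isAffine_pieceEquiv M
  choose V hV h using fun i => exists_isAffine_pieceEquiv (A i)
  obtain ⟨E, hE⟩ := exists_configurationSpaces_of_isAffine W V hW hV
  rw [coeff_confSeries' hWM (fun i _ => h i) (hE n),
    coeff_confSeries' (hWM.trans hM) (fun i hi => (h i).trans (hA i hi)) (hE n)]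

lemma confSeries_congr (hM : PieceEquiv M M') (hA : ∀ i, 0 < i → PieceEquiv (A i) (A' i)) :
    confSeries M A = confSeries M' A' :=
  PowerSeries.ext fun _ => coeff_confSeries_congr hM fun i hi => hA i hi.1

variable (M A) in
lemma constantCoeff_confSeries : PowerSeries.constantCoeff (confSeries M A) = 1 := by
  obtain ⟨W, hW, hWM⟩ := exists_isAffine_pieceEquiv M
  choose V hV h using fun i => exists_isAffine_pieceEquiv (A i)
  obtain ⟨E, hE⟩ := exists_configurationSpaces_of_isAffine W V hW hV
  rw [← PowerSeries.coeff_zero_eq_constantCoeff_apply,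
    coeff_confSeries' hWM (fun i _ => h i) (hE 0), sum_cls_degree_zero (hE 0)]

variable (M A) in
lemma isUnit_confSeries : IsUnit (confSeries M A) := by
  rw [PowerSeries.isUnit_iff_constantCoeff, constantCoeff_confSeries]
  exact isUnit_one

variable (A) in
lemma confSeries_empty : confSeries (RelVar.empty 𝔐) A = 1 := by
  choose V hV h using fun i => exists_isAffine_pieceEquiv (A i)
  have hM : IsEmpty (RelVar.empty 𝔐).obj.left := inferInstanceAs (IsEmpty PEmpty)
  obtain ⟨E, hE⟩ := exists_configurationSpaces_of_isAffine (RelVar.empty 𝔐) V inferInstance hV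
  ext n
  obtain rfl | hn := Nat.eq_zero_or_pos n
  · rw [PowerSeries.coeff_zero_eq_constantCoeff_apply, constantCoeff_confSeries,
      PowerSeries.coeff_zero_one]
  · rw [PowerSeries.coeff_one, if_neg hn.ne', coeff_confSeries' (.refl _) (fun i _ => h i) (hE n),
      sum_cls_empty hM (hE n) hn]

variable (A) in
lemma coeff_confSeries_point (hn : 0 < n) :
    PowerSeries.coeff n (confSeries (RelVar.point 𝔐) A) = cls (A n) := by
  choose V j hV hj hjb using fun i => exists_affine_model (A i)
  obtain ⟨E, hE⟩ := exists_configurationSpaces_of_isAffine (RelVar.point 𝔐) V inferInstance hV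
  rw [coeff_confSeries' (.refl _) (fun i _ => .of_hom (j i) (hj i) (hjb i)) (hE n),
    sum_cls_point (hE n) hn, cls_eq_of_kBijective (j n) (hj n) (hjb n)]

variable (M N A) in
lemma confSeries_coprod : confSeries (M.coprod N) A = confSeries M A * confSeries N A := by
  obtain ⟨W, hW, hWM⟩ := exists_isAffine_pieceEquiv M
  obtain ⟨U, hU, hUN⟩ := exists_isAffine_pieceEquiv N
  choose V hV h using fun i => exists_isAffine_pieceEquiv (A i)
  obtain ⟨E, hE⟩ := exists_configurationSpaces_of_isAffine (W.coprod U) V inferInstance hV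
  obtain ⟨E₁, hE₁⟩ := exists_configurationSpaces_of_isAffine W V hW hV
  obtain ⟨E₂, hE₂⟩ := exists_configurationSpaces_of_isAffine U V hU hV
  ext n
  rw [coeff_confSeries' (hWM.coprod hUN) (fun i _ => h i) (hE n), PowerSeries.coeff_mul,
    sum_cls_coprod (hE n) hE₁ hE₂]
  refine Finset.sum_congr rfl fun x _ => ?_
  rw [coeff_confSeries' hWM (fun i _ => h i) (hE₁ x.1),
    coeff_confSeries' hUN (fun i _ => h i) (hE₂ x.2)]

/-- Besides the classes, the piecewise classes of the convolution are needed: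
`coeff_confSeries_eq_of_cls_eq` has to conclude piecewise equivalences from them. -/
lemma exists_convolution (A₁ A₂ : ℕ → RelVar 𝔐) (h₁ : A₁ 0 = RelVar.point 𝔐)
    (h₂ : A₂ 0 = RelVar.point 𝔐) : ∃ C : ℕ → RelVar 𝔐,
      (∀ k, PieceClass.mk (C k) =
        ∑ x : AntidiagIndex k, PieceClass.mk ((A₁ x.1.1).prod (A₂ x.1.2))) ∧
      (∀ k, cls (C k) = ∑ x ∈ Finset.HasAntidiagonal.antidiagonal k, cls (A₁ x.1) * cls (A₂ x.2)) ∧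
      ∀ M : RelVar 𝔐, confSeries M C = confSeries M A₁ * confSeries M A₂ := by
  obtain ⟨V₁, hV₁0, hV₁, hVA₁⟩ := exists_isAffine_family A₁ h₁
  obtain ⟨V₂, hV₂0, hV₂, hVA₂⟩ := exists_isAffine_family A₂ h₂
  choose C inj hC hsum hCa using fun k => exists_isSum_additive
    (fun x : AntidiagIndex k => (V₁ x.1.1).prod (V₂ x.1.2))
    (fun X : RelVar 𝔐 => (PieceClass.mk X, cls X)) (Prod.ext PieceClass.mk_empty cls_empty)
    (fun X Y => Prod.ext (PieceClass.mk_coprod X Y) (cls_coprod X Y))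
  have hcls : ∀ {X Y : RelVar 𝔐}, PieceEquiv X Y → cls X = cls Y := by
    rintro X Y ⟨W, f, g, hf, hg, hfb, hgb⟩
    rw [← cls_eq_of_kBijective f hf hfb, cls_eq_of_kBijective g hg hgb]
  refine ⟨C, fun k => ?_, fun k => ?_, fun M => ?_⟩
  · have := congrArg Prod.fst (hsum k)
    rw [Prod.fst_sum] at this
    refine this.trans (Finset.sum_congr rfl fun x _ => ?_)
    exact PieceClass.mk_eq_mk.mpr ((hVA₁ _).prod (hVA₂ _))
  · have := congrArg Prod.snd (hsum k)
    rw [Prod.snd_sum] at this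
    rw [← Finset.sum_coe_sort]
    refine this.trans (Finset.sum_congr rfl fun x _ => ?_)
    dsimp only
    rw [cls_prod, hcls (hVA₁ _), hcls (hVA₂ _)]
  · obtain ⟨W, hW, hWM⟩ := exists_isAffine_pieceEquiv M
    obtain ⟨E, hE⟩ := exists_configurationSpaces_of_isAffine W C hW
      fun k => hCa k fun x => inferInstance
    obtain ⟨E₁, hE₁⟩ := exists_configurationSpaces_of_isAffine W V₁ hW hV₁
    obtain ⟨E₂, hE₂⟩ := exists_configurationSpaces_of_isAffine W V₂ hW hV₂
    ext n
    rw [coeff_confSeries' hWM (fun i _ => .refl _) (hE n), PowerSeries.coeff_mul,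
      sum_cls_mul hC hV₁0 hV₂0 (hE n) hE₁ hE₂]
    refine Finset.sum_congr rfl fun x _ => ?_
    rw [coeff_confSeries' hWM (fun i _ => hVA₁ i) (hE₁ x.1),
      coeff_confSeries' hWM (fun i _ => hVA₂ i) (hE₂ x.2)]

variable (M N A) in
lemma exists_confSeries_prod : ∃ C : ℕ → RelVar 𝔐,
    (∀ k, cls (C k) = PowerSeries.coeff k (confSeries N A)) ∧
    confSeries (N.prod M) A = confSeries M C := by
  obtain ⟨W, hW, hWM⟩ := exists_isAffine_pieceEquiv M
  obtain ⟨U, hU, hUN⟩ := exists_isAffine_pieceEquiv N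
  choose V hV h using fun i => exists_isAffine_pieceEquiv (A i)
  obtain ⟨E, hE⟩ := exists_configurationSpaces_of_isAffine U V hU hV
  obtain ⟨C, P, o, w, hP, hC, hCa, hcls⟩ := exists_isConfigurationFamily hE
  obtain ⟨E₁, hE₁⟩ := exists_configurationSpaces_of_isAffine (U.prod W) V inferInstance hV
  obtain ⟨E₂, hE₂⟩ := exists_configurationSpaces_of_isAffine W C hW hCa
  refine ⟨C, fun k => ?_, PowerSeries.ext fun n => ?_⟩
  · rw [hcls, coeff_confSeries' hUN (fun i _ => h i) (hE k)]
  · rw [coeff_confSeries' (hUN.prod hWM) (fun i _ => h i) (hE₁ n),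
      coeff_confSeries' hWM (fun i _ => .refl _) (hE₂ n), sum_cls_prod hC (hE₂ n) (hE₁ n)]

end ConfigurationSeries

/-! ### The power structure -/

section PowerStructure

lemma coeff_eq_of_coeff_mul_eq {R : Type*} [CommRing R] {f g h : R⟦X⟧} (hh : IsUnit h) {n : ℕ}
    (e : ∀ m ≤ n, PowerSeries.coeff m (f * h) = PowerSeries.coeff m (g * h)) :
    ∀ m ≤ n, PowerSeries.coeff m f = PowerSeries.coeff m g := by
  obtain ⟨u, hu⟩ := hh.exists_right_inv
  intro m hm
  rw [← _root_.mul_one f, ← _root_.mul_one g, ← hu, ← _root_.mul_assoc, ← _root_.mul_assoc,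
    PowerSeries.coeff_mul, PowerSeries.coeff_mul]
  refine Finset.sum_congr rfl fun x hx => ?_
  rw [e x.1 ((Finset.HasAntidiagonal.antidiagonal.fst_le hx).trans hm)]

variable {𝔐 : Over SpecC} [MonObj 𝔐] [IsCommMonObj 𝔐]

/-- As a function of `M` the series takes values in units and turns disjoint unions into products,
so it is an additive invariant with values in the group of units. -/
lemma confSeries_eq_of_cls_eq_left {M N : RelVar 𝔐} (h : cls M = cls N) (A : ℕ → RelVar 𝔐) :
    confSeries M A = confSeries N A := by
  have e := eq_of_cls_eq (fun M : RelVar 𝔐 => Additive.ofMul (isUnit_confSeries M A).unit)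
    (fun X Y f hf hb => congrArg Additive.ofMul (Units.ext
      (confSeries_congr (.of_hom f hf hb) fun _ _ => .refl _)))
    (fun X Y => congrArg Additive.ofMul (Units.ext (confSeries_coprod X Y A))) h
  exact congrArg Units.val (congrArg Additive.toMul e)

/-- No particle has degree zero. -/
lemma confSeries_update_zero (M X : RelVar 𝔐) (A : ℕ → RelVar 𝔐) :
    confSeries M (Function.update A 0 X) = confSeries M A :=
  confSeries_congr (.refl M) fun i hi => by
    rw [Function.update_of_ne hi.ne']
    exact .refl _

/-- Here `k` is the first degree in which the families may fail to be piecewise equivalent, and `d`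
bounds the number of degrees left up to `n`. Equal classes in degree `k` give a variety `C` whose
disjoint unions with `A k` and with `A' k` are equivalent. Both families are convolved with a family
`D` such that `D 0` is the point and `D k` is `C`. Degrees below `k` stay equivalent, and in degree
`k` the terms `A k × D 0` and `A 0 × D k` together form the disjoint union of `A k` and `C`, all
other terms involving only lower degrees of `A`. So the first possible failure moves to `k + 1`, and
multiplication by the series of `D` is undone because that series is a unit. -/
lemma coeff_confSeries_eq_of_cls_eq (M : RelVar 𝔐) {n : ℕ} (d : ℕ) : ∀ (k : ℕ) (A A' : ℕ → RelVar 𝔐),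
    0 < k → n < k + d → (∀ i, 0 < i → i < k → PieceEquiv (A i) (A' i)) →
    (∀ i, 0 < i → cls (A i) = cls (A' i)) →
    ∀ m ≤ n, PowerSeries.coeff m (confSeries M A) = PowerSeries.coeff m (confSeries M A') := by
  induction d with
  | zero =>
    intro k A A' _ hn hA _ m hm
    exact coeff_confSeries_congr (.refl M) fun i hi => hA i hi.1 (by omega)
  | succ d ih =>
    intro k A A' hk hn hA hcls
    obtain ⟨C, hC⟩ := exists_pieceEquiv_coprod (hcls k hk)
    -- The convolution requires the point in degree zero, where the given families are
    -- unconstrained.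
    rw [← confSeries_update_zero M (.point 𝔐) A, ← confSeries_update_zero M (.point 𝔐) A']
    have hA0 : Function.update A 0 (.point 𝔐) 0 = .point 𝔐 := Function.update_self _ _ _
    have hA0' : Function.update A' 0 (.point 𝔐) 0 = .point 𝔐 := Function.update_self _ _ _
    have hAk : ∀ i, 0 < i → Function.update A 0 (.point 𝔐) i = A i := fun i hi =>
      Function.update_of_ne hi.ne' _ _
    have hAk' : ∀ i, 0 < i → Function.update A' 0 (.point 𝔐) i = A' i := fun i hi =>
      Function.update_of_ne hi.ne' _ _
    generalize Function.update A 0 (.point 𝔐) = F at hA0 hAk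
    generalize Function.update A' 0 (.point 𝔐) = F' at hA0' hAk'
    obtain ⟨D, hD0, hDk⟩ : ∃ D : ℕ → RelVar 𝔐, D 0 = .point 𝔐 ∧ D k = C :=
      ⟨Function.update (fun _ => C) 0 (.point 𝔐), Function.update_self _ _ _,
        Function.update_of_ne hk.ne' _ _⟩
    have hF : ∀ i, i < k → PieceEquiv (F i) (F' i) := by
      intro i hi
      obtain rfl | hi0 := Nat.eq_zero_or_pos i
      · rw [hA0, hA0']
        exact .refl _
      · rw [hAk i hi0, hAk' i hi0]
        exact hA i hi0 hi
    have hFcls : ∀ i, cls (F i) = cls (F' i) := by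
      intro i
      obtain rfl | hi0 := Nat.eq_zero_or_pos i
      · rw [hA0, hA0']
      · rw [hAk i hi0, hAk' i hi0, hcls i hi0]
    obtain ⟨G, hG, hGcls, hGs⟩ := exists_convolution F D hA0 hD0
    obtain ⟨G', hG', hGcls', hGs'⟩ := exists_convolution F' D hA0' hD0
    refine coeff_eq_of_coeff_mul_eq (isUnit_confSeries M D) ?_
    rw [← hGs, ← hGs']
    refine ih (k + 1) G G' (by omega) (by omega) (fun i _ hi => ?_) fun i _ => ?_
    · refine PieceClass.mk_eq_mk.mp ?_
      rw [hG, hG']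
      have hle : ∀ x : AntidiagIndex i, x.1.1 + x.1.2 = i := fun x =>
        Finset.HasAntidiagonal.mem_antidiagonal.mp x.2
      have hterm : ∀ x : AntidiagIndex i, x.1.1 < k →
          PieceClass.mk ((F x.1.1).prod (D x.1.2)) = PieceClass.mk ((F' x.1.1).prod (D x.1.2)) :=
        fun x hx => PieceClass.mk_eq_mk.mpr ((hF _ hx).prod (.refl _))
      obtain hi | rfl := Nat.lt_succ_iff_lt_or_eq.mp hi
      · refine Finset.sum_congr rfl fun x _ => hterm x ?_
        have := hle x
        omega
      -- In the critical degree, now called `i`, the terms `x₀` and `x₁` are the two that combine to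
      -- the disjoint union with `C`; they are distinct as the degree is positive.
      · let x₀ : AntidiagIndex i := ⟨(i, 0), Finset.HasAntidiagonal.mem_antidiagonal.mpr (add_zero i)⟩
        let x₁ : AntidiagIndex i := ⟨(0, i), Finset.HasAntidiagonal.mem_antidiagonal.mpr (zero_add i)⟩
        have hne : x₁ ≠ x₀ := fun h => hk.ne (congrArg (fun x : AntidiagIndex i => x.1.1) h)
        rw [← Finset.add_sum_erase _ _ (Finset.mem_univ x₀),
          ← Finset.add_sum_erase _ _ (Finset.mem_erase.mpr ⟨hne, Finset.mem_univ x₁⟩),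
          ← Finset.add_sum_erase _ _ (Finset.mem_univ x₀),
          ← Finset.add_sum_erase _ _ (Finset.mem_erase.mpr ⟨hne, Finset.mem_univ x₁⟩),
          ← add_assoc, ← add_assoc]
        have hpt : ∀ X : RelVar 𝔐, PieceClass.mk (X.prod (D 0)) = PieceClass.mk X := fun X => by
          rw [hD0]
          exact PieceClass.mk_eq_mk.mpr (.prod_point X)
        congr 1
        · rw [← hterm x₁ hk]
          change PieceClass.mk ((F i).prod (D 0)) + PieceClass.mk ((F 0).prod (D i)) =
            PieceClass.mk ((F' i).prod (D 0)) + PieceClass.mk ((F 0).prod (D i))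
          rw [hpt, hpt, hA0, PieceClass.mk_eq_mk.mpr (.point_prod (D i)), hDk, hAk i hk, hAk' i hk,
            add_comm, add_comm (PieceClass.mk (A' i))]
          exact PieceClass.mk_eq_mk.mpr hC
        · refine Finset.sum_congr rfl fun x hx => hterm x ?_
          have hx0 : x ≠ x₀ := (Finset.mem_erase.mp (Finset.mem_erase.mp hx).2).1
          have h1 := hle x
          refine lt_of_le_of_ne (by omega) fun h => hx0 (Subtype.ext (Prod.ext h ?_))
          change x.1.2 = 0
          omega
    · rw [hGcls, hGcls']
      exact Finset.sum_congr rfl fun x _ => by rw [hFcls]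

lemma confSeries_eq_of_cls_eq {M M' : RelVar 𝔐} {A A' : ℕ → RelVar 𝔐} (hM : cls M = cls M')
    (hA : ∀ i, 0 < i → cls (A i) = cls (A' i)) : confSeries M A = confSeries M' A' := by
  rw [confSeries_eq_of_cls_eq_left hM]
  ext n
  exact coeff_confSeries_eq_of_cls_eq M' (n + 1) 1 A A' one_pos (by omega)
    (fun i h1 h2 => by omega) hA n le_rfl

lemma coeff_confSeries_mem (M : RelVar 𝔐) (A : ℕ → RelVar 𝔐) (n : ℕ) :
    PowerSeries.coeff n (confSeries M A) ∈ S0 𝔐 := by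
  obtain ⟨W, hW, hWM⟩ := exists_isAffine_pieceEquiv M
  choose V hV h using fun i => exists_isAffine_pieceEquiv (A i)
  obtain ⟨E, hE⟩ := exists_configurationSpaces_of_isAffine W V hW hV
  rw [coeff_confSeries' hWM (fun i _ => h i) (hE n)]
  exact sum_mem fun α _ => ⟨E n α, rfl⟩

lemma exists_effCls_eq (r : S0 𝔐) : ∃ X : RelVar 𝔐, effCls X = r := by
  obtain ⟨_, X, rfl⟩ := r
  exact ⟨X, rfl⟩

/-- The power of a series with coefficients in `S₀(Var/𝔐)`. -/
def chargedPow (a : OneSeries (S0 𝔐)) (r : S0 𝔐) : OneSeries (S0 𝔐) :=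
  ⟨PowerSeries.mk fun n => ⟨PowerSeries.coeff n (confSeries (exists_effCls_eq r).choose
      fun i => (exists_effCls_eq (PowerSeries.coeff i (a : (S0 𝔐)⟦X⟧))).choose),
      coeff_confSeries_mem _ _ n⟩, by
    rw [MonoidHom.mem_mker]
    refine Subtype.ext ?_
    refine Eq.trans ?_ (constantCoeff_confSeries (exists_effCls_eq r).choose
      fun i => (exists_effCls_eq (PowerSeries.coeff i (a : (S0 𝔐)⟦X⟧))).choose)
    rw [← PowerSeries.coeff_zero_eq_constantCoeff_apply, PowerSeries.coeff_mk,
      ← PowerSeries.coeff_zero_eq_constantCoeff_apply]⟩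

/-- The inclusion of the series with coefficients in `S₀(Var/𝔐)`. -/
def seriesIncl : (S0 𝔐)⟦X⟧ →+* (K0 𝔐)⟦X⟧ := PowerSeries.map (S0 𝔐).subtype

lemma coeff_seriesIncl (f : (S0 𝔐)⟦X⟧) (n : ℕ) :
    PowerSeries.coeff n (seriesIncl f) = (PowerSeries.coeff n f : S0 𝔐) :=
  PowerSeries.coeff_map _ _ _

lemma oneSeries_ext {a b : OneSeries (S0 𝔐)} (h : seriesIncl (a : (S0 𝔐)⟦X⟧) = seriesIncl b) :
    a = b := by
  refine Subtype.ext (PowerSeries.ext fun n => Subtype.ext ?_)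
  rw [← coeff_seriesIncl, h, coeff_seriesIncl]

/-- Frees `chargedPow` from the representatives chosen in its definition. Degree zero is not
constrained because it has no influence. -/
lemma seriesIncl_chargedPow {a : OneSeries (S0 𝔐)} {r : S0 𝔐} {M : RelVar 𝔐} {A : ℕ → RelVar 𝔐}
    (hM : cls M = r) (hA : ∀ i, 0 < i → cls (A i) = (PowerSeries.coeff i (a : (S0 𝔐)⟦X⟧) : S0 𝔐)) :
    seriesIncl (chargedPow a r : (S0 𝔐)⟦X⟧) = confSeries M A := by
  have e : seriesIncl (chargedPow a r : (S0 𝔐)⟦X⟧) = confSeries (exists_effCls_eq r).choose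
      fun i => (exists_effCls_eq (PowerSeries.coeff i (a : (S0 𝔐)⟦X⟧))).choose := by
    ext n
    rw [coeff_seriesIncl, chargedPow, PowerSeries.coeff_mk]
  rw [e]
  refine confSeries_eq_of_cls_eq ?_ fun i hi => ?_
  · rw [hM]
    exact congrArg Subtype.val (exists_effCls_eq r).choose_spec
  · rw [hA i hi]
    exact congrArg Subtype.val (exists_effCls_eq (PowerSeries.coeff i (a : (S0 𝔐)⟦X⟧))).choose_spec

lemma isChargedParticlePower_chargedPow :
    IsChargedParticlePower (chargedPow : OneSeries (S0 𝔐) → S0 𝔐 → OneSeries (S0 𝔐)) := by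
  intro A M a hA n B hB
  refine Subtype.ext ?_
  rw [← coeff_seriesIncl, seriesIncl_chargedPow (M := M) (A := A) rfl
    (fun i _ => congrArg Subtype.val (hA i).symm), coeff_confSeries hB]
  exact (map_sum (S0 𝔐).subtype (fun α => effCls (B α)) Finset.univ).symm

/-- Every effective class has an affine representative. For affine data all configuration spaces
exist, so the condition prescribes every coefficient. -/
lemma IsChargedParticlePower.eq_chargedPow {pow : OneSeries (S0 𝔐) → S0 𝔐 → OneSeries (S0 𝔐)}
    (h : IsChargedParticlePower pow) : pow = chargedPow := by
  funext a r
  have key : ∀ X : RelVar 𝔐, ∃ V : RelVar 𝔐, IsAffine V.obj.left ∧ effCls V = effCls X := fun X => by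
    obtain ⟨V, j, hV, hj, hjb⟩ := exists_affine_model X
    exact ⟨V, hV, Subtype.ext (cls_eq_of_kBijective j hj hjb)⟩
  have key' : ∀ r : S0 𝔐, ∃ V : RelVar 𝔐, IsAffine V.obj.left ∧ effCls V = r := fun r => by
    obtain ⟨X, rfl⟩ := exists_effCls_eq r
    exact key X
  obtain ⟨M, hM, rfl⟩ := key' r
  choose A hA hAc using fun i => key' (PowerSeries.coeff i (a : (S0 𝔐)⟦X⟧))
  obtain ⟨B, hB⟩ := exists_configurationSpaces_of_isAffine M A hM hA
  refine Subtype.ext (PowerSeries.ext fun n => ?_)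
  rw [h A M a (fun i => (hAc i).symm) n (B n) (hB n),
    isChargedParticlePower_chargedPow A M a (fun i => (hAc i).symm) n (B n) (hB n)]

/-- The constant term has class `1`, so the point itself may represent it, as products of series
require. -/
lemma exists_cls_eq_coeff (a : OneSeries (S0 𝔐)) : ∃ A : ℕ → RelVar 𝔐, A 0 = .point 𝔐 ∧
    ∀ i, cls (A i) = (PowerSeries.coeff i (a : (S0 𝔐)⟦X⟧) : S0 𝔐) := by
  choose A hA using fun i => exists_effCls_eq (PowerSeries.coeff i (a : (S0 𝔐)⟦X⟧))
  refine ⟨Function.update A 0 (.point 𝔐), Function.update_self _ _ _, fun i => ?_⟩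
  obtain rfl | hi := eq_or_ne i 0
  · have h0 : PowerSeries.coeff 0 (a : (S0 𝔐)⟦X⟧) = 1 :=
      (PowerSeries.coeff_zero_eq_constantCoeff_apply _).trans a.2
    rw [Function.update_self, cls_point, h0]
    rfl
  · rw [Function.update_of_ne hi, ← hA i]
    rfl

lemma isPowerStructure_chargedPow :
    IsPowerStructure (chargedPow : OneSeries (S0 𝔐) → S0 𝔐 → OneSeries (S0 𝔐)) where
  pow_zero a := by
    obtain ⟨A, -, hA⟩ := exists_cls_eq_coeff a
    refine oneSeries_ext ?_
    rw [seriesIncl_chargedPow (M := .empty 𝔐) cls_empty fun i _ => hA i, confSeries_empty]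
    exact (map_one seriesIncl).symm
  pow_one a := by
    obtain ⟨A, -, hA⟩ := exists_cls_eq_coeff a
    refine oneSeries_ext ?_
    rw [seriesIncl_chargedPow (M := .point 𝔐) cls_point fun i _ => hA i]
    ext n
    obtain rfl | hn := Nat.eq_zero_or_pos n
    · have h0 : PowerSeries.coeff 0 (a : (S0 𝔐)⟦X⟧) = 1 :=
        (PowerSeries.coeff_zero_eq_constantCoeff_apply _).trans a.2
      rw [PowerSeries.coeff_zero_eq_constantCoeff_apply, constantCoeff_confSeries, coeff_seriesIncl, h0]
      rfl
    · rw [coeff_confSeries_point A hn, hA, coeff_seriesIncl]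
  mul_pow a b r := by
    obtain ⟨A, hA0, hA⟩ := exists_cls_eq_coeff a
    obtain ⟨B, hB0, hB⟩ := exists_cls_eq_coeff b
    obtain ⟨M, rfl⟩ := exists_effCls_eq r
    obtain ⟨C, -, hC, hCs⟩ := exists_convolution A B hA0 hB0
    refine oneSeries_ext ?_
    rw [seriesIncl_chargedPow (a := a * b) (M := M) (A := C) rfl fun i _ => ?_, hCs]
    · change seriesIncl ((chargedPow a (effCls M) : (S0 𝔐)⟦X⟧) * (chargedPow b (effCls M) : (S0 𝔐)⟦X⟧)) = _
      rw [map_mul, seriesIncl_chargedPow (M := M) rfl fun i _ => hA i,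
        seriesIncl_chargedPow (M := M) rfl fun i _ => hB i]
    · rw [hC, ← coeff_seriesIncl]
      change _ = PowerSeries.coeff i (seriesIncl ((a : (S0 𝔐)⟦X⟧) * (b : (S0 𝔐)⟦X⟧)))
      rw [map_mul, PowerSeries.coeff_mul]
      exact Finset.sum_congr rfl fun x _ => by rw [coeff_seriesIncl, coeff_seriesIncl, hA, hB]
  pow_add a r s := by
    obtain ⟨A, -, hA⟩ := exists_cls_eq_coeff a
    obtain ⟨M, rfl⟩ := exists_effCls_eq r
    obtain ⟨N, rfl⟩ := exists_effCls_eq s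
    refine oneSeries_ext ?_
    rw [seriesIncl_chargedPow (M := M.coprod N) (cls_coprod M N) fun i _ => hA i, confSeries_coprod]
    change _ = seriesIncl ((chargedPow a (effCls M) : (S0 𝔐)⟦X⟧) * (chargedPow a (effCls N) : (S0 𝔐)⟦X⟧))
    rw [map_mul, seriesIncl_chargedPow (M := M) rfl fun i _ => hA i,
      seriesIncl_chargedPow (M := N) rfl fun i _ => hA i]
  pow_mul a r s := by
    obtain ⟨A, -, hA⟩ := exists_cls_eq_coeff a
    obtain ⟨N, rfl⟩ := exists_effCls_eq r
    obtain ⟨M, rfl⟩ := exists_effCls_eq s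
    -- The classes of the `C k` are the coefficients of the power with exponent `[N]`, so raising
    -- that power to `[M]` amounts to using `C` as the family of states on `M`.
    obtain ⟨C, hC, hCs⟩ := exists_confSeries_prod M N A
    refine oneSeries_ext ?_
    rw [seriesIncl_chargedPow (M := N.prod M) (cls_prod N M) fun i _ => hA i, hCs]
    refine (seriesIncl_chargedPow (M := M) rfl fun i _ => ?_).symm
    rw [hC, ← coeff_seriesIncl, seriesIncl_chargedPow (M := N) rfl fun i _ => hA i]

end PowerStructure

end RelativeMotives

end

/-- The charged particle construction is well defined on `S₀(Var/𝔐)`, and it is a power structure. -/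
theorem mainTheorem7 (𝔐 : Over SpecC) [MonObj 𝔐] [IsCommMonObj 𝔐] :
    (∀ (A : ℕ → RelVar 𝔐) (M : RelVar 𝔐), (∀ i, FinitelyAffine (A i)) → FinitelyAffine M →
      ∀ (n : ℕ) (α : n.Partition), ∃ B : RelVar 𝔐, IsConfigurationSpace α M A B) ∧
    ∃ pow : OneSeries (S0 𝔐) → S0 𝔐 → OneSeries (S0 𝔐),
      IsChargedParticlePower pow ∧ IsPowerStructure pow ∧
      ∀ pow', IsChargedParticlePower pow' → pow' = pow :=
  ⟨fun A M hA hM _ α => exists_isConfigurationSpace A M hA hM α, chargedPow,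
    isChargedParticlePower_chargedPow, isPowerStructure_chargedPow, fun _ h => h.eq_chargedPow⟩
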